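/- **Corollary (sample and communication complexities of DIAMOND).** *Problem.* There are $m\ge 1$ agents. Agent $i$ has sampled objectives $f_i(x,y;\xi)$, $\xi\sim\pi_{f,i}$, and $g_i(x,y;\zeta)$, $\zeta\sim\pi_{g,i}$, on $\mathbb R^{d_{\rm up}}\times\mathbb R^{d_{\rm low}}$, integrable in the sample. Put $f_i(x,y)=\mathbb E f_i(x,y;\xi)$, $g_i(x,y)=\mathbb E g_i(x,y;\zeta)$, $y_i^*(x)=\arg\min_y g_i(x,y)$, $l_i(x)=f_i(x,y_i^*(x))$ and $l=\frac1m\sum_i l_i$. *Assumptions.* Lipschitz continuity is in $(x,y)$ jointly, for the Euclidean norm. (1) $f_i$ is differentiable, $\nabla_xf_i$ and $\nabla_yf_i$ are Lipschitz with constants $L_{f_x},L_{f_y}$, and $\|\nabla_y f_i\|\le C_{f_y}$. (2) $g_i$ is $C^2$, $\mu_g$-strongly convex in $y$ with $\mu_g>0$; $\nabla_yg_i$, $\nabla^2_{xy}g_i$, $\nabla^2_{yy}g_i$ are Lipschitz with constants $L_g,L_{g_{xy}},L_{g_{yy}}$; and $\|\nabla^2_{xy}g_i\|^2\le C_{g_{xy}}$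 with $C_{g_{xy}}>0$. (3) (1) and (2) also hold for $f_i(\cdot;\xi)$ and $g_i(\cdot;\zeta)$, for almost every sample. (4) For $K\ge1$ let $$\hat\nabla f_i(x,y;\bar\xi)=\nabla_xf_i(x,y;\xi)-\tfrac K{L_g}\nabla^2_{xy}g_i(x,y;\zeta^0)\prod_{j=1}^{k}\Bigl(I-\tfrac{\nabla^2_{yy}g_i(x,y;\zeta^j)}{L_g}\Bigr)\nabla_yf_i(x,y;\xi),$$ where $\bar\xi=(\xi,\zeta^0,\dots,\zeta^K,k)$ is independent with $\xi\sim\pi_{f,i}$, $\zeta^j\sim\pi_{g,i}$ and $k$ uniform on $\{0,\dots,K-1\}$. For every $K\ge 1$ its variance is at most $\sigma_f(K)^2$ at every point, and that of $\nabla_yg_i(x,y;\zeta)$ is at most $\sigma_g^2$. The consensus matrix $M\in\mathbb R^{m\times m}$ is doubly stochastic and symmetric, and for $i\ne j$ we have $M_{ij}>0$ if agents $i,j$ are neighbours in the communication graph and $M_{ij}=0$ otherwise; its second largest eigenvalue in magnitude is at most $\lambda<1$. *Algorithm.* DIAMOND starts all agents at a common point $(x_0,y_0)=(x_{-1},y_{-1})$,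 with $p_{i,-1}=u_{i,-1}=0$ and $v_{i,-1}=0$. For $t=0,1,\dots$, with samples $\bar\xi_{i,t},\zeta_{i,t}$ independent over agents and iterations, $$p_{i,t}=\hat\nabla f_i(x_{i,t},y_{i,t};\bar\xi_{i,t})+(1-\eta_t)\bigl(p_{i,t-1}-\hat\nabla f_i(x_{i,t-1},y_{i,t-1};\bar\xi_{i,t})\bigr),$$ $$v_{i,t}=\nabla_yg_i(x_{i,t},y_{i,t};\zeta_{i,t})+(1-\gamma_t)\bigl(v_{i,t-1}-\nabla_yg_i(x_{i,t-1},y_{i,t-1};\zeta_{i,t})\bigr),$$ $$u_{i,t}=\sum_jM_{ij}u_{j,t-1}+p_{i,t}-p_{i,t-1},\qquad x_{i,t+1}=\sum_jM_{ij}x_{j,t}-\alpha_tu_{i,t},\qquad y_{i,t+1}=y_{i,t}-\beta_tv_{i,t}.$$ For horizon $T$ the parameters are $\alpha_t=(\omega+t)^{-1/3}$, $\beta_t=c_\beta\alpha_t$, $\eta_{t+1}=c_\eta\alpha_t^2$, $\gamma_{t+1}=c_\gamma\alpha_t^2$ (for $t\ge -1$), and $K=(L_g/\mu_g)\log(C_{g_{xy}}C_{f_y}T/\mu_g)$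 rounded up to a positive integer. *Claim.* There is a universal exponent $q$ such that the following holds. Given $m$, $\lambda$, the constants in (1), (2), (4), and a number $\Delta$, there is a constant $C>0$ such that for every $\varepsilon\in(0,1]$ there are a horizon $T\ge1$ and constants $\omega\ge2$, $c_\beta,c_\eta,c_\gamma>0$, with $\alpha_t\le1-\lambda$, $\beta_t\le1/(\mu_g+L_g)$ and $\eta_t,\gamma_t\in[0,1]$ for all $t\ge 0$, with the following property. For all problems as above (of any dimensions and with any sample distributions, hence any dataset sizes), all such networks, and all starting points with $l(x_0)-\inf l\le\Delta$, $\|y_0-y_i^*(x_0)\|^2\le\Delta$ and $\|\nabla l_i(x_0)\|^2\le\Delta$ for all $i$: the minimizers $y_i^*$ exist, $l$ is differentiable, and with $\bar x_t=\frac1m\sum_ix_{i,t}$ and $$\mathcal E_t=\|\nabla l(\bar x_t)\|^2+\sum_i\|y_i^*(x_{i,t})-y_{i,t}\|^2+\frac1m\sum_i\|x_{i,t}-\bar x_t\|^2,$$ each $\mathcal E_t$, $t<T$, is integrable and $\frac1T\sum_{t<T}\mathbb E[\mathcal E_t]\le\varepsilon$. In particular DIAMOND reaches an $\varepsilon$-stationary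 point, i.e. $\mathbb E[\mathcal E_t]\le\varepsilon$ for some $t<T$. In these $T$ iterations both the number of incremental first-order oracle (IFO) calls per agent and the number of communication rounds are at most $$C\,\varepsilon^{-3/2}\,(1+\log(1/\varepsilon))^{q},$$ that is, $\tilde{\mathcal O}(\varepsilon^{-3/2})$. Here each evaluation of the derivatives of one sampled function at one point counts as an IFO call, so that an iteration costs $2(K+3)$ calls per agent; it uses one communication round. -/

import Mathlib

open MeasureTheory ProbabilityTheory

noncomputable section

namespace Diamond

/-- `ℝ^d` with its Euclidean norm. -/
abbrev E (d : ℕ) := EuclideanSpace ℝ (Fin d)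

section Derivatives

variable {a b : ℕ}

/-- Partial gradient `∇ₓ F(x, y)`. -/
def gradX (F : E a → E b → ℝ) (x : E a) (y : E b) : E a := gradient (fun x' => F x' y) x

/-- Partial gradient `∇_y F(x, y)`. -/
def gradY (F : E a → E b → ℝ) (x : E a) (y : E b) : E b := gradient (fun y' => F x y') y

/-- Mixed second derivative `∇²ₓ_y F(x, y)`, the matrix with `a` rows and `b` columns. -/
def hessXY (F : E a → E b → ℝ) (x : E a) (y : E b) : E b →L[ℝ] E a :=
  fderiv ℝ (fun y' => gradX F x y') y

/-- Second derivative `∇²_yy F(x, y)`. -/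
def hessYY (F : E a → E b → ℝ) (x : E a) (y : E b) : E b →L[ℝ] E b :=
  fderiv ℝ (fun y' => gradY F x y') y

/-- `H` is `L`-Lipschitz in `(x, y)` for the Euclidean norm on `ℝ^a × ℝ^b`. -/
def LipschitzXY {V : Type*} [NormedAddCommGroup V] (L : ℝ) (H : E a → E b → V) : Prop :=
  ∀ x y x' y', ‖H x y - H x' y'‖ ≤ L * Real.sqrt (‖x - x'‖ ^ 2 + ‖y - y'‖ ^ 2)

end Derivatives

/-- The regularity constants of the upper- and lower-level objectives. -/
structure Constants where
  Lfx : ℝ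
  Lfy : ℝ
  Cfy : ℝ
  Lg : ℝ
  μg : ℝ
  Lgxy : ℝ
  Lgyy : ℝ
  Cgxy : ℝ

/-- The sign conditions on the constants. -/
structure Constants.Valid (c : Constants) : Prop where
  Lfx_nonneg : 0 ≤ c.Lfx
  Lfy_nonneg : 0 ≤ c.Lfy
  Cfy_nonneg : 0 ≤ c.Cfy
  Lg_nonneg : 0 ≤ c.Lg
  μg_pos : 0 < c.μg
  Lgxy_nonneg : 0 ≤ c.Lgxy
  Lgyy_nonneg : 0 ≤ c.Lgyy
  Cgxy_pos : 0 < c.Cgxy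

/-- Regularity of an upper-level objective `F(x, y)`. -/
structure UpperRegular {a b : ℕ} (c : Constants) (F : E a → E b → ℝ) : Prop where
  differentiable : Differentiable ℝ (fun z : E a × E b => F z.1 z.2)
  gradX_lipschitz : LipschitzXY c.Lfx (gradX F)
  gradY_lipschitz : LipschitzXY c.Lfy (gradY F)
  gradY_bounded : ∀ x y, ‖gradY F x y‖ ≤ c.Cfy

/-- Regularity of a lower-level objective `G(x, y)`, strongly convex in `y`. -/
structure LowerRegular {a b : ℕ} (c : Constants) (G : E a → E b → ℝ) : Prop where
  contDiff : ContDiff ℝ 2 (fun z : E a × E b => G z.1 z.2)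
  gradY_lipschitz : LipschitzXY c.Lg (gradY G)
  strongConvex : ∀ x, StrongConvexOn Set.univ c.μg (G x)
  hessXY_lipschitz : LipschitzXY c.Lgxy (hessXY G)
  hessYY_lipschitz : LipschitzXY c.Lgyy (hessYY G)
  hessXY_bounded : ∀ x y, ‖hessXY G x y‖ ^ 2 ≤ c.Cgxy

/-- A decentralized stochastic bilevel problem with `m` agents: sampled objectives
`f_i(x, y; ξ)` and `g_i(x, y; ζ)` and the laws of the samples `ξ_i` and `ζ_i`. -/
structure Problem (m a b : ℕ) (Ξ Z : Type*) [MeasurableSpace Ξ] [MeasurableSpace Z] where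
  f : Fin m → E a → E b → Ξ → ℝ
  g : Fin m → E a → E b → Z → ℝ
  πf : Fin m → Measure Ξ
  πg : Fin m → Measure Z

/-- The samples used in one evaluation of the hypergradient estimator with `K` terms:
`ξ`, `(ζ⁰, …, ζᴷ)` and the truncation level `k ∈ {0, …, K - 1}`. -/
abbrev EstSample (Ξ Z : Type*) (K : ℕ) := Ξ × (Fin (K + 1) → Z) × Fin K

/-- The samples one agent draws in one iteration: those for the hypergradient estimator,
and one lower-level sample `ζ` for the lower-level gradient. -/
abbrev IterSample (Ξ Z : Type*) (K : ℕ) := EstSample Ξ Z K × Z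

namespace Problem

variable {m a b : ℕ} {Ξ Z : Type*} [MeasurableSpace Ξ] [MeasurableSpace Z]
variable (P : Problem m a b Ξ Z)

/-- `f_i(x, y) = 𝔼[f_i(x, y; ξ_i)]`. -/
def fAvg (i : Fin m) (x : E a) (y : E b) : ℝ := ∫ ξ, P.f i x y ξ ∂(P.πf i)

/-- `g_i(x, y) = 𝔼[g_i(x, y; ζ_i)]`. -/
def gAvg (i : Fin m) (x : E a) (y : E b) : ℝ := ∫ ζ, P.g i x y ζ ∂(P.πg i)

/-- `y_i^*(x)`, the minimizer of `g_i(x, ·)`. -/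
def ystar (i : Fin m) (x : E a) : E b :=
  Classical.epsilon fun y => ∀ y', P.gAvg i x y ≤ P.gAvg i x y'

/-- `l_i(x) = f_i(x, y_i^*(x))`. -/
def localObj (i : Fin m) (x : E a) : ℝ := P.fAvg i x (P.ystar i x)

/-- `l(x) = (1/m) ∑ l_i(x)`. -/
def obj (x : E a) : ℝ := (1 / (m : ℝ)) * ∑ i, P.localObj i x

/-- The surrogate hypergradient
`∇ₓ f_i - ∇²ₓ_y g_i [∇²_yy g_i]⁻¹ ∇_y f_i` at `(x, y)`. -/
def barGrad (i : Fin m) (x : E a) (y : E b) : E a :=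
  gradX (P.fAvg i) x y -
    hessXY (P.gAvg i) x y ((hessYY (P.gAvg i) x y).inverse (gradY (P.fAvg i) x y))

/-- The stochastic hypergradient estimator
`∇ₓ f_i(ξ) - (K / L_g) ∇²ₓ_y g_i(ζ⁰) ∏_{j=1}^{k} (I - ∇²_yy g_i(ζʲ) / L_g) ∇_y f_i(ξ)`. -/
def hatGrad (Lg : ℝ) {K : ℕ} (i : Fin m) (x : E a) (y : E b) (s : EstSample Ξ Z K) : E a :=
  gradX (fun x y => P.f i x y s.1) x y -
    ((K : ℝ) / Lg) • hessXY (fun x y => P.g i x y (s.2.1 0)) x y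
      ((List.ofFn fun j : Fin (s.2.2 : ℕ) =>
          (1 : E b →L[ℝ] E b) - (1 / Lg) • hessYY (fun x y => P.g i x y
            (s.2.1 ⟨(j : ℕ) + 1, by have := j.2; have := s.2.2.2; omega⟩)) x y).prod
        (gradY (fun x y => P.f i x y s.1) x y))

/-- The stochastic lower-level gradient `∇_y g_i(x, y; ζ)`. -/
def lowGrad (i : Fin m) (x : E a) (y : E b) (ζ : Z) : E b :=
  gradY (fun x y => P.g i x y ζ) x y

/-- The law of the estimator samples of agent `i`: independent `ξ ∼ π_f`, `ζʲ ∼ π_g` and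
`k` uniform on `{0, …, K - 1}`. -/
def estLaw (K : ℕ) (i : Fin m) : Measure (EstSample Ξ Z K) :=
  (P.πf i).prod ((Measure.pi fun _ => P.πg i).prod (uniformOn Set.univ))

/-- The law of the samples that agent `i` draws in one iteration. -/
def iterLaw (K : ℕ) (i : Fin m) : Measure (IterSample Ξ Z K) :=
  (P.estLaw K i).prod (P.πg i)

/-- The bias of the stochastic hypergradient estimator. -/
def bias (Lg : ℝ) (K : ℕ) (i : Fin m) (x : E a) (y : E b) : E a :=
  (∫ s, P.hatGrad Lg i x y s ∂(P.estLaw K i)) - P.barGrad i x y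

/-- The standing assumptions on the problem. The bound on the variance of the hypergradient
estimator may depend on its number of terms `K`. -/
structure Regular (c : Constants) (σf : ℕ → ℝ) (σg : ℝ) : Prop where
  prob_f : ∀ i, IsProbabilityMeasure (P.πf i)
  prob_g : ∀ i, IsProbabilityMeasure (P.πg i)
  measurable_f : ∀ i x y, Measurable (P.f i x y)
  measurable_g : ∀ i x y, Measurable (P.g i x y)
  integrable_f : ∀ i x y, Integrable (P.f i x y) (P.πf i)
  integrable_g : ∀ i x y, Integrable (P.g i x y) (P.πg i)
  upper : ∀ i, UpperRegular c (P.fAvg i)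
  lower : ∀ i, LowerRegular c (P.gAvg i)
  upper_sample : ∀ i, ∀ᵐ ξ ∂(P.πf i), UpperRegular c fun x y => P.f i x y ξ
  lower_sample : ∀ i, ∀ᵐ ζ ∂(P.πg i), LowerRegular c fun x y => P.g i x y ζ
  variance_f : ∀ K, 1 ≤ K → ∀ i x y,
    ∫⁻ s, ‖P.hatGrad c.Lg i x y s - P.barGrad i x y - P.bias c.Lg K i x y‖ₑ ^ 2
      ∂(P.estLaw K i) ≤ ENNReal.ofReal (σf K ^ 2)
  variance_g : ∀ i x y,
    ∫⁻ ζ, ‖P.lowGrad i x y ζ - gradY (P.gAvg i) x y‖ₑ ^ 2 ∂(P.πg i) ≤ ENNReal.ofReal (σg ^ 2)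

/-- `l(x₀) - inf l`, the initial lower-level errors and the squared norms of the initial local
hypergradients are at most `Δ`. -/
structure InitialBound (x₀ : E a) (y₀ : E b) (Δ : ℝ) : Prop where
  gap : ∀ x, P.obj x₀ - P.obj x ≤ Δ
  lower_error : ∀ i, ‖y₀ - P.ystar i x₀‖ ^ 2 ≤ Δ
  hypergradient : ∀ i, ‖gradient (P.localObj i) x₀‖ ^ 2 ≤ Δ

end Problem

/-- The conditions on the consensus weights `M` of the communication graph `G`. Agents always
have access to their own parameters, so the sparsity pattern concerns pairs `i ≠ j`. -/
structure IsConsensusMatrix {m : ℕ} (G : SimpleGraph (Fin m)) (M : Matrix (Fin m) (Fin m) ℝ) :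
    Prop where
  doublyStochastic : M ∈ doublyStochastic ℝ (Fin m)
  symm : M.IsSymm
  pos_of_adj : ∀ i j, G.Adj i j → 0 < M i j
  eq_zero_of_not_adj : ∀ i j, i ≠ j → ¬ G.Adj i j → M i j = 0

/-- The second largest eigenvalue in magnitude, `max {|λ₂(M)|, |λ_m(M)|}`. As `M` is symmetric
and fixes the all-ones vector, the eigenvalues other than this copy of `λ₁ = 1` are those with
an eigenvector orthogonal to the all-ones vector. -/
def secondEigenvalue {m : ℕ} (M : Matrix (Fin m) (Fin m) ℝ) : ℝ :=
  sSup {r | ∃ (θ : ℝ) (w : Fin m → ℝ),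
    w ≠ 0 ∧ ∑ i, w i = 0 ∧ M.mulVec w = θ • w ∧ r = |θ|}

/-- The inputs of the algorithm: step-sizes, momentum coefficients, the number `K` of terms and
the constant `Lg` of the hypergradient estimator. -/
structure Params where
  α : ℕ → ℝ
  β : ℕ → ℝ
  η : ℕ → ℝ
  γ : ℕ → ℝ
  K : ℕ
  Lg : ℝ

/-- The state at the start of iteration `t`: `x = x_t`, `y = y_t`, `xPrev = x_{t-1}`,
`yPrev = y_{t-1}`, `p = p_{t-1}`, `v = v_{t-1}`, `u = u_{t-1}` (one block per agent), the number
of oracle calls made so far by each agent, and the number of communication rounds so far. -/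
structure State (m a b : ℕ) where
  x : Fin m → E a
  y : Fin m → E b
  xPrev : Fin m → E a
  yPrev : Fin m → E b
  p : Fin m → E a
  v : Fin m → E b
  u : Fin m → E a
  ifoCalls : ℕ
  commRounds : ℕ

/-- Initialization. All agents start from `(x₀, y₀)`; since `u_{-1} = 0` and `v_{-1} = 0`, the
updates leave `x_0 = x_{-1}` and `y_0 = y_{-1}`. -/
def State.init (m : ℕ) {a b : ℕ} (x₀ : E a) (y₀ : E b) : State m a b where
  x := fun _ => x₀
  y := fun _ => y₀
  xPrev := fun _ => x₀
  yPrev := fun _ => y₀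
  p := fun _ => 0
  v := fun _ => 0
  u := fun _ => 0
  ifoCalls := 0
  commRounds := 0

/-- Oracle calls for one evaluation of the hypergradient estimator: derivatives of `f_i(·; ξ)`
and of `g_i(·; ζ⁰), …, g_i(·; ζᴷ)` at one point, one call for each sample. -/
def estimatorCalls (K : ℕ) : ℕ := K + 2

/-- One call, for `∇_y g_i(·; ζ)` at one point. -/
def lowGradCalls : ℕ := 1

section Algorithm

variable {m a b : ℕ} {Ξ Z : Type*} [MeasurableSpace Ξ] [MeasurableSpace Z]

/-- One iteration of DIAMOND. Both stochastic gradients are evaluated at the current and at the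
previous iterate; each agent exchanges its `x_t` and `u_{t-1}` with its neighbours in one round. -/
def step (P : Problem m a b Ξ Z) (M : Matrix (Fin m) (Fin m) ℝ) (θ : Params) (t : ℕ)
    (s : Fin m → IterSample Ξ Z θ.K) (S : State m a b) : State m a b :=
  let p : Fin m → E a := fun i =>
    P.hatGrad θ.Lg i (S.x i) (S.y i) (s i).1 +
      (1 - θ.η t) • (S.p i - P.hatGrad θ.Lg i (S.xPrev i) (S.yPrev i) (s i).1)
  let v : Fin m → E b := fun i =>
    P.lowGrad i (S.x i) (S.y i) (s i).2 +
      (1 - θ.γ t) • (S.v i - P.lowGrad i (S.xPrev i) (S.yPrev i) (s i).2)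
  let u : Fin m → E a := fun i => (∑ j, M i j • S.u j) + p i - S.p i
  { x := fun i => (∑ j, M i j • S.x j) - θ.α t • u i
    y := fun i => S.y i - θ.β t • v i
    xPrev := S.x
    yPrev := S.y
    p := p
    v := v
    u := u
    ifoCalls := S.ifoCalls + 2 * (estimatorCalls θ.K + lowGradCalls)
    commRounds := S.commRounds + 1 }

/-- The state after `t` iterations of DIAMOND when `s t i` are the samples drawn by agent `i` in
iteration `t`. -/
def run (P : Problem m a b Ξ Z) (M : Matrix (Fin m) (Fin m) ℝ) (θ : Params) (x₀ : E a) (y₀ : E b)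
    (s : ℕ → Fin m → IterSample Ξ Z θ.K) : ℕ → State m a b
  | 0 => State.init m x₀ y₀
  | t + 1 => step P M θ t (s t) (run P M θ x₀ y₀ s t)

/-- The state after `t` iterations as a random variable, when `S t i` are the random samples. -/
def process (P : Problem m a b Ξ Z) (M : Matrix (Fin m) (Fin m) ℝ) (θ : Params) (x₀ : E a)
    (y₀ : E b) {Ω : Type*} (S : ℕ → Fin m → Ω → IterSample Ξ Z θ.K) (t : ℕ) (ω : Ω) :
    State m a b :=
  run P M θ x₀ y₀ (fun t i => S t i ω) t

/-- The average `(1/m) ∑ x_i`. -/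
def mean (x : Fin m → E a) : E a := (1 / (m : ℝ)) • ∑ i, x i

/-- `‖∇l(x̄)‖² + ‖y^* - y‖² + (1/m) ∑ ‖x_i - x̄‖²`, with `y^*` the stacked `y_i^*(x_i)`. -/
def stationarityError (P : Problem m a b Ξ Z) (x : Fin m → E a) (y : Fin m → E b) : ℝ :=
  ‖gradient P.obj (mean x)‖ ^ 2 + ∑ i, ‖P.ystar i (x i) - y i‖ ^ 2 +
    (1 / (m : ℝ)) * ∑ i, ‖x i - mean x‖ ^ 2

/-- The random point `(x, y)` is `ε`-stationary. -/
def IsEpsStationary (P : Problem m a b Ξ Z) {Ω : Type*} [MeasurableSpace Ω] (ν : Measure Ω)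
    (x : Ω → Fin m → E a) (y : Ω → Fin m → E b) (ε : ℝ) : Prop :=
  Integrable (fun ω => stationarityError P (x ω) (y ω)) ν ∧
    ∫ ω, stationarityError P (x ω) (y ω) ∂ν ≤ ε

end Algorithm

/-- The step-size `α_t = (w + t)^{-1/3}`, for real `t ≥ -1`. -/
def stepsize (w t : ℝ) : ℝ := (w + t) ^ (-(1 / 3) : ℝ)

/-- `K = (L_g / μ_g) log (C_gxy C_fy T / μ_g)`, rounded up to a positive integer. -/
def numTerms (c : Constants) (T : ℕ) : ℕ :=
  max 1 ⌈(c.Lg / c.μg) * Real.log (c.Cgxy * c.Cfy * T / c.μg)⌉₊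

/-- The parameters for horizon `T`: `α_t = (w + t)^{-1/3}`, `β_t = c_β α_t`,
`η_t = c_η α_{t-1}²`, `γ_t = c_γ α_{t-1}²`. -/
def schedule (c : Constants) (T : ℕ) (w cβ cη cγ : ℝ) : Params where
  α := fun t => stepsize w t
  β := fun t => cβ * stepsize w t
  η := fun t => cη * stepsize w ((t : ℝ) - 1) ^ 2
  γ := fun t => cγ * stepsize w ((t : ℝ) - 1) ^ 2
  K := numTerms c T
  Lg := c.Lg

/-- The explicit restrictions on the parameters, for a matrix with `secondEigenvalue ≤ lam`. -/
structure Params.Admissible (θ : Params) (c : Constants) (lam : ℝ) : Prop where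
  α_le : ∀ t, θ.α t ≤ 1 - lam
  β_le : ∀ t, θ.β t ≤ 1 / (c.μg + c.Lg)
  η_mem : ∀ t, θ.η t ∈ Set.Icc (0 : ℝ) 1
  γ_mem : ∀ t, θ.γ t ∈ Set.Icc (0 : ℝ) 1

end Diamond

end

open Diamond

/-!
DIAMOND combines gradient tracking over a network with momentum-corrected stochastic gradients. Its
expected error is controlled by a Lyapunov function, the sum of the objective at the averaged
iterate and of five weighted errors, all in expected square: the distance of the lower-level
variables from their minimizers, the deviations from the average of the iterates `x` and of the
tracked directions `u`, and the errors of the two momentum estimators `p` and `v`.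

* *Hypergradient.* Strong convexity makes `y_i^*` differentiable (`LowerRegular.hasFDerivAt_argmin`),
  which identifies the gradient of `l_i` and shows that it is Lipschitz
  (`LowerRegular.value_gradient_lipschitz`). The stochastic estimator averages to a truncated
  Neumann series (`Problem.integral_hatGrad`), and the logarithmic number of terms `K` makes its
  bias of order `1 / T` (`Problem.norm_bias_numTerms_le`). Its Lipschitz constant and variance are of
  order `K ^ 4` (`Problem.oracle_hatGrad`). For the variance only the assumed bound for a single term
  is used, as the remaining terms are bounded; so the growth of `σf` in `K` plays no role.
* *Momentum.* Given the past, a fresh sample is independent of the iterates, so in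
  `p⁺ - h(x') = (1 - η) (p - h(x)) + noise` the noise is orthogonal to the old error. Evaluating the
  same sample at both iterates makes the noise of order `η` plus the displacement
  (`Oracle.momentum_step`).
* *Consensus.* On vectors orthogonal to the all-ones vector the matrix `M` contracts by its second
  eigenvalue (`sum_sq_mulVec_le`), which gives the recursions for the deviations of `x` and `u`.
* *Descent.* The averaged iterate moves along the averaged momentum estimator, and the objective
  decreases up to the other errors (`IsRun.descent_step`).

These recursions (`ErrorRecursions`) are coupled, but with weights of order `1`, `1 / α`, `α` and
`1 / α` one step lowers the Lyapunov function by `α` times the stationarity error, up to noise of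
order `α ^ 3` (`lyapunov_step`). Since `∑ α_t ^ 3` is logarithmic and `α_T` is of order `T ^ (-1/3)`,
the average error over `T` steps is of order `R ^ 3 (1 + log T) T ^ (-2/3)`, where `R`, of order
`K ^ 4`, is the noise level of the estimator (`exists_average_bound`). As `K` is logarithmic in `T`, a
horizon `T` of order `ε ^ (-3/2)` up to logarithms suffices (`exists_horizon`).

The step-size offset `w` is of order `R ^ 3`, so that all step-sizes are below `1 / R` up to a
constant. The assumptions on the samples hold almost surely only. For the joint measurability of the
sampled derivatives they are needed at every sample, which is arranged by replacing exceptional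
samples by a fixed regular one (`Problem.Regular.exists_sampleRegular`); this changes the iterates on
a null set only.
-/

namespace Diamond

open Filter
open scoped RealInnerProductSpace Topology ENNReal NNReal

/-! ### Partial gradients and second derivatives -/

section Calculus

variable {a b : ℕ}

theorem LipschitzXY.sq {V : Type*} [NormedAddCommGroup V] {L : ℝ} {H : E a → E b → V}
    (h : LipschitzXY L H) (x : E a) (y : E b) (x' : E a) (y' : E b) :
    ‖H x y - H x' y'‖ ^ 2 ≤ L ^ 2 * (‖x - x'‖ ^ 2 + ‖y - y'‖ ^ 2) := by
  have h1 := pow_le_pow_left₀ (norm_nonneg _) (h x y x' y') 2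
  rwa [mul_pow, Real.sq_sqrt (by positivity)] at h1

theorem LipschitzXY.le_add {V : Type*} [NormedAddCommGroup V] {L : ℝ} (hL : 0 ≤ L)
    {H : E a → E b → V} (h : LipschitzXY L H) (x : E a) (y : E b) (x' : E a) (y' : E b) :
    ‖H x y - H x' y'‖ ≤ L * (‖x - x'‖ + ‖y - y'‖) := by
  refine (h x y x' y').trans (mul_le_mul_of_nonneg_left ?_ hL)
  rw [Real.sqrt_le_left (by positivity)]
  nlinarith [norm_nonneg (x - x'), norm_nonneg (y - y')]

theorem LipschitzXY.right {V : Type*} [NormedAddCommGroup V] {L : ℝ} {H : E a → E b → V}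
    (h : LipschitzXY L H) (x : E a) (y y' : E b) : ‖H x y - H x y'‖ ≤ L * ‖y - y'‖ := by
  simpa [Real.sqrt_sq (norm_nonneg (y - y'))] using h x y x y'

theorem LipschitzXY.left {V : Type*} [NormedAddCommGroup V] {L : ℝ} {H : E a → E b → V}
    (h : LipschitzXY L H) (x x' : E a) (y : E b) : ‖H x y - H x' y‖ ≤ L * ‖x - x'‖ := by
  simpa [Real.sqrt_sq (norm_nonneg (x - x'))] using h x y x' y

section Gradients

variable {F : E a → E b → ℝ} (hF : Differentiable ℝ fun z : E a × E b => F z.1 z.2)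

include hF

theorem hasFDerivAt_right (x : E a) (y : E b) :
    HasFDerivAt (fun y' => F x y')
      ((fderiv ℝ (fun z : E a × E b => F z.1 z.2) (x, y)).comp
        (ContinuousLinearMap.inr ℝ (E a) (E b))) y :=
  HasFDerivAt.comp (g := fun z : E a × E b => F z.1 z.2) y (hF (x, y)).hasFDerivAt
    (hasFDerivAt_prodMk_right x y)

theorem hasFDerivAt_left (x : E a) (y : E b) :
    HasFDerivAt (fun x' => F x' y)
      ((fderiv ℝ (fun z : E a × E b => F z.1 z.2) (x, y)).comp
        (ContinuousLinearMap.inl ℝ (E a) (E b))) x :=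
  HasFDerivAt.comp (g := fun z : E a × E b => F z.1 z.2) (f := fun x' => (x', y)) x
    (hF (x, y)).hasFDerivAt
    (hasFDerivAt_prodMk_left x y)

theorem inner_gradY (x : E a) (y v : E b) :
    ⟪gradY F x y, v⟫ = fderiv ℝ (fun z : E a × E b => F z.1 z.2) (x, y) (0, v) := by
  rw [gradY, gradient, (hasFDerivAt_right hF x y).fderiv]
  simp

theorem inner_gradX (x u : E a) (y : E b) :
    ⟪gradX F x y, u⟫ = fderiv ℝ (fun z : E a × E b => F z.1 z.2) (x, y) (u, 0) := by
  rw [gradX, gradient, (hasFDerivAt_left hF x y).fderiv]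
  simp

theorem fderiv_eq_inner_grad (x u : E a) (y v : E b) :
    fderiv ℝ (fun z : E a × E b => F z.1 z.2) (x, y) (u, v) =
      ⟪gradX F x y, u⟫ + ⟪gradY F x y, v⟫ := by
  rw [inner_gradY hF, inner_gradX hF, ← map_add]
  simp

theorem hasGradientAt_gradY (x : E a) (y : E b) :
    HasGradientAt (fun y' => F x y') (gradY F x y) y :=
  (hasFDerivAt_right hF x y).differentiableAt.hasGradientAt

theorem hasGradientAt_gradX (x : E a) (y : E b) :
    HasGradientAt (fun x' => F x' y) (gradX F x y) x :=
  (hasFDerivAt_left hF x y).differentiableAt.hasGradientAt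

end Gradients

/-- Directional derivative of a function on `E d` in terms of its gradient. -/
theorem hasDerivAt_line_of_hasGradientAt {d : ℕ} {φ : E d → ℝ} {φ' z : E d}
    (h : HasGradientAt φ φ' z) (v : E d) : HasDerivAt (fun t : ℝ => φ (z + t • v)) ⟪φ', v⟫ 0 := by
  have h1 : HasDerivAt (fun t : ℝ => z + t • v) v 0 := by
    simpa using ((hasDerivAt_id (0 : ℝ)).smul_const v).const_add z
  have h2 : HasFDerivAt φ (InnerProductSpace.toDual ℝ (E d) φ') (z + (0 : ℝ) • v) := by
    simpa using h.hasFDerivAt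
  have h3 := h2.comp_hasDerivAt (0 : ℝ) h1
  rwa [InnerProductSpace.toDual_apply_apply] at h3

end Calculus

section LowerLevel

variable {a b : ℕ} {c : Constants} {G : E a → E b → ℝ} (hG : LowerRegular c G)

include hG

theorem LowerRegular.differentiable : Differentiable ℝ fun z : E a × E b => G z.1 z.2 :=
  hG.contDiff.differentiable (by norm_num)

theorem LowerRegular.differentiable_fderiv :
    Differentiable ℝ (fderiv ℝ fun z : E a × E b => G z.1 z.2) :=
  (hG.contDiff.fderiv_right (m := 1) (by norm_num)).differentiable (by norm_num)

theorem LowerRegular.differentiable_gradY :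
    Differentiable ℝ fun z : E a × E b => gradY G z.1 z.2 := by
  rw [differentiable_euclidean]
  intro j
  have h : (fun z : E a × E b => gradY G z.1 z.2 j) = fun z =>
      fderiv ℝ (fun z : E a × E b => G z.1 z.2) z (0, EuclideanSpace.single j 1) := by
    funext z
    rw [show z = (z.1, z.2) from rfl, ← inner_gradY hG.differentiable]
    simp [EuclideanSpace.inner_single_right]
  rw [h]
  exact hG.differentiable_fderiv.clm_apply (differentiable_const _)

theorem LowerRegular.differentiable_gradX :
    Differentiable ℝ fun z : E a × E b => gradX G z.1 z.2 := by
  rw [differentiable_euclidean]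
  intro j
  have h : (fun z : E a × E b => gradX G z.1 z.2 j) = fun z =>
      fderiv ℝ (fun z : E a × E b => G z.1 z.2) z (EuclideanSpace.single j 1, 0) := by
    funext z
    rw [show z = (z.1, z.2) from rfl, ← inner_gradX hG.differentiable]
    simp [EuclideanSpace.inner_single_right]
  rw [h]
  exact hG.differentiable_fderiv.clm_apply (differentiable_const _)

theorem LowerRegular.inner_fderiv_gradY (z w : E a × E b) (v : E b) :
    ⟪fderiv ℝ (fun z : E a × E b => gradY G z.1 z.2) z w, v⟫ =
      fderiv ℝ (fderiv ℝ fun z : E a × E b => G z.1 z.2) z w (0, v) := by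
  have h1 := ((hG.differentiable_gradY z).hasFDerivAt.inner ℝ (hasFDerivAt_const v z))
  have h2 := (hG.differentiable_fderiv z).hasFDerivAt.clm_apply
    (hasFDerivAt_const ((0 : E a), v) z)
  have h3 : (fun z : E a × E b => ⟪gradY G z.1 z.2, v⟫) = fun z =>
      fderiv ℝ (fun z : E a × E b => G z.1 z.2) z (0, v) := by
    funext z
    exact inner_gradY hG.differentiable z.1 z.2 v
  rw [h3] at h1
  have h4 := congrArg (fun A => A w) (h1.unique h2)
  simpa using h4

theorem LowerRegular.inner_fderiv_gradX (z w : E a × E b) (u : E a) :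
    ⟪fderiv ℝ (fun z : E a × E b => gradX G z.1 z.2) z w, u⟫ =
      fderiv ℝ (fderiv ℝ fun z : E a × E b => G z.1 z.2) z w (u, 0) := by
  have h1 := ((hG.differentiable_gradX z).hasFDerivAt.inner ℝ (hasFDerivAt_const u z))
  have h2 := (hG.differentiable_fderiv z).hasFDerivAt.clm_apply
    (hasFDerivAt_const (u, (0 : E b)) z)
  have h3 : (fun z : E a × E b => ⟪gradX G z.1 z.2, u⟫) = fun z =>
      fderiv ℝ (fun z : E a × E b => G z.1 z.2) z (u, 0) := by
    funext z
    exact inner_gradX hG.differentiable z.1 u z.2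
  rw [h3] at h1
  have h4 := congrArg (fun A => A w) (h1.unique h2)
  simpa using h4

theorem LowerRegular.hasFDerivAt_gradX_right (x : E a) (y : E b) :
    HasFDerivAt (fun y' => gradX G x y') (hessXY G x y) y :=
  (HasFDerivAt.comp (g := fun z : E a × E b => gradX G z.1 z.2) y
    (hG.differentiable_gradX (x, y)).hasFDerivAt
    (hasFDerivAt_prodMk_right x y)).differentiableAt.hasFDerivAt

theorem LowerRegular.hasFDerivAt_gradY_right (x : E a) (y : E b) :
    HasFDerivAt (fun y' => gradY G x y') (hessYY G x y) y :=
  (HasFDerivAt.comp (g := fun z : E a × E b => gradY G z.1 z.2) y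
    (hG.differentiable_gradY (x, y)).hasFDerivAt
    (hasFDerivAt_prodMk_right x y)).differentiableAt.hasFDerivAt

theorem LowerRegular.hessXY_apply (x : E a) (y v : E b) :
    hessXY G x y v = fderiv ℝ (fun z : E a × E b => gradX G z.1 z.2) (x, y) (0, v) := by
  have h := HasFDerivAt.comp (g := fun z : E a × E b => gradX G z.1 z.2) y
    (hG.differentiable_gradX (x, y)).hasFDerivAt (hasFDerivAt_prodMk_right x y)
  have h2 := (hG.hasFDerivAt_gradX_right x y).unique h
  rw [h2]
  simp

theorem LowerRegular.hessYY_apply (x : E a) (y v : E b) :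
    hessYY G x y v = fderiv ℝ (fun z : E a × E b => gradY G z.1 z.2) (x, y) (0, v) := by
  have h := HasFDerivAt.comp (g := fun z : E a × E b => gradY G z.1 z.2) y
    (hG.differentiable_gradY (x, y)).hasFDerivAt (hasFDerivAt_prodMk_right x y)
  have h2 := (hG.hasFDerivAt_gradY_right x y).unique h
  rw [h2]
  simp

theorem LowerRegular.isSymmSndFDerivAt (z : E a × E b) :
    IsSymmSndFDerivAt ℝ (fun z : E a × E b => G z.1 z.2) z :=
  hG.contDiff.contDiffAt.isSymmSndFDerivAt (by simp)

theorem LowerRegular.hessYY_symm (x : E a) (y v w : E b) :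
    ⟪hessYY G x y v, w⟫ = ⟪v, hessYY G x y w⟫ := by
  rw [real_inner_comm _ v, hG.hessYY_apply, hG.hessYY_apply, hG.inner_fderiv_gradY,
    hG.inner_fderiv_gradY, (hG.isSymmSndFDerivAt (x, y)).eq]

/-- The derivative of `∇_y G` in `x` is the transpose of `∇²_xy G`. -/
theorem LowerRegular.fderiv_gradY_apply (x u : E a) (y v w : E b) :
    ⟪fderiv ℝ (fun z : E a × E b => gradY G z.1 z.2) (x, y) (u, v), w⟫ =
      ⟪u, hessXY G x y w⟫ + ⟪hessYY G x y v, w⟫ := by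
  have h : ((u, v) : E a × E b) = (u, 0) + (0, v) := by simp
  rw [h, map_add, inner_add_left, ← hG.hessYY_apply, hG.inner_fderiv_gradY, real_inner_comm _ u,
    hG.hessXY_apply, hG.inner_fderiv_gradX, (hG.isSymmSndFDerivAt (x, y)).eq]

/-- First-order characterization of strong convexity. -/
theorem LowerRegular.strong_lower_bound (x : E a) (y y' : E b) :
    G x y + ⟪gradY G x y, y' - y⟫ + c.μg / 2 * ‖y' - y‖ ^ 2 ≤ G x y' := by
  have hd := hasDerivAt_line_of_hasGradientAt (hasGradientAt_gradY hG.differentiable x y) (y' - y)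
  have hs := hd.hasDerivWithinAt (s := Set.Ioi 0)
  rw [hasDerivWithinAt_iff_tendsto_slope' (by simp)] at hs
  have hlim : Tendsto (fun t : ℝ => G x y' - G x y - (1 - t) * (c.μg / 2 * ‖y - y'‖ ^ 2))
      (𝓝[>] 0) (𝓝 (G x y' - G x y - (1 - 0) * (c.μg / 2 * ‖y - y'‖ ^ 2))) := by
    refine (Continuous.tendsto ?_ _).mono_left nhdsWithin_le_nhds
    fun_prop
  have hle := le_of_tendsto_of_tendsto hs hlim ?_
  · rw [norm_sub_rev y y'] at hle
    linarith
  have : Set.Ioo (0 : ℝ) 1 ∈ 𝓝[>] (0 : ℝ) := Ioo_mem_nhdsGT one_pos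
  filter_upwards [this] with t ht
  have hc := (hG.strongConvex x).2 (Set.mem_univ y) (Set.mem_univ y') (sub_nonneg.2 ht.2.le)
    ht.1.le (by ring)
  have e : (1 - t) • y + t • y' = y + t • (y' - y) := by
    rw [sub_smul, smul_sub, one_smul]; abel
  rw [e] at hc
  simp only [smul_eq_mul] at hc
  rw [slope_def_field, div_le_iff₀ (by linarith [ht.1])]
  simp only [zero_smul, add_zero, sub_zero]
  nlinarith [hc]

theorem LowerRegular.strongly_monotone (x : E a) (y y' : E b) :
    c.μg * ‖y - y'‖ ^ 2 ≤ ⟪gradY G x y - gradY G x y', y - y'⟫ := by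
  have h1 := hG.strong_lower_bound x y y'
  have h2 := hG.strong_lower_bound x y' y
  rw [norm_sub_rev y' y] at h1
  have h3 : ⟪gradY G x y, y' - y⟫ = - ⟪gradY G x y, y - y'⟫ := by
    rw [← inner_neg_right, neg_sub]
  rw [inner_sub_left]
  linarith

/-- Strong monotonicity of `∇_y G` along a line, differentiated at the base point. -/
theorem LowerRegular.hessYY_coercive (x : E a) (y v : E b) :
    c.μg * ‖v‖ ^ 2 ≤ ⟪hessYY G x y v, v⟫ := by
  have h1 : HasDerivAt (fun t : ℝ => y + t • v) v 0 := by
    simpa using ((hasDerivAt_id (0 : ℝ)).smul_const v).const_add y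
  have h2 : HasFDerivAt (fun y' => gradY G x y') (hessYY G x y) (y + (0 : ℝ) • v) := by
    simpa using hG.hasFDerivAt_gradY_right x y
  have h3 := ((h2.comp_hasDerivAt (0 : ℝ) h1).inner ℝ (hasDerivAt_const (0 : ℝ) v))
  have hs := h3.hasDerivWithinAt (s := Set.Ioi 0)
  rw [hasDerivWithinAt_iff_tendsto_slope' (by simp)] at hs
  have h4 : c.μg * ‖v‖ ^ 2 ≤ ⟪gradY G x (y + (0 : ℝ) • v), 0⟫ + ⟪hessYY G x y v, v⟫ := by
    refine ge_of_tendsto hs ?_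
    filter_upwards [self_mem_nhdsWithin] with t ht
    have ht' : 0 < t := ht
    rw [slope_def_field, le_div_iff₀ (by linarith)]
    have h5 := hG.strongly_monotone x (y + t • v) y
    simp only [add_sub_cancel_left, norm_smul, inner_smul_right, Real.norm_eq_abs,
      abs_of_pos ht', inner_sub_left] at h5
    simp only [Function.comp, zero_smul, add_zero, sub_zero]
    have h6 : t * (c.μg * ‖v‖ ^ 2 * t) ≤
        t * (⟪gradY G x (y + t • v), v⟫ - ⟪gradY G x y, v⟫) := by linarith
    exact le_of_mul_le_mul_left h6 ht'
  simpa using h4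

theorem LowerRegular.norm_hessYY_le (hc : c.Valid) (x : E a) (y : E b) :
    ‖hessYY G x y‖ ≤ c.Lg := by
  have h : LipschitzWith c.Lg.toNNReal (fun y' => gradY G x y') := by
    refine LipschitzWith.of_dist_le_mul fun y y' => ?_
    rw [dist_eq_norm, dist_eq_norm, Real.coe_toNNReal _ hc.Lg_nonneg]
    exact hG.gradY_lipschitz.right x y y'
  have := norm_fderiv_le_of_lipschitz ℝ h (x₀ := y)
  rwa [Real.coe_toNNReal _ hc.Lg_nonneg] at this

theorem LowerRegular.norm_hessXY_le (x : E a) (y : E b) :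
    ‖hessXY G x y‖ ≤ Real.sqrt c.Cgxy :=
  Real.le_sqrt_of_sq_le (hG.hessXY_bounded x y)

/-- In dimension zero nothing relates the two constants, and `c.Lg` may vanish. -/
theorem LowerRegular.μg_le_Lg [Nontrivial (E b)] : c.μg ≤ c.Lg := by
  obtain ⟨v, hv⟩ := exists_ne (0 : E b)
  have h1 := hG.strongly_monotone 0 v 0
  have h2 := hG.gradY_lipschitz.right 0 v 0
  have h3 := real_inner_le_norm (gradY G 0 v - gradY G 0 0) (v - 0)
  rw [sub_zero] at *
  have hv' : 0 < ‖v‖ := norm_pos_iff.2 hv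
  have h4 : c.μg * ‖v‖ ^ 2 ≤ c.Lg * ‖v‖ ^ 2 := by nlinarith
  exact le_of_mul_le_mul_right h4 (by positivity)

end LowerLevel

/-- A symmetric operator is bounded by any bound on its quadratic form. -/
theorem norm_le_of_quadratic_form {d : ℕ} (A : E d →L[ℝ] E d) {r : ℝ} (hr : 0 ≤ r)
    (hs : ∀ v w, ⟪A v, w⟫ = ⟪v, A w⟫) (hq : ∀ v, |⟪A v, v⟫| ≤ r * ‖v‖ ^ 2) : ‖A‖ ≤ r := by
  have key : ∀ v w, ⟪A v, w⟫ ≤ r / 2 * (‖v‖ ^ 2 + ‖w‖ ^ 2) := by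
    intro v w
    have h1 := (abs_le.1 (hq (v + w))).2
    have h2 := (abs_le.1 (hq (v - w))).1
    have h3 : ⟪A w, v⟫ = ⟪A v, w⟫ := by rw [hs v w, real_inner_comm]
    have h4 := parallelogram_law_with_norm ℝ v w
    simp only [map_add, map_sub, inner_add_left, inner_add_right, inner_sub_left,
      inner_sub_right] at h1 h2
    nlinarith
  refine A.opNorm_le_bound hr fun v => ?_
  by_cases hv : ‖v‖ = 0
  · rw [norm_eq_zero] at hv; simp [hv]
  by_cases hA : ‖A v‖ = 0
  · rw [hA]; positivity
  have hv' : 0 < ‖v‖ := lt_of_le_of_ne (norm_nonneg _) (Ne.symm hv)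
  have hA' : 0 < ‖A v‖ := lt_of_le_of_ne (norm_nonneg _) (Ne.symm hA)
  -- rescaling `A v` to the length of `v` turns the bound on the form into one on `‖A v‖`
  have h := key v ((‖v‖ / ‖A v‖) • A v)
  rw [inner_smul_right, real_inner_self_eq_norm_sq, norm_smul, norm_div, norm_norm, norm_norm,
    div_mul_cancel₀ _ hA] at h
  have e : ‖v‖ / ‖A v‖ * ‖A v‖ ^ 2 = ‖v‖ * ‖A v‖ := by field_simp
  rw [e] at h
  have : ‖v‖ * ‖A v‖ ≤ ‖v‖ * (r * ‖v‖) := by nlinarith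
  exact le_of_mul_le_mul_left this hv'

/-- One factor of the truncated Neumann series for `[∇²_yy G]⁻¹`. -/
noncomputable def neumannFactor {a b : ℕ} (Lg : ℝ) (G : E a → E b → ℝ) (x : E a) (y : E b) :
    E b →L[ℝ] E b :=
  1 - (1 / Lg) • hessYY G x y

/-- In positive dimension `μ_g ≤ L_g`, and the bound is `1 - μ_g / L_g`; the absolute value keeps the
statement true in dimension zero. -/
theorem LowerRegular.norm_neumannFactor_le {a b : ℕ} {c : Constants} {G : E a → E b → ℝ}
    (hG : LowerRegular c G) (hc : c.Valid) (x : E a) (y : E b) :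
    ‖neumannFactor c.Lg G x y‖ ≤ |1 - c.μg / c.Lg| := by
  rcases subsingleton_or_nontrivial (E b) with hb | hb
  · rw [Subsingleton.elim (neumannFactor c.Lg G x y) 0, norm_zero]
    positivity
  have hL : 0 < c.Lg := hc.μg_pos.trans_le hG.μg_le_Lg
  have h1 : 0 ≤ 1 - c.μg / c.Lg := by
    rw [sub_nonneg, div_le_one hL]; exact hG.μg_le_Lg
  rw [abs_of_nonneg h1]
  refine norm_le_of_quadratic_form _ h1 (fun v w => ?_) (fun v => ?_)
  · simp [neumannFactor, inner_sub_left, inner_sub_right, inner_smul_left, inner_smul_right,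
      hG.hessYY_symm]
  · have h2 := hG.hessYY_coercive x y v
    have h3 := real_inner_le_norm (hessYY G x y v) v
    have h4 := (hessYY G x y).le_of_opNorm_le (hG.norm_hessYY_le hc x y) v
    have h5 : ⟪hessYY G x y v, v⟫ ≤ c.Lg * ‖v‖ ^ 2 := by nlinarith [norm_nonneg v]
    have e : ⟪neumannFactor c.Lg G x y v, v⟫ = ‖v‖ ^ 2 - ⟪hessYY G x y v, v⟫ / c.Lg := by
      simp [neumannFactor, inner_sub_left, inner_smul_left]
      ring
    rw [e, abs_le]
    have h6 : ⟪hessYY G x y v, v⟫ / c.Lg ≤ ‖v‖ ^ 2 := by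
      rw [div_le_iff₀ hL]; linarith
    have h7 : c.μg / c.Lg * ‖v‖ ^ 2 ≤ ⟪hessYY G x y v, v⟫ / c.Lg := by
      rw [le_div_iff₀ hL]
      calc c.μg / c.Lg * ‖v‖ ^ 2 * c.Lg = c.μg * ‖v‖ ^ 2 := by field_simp
        _ ≤ _ := h2
    constructor
    · have := mul_nonneg h1 (sq_nonneg ‖v‖)
      linarith
    · linarith

theorem LowerRegular.norm_neumannFactor_le_one {a b : ℕ} {c : Constants} {G : E a → E b → ℝ}
    (hG : LowerRegular c G) (hc : c.Valid) (x : E a) (y : E b) :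
    ‖neumannFactor c.Lg G x y‖ ≤ 1 := by
  rcases subsingleton_or_nontrivial (E b) with hb | hb
  · rw [Subsingleton.elim (neumannFactor c.Lg G x y) 0, norm_zero]
    positivity
  refine (hG.norm_neumannFactor_le hc x y).trans ?_
  have hL : 0 < c.Lg := hc.μg_pos.trans_le hG.μg_le_Lg
  have h1 : 0 ≤ c.μg / c.Lg := div_nonneg hc.μg_pos.le hL.le
  have h2 : c.μg / c.Lg ≤ 1 := by rw [div_le_one hL]; exact hG.μg_le_Lg
  rw [abs_of_nonneg (by linarith)]
  linarith

/-! ### The lower-level solution and the hypergradient -/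

section Inverse

variable {a b : ℕ} {c : Constants} {G : E a → E b → ℝ} (hG : LowerRegular c G) (hc : c.Valid)

include hG hc

theorem LowerRegular.hessYY_inverse (x : E a) (y : E b) :
    (∀ v, (hessYY G x y).inverse (hessYY G x y v) = v) ∧
      ∀ v, hessYY G x y ((hessYY G x y).inverse v) = v := by
  have hinj : Function.Injective (hessYY G x y : E b →ₗ[ℝ] E b) := by
    rw [← LinearMap.ker_eq_bot, LinearMap.ker_eq_bot']
    intro v hv
    have h := hG.hessYY_coercive x y v
    have hv' : hessYY G x y v = 0 := hv
    rw [hv', inner_zero_left] at h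
    have := hc.μg_pos
    have h2 : ‖v‖ ^ 2 ≤ 0 := by nlinarith [sq_nonneg ‖v‖]
    exact norm_eq_zero.1 (pow_eq_zero_iff two_ne_zero |>.1 (le_antisymm h2 (sq_nonneg _)))
  let e := (LinearEquiv.ofInjectiveEndo _ hinj).toContinuousLinearEquiv
  have he : (e : E b →L[ℝ] E b) = hessYY G x y := by
    ext v
    rfl
  rw [← he, ContinuousLinearMap.inverse_equiv]
  exact ⟨e.symm_apply_apply, e.apply_symm_apply⟩

theorem LowerRegular.norm_inverse_apply_le (x : E a) (y v : E b) :
    ‖(hessYY G x y).inverse v‖ ≤ ‖v‖ / c.μg := by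
  set w := (hessYY G x y).inverse v with hw
  have h1 := hG.hessYY_coercive x y w
  rw [hw, (hG.hessYY_inverse hc x y).2, ← hw] at h1
  have h2 := real_inner_le_norm v w
  rw [le_div_iff₀ hc.μg_pos]
  rcases (norm_nonneg w).eq_or_lt with h0 | h0
  · rw [← h0]; simp
  · have : ‖w‖ * (‖w‖ * c.μg) ≤ ‖w‖ * ‖v‖ := by nlinarith
    exact le_of_mul_le_mul_left this h0

theorem LowerRegular.inverse_symm (x : E a) (y v w : E b) :
    ⟪(hessYY G x y).inverse v, w⟫ = ⟪v, (hessYY G x y).inverse w⟫ := by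
  have h := hG.hessYY_symm x y ((hessYY G x y).inverse v) ((hessYY G x y).inverse w)
  rw [(hG.hessYY_inverse hc x y).2, (hG.hessYY_inverse hc x y).2] at h
  exact h.symm

end Inverse

section Argmin

variable {a b : ℕ}

/-- A minimizer of `G(x, ·)`, where one exists. -/
noncomputable def argmin (G : E a → E b → ℝ) (x : E a) : E b :=
  Classical.epsilon fun y => ∀ y', G x y ≤ G x y'

/-- The hypergradient surrogate `∇ₓ F - ∇²_xy G [∇²_yy G]⁻¹ ∇_y F` at an arbitrary point
`(x, y)`; at `y = argmin G x` it is the gradient of `x ↦ F(x, argmin G x)`. -/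
noncomputable def hyperGrad (F G : E a → E b → ℝ) (x : E a) (y : E b) : E a :=
  gradX F x y - hessXY G x y ((hessYY G x y).inverse (gradY F x y))

variable {c : Constants} {G : E a → E b → ℝ} (hG : LowerRegular c G) (hc : c.Valid)

include hG hc

/-- Strong convexity makes `G(x, ·)` coercive, so that the minimum is attained. -/
theorem LowerRegular.argmin_le (x : E a) (y : E b) : G x (argmin G x) ≤ G x y := by
  have hcont : Continuous (G x) := by
    have := hG.differentiable.continuous
    exact this.comp (Continuous.prodMk_right x)
  have hμ := hc.μg_pos
  have hcoer : Tendsto (G x) (cocompact (E b)) atTop := by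
    have hn : Tendsto (fun y : E b => ‖y‖ + G x 0) (cocompact (E b)) atTop :=
      tendsto_atTop_add_const_right _ _ tendsto_norm_cocompact_atTop
    refine tendsto_atTop_mono' _ ?_ hn
    filter_upwards [(tendsto_norm_cocompact_atTop (E := E b)).eventually_ge_atTop
      (2 / c.μg * (‖gradY G x 0‖ + 1))] with y hy
    have h1 := hG.strong_lower_bound x 0 y
    have h2 := (abs_le.1 (abs_real_inner_le_norm (gradY G x 0) (y - 0))).1
    rw [sub_zero] at *
    have h3 : ‖gradY G x 0‖ + 1 ≤ c.μg / 2 * ‖y‖ := by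
      have := mul_le_mul_of_nonneg_left hy (by positivity : 0 ≤ c.μg / 2)
      have e : c.μg / 2 * (2 / c.μg * (‖gradY G x 0‖ + 1)) = ‖gradY G x 0‖ + 1 := by field_simp
      linarith
    nlinarith [norm_nonneg y]
  exact Classical.epsilon_spec (p := fun y => ∀ y', G x y ≤ G x y')
    (hcont.exists_forall_le hcoer) y

theorem LowerRegular.gradY_argmin (x : E a) : gradY G x (argmin G x) = 0 := by
  have h : IsLocalMin (fun y => G x y) (argmin G x) :=
    Filter.Eventually.of_forall fun y => hG.argmin_le hc x y
  rw [gradY, gradient, h.fderiv_eq_zero, map_zero]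

/-- Strong monotonicity bounds `‖y^*(x) - y^*(x')‖` by the change of `∇_y G(·, y^*(x))`. -/
theorem LowerRegular.argmin_lipschitz (x x' : E a) :
    ‖argmin G x - argmin G x'‖ ≤ c.Lg / c.μg * ‖x - x'‖ := by
  set y := argmin G x with hy
  set y' := argmin G x' with hy'
  have h1 := hG.strongly_monotone x y y'
  have h2 : gradY G x y = gradY G x' y' := by
    rw [hy, hy', hG.gradY_argmin hc, hG.gradY_argmin hc]
  rw [h2] at h1
  have h3 := real_inner_le_norm (gradY G x' y' - gradY G x y') (y - y')
  have h4 := hG.gradY_lipschitz.left x' x y'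
  rw [norm_sub_rev x' x] at h4
  rw [div_mul_eq_mul_div, le_div_iff₀ hc.μg_pos]
  rcases (norm_nonneg (y - y')).eq_or_lt with h0 | h0
  · rw [← h0]
    have := hc.Lg_nonneg
    simp only [zero_mul]; positivity
  · have : ‖y - y'‖ * (‖y - y'‖ * c.μg) ≤ ‖y - y'‖ * (c.Lg * ‖x - x'‖) := by nlinarith
    exact le_of_mul_le_mul_left this h0

theorem LowerRegular.continuous_argmin : Continuous (argmin G) := by
  have : LipschitzWith (c.Lg / c.μg).toNNReal (argmin G) := by
    refine LipschitzWith.of_dist_le_mul fun x x' => ?_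
    rw [dist_eq_norm, dist_eq_norm,
      Real.coe_toNNReal _ (div_nonneg hc.Lg_nonneg hc.μg_pos.le)]
    exact hG.argmin_lipschitz hc x x'
  exact this.continuous

/-- Implicit differentiation of `∇_y G(x, argmin G x) = 0`. -/
theorem LowerRegular.hasFDerivAt_argmin (x : E a) :
    HasFDerivAt (argmin G)
      (-((hessYY G x (argmin G x)).inverse.comp
        ((fderiv ℝ (fun z : E a × E b => gradY G z.1 z.2) (x, argmin G x)).comp
          (ContinuousLinearMap.inl ℝ (E a) (E b))))) x := by
  set y := argmin G x with hy
  set A := fderiv ℝ (fun z : E a × E b => gradY G z.1 z.2) (x, y) with hA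
  have hbig : (fun x' => ((x', argmin G x') : E a × E b) - (x, y)) =O[𝓝 x] fun x' => x' - x := by
    refine Asymptotics.IsBigO.of_bound (max 1 (c.Lg / c.μg)) (Eventually.of_forall fun x' => ?_)
    rw [Prod.mk_sub_mk, Prod.norm_mk]
    refine max_le ?_ ?_
    · exact le_mul_of_one_le_left (norm_nonneg _) (le_max_left _ _)
    · exact (hG.argmin_lipschitz hc x' x).trans
        (mul_le_mul_of_nonneg_right (le_max_right _ _) (norm_nonneg _))
  have htend : Tendsto (fun x' => ((x', argmin G x') : E a × E b)) (𝓝 x) (𝓝 (x, y)) := by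
    have : Continuous fun x' => ((x', argmin G x') : E a × E b) :=
      continuous_id.prodMk (hG.continuous_argmin hc)
    exact this.tendsto x
  have hlo := ((hG.differentiable_gradY (x, y)).hasFDerivAt.isLittleO.comp_tendsto
    htend).trans_isBigO hbig
  have hlo2 := ((-(hessYY G x y).inverse).isBigO_comp _ (𝓝 x)).trans_isLittleO hlo
  refine HasFDerivAt.of_isLittleO (hlo2.congr_left fun x' => ?_)
  simp only [Function.comp_apply, hG.gradY_argmin hc, hy]
  rw [← hy, ← hA]
  have e : A ((x', argmin G x') - (x, y)) = A (x' - x, 0) + hessYY G x y (argmin G x' - y) := by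
    rw [hG.hessYY_apply, ← hA, ← map_add]
    simp
  rw [e]
  simp [(hG.hessYY_inverse hc x y).1]
  abel

/-- The chain rule, with the derivative of `argmin G` moved to the other side of the inner product by
symmetry of the inverse Hessian. -/
theorem LowerRegular.hasGradientAt_value {F : E a → E b → ℝ} (hF : UpperRegular c F) (x : E a) :
    HasGradientAt (fun x => F x (argmin G x)) (hyperGrad F G x (argmin G x)) x := by
  have h := HasFDerivAt.comp (g := fun z : E a × E b => F z.1 z.2)
    (f := fun x => (x, argmin G x)) x (hF.differentiable (x, argmin G x)).hasFDerivAt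
    ((hasFDerivAt_id x).prodMk (hG.hasFDerivAt_argmin hc x))
  rw [hasGradientAt_iff_hasFDerivAt]
  refine h.congr_fderiv ?_
  ext u
  rw [InnerProductSpace.toDual_apply_apply, ContinuousLinearMap.comp_apply,
    ContinuousLinearMap.prod_apply, fderiv_eq_inner_grad hF.differentiable, hyperGrad,
    inner_sub_left, ContinuousLinearMap.id_apply, sub_eq_add_neg, _root_.neg_apply,
    inner_neg_right, ContinuousLinearMap.comp_apply, ContinuousLinearMap.comp_apply,
    ← hG.inverse_symm hc, ContinuousLinearMap.inl_apply, real_inner_comm _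
      ((hessYY G x (argmin G x)).inverse _), hG.fderiv_gradY_apply,
    real_inner_comm u (hessXY G x (argmin G x) _)]
  simp

/-- A Lipschitz constant of the hypergradient surrogate with respect to `‖x‖ + ‖y‖`. -/
noncomputable def hyperLip (c : Constants) : ℝ :=
  c.Lfx + Real.sqrt c.Cgxy * ((c.Lfy + c.Lgyy * (c.Cfy / c.μg)) / c.μg) +
    c.Lgxy * (c.Cfy / c.μg)

omit hG in
theorem hyperLip_nonneg : 0 ≤ hyperLip c := by
  have h1 := hc.Lfx_nonneg
  have h2 := hc.Lfy_nonneg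
  have h3 := hc.Cfy_nonneg
  have h4 := hc.Lgxy_nonneg
  have h5 := hc.Lgyy_nonneg
  have h6 := hc.μg_pos
  unfold hyperLip
  positivity

theorem LowerRegular.hyperGrad_lipschitz {F : E a → E b → ℝ} (hF : UpperRegular c F)
    (x : E a) (y : E b) (x' : E a) (y' : E b) :
    ‖hyperGrad F G x y - hyperGrad F G x' y'‖ ≤ hyperLip c * (‖x - x'‖ + ‖y - y'‖) := by
  set d := ‖x - x'‖ + ‖y - y'‖ with hd
  have hd0 : 0 ≤ d := by positivity
  have hμ := hc.μg_pos
  set g := gradY F x y with hg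
  set g' := gradY F x' y' with hg'
  set w := (hessYY G x y).inverse g with hw
  set w' := (hessYY G x' y').inverse g' with hw'
  have hgg : ‖g - g'‖ ≤ c.Lfy * d := hF.gradY_lipschitz.le_add hc.Lfy_nonneg x y x' y'
  have hfx : ‖gradX F x y - gradX F x' y'‖ ≤ c.Lfx * d :=
    hF.gradX_lipschitz.le_add hc.Lfx_nonneg x y x' y'
  have hHH : ‖hessYY G x' y' - hessYY G x y‖ ≤ c.Lgyy * d := by
    rw [norm_sub_rev]
    exact hG.hessYY_lipschitz.le_add hc.Lgyy_nonneg x y x' y'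
  have hXX : ‖hessXY G x y - hessXY G x' y'‖ ≤ c.Lgxy * d :=
    hG.hessXY_lipschitz.le_add hc.Lgxy_nonneg x y x' y'
  have hw'n : ‖w'‖ ≤ c.Cfy / c.μg := (hG.norm_inverse_apply_le hc x' y' g').trans
    (div_le_div_of_nonneg_right (hF.gradY_bounded x' y') hμ.le)
  have hww : ‖w - w'‖ ≤ (c.Lfy * d + c.Lgyy * d * (c.Cfy / c.μg)) / c.μg := by
    have e : w - w' = (hessYY G x y).inverse ((g - g') + (hessYY G x' y' - hessYY G x y) w') := by
      rw [_root_.sub_apply, hw', (hG.hessYY_inverse hc x' y').2, ← hw',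
        sub_add_sub_cancel, map_sub, (hG.hessYY_inverse hc x y).1]
    rw [e]
    refine (hG.norm_inverse_apply_le hc x y _).trans (div_le_div_of_nonneg_right ?_ hμ.le)
    refine (norm_add_le _ _).trans (add_le_add hgg ?_)
    refine ((hessYY G x' y' - hessYY G x y).le_opNorm w').trans ?_
    exact mul_le_mul hHH hw'n (norm_nonneg _) (mul_nonneg hc.Lgyy_nonneg hd0)
  have e : hyperGrad F G x y - hyperGrad F G x' y' = (gradX F x y - gradX F x' y') -
      (hessXY G x y (w - w') + (hessXY G x y - hessXY G x' y') w') := by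
    simp only [hyperGrad, ← hw, ← hw', ← hg, ← hg', map_sub, _root_.sub_apply]
    abel
  rw [e]
  calc _ ≤ ‖gradX F x y - gradX F x' y'‖ + (‖hessXY G x y (w - w')‖ +
        ‖(hessXY G x y - hessXY G x' y') w'‖) :=
      (norm_sub_le _ _).trans (add_le_add_right (norm_add_le _ _) _)
    _ ≤ c.Lfx * d + (Real.sqrt c.Cgxy * ((c.Lfy * d + c.Lgyy * d * (c.Cfy / c.μg)) / c.μg) +
        c.Lgxy * d * (c.Cfy / c.μg)) := by
      refine add_le_add hfx (add_le_add ?_ ?_)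
      · refine ((hessXY G x y).le_opNorm _).trans ?_
        exact mul_le_mul (hG.norm_hessXY_le x y) hww (norm_nonneg _) (Real.sqrt_nonneg _)
      · refine ((hessXY G x y - hessXY G x' y').le_opNorm w').trans ?_
        exact mul_le_mul hXX hw'n (norm_nonneg _) (mul_nonneg hc.Lgxy_nonneg hd0)
    _ = hyperLip c * d := by unfold hyperLip; field_simp; ring

/-- A Lipschitz constant of the gradient of `x ↦ F(x, argmin G x)`. -/
noncomputable def valueLip (c : Constants) : ℝ := hyperLip c * (1 + c.Lg / c.μg)

omit hG in
theorem valueLip_nonneg : 0 ≤ valueLip c := by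
  have h1 := hyperLip_nonneg hc
  have h2 := hc.μg_pos
  have h3 := hc.Lg_nonneg
  unfold valueLip
  positivity

theorem LowerRegular.value_gradient_lipschitz {F : E a → E b → ℝ} (hF : UpperRegular c F)
    (x x' : E a) :
    ‖hyperGrad F G x (argmin G x) - hyperGrad F G x' (argmin G x')‖ ≤
      valueLip c * ‖x - x'‖ := by
  refine (hG.hyperGrad_lipschitz hc hF _ _ _ _).trans ?_
  rw [valueLip, mul_assoc]
  refine mul_le_mul_of_nonneg_left ?_ (hyperLip_nonneg hc)
  have := hG.argmin_lipschitz hc x x'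
  linarith

end Argmin

/-- Second-order upper bound for a function with Lipschitz gradient. -/
theorem le_of_gradient_lipschitz {d : ℕ} {φ : E d → ℝ} {φ' : E d → E d} {L : ℝ} (hL : 0 ≤ L)
    (hφ : ∀ x, HasGradientAt φ (φ' x) x) (hlip : ∀ x x', ‖φ' x - φ' x'‖ ≤ L * ‖x - x'‖)
    (x x' : E d) : |φ x' - φ x - ⟪φ' x, x' - x⟫| ≤ L * ‖x' - x‖ ^ 2 := by
  have h := (convex_segment x x').norm_image_sub_le_of_norm_hasFDerivWithin_le'
    (f := φ) (f' := fun z => InnerProductSpace.toDual ℝ (E d) (φ' z))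
    (φ := InnerProductSpace.toDual ℝ (E d) (φ' x)) (C := L * ‖x' - x‖)
    (fun z _ => (hφ z).hasFDerivAt.hasFDerivWithinAt) (fun z hz => ?_)
    (left_mem_segment ℝ x x') (right_mem_segment ℝ x x')
  · rw [InnerProductSpace.toDual_apply_apply, Real.norm_eq_abs] at h
    rw [sq, ← mul_assoc]
    exact h
  · rw [← map_sub, LinearIsometryEquiv.norm_map]
    refine (hlip z x).trans (mul_le_mul_of_nonneg_left ?_ hL)
    obtain ⟨t, ht, rfl⟩ := (segment_eq_image' ℝ x x') ▸ hz
    rw [add_sub_cancel_left, norm_smul, Real.norm_eq_abs, abs_of_nonneg ht.1]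
    exact mul_le_of_le_one_left (norm_nonneg _) ht.2

/-! ### Joint measurability of sampled derivatives -/

section Measurability

theorem measurable_of_measurable_coord {d : ℕ} {Q : Type*} [MeasurableSpace Q] {w : Q → E d}
    (h : ∀ j, Measurable fun q => ⟪w q, EuclideanSpace.single j (1 : ℝ)⟫) : Measurable w := by
  have e : w = fun q => ∑ j, ⟪w q, EuclideanSpace.single j (1 : ℝ)⟫ •
      EuclideanSpace.single j (1 : ℝ) := by
    funext q
    ext i
    simp [EuclideanSpace.inner_single_right, Pi.single_apply]
  rw [e]
  exact Finset.measurable_sum _ fun j _ => (h j).smul_const _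

/-- A derivative is measurable in a parameter, being a limit of difference quotients. -/
theorem measurable_of_hasDerivAt {Q V : Type*} [MeasurableSpace Q] [NormedAddCommGroup V]
    [NormedSpace ℝ V] [MeasurableSpace V] [BorelSpace V] [SecondCountableTopology V]
    {φ : Q → ℝ → V} {D : Q → V} (hφ : ∀ t, Measurable fun q => φ q t)
    (hD : ∀ q, HasDerivAt (φ q) (D q) 0) : Measurable D := by
  have htend : Tendsto (fun n : ℕ => 1 / ((n : ℝ) + 1)) atTop (𝓝[≠] 0) := by
    rw [tendsto_nhdsWithin_iff]
    refine ⟨tendsto_one_div_add_atTop_nhds_zero_nat, Eventually.of_forall fun n => ?_⟩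
    have : (0 : ℝ) < 1 / ((n : ℝ) + 1) := by positivity
    exact this.ne'
  refine measurable_of_tendsto_metrizable (f := fun (n : ℕ) q => slope (φ q) 0 (1 / ((n : ℝ) + 1)))
    (fun n => ?_) (tendsto_pi_nhds.2 fun q => ?_)
  · simp only [slope_def_module]
    exact ((hφ _).sub (hφ _)).const_smul _
  · exact (hasDerivAt_iff_tendsto_slope.1 (hD q)).comp htend

theorem measurable_clm_apply {Q : Type*} [MeasurableSpace Q] {b d : ℕ} {B : Q → E b →L[ℝ] E d}
    (hB : ∀ v, Measurable fun q => B q v) : Measurable fun p : Q × E b => B p.1 p.2 := by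
  have e : (fun p : Q × E b => B p.1 p.2) = fun p => ∑ j, p.2 j •
      B p.1 (EuclideanSpace.single j (1 : ℝ)) := by
    funext p
    conv_lhs => rw [← (EuclideanSpace.basisFun (Fin b) ℝ).sum_repr p.2]
    simp
  rw [e]
  refine Finset.measurable_sum _ fun j _ => ?_
  have hcont : Continuous fun v : E b => v j := by fun_prop
  exact (hcont.measurable.comp measurable_snd).smul ((hB _).comp measurable_fst)

theorem measurable_list_prod_apply {Q : Type*} [MeasurableSpace Q] {b k : ℕ}
    {B : Fin k → Q → E b →L[ℝ] E b} (hB : ∀ j v, Measurable fun q => B j q v) :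
    Measurable fun p : Q × E b => (List.ofFn fun j => B j p.1).prod p.2 := by
  induction k with
  | zero => simpa using measurable_snd
  | succ k ih =>
    simp only [List.ofFn_succ, List.prod_cons, mul_apply_eq_comp]
    exact (measurable_clm_apply (hB 0)).comp (measurable_fst.prodMk (ih fun j => hB j.succ))

variable {a b : ℕ} {𝒮 : Type*} [MeasurableSpace 𝒮] {Φ : E a → E b → 𝒮 → ℝ}
  (hm : ∀ x y, Measurable (Φ x y))

include hm

theorem measurable_uncurry_objective
    (hd : ∀ s, Differentiable ℝ fun z : E a × E b => Φ z.1 z.2 s) :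
    Measurable fun q : (E a × E b) × 𝒮 => Φ q.1.1 q.1.2 q.2 :=
  measurable_uncurry_of_continuous_of_measurable (u := fun z : E a × E b => Φ z.1 z.2)
    (fun s => (hd s).continuous) (fun z => hm z.1 z.2)

theorem measurable_gradX_sample (hd : ∀ s, Differentiable ℝ fun z : E a × E b => Φ z.1 z.2 s) :
    Measurable fun q : (E a × E b) × 𝒮 => gradX (fun x y => Φ x y q.2) q.1.1 q.1.2 := by
  refine measurable_of_measurable_coord fun j => measurable_of_hasDerivAt
    (φ := fun (q : (E a × E b) × 𝒮) t =>
      Φ (q.1.1 + t • EuclideanSpace.single j (1 : ℝ)) q.1.2 q.2) (fun t => ?_) (fun q => ?_)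
  · have h : Measurable fun q : (E a × E b) × 𝒮 =>
        ((q.1.1 + t • EuclideanSpace.single j (1 : ℝ), q.1.2), q.2) := by fun_prop
    exact (measurable_uncurry_objective hm hd).comp h
  · exact hasDerivAt_line_of_hasGradientAt (hasGradientAt_gradX
      (F := fun x y => Φ x y q.2) (hd q.2) q.1.1 q.1.2) _

theorem measurable_gradY_sample (hd : ∀ s, Differentiable ℝ fun z : E a × E b => Φ z.1 z.2 s) :
    Measurable fun q : (E a × E b) × 𝒮 => gradY (fun x y => Φ x y q.2) q.1.1 q.1.2 := by
  refine measurable_of_measurable_coord fun j => measurable_of_hasDerivAt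
    (φ := fun (q : (E a × E b) × 𝒮) t =>
      Φ q.1.1 (q.1.2 + t • EuclideanSpace.single j (1 : ℝ)) q.2) (fun t => ?_) (fun q => ?_)
  · have h : Measurable fun q : (E a × E b) × 𝒮 =>
        ((q.1.1, q.1.2 + t • EuclideanSpace.single j (1 : ℝ)), q.2) := by fun_prop
    exact (measurable_uncurry_objective hm hd).comp h
  · exact hasDerivAt_line_of_hasGradientAt (hasGradientAt_gradY
      (F := fun x y => Φ x y q.2) (hd q.2) q.1.1 q.1.2) _

variable {c : Constants} (hr : ∀ s, LowerRegular c fun x y => Φ x y s)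

include hr

theorem measurable_hessXY_sample (v : E b) :
    Measurable fun q : (E a × E b) × 𝒮 => hessXY (fun x y => Φ x y q.2) q.1.1 q.1.2 v := by
  refine measurable_of_hasDerivAt (φ := fun (q : (E a × E b) × 𝒮) t =>
      gradX (fun x y => Φ x y q.2) q.1.1 (q.1.2 + t • v)) (fun t => ?_) (fun q => ?_)
  · have h : Measurable fun q : (E a × E b) × 𝒮 => ((q.1.1, q.1.2 + t • v), q.2) := by fun_prop
    exact (measurable_gradX_sample hm fun s => (hr s).differentiable).comp h
  · have h1 : HasDerivAt (fun t : ℝ => q.1.2 + t • v) v 0 := by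
      simpa using ((hasDerivAt_id (0 : ℝ)).smul_const v).const_add q.1.2
    have h2 : HasFDerivAt (fun y' => gradX (fun x y => Φ x y q.2) q.1.1 y')
        (hessXY (fun x y => Φ x y q.2) q.1.1 q.1.2) (q.1.2 + (0 : ℝ) • v) := by
      simpa using (hr q.2).hasFDerivAt_gradX_right q.1.1 q.1.2
    exact h2.comp_hasDerivAt (0 : ℝ) h1

theorem measurable_hessYY_sample (v : E b) :
    Measurable fun q : (E a × E b) × 𝒮 => hessYY (fun x y => Φ x y q.2) q.1.1 q.1.2 v := by
  refine measurable_of_hasDerivAt (φ := fun (q : (E a × E b) × 𝒮) t =>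
      gradY (fun x y => Φ x y q.2) q.1.1 (q.1.2 + t • v)) (fun t => ?_) (fun q => ?_)
  · have h : Measurable fun q : (E a × E b) × 𝒮 => ((q.1.1, q.1.2 + t • v), q.2) := by fun_prop
    exact (measurable_gradY_sample hm fun s => (hr s).differentiable).comp h
  · have h1 : HasDerivAt (fun t : ℝ => q.1.2 + t • v) v 0 := by
      simpa using ((hasDerivAt_id (0 : ℝ)).smul_const v).const_add q.1.2
    have h2 : HasFDerivAt (fun y' => gradY (fun x y => Φ x y q.2) q.1.1 y')
        (hessYY (fun x y => Φ x y q.2) q.1.1 q.1.2) (q.1.2 + (0 : ℝ) • v) := by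
      simpa using (hr q.2).hasFDerivAt_gradY_right q.1.1 q.1.2
    exact h2.comp_hasDerivAt (0 : ℝ) h1

theorem measurable_neumannFactor_sample (Lg : ℝ) (v : E b) :
    Measurable fun q : (E a × E b) × 𝒮 =>
      neumannFactor Lg (fun x y => Φ x y q.2) q.1.1 q.1.2 v := by
  have h := (measurable_hessYY_sample hm hr v).const_smul (1 / Lg)
  simpa [neumannFactor] using h.const_sub v

end Measurability

/-! ### Products of contractions -/

section ListProd

variable {b k : ℕ} {A A' : Fin k → E b →L[ℝ] E b}

theorem norm_list_prod_le_one (hA : ∀ j, ‖A j‖ ≤ 1) : ‖(List.ofFn A).prod‖ ≤ 1 := by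
  induction k with
  | zero =>
    rw [List.ofFn_zero, List.prod_nil]
    exact ContinuousLinearMap.norm_id_le
  | succ k ih =>
    rw [List.ofFn_succ, List.prod_cons]
    exact (norm_mul_le _ _).trans
      (mul_le_one₀ (hA 0) (norm_nonneg _) (ih fun j => hA j.succ))

theorem norm_list_prod_sub_le {δ : ℝ} (hA : ∀ j, ‖A j‖ ≤ 1) (hA' : ∀ j, ‖A' j‖ ≤ 1)
    (hδ : ∀ j, ‖A j - A' j‖ ≤ δ) : ‖(List.ofFn A).prod - (List.ofFn A').prod‖ ≤ k * δ := by
  induction k with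
  | zero => simp
  | succ k ih =>
    rw [List.ofFn_succ, List.prod_cons, List.ofFn_succ, List.prod_cons]
    set B := (List.ofFn fun i : Fin k => A i.succ).prod
    set B' := (List.ofFn fun i : Fin k => A' i.succ).prod
    have e : A 0 * B - A' 0 * B' = A 0 * (B - B') + (A 0 - A' 0) * B' := by
      rw [mul_sub, sub_mul]; abel
    have h1 : ‖B - B'‖ ≤ k * δ := ih (fun j => hA j.succ) (fun j => hA' j.succ) fun j => hδ j.succ
    have h2 : ‖B'‖ ≤ 1 := norm_list_prod_le_one fun j => hA' j.succ
    rw [e]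
    refine (norm_add_le _ _).trans ?_
    have h3 : ‖A 0 * (B - B')‖ ≤ 1 * (k * δ) :=
      (norm_mul_le _ _).trans (mul_le_mul (hA 0) h1 (norm_nonneg _) zero_le_one)
    have h4 : ‖(A 0 - A' 0) * B'‖ ≤ δ * 1 :=
      (norm_mul_le _ _).trans (mul_le_mul (hδ 0) h2 (norm_nonneg _)
        ((norm_nonneg _).trans (hδ 0)))
    push_cast
    linarith

end ListProd

/-! ### The hypergradient estimator as a function of the point -/

namespace Problem

variable {m a b : ℕ} {Ξ Z : Type*} [MeasurableSpace Ξ] [MeasurableSpace Z]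

/-- Regularity of the sampled objectives for every sample, rather than almost every one. -/
structure SampleRegular (P : Problem m a b Ξ Z) (c : Constants) : Prop where
  upper : ∀ i ξ, UpperRegular c fun x y => P.f i x y ξ
  lower : ∀ i ζ, LowerRegular c fun x y => P.g i x y ζ
  measurable_f : ∀ i x y, Measurable (P.f i x y)
  measurable_g : ∀ i x y, Measurable (P.g i x y)

/-- The part of the hypergradient estimator with `k` Neumann factors, before scaling. -/
noncomputable def correction (P : Problem m a b Ξ Z) (Lg : ℝ) {K k : ℕ} (hk : k < K) (i : Fin m)
    (x : E a) (y : E b) (ξ : Ξ) (ζ : Fin (K + 1) → Z) : E a :=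
  hessXY (fun x y => P.g i x y (ζ 0)) x y
    ((List.ofFn fun j : Fin k => neumannFactor Lg (fun x y => P.g i x y
      (ζ ⟨(j : ℕ) + 1, by omega⟩)) x y).prod (gradY (fun x y => P.f i x y ξ) x y))

theorem hatGrad_eq (P : Problem m a b Ξ Z) (Lg : ℝ) {K : ℕ} (i : Fin m) (x : E a) (y : E b)
    (s : EstSample Ξ Z K) : P.hatGrad Lg i x y s = gradX (fun x y => P.f i x y s.1) x y -
      ((K : ℝ) / Lg) • P.correction Lg s.2.2.2 i x y s.1 s.2.1 := rfl

variable {P : Problem m a b Ξ Z} {c : Constants} (hP : P.SampleRegular c)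

include hP

theorem SampleRegular.measurable_correction {K k : ℕ} (hk : k < K) (i : Fin m) :
    Measurable fun q : (E a × E b) × Ξ × (Fin (K + 1) → Z) =>
      P.correction c.Lg hk i q.1.1 q.1.2 q.2.1 q.2.2 := by
  have h1 := measurable_gradY_sample (hP.measurable_f i) fun ξ => (hP.upper i ξ).differentiable
  have h2 : Measurable fun q : (E a × E b) × Ξ × (Fin (K + 1) → Z) =>
      gradY (fun x y => P.f i x y q.2.1) q.1.1 q.1.2 :=
    h1.comp (g := fun q : (E a × E b) × Ξ =>
      gradY (fun x y => P.f i x y q.2) q.1.1 q.1.2)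
      (f := fun q : (E a × E b) × Ξ × (Fin (K + 1) → Z) => (q.1, q.2.1)) (by fun_prop)
  have h3 := measurable_list_prod_apply (Q := (E a × E b) × Ξ × (Fin (K + 1) → Z))
    (B := fun (j : Fin k) q => neumannFactor c.Lg (fun x y => P.g i x y
      (q.2.2 ⟨(j : ℕ) + 1, by omega⟩)) q.1.1 q.1.2) (fun j v =>
        (measurable_neumannFactor_sample (hP.measurable_g i) (hP.lower i) c.Lg v).comp
          (f := fun q : (E a × E b) × Ξ × (Fin (K + 1) → Z) =>
            (q.1, q.2.2 ⟨(j : ℕ) + 1, by omega⟩)) (by fun_prop))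
  have h4 := h3.comp (measurable_id.prodMk h2)
  have h5 := measurable_clm_apply (Q := (E a × E b) × Ξ × (Fin (K + 1) → Z))
    (B := fun q => hessXY (fun x y => P.g i x y (q.2.2 0)) q.1.1 q.1.2) (fun v =>
      (measurable_hessXY_sample (hP.measurable_g i) (hP.lower i) v).comp
        (f := fun q : (E a × E b) × Ξ × (Fin (K + 1) → Z) => (q.1, q.2.2 0)) (by fun_prop))
  exact h5.comp (measurable_id.prodMk h4)

theorem SampleRegular.measurable_hatGrad {K : ℕ} (i : Fin m) :
    Measurable fun q : (E a × E b) × EstSample Ξ Z K =>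
      P.hatGrad c.Lg i q.1.1 q.1.2 q.2 := by
  have h1 : Measurable fun q : (E a × E b) × EstSample Ξ Z K =>
      gradX (fun x y => P.f i x y q.2.1) q.1.1 q.1.2 :=
    (measurable_gradX_sample (hP.measurable_f i) fun ξ => (hP.upper i ξ).differentiable).comp
      (f := fun q : (E a × E b) × EstSample Ξ Z K => (q.1, q.2.1)) (by fun_prop)
  have h2 : (fun q : (E a × E b) × EstSample Ξ Z K =>
      P.correction c.Lg q.2.2.2.2 i q.1.1 q.1.2 q.2.1 q.2.2.1) = fun q => ∑ k : Fin K,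
        if q.2.2.2 = k then P.correction c.Lg k.2 i q.1.1 q.1.2 q.2.1 q.2.2.1 else 0 := by
    funext q
    simp
  have h3 : Measurable fun q : (E a × E b) × EstSample Ξ Z K =>
      P.correction c.Lg q.2.2.2.2 i q.1.1 q.1.2 q.2.1 q.2.2.1 := by
    rw [h2]
    refine Finset.measurable_sum _ fun k _ => Measurable.ite ?_ ?_ measurable_const
    · exact measurableSet_eq_fun (by fun_prop) measurable_const
    · exact (hP.measurable_correction k.2 i).comp
        (f := fun q : (E a × E b) × EstSample Ξ Z K => (q.1, q.2.1, q.2.2.1)) (by fun_prop)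
  simp only [hatGrad_eq]
  exact h1.sub (h3.const_smul ((K : ℝ) / c.Lg))

theorem SampleRegular.measurable_lowGrad (i : Fin m) :
    Measurable fun q : (E a × E b) × Z => P.lowGrad i q.1.1 q.1.2 q.2 :=
  measurable_gradY_sample (hP.measurable_g i) fun ζ => (hP.lower i ζ).differentiable

variable (hc : c.Valid)

include hc

theorem SampleRegular.norm_correction_le {K k : ℕ} (hk : k < K) (i : Fin m) (x : E a) (y : E b)
    (ξ : Ξ) (ζ : Fin (K + 1) → Z) :
    ‖P.correction c.Lg hk i x y ξ ζ‖ ≤ Real.sqrt c.Cgxy * c.Cfy := by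
  refine (ContinuousLinearMap.le_opNorm _ _).trans ?_
  refine mul_le_mul ((hP.lower i _).norm_hessXY_le x y) ?_ (norm_nonneg _) (Real.sqrt_nonneg _)
  refine (ContinuousLinearMap.le_opNorm _ _).trans ?_
  rw [← one_mul c.Cfy]
  exact mul_le_mul (norm_list_prod_le_one fun j => (hP.lower i _).norm_neumannFactor_le_one hc x y)
    ((hP.upper i ξ).gradY_bounded x y) (norm_nonneg _) zero_le_one

omit hP in
theorem neumannFactor_lipschitz {G : E a → E b → ℝ} (hG : LowerRegular c G)
    (x : E a) (y : E b) (x' : E a) (y' : E b) :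
    ‖neumannFactor c.Lg G x y - neumannFactor c.Lg G x' y'‖ ≤
      c.Lgyy / c.Lg * (‖x - x'‖ + ‖y - y'‖) := by
  have e : neumannFactor c.Lg G x y - neumannFactor c.Lg G x' y' =
      (1 / c.Lg) • (hessYY G x' y' - hessYY G x y) := by
    simp only [neumannFactor, smul_sub]; abel
  rw [e, norm_smul, norm_sub_rev, Real.norm_eq_abs,
    abs_of_nonneg (div_nonneg zero_le_one hc.Lg_nonneg)]
  have := mul_le_mul_of_nonneg_left (hG.hessYY_lipschitz.le_add hc.Lgyy_nonneg x y x' y')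
    (div_nonneg zero_le_one hc.Lg_nonneg)
  refine this.trans (le_of_eq ?_)
  ring

/-- A Lipschitz constant of the estimator with `K` terms is `estLip c * K ^ 2`. -/
noncomputable def _root_.Diamond.estLip (c : Constants) : ℝ :=
  c.Lfx + 1 / c.Lg * (Real.sqrt c.Cgxy * (c.Lgyy / c.Lg * c.Cfy + c.Lfy) + c.Lgxy * c.Cfy)

theorem SampleRegular.correction_lipschitz {K k : ℕ} (hk : k < K) (i : Fin m) (ξ : Ξ)
    (ζ : Fin (K + 1) → Z) (x : E a) (y : E b) (x' : E a) (y' : E b) :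
    ‖P.correction c.Lg hk i x y ξ ζ - P.correction c.Lg hk i x' y' ξ ζ‖ ≤
      (Real.sqrt c.Cgxy * (K * (c.Lgyy / c.Lg) * c.Cfy + c.Lfy) + c.Lgxy * c.Cfy) *
        (‖x - x'‖ + ‖y - y'‖) := by
  set d := ‖x - x'‖ + ‖y - y'‖ with hd
  have hd0 : 0 ≤ d := by positivity
  have hLL : 0 ≤ c.Lgyy / c.Lg := div_nonneg hc.Lgyy_nonneg hc.Lg_nonneg
  simp only [correction]
  set X := hessXY (fun x y => P.g i x y (ζ 0)) x y
  set X' := hessXY (fun x y => P.g i x y (ζ 0)) x' y'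
  set A := fun j : Fin k => neumannFactor c.Lg (fun x y => P.g i x y
      (ζ ⟨(j : ℕ) + 1, by omega⟩)) x y
  set A' := fun j : Fin k => neumannFactor c.Lg (fun x y => P.g i x y
      (ζ ⟨(j : ℕ) + 1, by omega⟩)) x' y'
  set w := gradY (fun x y => P.f i x y ξ) x y
  set w' := gradY (fun x y => P.f i x y ξ) x' y'
  have hA : ∀ j, ‖A j‖ ≤ 1 := fun j => (hP.lower i _).norm_neumannFactor_le_one hc x y
  have hA' : ∀ j, ‖A' j‖ ≤ 1 := fun j => (hP.lower i _).norm_neumannFactor_le_one hc x' y'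
  have hAA : ‖(List.ofFn A).prod - (List.ofFn A').prod‖ ≤ k * (c.Lgyy / c.Lg * d) :=
    norm_list_prod_sub_le hA hA' fun j => neumannFactor_lipschitz hc (hP.lower i _) x y x' y'
  have hw : ‖w‖ ≤ c.Cfy := (hP.upper i ξ).gradY_bounded x y
  have hw' : ‖w'‖ ≤ c.Cfy := (hP.upper i ξ).gradY_bounded x' y'
  have hww : ‖w - w'‖ ≤ c.Lfy * d :=
    (hP.upper i ξ).gradY_lipschitz.le_add hc.Lfy_nonneg x y x' y'
  have hX : ‖X‖ ≤ Real.sqrt c.Cgxy := (hP.lower i _).norm_hessXY_le x y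
  have hXX : ‖X - X'‖ ≤ c.Lgxy * d :=
    (hP.lower i _).hessXY_lipschitz.le_add hc.Lgxy_nonneg x y x' y'
  have hkK : (k : ℝ) ≤ K := by exact_mod_cast hk.le
  have e : X ((List.ofFn A).prod w) - X' ((List.ofFn A').prod w') =
      X (((List.ofFn A).prod - (List.ofFn A').prod) w + (List.ofFn A').prod (w - w')) +
        (X - X') ((List.ofFn A').prod w') := by
    simp only [_root_.sub_apply, map_add, map_sub]
    abel
  rw [e]
  have h1 : ‖((List.ofFn A).prod - (List.ofFn A').prod) w‖ ≤ K * (c.Lgyy / c.Lg) * d * c.Cfy := by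
    refine (ContinuousLinearMap.le_opNorm _ _).trans ?_
    refine mul_le_mul (hAA.trans ?_) hw (norm_nonneg _) (by positivity)
    rw [← mul_assoc]
    exact mul_le_mul_of_nonneg_right (mul_le_mul_of_nonneg_right hkK hLL) hd0
  have h2 : ‖(List.ofFn A').prod (w - w')‖ ≤ c.Lfy * d := by
    refine (ContinuousLinearMap.le_opNorm _ _).trans ?_
    rw [← one_mul (c.Lfy * d)]
    exact mul_le_mul (norm_list_prod_le_one hA') hww (norm_nonneg _) zero_le_one
  have h3 : ‖(List.ofFn A').prod w'‖ ≤ c.Cfy := by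
    refine (ContinuousLinearMap.le_opNorm _ _).trans ?_
    rw [← one_mul c.Cfy]
    exact mul_le_mul (norm_list_prod_le_one hA') hw' (norm_nonneg _) zero_le_one
  calc _ ≤ Real.sqrt c.Cgxy * (K * (c.Lgyy / c.Lg) * d * c.Cfy + c.Lfy * d) +
        c.Lgxy * d * c.Cfy := by
        refine (norm_add_le _ _).trans (add_le_add ?_ ?_)
        · refine (ContinuousLinearMap.le_opNorm _ _).trans ?_
          exact mul_le_mul hX ((norm_add_le _ _).trans (add_le_add h1 h2)) (norm_nonneg _)
            (Real.sqrt_nonneg _)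
        · refine (ContinuousLinearMap.le_opNorm _ _).trans ?_
          exact mul_le_mul hXX h3 (norm_nonneg _) (mul_nonneg hc.Lgxy_nonneg hd0)
    _ = _ := by ring

theorem SampleRegular.hatGrad_lipschitz {K : ℕ} (hK : 1 ≤ K) (i : Fin m) (s : EstSample Ξ Z K)
    (x : E a) (y : E b) (x' : E a) (y' : E b) :
    ‖P.hatGrad c.Lg i x y s - P.hatGrad c.Lg i x' y' s‖ ^ 2 ≤
      2 * estLip c ^ 2 * K ^ 4 * (‖x - x'‖ ^ 2 + ‖y - y'‖ ^ 2) := by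
  set d := ‖x - x'‖ + ‖y - y'‖ with hd
  have hd0 : 0 ≤ d := by positivity
  have hK1 : (1 : ℝ) ≤ K := by exact_mod_cast hK
  have h1 := hc.Lfx_nonneg
  have h2 := hc.Lfy_nonneg
  have h3 := hc.Cfy_nonneg
  have h4 := hc.Lgxy_nonneg
  have h5 := hc.Lgyy_nonneg
  have h6 := hc.Lg_nonneg
  have hcorr := hP.correction_lipschitz hc s.2.2.2 i s.1 s.2.1 x y x' y'
  rw [← hd] at hcorr
  have hfx : ‖gradX (fun x y => P.f i x y s.1) x y - gradX (fun x y => P.f i x y s.1) x' y'‖ ≤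
      c.Lfx * d := (hP.upper i _).gradX_lipschitz.le_add h1 x y x' y'
  have hmain : ‖P.hatGrad c.Lg i x y s - P.hatGrad c.Lg i x' y' s‖ ≤ estLip c * K ^ 2 * d := by
    rw [hatGrad_eq, hatGrad_eq, sub_sub_sub_comm, ← smul_sub]
    refine (norm_sub_le _ _).trans ?_
    rw [norm_smul, Real.norm_eq_abs, abs_of_nonneg (by positivity : 0 ≤ (K : ℝ) / c.Lg)]
    calc _ ≤ c.Lfx * d + K / c.Lg * ((Real.sqrt c.Cgxy * (K * (c.Lgyy / c.Lg) * c.Cfy + c.Lfy) +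
          c.Lgxy * c.Cfy) * d) :=
        add_le_add hfx (mul_le_mul_of_nonneg_left hcorr (by positivity))
      _ ≤ c.Lfx * K ^ 2 * d + K / c.Lg * ((Real.sqrt c.Cgxy * (K * (c.Lgyy / c.Lg) * c.Cfy +
          K * c.Lfy) + K * (c.Lgxy * c.Cfy)) * d) := by
        have e1 : c.Lfx ≤ c.Lfx * K ^ 2 := le_mul_of_one_le_right h1 (one_le_pow₀ hK1)
        have e2 : c.Lfy ≤ K * c.Lfy := le_mul_of_one_le_left h2 hK1
        have e3 : c.Lgxy * c.Cfy ≤ K * (c.Lgxy * c.Cfy) :=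
          le_mul_of_one_le_left (by positivity) hK1
        gcongr
      _ = estLip c * K ^ 2 * d := by unfold estLip; ring
  have hsq : d ^ 2 ≤ 2 * (‖x - x'‖ ^ 2 + ‖y - y'‖ ^ 2) := by
    nlinarith [sq_nonneg (‖x - x'‖ - ‖y - y'‖)]
  calc _ ≤ (estLip c * K ^ 2 * d) ^ 2 := pow_le_pow_left₀ (norm_nonneg _) hmain 2
    _ = estLip c ^ 2 * K ^ 4 * d ^ 2 := by ring
    _ ≤ estLip c ^ 2 * K ^ 4 * (2 * (‖x - x'‖ ^ 2 + ‖y - y'‖ ^ 2)) := by gcongr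
    _ = _ := by ring

end Problem

/-! ### Expectations of sampled derivatives -/

theorem hasDerivAt_comp_line {d : ℕ} {V : Type*} [NormedAddCommGroup V] [NormedSpace ℝ V]
    {φ : E d → V} {φ' : E d →L[ℝ] V} {z v : E d} {t : ℝ} (h : HasFDerivAt φ φ' (z + t • v)) :
    HasDerivAt (fun t : ℝ => φ (z + t • v)) (φ' v) t := by
  have h1 : HasDerivAt (fun t : ℝ => z + t • v) v t := by
    simpa using ((hasDerivAt_id t).smul_const v).const_add z
  exact h.comp_hasDerivAt t h1

/-- Differentiation under the expectation, along a line. -/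
theorem integral_eq_of_hasDerivAt {𝒮 : Type*} [MeasurableSpace 𝒮] {μ : Measure 𝒮}
    {H D : ℝ → 𝒮 → ℝ} {B : 𝒮 → ℝ} {δ : ℝ} (hH : ∀ t, Measurable (H t)) (hi : Integrable (H 0) μ)
    (hD : Measurable (D 0)) (hB : Integrable B μ) (hb : ∀ s t, |t| < 1 → |D t s| ≤ B s)
    (hd : ∀ s t, HasDerivAt (fun t => H t s) (D t s) t)
    (havg : HasDerivAt (fun t => ∫ s, H t s ∂μ) δ 0) : ∫ s, D 0 s ∂μ = δ := by
  have h := hasDerivAt_integral_of_dominated_loc_of_deriv_le (μ := μ) (F := H) (F' := D)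
    (x₀ := 0) (bound := B) (Metric.ball_mem_nhds 0 one_pos)
    (Eventually.of_forall fun t => (hH t).aestronglyMeasurable) hi hD.aestronglyMeasurable
    (ae_of_all _ fun s t ht => hb s t (by simpa using ht)) hB
    (ae_of_all _ fun s t _ => hd s t)
  exact h.2.unique havg

section Means

variable {a b : ℕ} {𝒮 : Type*} [MeasurableSpace 𝒮] {μ : Measure 𝒮}
  {Φ : E a → E b → 𝒮 → ℝ} (hm : ∀ x y, Measurable (Φ x y))
  (hi : ∀ x y, Integrable (Φ x y) μ)

theorem inner_integral_right {d : ℕ} {X : 𝒮 → E d} (hX : Integrable X μ) (v : E d) :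
    ⟪∫ s, X s ∂μ, v⟫ = ∫ s, ⟪X s, v⟫ ∂μ := by
  rw [real_inner_comm, ← integral_inner hX]
  simp_rw [real_inner_comm]

include hm hi

/-- The gradient of an expectation is the expectation of the gradients. The uniform Lipschitz bound
on the sampled gradients gives an integrable majorant of the derivatives near the point. -/
theorem integral_gradX [IsProbabilityMeasure μ]
    (hd : ∀ s, Differentiable ℝ fun z : E a × E b => Φ z.1 z.2 s)
    (hdavg : Differentiable ℝ fun z : E a × E b => ∫ s, Φ z.1 z.2 s ∂μ) {L : ℝ} (hL : 0 ≤ L)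
    (hlip : ∀ s, LipschitzXY L (gradX fun x y => Φ x y s)) (x : E a) (y : E b)
    (hgi : Integrable (fun s => gradX (fun x y => Φ x y s) x y) μ) :
    ∫ s, gradX (fun x y => Φ x y s) x y ∂μ = gradX (fun x y => ∫ s, Φ x y s ∂μ) x y := by
  refine ext_inner_right ℝ fun v => ?_
  rw [inner_integral_right hgi]
  have key := integral_eq_of_hasDerivAt (μ := μ) (H := fun t s => Φ (x + t • v) y s)
    (D := fun t s => ⟪gradX (fun x y => Φ x y s) (x + t • v) y, v⟫)
    (B := fun s => (‖gradX (fun x y => Φ x y s) x y‖ + L * ‖v‖) * ‖v‖)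
    (δ := ⟪gradX (fun x y => ∫ s, Φ x y s ∂μ) x y, v⟫)
    (fun t => hm _ _) (hi _ _) ?_ ((hgi.norm.add (integrable_const _)).mul_const _) ?_ ?_ ?_
  · simpa using key
  · have h := (measurable_gradX_sample hm hd).comp
      (f := fun s => ((x + (0 : ℝ) • v, y), s)) (by fun_prop)
    exact h.inner measurable_const
  · intro s t ht
    refine (abs_real_inner_le_norm _ _).trans (mul_le_mul_of_nonneg_right ?_ (norm_nonneg _))
    have h1 := (hlip s).left (x + t • v) x y
    rw [add_sub_cancel_left, norm_smul, Real.norm_eq_abs] at h1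
    have h2 : L * (|t| * ‖v‖) ≤ L * ‖v‖ :=
      mul_le_mul_of_nonneg_left (mul_le_of_le_one_left (norm_nonneg _) ht.le) hL
    have h3 := norm_le_norm_add_norm_sub' (gradX (fun x y => Φ x y s) (x + t • v) y)
      (gradX (fun x y => Φ x y s) x y)
    linarith
  · intro s t
    have h := hasDerivAt_comp_line (v := v)
      (hasGradientAt_gradX (F := fun x y => Φ x y s) (hd s) (x + t • v) y).hasFDerivAt
    rwa [InnerProductSpace.toDual_apply_apply] at h
  · have h := hasDerivAt_comp_line (z := x) (t := 0) (v := v)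
      (φ := fun x => ∫ s, Φ x y s ∂μ)
      (by simpa using
        (hasGradientAt_gradX (F := fun x y => ∫ s, Φ x y s ∂μ) hdavg x y).hasFDerivAt)
    rwa [InnerProductSpace.toDual_apply_apply] at h

theorem integral_gradY [IsProbabilityMeasure μ]
    (hd : ∀ s, Differentiable ℝ fun z : E a × E b => Φ z.1 z.2 s)
    (hdavg : Differentiable ℝ fun z : E a × E b => ∫ s, Φ z.1 z.2 s ∂μ) {L : ℝ} (hL : 0 ≤ L)
    (hlip : ∀ s, LipschitzXY L (gradY fun x y => Φ x y s)) (x : E a) (y : E b)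
    (hgi : Integrable (fun s => gradY (fun x y => Φ x y s) x y) μ) :
    ∫ s, gradY (fun x y => Φ x y s) x y ∂μ = gradY (fun x y => ∫ s, Φ x y s ∂μ) x y := by
  refine ext_inner_right ℝ fun v => ?_
  rw [inner_integral_right hgi]
  have key := integral_eq_of_hasDerivAt (μ := μ) (H := fun t s => Φ x (y + t • v) s)
    (D := fun t s => ⟪gradY (fun x y => Φ x y s) x (y + t • v), v⟫)
    (B := fun s => (‖gradY (fun x y => Φ x y s) x y‖ + L * ‖v‖) * ‖v‖)
    (δ := ⟪gradY (fun x y => ∫ s, Φ x y s ∂μ) x y, v⟫)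
    (fun t => hm _ _) (hi _ _) ?_ ((hgi.norm.add (integrable_const _)).mul_const _) ?_ ?_ ?_
  · simpa using key
  · have h := (measurable_gradY_sample hm hd).comp
      (f := fun s => ((x, y + (0 : ℝ) • v), s)) (by fun_prop)
    exact h.inner measurable_const
  · intro s t ht
    refine (abs_real_inner_le_norm _ _).trans (mul_le_mul_of_nonneg_right ?_ (norm_nonneg _))
    have h1 := (hlip s).right x (y + t • v) y
    rw [add_sub_cancel_left, norm_smul, Real.norm_eq_abs] at h1
    have h2 : L * (|t| * ‖v‖) ≤ L * ‖v‖ :=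
      mul_le_mul_of_nonneg_left (mul_le_of_le_one_left (norm_nonneg _) ht.le) hL
    have h3 := norm_le_norm_add_norm_sub' (gradY (fun x y => Φ x y s) x (y + t • v))
      (gradY (fun x y => Φ x y s) x y)
    linarith
  · intro s t
    have h := hasDerivAt_comp_line (v := v)
      (hasGradientAt_gradY (F := fun x y => Φ x y s) (hd s) x (y + t • v)).hasFDerivAt
    rwa [InnerProductSpace.toDual_apply_apply] at h
  · have h := hasDerivAt_comp_line (z := y) (t := 0) (v := v)
      (φ := fun y => ∫ s, Φ x y s ∂μ)
      (by simpa using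
        (hasGradientAt_gradY (F := fun x y => ∫ s, Φ x y s ∂μ) hdavg x y).hasFDerivAt)
    rwa [InnerProductSpace.toDual_apply_apply] at h

variable {c : Constants} (hc : c.Valid) (hr : ∀ s, LowerRegular c fun x y => Φ x y s)
  (havg : LowerRegular c fun x y => ∫ s, Φ x y s ∂μ)
  (hgi : ∀ x y, Integrable (fun s => gradY (fun x y => Φ x y s) x y) μ)

include hc hr

omit hi in
theorem integrable_hessYY_apply [IsProbabilityMeasure μ] (x : E a) (y v : E b) :
    Integrable (fun s => hessYY (fun x y => Φ x y s) x y v) μ := by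
  refine Integrable.of_bound (Measurable.aestronglyMeasurable ?_) (c.Lg * ‖v‖)
    (ae_of_all _ fun s => (hessYY (fun x y => Φ x y s) x y).le_of_opNorm_le
      ((hr s).norm_hessYY_le hc x y) v)
  exact (measurable_hessYY_sample hm hr v).comp (f := fun s => ((x, y), s)) (by fun_prop)

omit hi hc in
theorem integrable_hessXY_apply [IsProbabilityMeasure μ] (x : E a) (y v : E b) :
    Integrable (fun s => hessXY (fun x y => Φ x y s) x y v) μ := by
  refine Integrable.of_bound (Measurable.aestronglyMeasurable ?_) (Real.sqrt c.Cgxy * ‖v‖)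
    (ae_of_all _ fun s => (hessXY (fun x y => Φ x y s) x y).le_of_opNorm_le
      ((hr s).norm_hessXY_le x y) v)
  exact (measurable_hessXY_sample hm hr v).comp (f := fun s => ((x, y), s)) (by fun_prop)

include havg hgi

theorem integral_hessYY_apply [IsProbabilityMeasure μ] (x : E a) (y v : E b) :
    ∫ s, hessYY (fun x y => Φ x y s) x y v ∂μ = hessYY (fun x y => ∫ s, Φ x y s ∂μ) x y v := by
  refine ext_inner_right ℝ fun w => ?_
  rw [inner_integral_right (integrable_hessYY_apply hm hc hr x y v)]
  have key := integral_eq_of_hasDerivAt (μ := μ)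
    (H := fun t s => ⟪gradY (fun x y => Φ x y s) x (y + t • v), w⟫)
    (D := fun t s => ⟪hessYY (fun x y => Φ x y s) x (y + t • v) v, w⟫)
    (B := fun _ => c.Lg * ‖v‖ * ‖w‖)
    (δ := ⟪hessYY (fun x y => ∫ s, Φ x y s ∂μ) x y v, w⟫)
    (fun t => ?_) ((hgi _ _).inner_const w) ?_ (integrable_const _) ?_ ?_ ?_
  · simpa using key
  · exact ((measurable_gradY_sample hm fun s => (hr s).differentiable).comp
      (f := fun s => ((x, y + t • v), s)) (by fun_prop)).inner measurable_const
  · exact ((measurable_hessYY_sample hm hr v).comp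
      (f := fun s => ((x, y + (0 : ℝ) • v), s)) (by fun_prop)).inner measurable_const
  · intro s t _
    refine (abs_real_inner_le_norm _ _).trans (mul_le_mul_of_nonneg_right ?_ (norm_nonneg _))
    exact ContinuousLinearMap.le_of_opNorm_le _ ((hr s).norm_hessYY_le hc _ _) v
  · intro s t
    have h := (hasDerivAt_comp_line (v := v) ((hr s).hasFDerivAt_gradY_right x (y + t • v))).inner ℝ
      (hasDerivAt_const t w)
    simpa using h
  · have h := (hasDerivAt_comp_line (z := y) (t := 0) (v := v)
      (φ := fun y => gradY (fun x y => ∫ s, Φ x y s ∂μ) x y)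
      (by simpa using havg.hasFDerivAt_gradY_right x y)).inner ℝ (hasDerivAt_const (0 : ℝ) w)
    simp only [inner_zero_right, zero_add] at h
    refine h.congr_of_eventuallyEq (Eventually.of_forall fun t => ?_)
    simp only
    rw [← inner_integral_right (hgi _ _), integral_gradY hm hi (fun s => (hr s).differentiable)
      havg.differentiable hc.Lg_nonneg (fun s => (hr s).gradY_lipschitz) _ _ (hgi _ _)]

/-- The mixed derivative is identified through `∂ₓ ∇_y`, since `∇ₓ` of the sampled lower-level
objective need not be integrable. -/
theorem integral_hessXY_apply [IsProbabilityMeasure μ] (x : E a) (y v : E b) :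
    ∫ s, hessXY (fun x y => Φ x y s) x y v ∂μ = hessXY (fun x y => ∫ s, Φ x y s ∂μ) x y v := by
  refine ext_inner_right ℝ fun u => ?_
  rw [inner_integral_right (integrable_hessXY_apply hm hr x y v)]
  have hder : ∀ {G : E a → E b → ℝ}, LowerRegular c G → ∀ t : ℝ,
      HasDerivAt (fun t : ℝ => ⟪gradY G (x + t • u) y, v⟫)
        ⟪hessXY G (x + t • u) y v, u⟫ t := by
    intro G hG t
    have h1 : HasFDerivAt (fun x' => gradY G x' y)
        ((fderiv ℝ (fun z : E a × E b => gradY G z.1 z.2) (x + t • u, y)).comp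
        (ContinuousLinearMap.inl ℝ (E a) (E b))) (x + t • u) :=
      HasFDerivAt.comp (g := fun z : E a × E b => gradY G z.1 z.2) (f := fun x' => (x', y))
        (x + t • u) (hG.differentiable_gradY (x + t • u, y)).hasFDerivAt
        (hasFDerivAt_prodMk_left (x + t • u) y)
    have h := (hasDerivAt_comp_line (v := u) h1).inner ℝ (hasDerivAt_const t v)
    simp only [inner_zero_right, zero_add, ContinuousLinearMap.comp_apply,
      ContinuousLinearMap.inl_apply, hG.fderiv_gradY_apply, map_zero, inner_zero_left,
      add_zero] at h
    rwa [real_inner_comm] at h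
  have key := integral_eq_of_hasDerivAt (μ := μ)
    (H := fun t s => ⟪gradY (fun x y => Φ x y s) (x + t • u) y, v⟫)
    (D := fun t s => ⟪hessXY (fun x y => Φ x y s) (x + t • u) y v, u⟫)
    (B := fun _ => Real.sqrt c.Cgxy * ‖v‖ * ‖u‖)
    (δ := ⟪hessXY (fun x y => ∫ s, Φ x y s ∂μ) x y v, u⟫)
    (fun t => ?_) ((hgi _ _).inner_const v) ?_ (integrable_const _) ?_ ?_ ?_
  · simpa using key
  · exact ((measurable_gradY_sample hm fun s => (hr s).differentiable).comp
      (f := fun s => ((x + t • u, y), s)) (by fun_prop)).inner measurable_const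
  · exact ((measurable_hessXY_sample hm hr v).comp
      (f := fun s => ((x + (0 : ℝ) • u, y), s)) (by fun_prop)).inner measurable_const
  · intro s t _
    refine (abs_real_inner_le_norm _ _).trans (mul_le_mul_of_nonneg_right ?_ (norm_nonneg _))
    exact ContinuousLinearMap.le_of_opNorm_le _ ((hr s).norm_hessXY_le _ _) v
  · exact fun s t => hder (hr s) t
  · have h := hder havg 0
    simp only [zero_smul, add_zero] at h
    refine h.congr_of_eventuallyEq (Eventually.of_forall fun t => ?_)
    simp only
    rw [← inner_integral_right (hgi _ _), integral_gradY hm hi (fun s => (hr s).differentiable)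
      havg.differentiable hc.Lg_nonneg (fun s => (hr s).gradY_lipschitz) _ _ (hgi _ _)]

theorem integral_neumannFactor_apply [IsProbabilityMeasure μ] (x : E a) (y v : E b) :
    ∫ s, neumannFactor c.Lg (fun x y => Φ x y s) x y v ∂μ =
      neumannFactor c.Lg (fun x y => ∫ s, Φ x y s ∂μ) x y v := by
  have h := integral_hessYY_apply hm hi hc hr havg hgi x y v
  simp only [neumannFactor, _root_.sub_apply, _root_.smul_apply]
  have hs : Integrable (fun s => (1 / c.Lg) • hessYY (fun x y => Φ x y s) x y v) μ :=
    (integrable_hessYY_apply hm hc hr x y v).smul (1 / c.Lg)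
  rw [integral_sub (integrable_const _) hs, integral_smul, h]
  simp

end Means

/-! ### Expectation of products of independent operators -/

section Products

variable {Z : Type*} [MeasurableSpace Z] {μ : Measure Z} [IsProbabilityMeasure μ]

/-- The first of `n + 1` independent samples averages separately from the remaining ones. -/
theorem integral_pi_succ {n b d : ℕ} {B : Z → E b →L[ℝ] E d} {B' : E b →L[ℝ] E d} {r : ℝ}
    (hB : ∀ v, Measurable fun z => B z v) (hr : ∀ z, ‖B z‖ ≤ r)
    (hB' : ∀ v, ∫ z, B z v ∂μ = B' v) {W : (Fin n → Z) → E b} (hW : Measurable W) {C : ℝ}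
    (hC : ∀ ζ, ‖W ζ‖ ≤ C) :
    ∫ ζ : Fin (n + 1) → Z, B (ζ 0) (W fun j => ζ j.succ) ∂(Measure.pi fun _ => μ) =
      B' (∫ ζ, W ζ ∂(Measure.pi fun _ => μ)) := by
  have hmp := measurePreserving_piFinSuccAbove (fun _ : Fin (n + 1) => μ) 0
  have h1 := hmp.integral_comp' (fun p : Z × (Fin n → Z) => B p.1 (W p.2))
  have e : (fun ζ : Fin (n + 1) → Z => B (ζ 0) (W fun j => ζ j.succ)) = fun ζ =>
      (fun p : Z × (Fin n → Z) => B p.1 (W p.2))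
        (MeasurableEquiv.piFinSuccAbove (fun _ => Z) 0 ζ) := by
    funext ζ
    simp [MeasurableEquiv.piFinSuccAbove_apply, Fin.tail_def]
  have hmeas : Measurable fun p : Z × (Fin n → Z) => B p.1 (W p.2) :=
    (measurable_clm_apply hB).comp (measurable_fst.prodMk (hW.comp measurable_snd))
  have hWint : Integrable W (Measure.pi fun _ => μ) :=
    Integrable.of_bound hW.aestronglyMeasurable C (ae_of_all _ hC)
  have hint : Integrable (fun p : Z × (Fin n → Z) => B p.1 (W p.2))
      (μ.prod (Measure.pi fun _ => μ)) := by
    refine Integrable.of_bound hmeas.aestronglyMeasurable (r * C) (ae_of_all _ fun p => ?_)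
    refine (ContinuousLinearMap.le_opNorm _ _).trans ?_
    exact mul_le_mul (hr _) (hC _) (norm_nonneg _) ((norm_nonneg _).trans (hr p.1))
  rw [e, h1, integral_prod _ hint]
  simp only
  rw [← hB']
  congr 1
  funext z
  exact (B z).integral_comp_comm hWint

/-- The expectation of a product of independent copies of a random operator is a power of its mean. -/
theorem integral_list_prod_apply {b k n : ℕ} {A : Z → E b →L[ℝ] E b} {A' : E b →L[ℝ] E b}
    (hA : ∀ v, Measurable fun z => A z v) (hr : ∀ z, ‖A z‖ ≤ 1)
    (hA' : ∀ v, ∫ z, A z v ∂μ = A' v) (hk : k ≤ n) (v : E b) :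
    ∫ ζ : Fin n → Z, (List.ofFn fun j : Fin k => A (ζ ⟨j, j.2.trans_le hk⟩)).prod v
      ∂(Measure.pi fun _ => μ) = (A' ^ k) v := by
  induction k generalizing n with
  | zero => simp
  | succ k ih =>
    obtain ⟨n, rfl⟩ : ∃ n', n = n' + 1 := ⟨n - 1, by omega⟩
    have hk' : k ≤ n := by omega
    have h := integral_pi_succ (μ := μ) (n := n) (W := fun ζ : Fin n → Z =>
      (List.ofFn fun j : Fin k => A (ζ ⟨j, j.2.trans_le hk'⟩)).prod v) hA hr hA'
      ((measurable_list_prod_apply (Q := Fin n → Z)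
        (B := fun (j : Fin k) ζ => A (ζ ⟨j, j.2.trans_le hk'⟩))
        fun j w => (hA w).comp (measurable_pi_apply _)).comp
          (measurable_id.prodMk measurable_const)) (C := ‖v‖) (fun ζ => by
        simpa using ContinuousLinearMap.le_of_opNorm_le _
          (norm_list_prod_le_one fun j : Fin k => hr (ζ ⟨j, j.2.trans_le hk'⟩)) v)
    rw [ih hk'] at h
    rw [pow_succ', mul_apply_eq_comp, ← h]
    refine integral_congr_ae (ae_of_all _ fun ζ => ?_)
    simp only [List.ofFn_succ, List.prod_cons, mul_apply_eq_comp]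
    rfl

end Products

/-! ### Mean, bias and variance of the stochastic gradients -/

theorem memLp_two_of_lintegral_le {𝒮 : Type*} [MeasurableSpace 𝒮] {μ : Measure 𝒮} {d : ℕ}
    {X : 𝒮 → E d} (hX : AEStronglyMeasurable X μ) {σ : ℝ} (hσ : 0 ≤ σ)
    (h : ∫⁻ s, ‖X s‖ₑ ^ 2 ∂μ ≤ ENNReal.ofReal σ) : MemLp X 2 μ ∧ ∫ s, ‖X s‖ ^ 2 ∂μ ≤ σ := by
  have e : ∀ s, ‖X s‖ₑ ^ 2 = ENNReal.ofReal (‖X s‖ ^ 2) := fun s => by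
    rw [← ofReal_norm, ENNReal.ofReal_pow (norm_nonneg _)]
  simp_rw [e] at h
  have hm : AEStronglyMeasurable (fun s => ‖X s‖ ^ 2) μ := hX.norm.pow 2
  constructor
  · rw [memLp_two_iff_integrable_sq_norm hX]
    refine ⟨hm, ?_⟩
    rw [hasFiniteIntegral_iff_ofReal (ae_of_all _ fun s => by positivity)]
    exact h.trans_lt ENNReal.ofReal_lt_top
  · rw [integral_eq_lintegral_of_nonneg_ae (ae_of_all _ fun s => by positivity) hm]
    exact ENNReal.toReal_le_of_le_ofReal hσ h

/-- A stochastic oracle `H` for the vector field `h`: unbiased, with second moment of the error at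
most `σ`, and `√L`-Lipschitz for every sample. -/
structure Oracle {a b d : ℕ} {𝒮 : Type*} [MeasurableSpace 𝒮] (μ : Measure 𝒮)
    (H : E a → E b → 𝒮 → E d) (h : E a → E b → E d) (L σ : ℝ) : Prop where
  measurable : Measurable fun q : (E a × E b) × 𝒮 => H q.1.1 q.1.2 q.2
  lipschitz : ∀ s x y x' y', ‖H x y s - H x' y' s‖ ^ 2 ≤ L * (‖x - x'‖ ^ 2 + ‖y - y'‖ ^ 2)
  integrable : ∀ x y, Integrable (H x y) μ
  mean : ∀ x y, ∫ s, H x y s ∂μ = h x y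
  memLp : ∀ x y, MemLp (fun s => H x y s - h x y) 2 μ
  variance : ∀ x y, ∫ s, ‖H x y s - h x y‖ ^ 2 ∂μ ≤ σ

theorem Oracle.comp {a b d : ℕ} {𝒮 𝒯 : Type*} [MeasurableSpace 𝒮] [MeasurableSpace 𝒯]
    {μ : Measure 𝒮} {ρ : Measure 𝒯} {H : E a → E b → 𝒮 → E d} {h : E a → E b → E d} {L σ : ℝ}
    (o : Oracle μ H h L σ) {φ : 𝒯 → 𝒮} (hφ : MeasurePreserving φ ρ μ) :
    Oracle ρ (fun x y t => H x y (φ t)) h L σ where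
  measurable := o.measurable.comp
    (measurable_fst.prodMk (hφ.measurable.comp measurable_snd))
  lipschitz t := o.lipschitz (φ t)
  integrable x y := (hφ.integrable_comp (o.integrable x y).aestronglyMeasurable).2
    (o.integrable x y)
  mean x y := by
    rw [← o.mean, ← hφ.map_eq, integral_map hφ.measurable.aemeasurable]
    rw [hφ.map_eq]
    exact (o.integrable x y).aestronglyMeasurable
  memLp x y := (o.memLp x y).comp_measurePreserving hφ
  variance x y := by
    refine le_trans (le_of_eq ?_) (o.variance x y)
    rw [← hφ.map_eq, integral_map hφ.measurable.aemeasurable]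
    rw [hφ.map_eq]
    exact ((o.memLp x y).aestronglyMeasurable.norm.pow 2)

namespace Problem

variable {m a b : ℕ} {Ξ Z : Type*} [MeasurableSpace Ξ] [MeasurableSpace Z]
  {P : Problem m a b Ξ Z} {c : Constants} {σf : ℕ → ℝ} {σg : ℝ}

theorem isProbabilityMeasure_estLaw (hR : P.Regular c σf σg) {K : ℕ} (hK : 1 ≤ K) (i : Fin m) :
    IsProbabilityMeasure (P.estLaw K i) := by
  have := hR.prob_f i
  have := hR.prob_g i
  have : Nonempty (Fin K) := ⟨⟨0, hK⟩⟩
  unfold estLaw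
  infer_instance

theorem measurePreserving_estLaw_fst (hR : P.Regular c σf σg) {K : ℕ} (hK : 1 ≤ K) (i : Fin m) :
    MeasurePreserving Prod.fst (P.estLaw K i) (P.πf i) := by
  have := hR.prob_f i
  have := hR.prob_g i
  have : Nonempty (Fin K) := ⟨⟨0, hK⟩⟩
  exact measurePreserving_fst

variable (hR : P.Regular c σf σg) (hP : P.SampleRegular c) (hc : c.Valid)

include hR hP

theorem oracle_lowGrad (hc : c.Valid) (i : Fin m) :
    Oracle (P.πg i) (P.lowGrad i) (gradY (P.gAvg i)) (c.Lg ^ 2) (σg ^ 2) := by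
  have := hR.prob_g i
  have hmeas : ∀ x y, Measurable (P.lowGrad i x y) := fun x y =>
    (hP.measurable_lowGrad i).comp (f := fun s => ((x, y), s)) (by fun_prop)
  have hvar : ∀ x y, MemLp (fun s => P.lowGrad i x y s - gradY (P.gAvg i) x y) 2 (P.πg i) ∧
      ∫ s, ‖P.lowGrad i x y s - gradY (P.gAvg i) x y‖ ^ 2 ∂(P.πg i) ≤ σg ^ 2 := fun x y =>
    memLp_two_of_lintegral_le ((hmeas x y).sub_const _).aestronglyMeasurable (sq_nonneg _)
      (hR.variance_g i x y)
  have hint : ∀ x y, Integrable (P.lowGrad i x y) (P.πg i) := fun x y => by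
    have h := ((hvar x y).1.integrable (by norm_num)).add
      (integrable_const (gradY (P.gAvg i) x y))
    refine h.congr (ae_of_all _ fun s => ?_)
    simp
  refine ⟨hP.measurable_lowGrad i, fun s => (hP.lower i s).gradY_lipschitz.sq, hint,
    fun x y => ?_, fun x y => (hvar x y).1, fun x y => (hvar x y).2⟩
  exact integral_gradY (hP.measurable_g i) (hR.integrable_g i)
    (fun ζ => (hP.lower i ζ).differentiable) (hR.lower i).differentiable hc.Lg_nonneg
    (fun ζ => (hP.lower i ζ).gradY_lipschitz) x y (hint x y)

include hc

omit hR hc in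
theorem measurable_hatGrad_sample {K : ℕ} (i : Fin m) (x : E a) (y : E b) :
    Measurable fun s : EstSample Ξ Z K => P.hatGrad c.Lg i x y s :=
  (hP.measurable_hatGrad i).comp (f := fun s => ((x, y), s)) (by fun_prop)

omit hR in
theorem norm_scaled_correction_le {K k : ℕ} (hk : k < K) (i : Fin m) (x : E a) (y : E b)
    (ξ : Ξ) (ζ : Fin (K + 1) → Z) :
    ‖((K : ℝ) / c.Lg) • P.correction c.Lg hk i x y ξ ζ‖ ≤
      K * (Real.sqrt c.Cgxy * c.Cfy / c.Lg) := by
  have h := hP.norm_correction_le hc hk i x y ξ ζ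
  have h6 := hc.Lg_nonneg
  rw [norm_smul, Real.norm_eq_abs, abs_of_nonneg (by positivity : 0 ≤ (K : ℝ) / c.Lg)]
  calc _ ≤ (K : ℝ) / c.Lg * (Real.sqrt c.Cgxy * c.Cfy) :=
      mul_le_mul_of_nonneg_left h (by positivity)
    _ = _ := by ring

omit hc in
theorem memLp_hatGrad {K : ℕ} (hK : 1 ≤ K) (i : Fin m) (x : E a) (y : E b) :
    MemLp (fun s : EstSample Ξ Z K => P.hatGrad c.Lg i x y s) 2 (P.estLaw K i) := by
  have := isProbabilityMeasure_estLaw hR hK i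
  have h := memLp_two_of_lintegral_le (X := fun s : EstSample Ξ Z K =>
      P.hatGrad c.Lg i x y s - P.barGrad i x y - P.bias c.Lg K i x y)
    (((measurable_hatGrad_sample hP i x y).sub_const _).sub_const _).aestronglyMeasurable
    (sq_nonneg (σf K)) (hR.variance_f K hK i x y)
  have h2 := (h.1.add (memLp_const (P.barGrad i x y + P.bias c.Lg K i x y)))
  refine h2.ae_eq (ae_of_all _ fun s => ?_)
  simp only [Pi.add_apply]
  abel

theorem memLp_correction {K : ℕ} (hK : 1 ≤ K) (i : Fin m) (x : E a) (y : E b) :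
    MemLp (fun s : EstSample Ξ Z K => ((K : ℝ) / c.Lg) •
      P.correction c.Lg s.2.2.2 i x y s.1 s.2.1) 2 (P.estLaw K i) := by
  have := isProbabilityMeasure_estLaw hR hK i
  have hmeas : Measurable fun s : EstSample Ξ Z K => ((K : ℝ) / c.Lg) •
      P.correction c.Lg s.2.2.2 i x y s.1 s.2.1 := by
    have h1 : Measurable fun s : EstSample Ξ Z K => gradX (fun x y => P.f i x y s.1) x y :=
      (measurable_gradX_sample (hP.measurable_f i) fun ξ => (hP.upper i ξ).differentiable).comp
        (f := fun s : EstSample Ξ Z K => ((x, y), s.1)) (by fun_prop)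
    have h2 := h1.sub (measurable_hatGrad_sample hP i x y)
    simp only [hatGrad_eq] at h2
    convert! h2 using 2 with s
    simp
  exact MemLp.of_bound hmeas.aestronglyMeasurable _
    (ae_of_all _ fun s => norm_scaled_correction_le hP hc s.2.2.2 i x y s.1 s.2.1)

/-- `∇ₓ f` differs from the estimator with one term, which has finite variance, by a bounded term. -/
theorem memLp_gradX (i : Fin m) (x : E a) (y : E b) :
    MemLp (fun ξ => gradX (fun x y => P.f i x y ξ) x y) 2 (P.πf i) := by
  have hmp := measurePreserving_estLaw_fst hR le_rfl i
  have h1 := (memLp_hatGrad hR hP le_rfl i x y).add (memLp_correction hR hP hc le_rfl i x y)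
  have hm : Measurable fun ξ => gradX (fun x y => P.f i x y ξ) x y :=
    (measurable_gradX_sample (hP.measurable_f i) fun ξ => (hP.upper i ξ).differentiable).comp
      (f := fun s => ((x, y), s)) (by fun_prop)
  rw [← hmp.map_eq, memLp_map_measure_iff hm.aestronglyMeasurable hmp.measurable.aemeasurable]
  refine h1.ae_eq (ae_of_all _ fun s => ?_)
  simp only [Pi.add_apply, hatGrad_eq, Function.comp]
  abel

theorem integral_gradX_sample (i : Fin m) (x : E a) (y : E b) :
    ∫ ξ, gradX (fun x y => P.f i x y ξ) x y ∂(P.πf i) = gradX (P.fAvg i) x y := by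
  have := hR.prob_f i
  exact integral_gradX (hP.measurable_f i) (hR.integrable_f i)
    (fun ξ => (hP.upper i ξ).differentiable) (hR.upper i).differentiable hc.Lfx_nonneg
    (fun ξ => (hP.upper i ξ).gradX_lipschitz) x y
    ((memLp_gradX hR hP hc i x y).integrable (by norm_num))

omit hc in
theorem integrable_gradY_sample (i : Fin m) (x : E a) (y : E b) :
    Integrable (fun ξ => gradY (fun x y => P.f i x y ξ) x y) (P.πf i) := by
  have := hR.prob_f i
  refine Integrable.of_bound (Measurable.aestronglyMeasurable ?_) c.Cfy
    (ae_of_all _ fun ξ => (hP.upper i ξ).gradY_bounded x y)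
  exact (measurable_gradY_sample (hP.measurable_f i) fun ξ => (hP.upper i ξ).differentiable).comp
      (f := fun s => ((x, y), s)) (by fun_prop)

theorem integral_gradY_sample (i : Fin m) (x : E a) (y : E b) :
    ∫ ξ, gradY (fun x y => P.f i x y ξ) x y ∂(P.πf i) = gradY (P.fAvg i) x y := by
  have := hR.prob_f i
  exact integral_gradY (hP.measurable_f i) (hR.integrable_f i)
    (fun ξ => (hP.upper i ξ).differentiable) (hR.upper i).differentiable hc.Lfy_nonneg
    (fun ξ => (hP.upper i ξ).gradY_lipschitz) x y (integrable_gradY_sample hR hP i x y)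

theorem integral_correction_pi {K k : ℕ} (hk : k < K) (i : Fin m) (x : E a) (y : E b) (ξ : Ξ) :
    ∫ ζ, P.correction c.Lg hk i x y ξ ζ ∂(Measure.pi fun _ => P.πg i) =
      hessXY (P.gAvg i) x y (((neumannFactor c.Lg (P.gAvg i) x y) ^ k)
        (gradY (fun x y => P.f i x y ξ) x y)) := by
  have := hR.prob_g i
  have hgi := (oracle_lowGrad hR hP hc i).integrable
  have hA : ∀ v, Measurable fun z => neumannFactor c.Lg (fun x y => P.g i x y z) x y v := fun v =>
    (measurable_neumannFactor_sample (hP.measurable_g i) (hP.lower i) c.Lg v).comp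
      (f := fun z => ((x, y), z)) (by fun_prop)
  have hn : ∀ z, ‖neumannFactor c.Lg (fun x y => P.g i x y z) x y‖ ≤ 1 := fun z =>
    (hP.lower i z).norm_neumannFactor_le_one hc x y
  have hinner := integral_list_prod_apply hA hn
    (fun v => integral_neumannFactor_apply (hP.measurable_g i) (hR.integrable_g i) hc (hP.lower i)
      (hR.lower i) hgi x y v) hk.le (gradY (fun x y => P.f i x y ξ) x y)
  have houter := integral_pi_succ (μ := P.πg i) (n := K)
    (B := fun z => hessXY (fun x y => P.g i x y z) x y)
    (fun v => (measurable_hessXY_sample (hP.measurable_g i) (hP.lower i) v).comp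
      (f := fun z => ((x, y), z)) (by fun_prop))
    (fun z => (hP.lower i z).norm_hessXY_le x y)
    (fun v => integral_hessXY_apply (hP.measurable_g i) (hR.integrable_g i) hc (hP.lower i)
      (hR.lower i) hgi x y v)
    ((measurable_list_prod_apply (Q := Fin K → Z)
        (B := fun (j : Fin k) ζ => neumannFactor c.Lg
          (fun x y => P.g i x y (ζ ⟨j, j.2.trans hk⟩)) x y)
        fun j w => (hA w).comp (measurable_pi_apply _)).comp
          (measurable_id.prodMk (measurable_const (a := gradY (fun x y => P.f i x y ξ) x y))))
    (C := ‖gradY (fun x y => P.f i x y ξ) x y‖) (fun ζ => by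
        simpa using ContinuousLinearMap.le_of_opNorm_le _
          (norm_list_prod_le_one fun j : Fin k => hn (ζ ⟨j, j.2.trans hk⟩))
          (gradY (fun x y => P.f i x y ξ) x y))
  change _ = hessXY (P.gAvg i) x y _ at houter
  have hA' : neumannFactor c.Lg (P.gAvg i) x y =
      neumannFactor c.Lg (fun x y => ∫ s, P.g i x y s ∂(P.πg i)) x y := rfl
  rw [hA', ← hinner]
  exact houter

/-- The estimator averages to the truncated Neumann series for the hypergradient surrogate. -/
theorem integral_hatGrad {K : ℕ} (hK : 1 ≤ K) (i : Fin m) (x : E a) (y : E b) :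
    ∫ s, P.hatGrad c.Lg i x y s ∂(P.estLaw K i) = gradX (P.fAvg i) x y -
      hessXY (P.gAvg i) x y ((1 / c.Lg) • ∑ k ∈ Finset.range K,
        ((neumannFactor c.Lg (P.gAvg i) x y) ^ k) (gradY (P.fAvg i) x y)) := by
  have hpf := hR.prob_f i
  have hpg := hR.prob_g i
  have hprob := isProbabilityMeasure_estLaw hR hK i
  have hne : Nonempty (Fin K) := ⟨⟨0, hK⟩⟩
  have hmp := measurePreserving_estLaw_fst hR hK i
  have hX : MemLp (fun s : EstSample Ξ Z K => gradX (fun x y => P.f i x y s.1) x y) 2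
    (P.estLaw K i) := (memLp_gradX hR hP hc i x y).comp_measurePreserving hmp
  have hQ := memLp_correction hR hP hc hK i x y
  have hQi := hQ.integrable (by norm_num)
  have hK0 : (K : ℝ) ≠ 0 := by positivity
  simp_rw [hatGrad_eq]
  rw [integral_sub (hX.integrable (by norm_num)) hQi]
  congr 1
  · have h := integral_map (μ := P.estLaw K i) hmp.measurable.aemeasurable
      (f := fun ξ => gradX (fun x y => P.f i x y ξ) x y)
      (by rw [hmp.map_eq]; exact (memLp_gradX hR hP hc i x y).aestronglyMeasurable)
    rw [hmp.map_eq, integral_gradX_sample hR hP hc] at h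
    exact h.symm
  · have hcorr : ∀ (k : Fin K) ξ, Integrable (fun ζ => P.correction c.Lg k.2 i x y ξ ζ)
        (Measure.pi fun _ => P.πg i) := fun k ξ =>
      Integrable.of_bound ((hP.measurable_correction k.2 i).comp
        (f := fun ζ => ((x, y), ξ, ζ)) (by fun_prop)).aestronglyMeasurable _
        (ae_of_all _ fun ζ => hP.norm_correction_le hc k.2 i x y ξ ζ)
    have hunif : ∀ k : Fin K, (uniformOn (Set.univ : Set (Fin K))).real {k} = 1 / K := fun k => by
      rw [measureReal_def, uniformOn_univ]
      simp
    set A := neumannFactor c.Lg (P.gAvg i) x y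
    have hstep : ∀ᵐ ξ ∂(P.πf i), ∫ p : (Fin (K + 1) → Z) × Fin K, ((K : ℝ) / c.Lg) •
        P.correction c.Lg p.2.2 i x y ξ p.1
          ∂((Measure.pi fun _ => P.πg i).prod (uniformOn Set.univ)) =
        hessXY (P.gAvg i) x y ((1 / c.Lg) • ∑ k ∈ Finset.range K,
          (A ^ k) (gradY (fun x y => P.f i x y ξ) x y)) := by
      filter_upwards [hQi.prod_right_ae] with ξ hξ
      rw [integral_prod _ hξ]
      have h1 : ∀ ζ : Fin (K + 1) → Z, ∫ k : Fin K, ((K : ℝ) / c.Lg) •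
          P.correction c.Lg k.2 i x y ξ ζ ∂(uniformOn Set.univ) =
          ∑ k : Fin K, (1 / c.Lg) • P.correction c.Lg k.2 i x y ξ ζ := by
        intro ζ
        rw [integral_fintype (Integrable.of_finite)]
        refine Finset.sum_congr rfl fun k _ => ?_
        rw [hunif, smul_smul]
        congr 1
        field_simp
      simp_rw [h1]
      have hci : ∀ k : Fin K, Integrable (fun ζ => (1 / c.Lg) • P.correction c.Lg k.2 i x y ξ ζ)
          (Measure.pi fun _ => P.πg i) := fun k => (hcorr k ξ).smul (1 / c.Lg)
      rw [integral_finsetSum _ fun k _ => hci k, map_smul, map_sum,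
        Finset.smul_sum, Finset.sum_range]
      refine Finset.sum_congr rfl fun k _ => ?_
      rw [integral_smul, integral_correction_pi hR hP hc]
    rw [estLaw, integral_prod _ hQi, integral_congr_ae hstep]
    have hT := ((hessXY (P.gAvg i) x y).comp
      ((1 / c.Lg) • ∑ k ∈ Finset.range K, A ^ k)).integral_comp_comm
        (integrable_gradY_sample hR hP i x y)
    rw [integral_gradY_sample hR hP hc] at hT
    simpa [sum_apply] using hT

/-- The expectation of the stochastic hypergradient estimator. -/
noncomputable def meanGrad (P : Problem m a b Ξ Z) (Lg : ℝ) (K : ℕ) (i : Fin m) (x : E a)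
    (y : E b) : E a :=
  ∫ s, P.hatGrad Lg i x y s ∂(P.estLaw K i)

/-- The truncation error of the Neumann series is the remainder `A^K [∇²_yy g]⁻¹ ∇_y f`. -/
theorem norm_meanGrad_sub_barGrad_le {K : ℕ} (hK : 1 ≤ K) (i : Fin m) (x : E a) (y : E b) :
    ‖P.meanGrad c.Lg K i x y - P.barGrad i x y‖ ≤
      Real.sqrt c.Cgxy * (|1 - c.μg / c.Lg| ^ K * (c.Cfy / c.μg)) := by
  have hG := hR.lower i
  set A := neumannFactor c.Lg (P.gAvg i) x y with hA
  set g := gradY (P.fAvg i) x y with hg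
  set w := (hessYY (P.gAvg i) x y).inverse g with hw
  have hgw : hessYY (P.gAvg i) x y w = g := (hG.hessYY_inverse hc x y).2 g
  have hH : (1 / c.Lg) • hessYY (P.gAvg i) x y = 1 - A := by simp [hA, neumannFactor]
  have hgeom : (1 / c.Lg) • ∑ k ∈ Finset.range K, (A ^ k) g = w - (A ^ K) w := by
    have h1 := congrArg (fun B : E b →L[ℝ] E b => B w) (geom_sum_mul_neg A K)
    rw [← hH] at h1
    simp only [mul_apply_eq_comp, _root_.smul_apply, _root_.sub_apply, hgw, sum_apply,
      map_smul] at h1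
    exact h1
  have e : P.meanGrad c.Lg K i x y - P.barGrad i x y = hessXY (P.gAvg i) x y ((A ^ K) w) := by
    rw [meanGrad, integral_hatGrad hR hP hc hK, ← hA, ← hg, hgeom, barGrad, ← hg, ← hw]
    simp only [map_sub]
    abel
  rw [e]
  refine (ContinuousLinearMap.le_opNorm _ _).trans ?_
  refine mul_le_mul (hG.norm_hessXY_le x y) ?_ (norm_nonneg _) (Real.sqrt_nonneg _)
  refine (ContinuousLinearMap.le_opNorm _ _).trans ?_
  refine mul_le_mul ?_ ?_ (norm_nonneg _) (by positivity)
  · exact (norm_pow_le' A hK).trans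
      (pow_le_pow_left₀ (norm_nonneg _) (hG.norm_neumannFactor_le hc x y) K)
  · exact (hG.norm_inverse_apply_le hc x y g).trans
      (div_le_div_of_nonneg_right ((hR.upper i).gradY_bounded x y) hc.μg_pos.le)

/-- The number of terms `numTerms c T` makes the bias of order `1 / T`. -/
theorem norm_bias_numTerms_le {T : ℕ} (hT : 0 < T) (i : Fin m) (x : E a) (y : E b) :
    ‖P.meanGrad c.Lg (numTerms c T) i x y - P.barGrad i x y‖ ≤ 1 / (Real.sqrt c.Cgxy * T) := by
  have hK : 1 ≤ numTerms c T := le_max_left _ _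
  have hT' : (0 : ℝ) < T := by exact_mod_cast hT
  have hμ := hc.μg_pos
  have hC := hc.Cgxy_pos
  have hsC : 0 < Real.sqrt c.Cgxy := Real.sqrt_pos.2 hC
  rcases subsingleton_or_nontrivial (E b) with hb | hb
  · have h0 : ‖P.meanGrad c.Lg (numTerms c T) i x y - P.barGrad i x y‖ = 0 := by
      rw [meanGrad, integral_hatGrad hR hP hc hK, barGrad,
        Subsingleton.elim ((1 / c.Lg) • ∑ k ∈ Finset.range (numTerms c T), _) (0 : E b),
        Subsingleton.elim ((hessYY (P.gAvg i) x y).inverse _) (0 : E b)]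
      simp
    rw [h0]
    positivity
  refine (norm_meanGrad_sub_barGrad_le hR hP hc hK i x y).trans ?_
  have hle := (hR.lower i).μg_le_Lg
  have hL : 0 < c.Lg := hμ.trans_le hle
  rcases hc.Cfy_nonneg.eq_or_lt with h0 | h0
  · rw [← h0]
    simp only [zero_div, mul_zero]
    positivity
  have hratio : 0 ≤ 1 - c.μg / c.Lg := by rw [sub_nonneg, div_le_one hL]; exact hle
  rw [abs_of_nonneg hratio]
  have hexp : 1 - c.μg / c.Lg ≤ Real.exp (-(c.μg / c.Lg)) := by
    have := Real.add_one_le_exp (-(c.μg / c.Lg)); linarith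
  have hlog : Real.log (c.Cgxy * c.Cfy * T / c.μg) ≤ (numTerms c T : ℝ) * (c.μg / c.Lg) := by
    have h1 : (c.Lg / c.μg) * Real.log (c.Cgxy * c.Cfy * T / c.μg) ≤ numTerms c T :=
      (Nat.le_ceil _).trans (by exact_mod_cast le_max_right _ _)
    have h2 := mul_le_mul_of_nonneg_right h1 (div_nonneg hμ.le hL.le)
    have e : c.Lg / c.μg * Real.log (c.Cgxy * c.Cfy * T / c.μg) * (c.μg / c.Lg) =
      Real.log (c.Cgxy * c.Cfy * T / c.μg) := by field_simp
    linarith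
  have hpow : (1 - c.μg / c.Lg) ^ numTerms c T ≤ c.μg / (c.Cgxy * c.Cfy * T) := by
    calc _ ≤ Real.exp (-(c.μg / c.Lg)) ^ numTerms c T := pow_le_pow_left₀ hratio hexp _
      _ = Real.exp (-((numTerms c T : ℝ) * (c.μg / c.Lg))) := by
        rw [← Real.exp_nat_mul]; ring_nf
      _ ≤ Real.exp (-Real.log (c.Cgxy * c.Cfy * T / c.μg)) :=
        Real.exp_le_exp.2 (neg_le_neg hlog)
      _ = _ := by rw [Real.exp_neg, Real.exp_log (by positivity), inv_div]
  calc _ ≤ Real.sqrt c.Cgxy * (c.μg / (c.Cgxy * c.Cfy * T) * (c.Cfy / c.μg)) := by gcongr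
    _ = Real.sqrt c.Cgxy / (c.Cgxy * T) := by field_simp
    _ = 1 / (Real.sqrt c.Cgxy * T) := by
      rw [div_eq_div_iff (by positivity) (by positivity)]
      nlinarith [Real.mul_self_sqrt hC.le]

/-- The variance of the estimator with `K` terms is at most `estVar c σf * K ^ 4`. Only the
assumed variance bound for one term enters: the other terms are bounded. -/
noncomputable def _root_.Diamond.estVar (c : Constants) (σf : ℕ → ℝ) : ℝ :=
  4 * σf 1 ^ 2 + 24 * (Real.sqrt c.Cgxy * c.Cfy / c.Lg) ^ 2

theorem norm_hatGrad_sub_meanGrad_sub_le {K : ℕ} (hK : 1 ≤ K) (i : Fin m) (x : E a) (y : E b)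
    (s : EstSample Ξ Z K) :
    ‖(P.hatGrad c.Lg i x y s - P.meanGrad c.Lg K i x y) -
      (gradX (fun x y => P.f i x y s.1) x y - gradX (P.fAvg i) x y)‖ ≤
      2 * (K * (Real.sqrt c.Cgxy * c.Cfy / c.Lg)) := by
  have hprob := isProbabilityMeasure_estLaw hR hK i
  have hmp := measurePreserving_estLaw_fst hR hK i
  have hX : MemLp (fun s : EstSample Ξ Z K => gradX (fun x y => P.f i x y s.1) x y) 2
    (P.estLaw K i) := (memLp_gradX hR hP hc i x y).comp_measurePreserving hmp
  have hQ := memLp_correction hR hP hc hK i x y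
  have hmean : P.meanGrad c.Lg K i x y = gradX (P.fAvg i) x y -
      ∫ s : EstSample Ξ Z K, ((K : ℝ) / c.Lg) • P.correction c.Lg s.2.2.2 i x y s.1 s.2.1
        ∂(P.estLaw K i) := by
    rw [meanGrad]
    simp_rw [hatGrad_eq]
    rw [integral_sub (hX.integrable (by norm_num)) (hQ.integrable (by norm_num))]
    congr 1
    have h := integral_map (μ := P.estLaw K i) hmp.measurable.aemeasurable
      (f := fun ξ => gradX (fun x y => P.f i x y ξ) x y)
      (by rw [hmp.map_eq]; exact (memLp_gradX hR hP hc i x y).aestronglyMeasurable)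
    rw [hmp.map_eq, integral_gradX_sample hR hP hc] at h
    exact h.symm
  have h1 := norm_integral_le_of_norm_le_const (μ := P.estLaw K i)
    (ae_of_all _ fun s : EstSample Ξ Z K =>
      norm_scaled_correction_le hP hc s.2.2.2 i x y s.1 s.2.1)
  rw [probReal_univ, mul_one] at h1
  have h2 := norm_scaled_correction_le hP hc s.2.2.2 i x y s.1 s.2.1
  rw [hmean, hatGrad_eq]
  have e : ∀ u v w z : E a, (u - v - (w - z)) - (u - w) = z - v := fun u v w z => by abel
  rw [e]
  refine (norm_sub_le _ _).trans ?_
  linarith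

theorem oracle_hatGrad {K : ℕ} (hK : 1 ≤ K) (i : Fin m) :
    Oracle (P.estLaw K i) (fun x y s => P.hatGrad c.Lg i x y s) (P.meanGrad c.Lg K i)
      (2 * estLip c ^ 2 * K ^ 4) (estVar c σf * K ^ 4) := by
  have hprob := isProbabilityMeasure_estLaw hR hK i
  have hprob1 := isProbabilityMeasure_estLaw hR le_rfl i
  have hpf := hR.prob_f i
  have hmemLp : ∀ x y, MemLp (fun s : EstSample Ξ Z K =>
      P.hatGrad c.Lg i x y s - P.meanGrad c.Lg K i x y) 2 (P.estLaw K i) := fun x y =>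
    (memLp_hatGrad hR hP hK i x y).sub (memLp_const _)
  refine ⟨hP.measurable_hatGrad i, fun s x y x' y' => hP.hatGrad_lipschitz hc hK i s x y x' y',
    fun x y => (memLp_hatGrad hR hP hK i x y).integrable (by norm_num), fun x y => rfl,
    hmemLp, fun x y => ?_⟩
  set r := Real.sqrt c.Cgxy * c.Cfy / c.Lg with hr
  have hsq : ∀ {u v : E a} {ρ : ℝ}, ‖u - v‖ ≤ ρ → ‖u‖ ^ 2 ≤ 2 * ‖v‖ ^ 2 + 2 * ρ ^ 2 := by
    intro u v ρ h
    have h1 : ‖u‖ ≤ ‖v‖ + ρ := by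
      have := norm_le_norm_add_norm_sub' u v; linarith
    have h2 := pow_le_pow_left₀ (norm_nonneg u) h1 2
    nlinarith [sq_nonneg (‖v‖ - ρ)]
  have hX : MemLp (fun ξ => gradX (fun x y => P.f i x y ξ) x y - gradX (P.fAvg i) x y) 2
    (P.πf i) := (memLp_gradX hR hP hc i x y).sub (memLp_const _)
  have hXi := hX.integrable_norm_pow (by norm_num : (2 : ℕ) ≠ 0)
  have htrans : ∀ {K' : ℕ} (_ : 1 ≤ K'), ∫ s : EstSample Ξ Z K',
      ‖gradX (fun x y => P.f i x y s.1) x y - gradX (P.fAvg i) x y‖ ^ 2 ∂(P.estLaw K' i) =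
      ∫ ξ, ‖gradX (fun x y => P.f i x y ξ) x y - gradX (P.fAvg i) x y‖ ^ 2 ∂(P.πf i) := by
    intro K' hK'
    have hmp := measurePreserving_estLaw_fst hR hK' i
    have h := integral_map (μ := P.estLaw K' i) hmp.measurable.aemeasurable
      (f := fun ξ => ‖gradX (fun x y => P.f i x y ξ) x y - gradX (P.fAvg i) x y‖ ^ 2)
      (by rw [hmp.map_eq]; exact hX.aestronglyMeasurable.norm.pow 2)
    rw [hmp.map_eq] at h
    exact h.symm
  have hXi' : ∀ {K' : ℕ} (_ : 1 ≤ K'), Integrable (fun s : EstSample Ξ Z K' =>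
      ‖gradX (fun x y => P.f i x y s.1) x y - gradX (P.fAvg i) x y‖ ^ 2) (P.estLaw K' i) := by
    intro K' hK'
    exact (measurePreserving_estLaw_fst hR hK' i).integrable_comp_of_integrable hXi
  -- the variance of `∇ₓ f` is controlled by that of the estimator with a single term
  have hvar1 : ∫ ξ, ‖gradX (fun x y => P.f i x y ξ) x y - gradX (P.fAvg i) x y‖ ^ 2 ∂(P.πf i) ≤
      2 * σf 1 ^ 2 + 8 * r ^ 2 := by
    have h1 := memLp_two_of_lintegral_le (X := fun s : EstSample Ξ Z 1 =>
        P.hatGrad c.Lg i x y s - P.barGrad i x y - P.bias c.Lg 1 i x y)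
      (((measurable_hatGrad_sample hP i x y).sub_const _).sub_const _).aestronglyMeasurable
      (sq_nonneg (σf 1)) (hR.variance_f 1 le_rfl i x y)
    have e : ∀ s : EstSample Ξ Z 1, P.hatGrad c.Lg i x y s - P.barGrad i x y -
        P.bias c.Lg 1 i x y = P.hatGrad c.Lg i x y s - P.meanGrad c.Lg 1 i x y := fun s => by
      rw [bias, meanGrad]; abel
    simp_rw [e] at h1
    rw [← htrans le_rfl]
    have h1i := h1.1.integrable_norm_pow (by norm_num : (2 : ℕ) ≠ 0)
    calc _ ≤ ∫ s : EstSample Ξ Z 1, (2 * ‖P.hatGrad c.Lg i x y s - P.meanGrad c.Lg 1 i x y‖ ^ 2 +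
          8 * r ^ 2) ∂(P.estLaw 1 i) := by
          refine integral_mono (hXi' le_rfl) ((h1i.const_mul 2).add (integrable_const _))
            fun s => ?_
          have h := norm_hatGrad_sub_meanGrad_sub_le hR hP hc le_rfl i x y s
          rw [norm_sub_rev] at h
          refine (hsq h).trans (le_of_eq ?_)
          push_cast
          ring
      _ ≤ _ := by
        rw [integral_add (h1i.const_mul 2) (integrable_const _), integral_const_mul,
          integral_const, probReal_univ, one_smul]
        linarith [h1.2]
  calc _ ≤ ∫ s : EstSample Ξ Z K, (2 * ‖gradX (fun x y => P.f i x y s.1) x y -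
        gradX (P.fAvg i) x y‖ ^ 2 + 8 * K ^ 2 * r ^ 2) ∂(P.estLaw K i) := by
        refine integral_mono ((hmemLp x y).integrable_norm_pow (by norm_num : (2 : ℕ) ≠ 0))
          (((hXi' hK).const_mul 2).add (integrable_const _)) fun s => ?_
        refine (hsq (norm_hatGrad_sub_meanGrad_sub_le hR hP hc hK i x y s)).trans (le_of_eq ?_)
        ring
    _ = 2 * (∫ ξ, ‖gradX (fun x y => P.f i x y ξ) x y - gradX (P.fAvg i) x y‖ ^ 2 ∂(P.πf i)) +
        8 * K ^ 2 * r ^ 2 := by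
        rw [integral_add ((hXi' hK).const_mul 2) (integrable_const _), integral_const_mul,
          integral_const, probReal_univ, one_smul, htrans hK]
    _ ≤ 2 * (2 * σf 1 ^ 2 + 8 * r ^ 2) + 8 * K ^ 2 * r ^ 2 := by linarith
    _ ≤ estVar c σf * K ^ 4 := by
      have hK1 : (1 : ℝ) ≤ K := by exact_mod_cast hK
      have h2 : (1 : ℝ) ≤ (K : ℝ) ^ 2 := one_le_pow₀ hK1
      have h4 : (K : ℝ) ^ 2 ≤ (K : ℝ) ^ 4 := pow_le_pow_right₀ hK1 (by norm_num)
      rw [estVar, ← hr]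
      nlinarith [sq_nonneg (σf 1), sq_nonneg r, mul_nonneg (sq_nonneg r) (sub_nonneg.2 h4),
        mul_nonneg (sq_nonneg r) (sub_nonneg.2 (h2.trans h4)),
        mul_nonneg (sq_nonneg (σf 1)) (sub_nonneg.2 (h2.trans h4))]

end Problem

/-! ### Consensus -/

section Scalar

variable {m : ℕ} {M : Matrix (Fin m) (Fin m) ℝ}

/-- This makes the set in `secondEigenvalue` bounded, so that its supremum is not a junk value. -/
theorem abs_eigenvalue_le_one (hM : M ∈ doublyStochastic ℝ (Fin m)) {θ : ℝ} {w : Fin m → ℝ}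
    (hw : w ≠ 0) (h : M.mulVec w = θ • w) : |θ| ≤ 1 := by
  obtain ⟨i₀, hi₀⟩ := Function.ne_iff.1 hw
  have hne : (Finset.univ : Finset (Fin m)).Nonempty := ⟨i₀, Finset.mem_univ _⟩
  obtain ⟨i, -, hi⟩ := Finset.exists_max_image Finset.univ (fun j => |w j|) hne
  have hpos : 0 < |w i| := (abs_pos.2 hi₀).trans_le (hi i₀ (Finset.mem_univ _))
  have h1 : θ * w i = ∑ j, M i j * w j := by
    have := congrFun h i
    simpa [Matrix.mulVec, dotProduct] using this.symm
  have h2 : |θ| * |w i| ≤ 1 * |w i| := by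
    rw [← abs_mul, h1, ← sum_row_of_mem_doublyStochastic hM i, Finset.sum_mul]
    refine (Finset.abs_sum_le_sum_abs _ _).trans (Finset.sum_le_sum fun j _ => ?_)
    rw [abs_mul, abs_of_nonneg (nonneg_of_mem_doublyStochastic hM)]
    exact mul_le_mul_of_nonneg_left (hi j (Finset.mem_univ _)) (nonneg_of_mem_doublyStochastic hM)
  exact le_of_mul_le_mul_right h2 hpos

theorem secondEigenvalue_nonneg (M : Matrix (Fin m) (Fin m) ℝ) : 0 ≤ secondEigenvalue M := by
  refine Real.sSup_nonneg ?_
  rintro r ⟨θ, w, -, -, -, rfl⟩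
  exact abs_nonneg θ

/-- On vectors orthogonal to the all-ones vector, `M` contracts by its second eigenvalue: this is
the spectral theorem for `M - (1/m) 𝟙𝟙ᵀ`. -/
theorem sum_sq_mulVec_le (hM : M ∈ doublyStochastic ℝ (Fin m)) (hs : M.IsSymm) {lam : ℝ}
    (hlam : secondEigenvalue M ≤ lam) {w : Fin m → ℝ} (hw : ∑ i, w i = 0) :
    ∑ i, (M.mulVec w i) ^ 2 ≤ lam ^ 2 * ∑ i, w i ^ 2 := by
  rcases Nat.eq_zero_or_pos m with rfl | hm
  · simp
  have hm0 : (m : ℝ) ≠ 0 := by positivity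
  let N : Matrix (Fin m) (Fin m) ℝ := M - Matrix.of fun _ _ => 1 / (m : ℝ)
  have hN : N.IsHermitian := by
    ext i j
    simp [N, hs.apply i j]
  have hNv : ∀ v : Fin m → ℝ, N.mulVec v = M.mulVec v - fun _ => 1 / (m : ℝ) * ∑ j, v j := by
    intro v
    rw [Matrix.sub_mulVec]
    congr 1
    funext i
    simp [Matrix.mulVec, dotProduct, Finset.mul_sum]
  have hsum : ∀ v : Fin m → ℝ, ∑ i, M.mulVec v i = ∑ i, v i := by
    intro v
    simp only [Matrix.mulVec, dotProduct]
    rw [Finset.sum_comm]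
    refine Finset.sum_congr rfl fun j _ => ?_
    rw [← Finset.sum_mul, sum_col_of_mem_doublyStochastic hM, one_mul]
  set B := hN.eigenvectorBasis
  set θ := hN.eigenvalues
  have heig : ∀ j, |θ j| ≤ lam := by
    intro j
    have h1 : N.mulVec (B j) = θ j • ⇑(B j) := hN.mulVec_eigenvectorBasis j
    rcases eq_or_ne (θ j) 0 with h0 | h0
    · rw [h0, abs_zero]
      exact (secondEigenvalue_nonneg M).trans hlam
    have h2 : ∑ i, B j i = 0 := by
      have h3 : ∑ i, N.mulVec (B j) i = 0 := by
        rw [hNv]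
        simp only [Pi.sub_apply, Finset.sum_sub_distrib, hsum, Finset.sum_const, Finset.card_univ,
          Fintype.card_fin, nsmul_eq_mul]
        field_simp
        simp
      rw [h1] at h3
      simp only [Pi.smul_apply, smul_eq_mul, ← Finset.mul_sum] at h3
      exact (mul_eq_zero.1 h3).resolve_left h0
    have h4 : M.mulVec (B j) = θ j • ⇑(B j) := by
      rw [← h1, hNv, h2]
      funext i
      simp
    have hne : (⇑(B j) : Fin m → ℝ) ≠ 0 := by
      intro hz
      have h5 : B j = 0 := by
        ext i
        exact congrFun hz i
      have h6 := B.orthonormal.1 j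
      rw [h5, norm_zero] at h6
      exact zero_ne_one h6
    refine le_trans (le_csSup (s := {r | ∃ (θ : ℝ) (w : Fin m → ℝ), w ≠ 0 ∧ ∑ i, w i = 0 ∧
      M.mulVec w = θ • w ∧ r = |θ|}) ⟨1, ?_⟩ ⟨θ j, ⇑(B j), hne, h2, h4, rfl⟩) hlam
    rintro r ⟨θ', w', hw', -, he, rfl⟩
    exact abs_eigenvalue_le_one hM hw' he
  let W : EuclideanSpace ℝ (Fin m) := WithLp.toLp 2 w
  let V : EuclideanSpace ℝ (Fin m) := WithLp.toLp 2 (N.mulVec w)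
  have hVW : N.mulVec w = M.mulVec w := by
    rw [hNv, hw]
    funext i
    simp
  have hinner : ∀ j, ⟪B j, V⟫ = θ j * ⟪B j, W⟫ := by
    intro j
    have h1 : N.mulVec (B j) = θ j • ⇑(B j) := hN.mulVec_eigenvectorBasis j
    have h2 : ⟪B j, V⟫ = dotProduct (⇑(B j)) (N.mulVec w) := by
      simp [V, PiLp.inner_apply, dotProduct, mul_comm]
    have h3 : ⟪B j, W⟫ = dotProduct (⇑(B j)) w := by
      simp [W, PiLp.inner_apply, dotProduct, mul_comm]
    have h4 : N.transpose = N := by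
      have := hN.eq
      rwa [Matrix.conjTranspose_eq_transpose_of_trivial] at this
    rw [h2, h3, Matrix.dotProduct_mulVec, ← Matrix.mulVec_transpose, h4, h1, smul_dotProduct,
      smul_eq_mul]
  have hl : ∑ i, (M.mulVec w i) ^ 2 = ‖V‖ ^ 2 := by
    rw [EuclideanSpace.real_norm_sq_eq, ← hVW]
  have hr : ∑ i, w i ^ 2 = ‖W‖ ^ 2 := by
    rw [EuclideanSpace.real_norm_sq_eq]
  rw [hl, hr, ← B.sum_sq_norm_inner_right, ← B.sum_sq_norm_inner_right, Finset.mul_sum]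
  refine Finset.sum_le_sum fun j _ => ?_
  rw [hinner, norm_mul, mul_pow, Real.norm_eq_abs (θ j)]
  exact mul_le_mul_of_nonneg_right (pow_le_pow_left₀ (abs_nonneg _) (heig j) 2) (sq_nonneg _)

end Scalar

section Vector

variable {m a : ℕ}

/-- The consensus error `∑ ‖z_i - z̄‖²`. -/
noncomputable def dev (z : Fin m → E a) : ℝ := ∑ i, ‖z i - mean z‖ ^ 2

theorem dev_nonneg (z : Fin m → E a) : 0 ≤ dev z := Finset.sum_nonneg fun _ _ => sq_nonneg _

theorem mean_add (z w : Fin m → E a) : mean (fun i => z i + w i) = mean z + mean w := by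
  simp [mean, Finset.sum_add_distrib, smul_add]

theorem mean_sub (z w : Fin m → E a) : mean (fun i => z i - w i) = mean z - mean w := by
  simp [mean, Finset.sum_sub_distrib, smul_sub]

theorem mean_smul (r : ℝ) (z : Fin m → E a) : mean (fun i => r • z i) = r • mean z := by
  simp only [mean, ← Finset.smul_sum]
  rw [smul_comm]

theorem mean_const (hm : 0 < m) (z : E a) : mean (fun _ : Fin m => z) = z := by
  have : (m : ℝ) ≠ 0 := by positivity
  simp [mean, ← Nat.cast_smul_eq_nsmul ℝ, smul_smul, this]

theorem sum_eq_smul_mean (hm : 0 < m) (z : Fin m → E a) : ∑ i, z i = (m : ℝ) • mean z := by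
  have : (m : ℝ) ≠ 0 := by positivity
  simp [mean, smul_smul, this]

/-- Decomposition of the second moment into variance and squared mean. -/
theorem sum_norm_sq_eq (hm : 0 < m) (z : Fin m → E a) :
    ∑ i, ‖z i‖ ^ 2 = dev z + m * ‖mean z‖ ^ 2 := by
  have h : dev z = ∑ i, ‖z i‖ ^ 2 - 2 * ⟪∑ i, z i, mean z⟫ + m * ‖mean z‖ ^ 2 := by
    simp only [dev, norm_sub_sq_real, Finset.sum_add_distrib, Finset.sum_sub_distrib,
      ← Finset.mul_sum, sum_inner, Finset.sum_const, Finset.card_univ, Fintype.card_fin,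
      nsmul_eq_mul]
  rw [sum_eq_smul_mean hm, inner_smul_left, real_inner_self_eq_norm_sq] at h
  simp only [conj_trivial] at h
  linarith

theorem dev_le_sum_norm_sq (hm : 0 < m) (z : Fin m → E a) : dev z ≤ ∑ i, ‖z i‖ ^ 2 := by
  rw [sum_norm_sq_eq hm]
  have : 0 ≤ (m : ℝ) * ‖mean z‖ ^ 2 := by positivity
  linarith

theorem norm_mean_sq_le (hm : 0 < m) (z : Fin m → E a) : ‖mean z‖ ^ 2 ≤ ∑ i, ‖z i‖ ^ 2 := by
  rw [sum_norm_sq_eq hm]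
  have h1 : (1 : ℝ) ≤ m := by exact_mod_cast hm
  nlinarith [dev_nonneg z, sq_nonneg ‖mean z‖]

theorem dev_smul (r : ℝ) (z : Fin m → E a) : dev (fun i => r • z i) = r ^ 2 * dev z := by
  simp only [dev, mean_smul, ← smul_sub, norm_smul, mul_pow, Finset.mul_sum, Real.norm_eq_abs,
    sq_abs]

theorem dev_const (hm : 0 < m) (z : E a) : dev (fun _ : Fin m => z) = 0 := by
  simp [dev, mean_const hm]

variable {M : Matrix (Fin m) (Fin m) ℝ} (hM : M ∈ doublyStochastic ℝ (Fin m))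

include hM

theorem mean_mix (z : Fin m → E a) : mean (fun i => ∑ j, M i j • z j) = mean z := by
  simp only [mean]
  rw [Finset.sum_comm]
  congr 1
  refine Finset.sum_congr rfl fun j _ => ?_
  rw [← Finset.sum_smul, sum_col_of_mem_doublyStochastic hM, one_smul]

theorem dev_mix_le (hs : M.IsSymm) {lam : ℝ} (hlam : secondEigenvalue M ≤ lam) (hm : 0 < m)
    (z : Fin m → E a) :
    ∑ i, ‖(∑ j, M i j • z j) - mean z‖ ^ 2 ≤ lam ^ 2 * dev z := by
  have hcoord : ∀ (i : Fin m) (l : Fin a), ((∑ j, M i j • z j) - mean z) l =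
      M.mulVec (fun j => (z j - mean z) l) i := by
    intro i l
    have : ∑ j, M i j * (mean z) l = (mean z) l := by
      rw [← Finset.sum_mul, sum_row_of_mem_doublyStochastic hM, one_mul]
    simp [Matrix.mulVec, dotProduct, mul_sub, Finset.sum_sub_distrib, this]
  have hzero : ∀ l : Fin a, ∑ i, (z i - mean z) l = 0 := by
    intro l
    have h1 : ∑ i, (z i - mean z) = 0 := by
      rw [Finset.sum_sub_distrib, sum_eq_smul_mean hm]
      simp [Nat.cast_smul_eq_nsmul]
    have h2 := congrArg (fun v : E a => v l) h1
    simpa using h2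
  simp only [dev, EuclideanSpace.real_norm_sq_eq, hcoord]
  rw [Finset.sum_comm, Finset.sum_comm (f := fun i l => (z i - mean z).ofLp l ^ 2), Finset.mul_sum]
  exact Finset.sum_le_sum fun l _ => sum_sq_mulVec_le hM hs hlam (hzero l)

omit hM in
/-- Convexity of the squared norm, for the weights `r` and `1 - r`. -/
theorem norm_add_sq_le_div {r : ℝ} (h0 : 0 < r) (h1 : r < 1) (v w : E a) :
    ‖v + w‖ ^ 2 ≤ ‖v‖ ^ 2 / r + ‖w‖ ^ 2 / (1 - r) := by
  have h2 := norm_add_le v w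
  have h3 : 0 < 1 - r := by linarith
  have h4 := pow_le_pow_left₀ (norm_nonneg _) h2 2
  refine h4.trans ?_
  rw [div_add_div _ _ h0.ne' h3.ne', le_div_iff₀ (mul_pos h0 h3)]
  nlinarith [sq_nonneg ((1 - r) * ‖v‖ - r * ‖w‖)]

/-- One round of mixing followed by a perturbation `q`. -/
theorem dev_mix_add_le (hs : M.IsSymm) {lam : ℝ} (hlam : secondEigenvalue M ≤ lam)
    (hm : 0 < m) {r : ℝ} (hr0 : 0 < r) (hr1 : r < 1) (hlr : lam ≤ r) (z q : Fin m → E a) :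
    dev (fun i => (∑ j, M i j • z j) + q i) ≤ r * dev z + dev q / (1 - r) := by
  have hl0 : 0 ≤ lam := (secondEigenvalue_nonneg M).trans hlam
  have h1 := dev_mix_le hM hs hlam hm z
  have hmean : mean (fun i => (∑ j, M i j • z j) + q i) = mean z + mean q := by
    rw [mean_add (fun i => ∑ j, M i j • z j) q, mean_mix hM]
  calc dev (fun i => (∑ j, M i j • z j) + q i)
      ≤ ∑ i, (‖(∑ j, M i j • z j) - mean z‖ ^ 2 / r + ‖q i - mean q‖ ^ 2 / (1 - r)) := by
        rw [dev, hmean]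
        refine Finset.sum_le_sum fun i _ => ?_
        rw [add_sub_add_comm]
        exact norm_add_sq_le_div hr0 hr1 _ _
    _ = (∑ i, ‖(∑ j, M i j • z j) - mean z‖ ^ 2) / r + dev q / (1 - r) := by
        rw [Finset.sum_add_distrib, ← Finset.sum_div, ← Finset.sum_div, dev]
    _ ≤ r * dev z + dev q / (1 - r) := by
        gcongr
        rw [div_le_iff₀ hr0]
        have h2 : lam ^ 2 ≤ r * r := by nlinarith
        nlinarith [dev_nonneg z]

/-- The displacement in one step `z ↦ M z - α u`. -/
theorem sum_norm_sq_step_le (hs : M.IsSymm) {lam : ℝ} (hlam : secondEigenvalue M ≤ lam)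
    (hlam1 : lam ≤ 1) (hm : 0 < m) (α : ℝ) (z u : Fin m → E a) :
    ∑ i, ‖(∑ j, M i j • z j) - α • u i - z i‖ ^ 2 ≤
      6 * dev z + 3 * α ^ 2 * (dev u + m * ‖mean u‖ ^ 2) := by
  have hl0 : 0 ≤ lam := (secondEigenvalue_nonneg M).trans hlam
  have h1 := dev_mix_le hM hs hlam hm z
  have h2 : lam ^ 2 * dev z ≤ dev z := mul_le_of_le_one_left (dev_nonneg z) (by nlinarith)
  have h3 : ∀ v w x : E a, ‖v - w - x‖ ^ 2 ≤ 3 * ‖v‖ ^ 2 + 3 * ‖w‖ ^ 2 + 3 * ‖x‖ ^ 2 := by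
    intro v w x
    have h4 : ‖v - w - x‖ ≤ ‖v‖ + ‖w‖ + ‖x‖ :=
      (norm_sub_le _ _).trans (add_le_add_left (norm_sub_le _ _) _)
    have h5 := pow_le_pow_left₀ (norm_nonneg _) h4 2
    nlinarith [sq_nonneg (‖v‖ - ‖w‖), sq_nonneg (‖v‖ - ‖x‖), sq_nonneg (‖w‖ - ‖x‖)]
  calc _ ≤ ∑ i, (3 * ‖(∑ j, M i j • z j) - mean z‖ ^ 2 + 3 * ‖α • u i‖ ^ 2 +
        3 * ‖z i - mean z‖ ^ 2) := by
        refine Finset.sum_le_sum fun i _ => ?_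
        have e : (∑ j, M i j • z j) - α • u i - z i =
          ((∑ j, M i j • z j) - mean z) - α • u i - (z i - mean z) := by abel
        rw [e]
        exact h3 _ _ _
    _ = 3 * (∑ i, ‖(∑ j, M i j • z j) - mean z‖ ^ 2) + 3 * α ^ 2 * (∑ i, ‖u i‖ ^ 2) +
        3 * dev z := by
        simp only [Finset.sum_add_distrib, ← Finset.mul_sum, norm_smul, mul_pow, Real.norm_eq_abs,
          sq_abs, dev]
        ring
    _ ≤ _ := by
        rw [sum_norm_sq_eq hm u]
        linarith

end Vector

/-! ### A Lyapunov inequality for the coupled error recursions -/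

/-- Weights of the Lyapunov function and step-size constants, in terms of a constant `C` in the
error recursions, the mixing rate `ρ` and the strong convexity modulus `μ`. The weights of the
errors are `A` (lower-level), `B / α` (consensus), `S α` (gradient tracking) and `φ / (R α)`,
`φ / α` (the two momentum estimators); `cβ`, `k R`, `cγ` are the constants of `β`, `η`, `γ`. -/
structure Weights (C ρ μ cβ A B S φ k cγ : ℝ) : Prop where
  cβ_pos : 0 < cβ
  A_pos : 0 < A
  B_pos : 0 < B
  S_pos : 0 < S
  φ_pos : 0 < φ
  k_ge : 2 ≤ k
  cγ_ge : 2 ≤ cγ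
  lower_tracking : A * C ≤ cβ / 8
  lower_gain : C + 1 + 5 * C ^ 2 * φ * cβ ^ 2 ≤ A * cβ * μ / 2
  φ_le : 5 * C ^ 2 * φ ≤ 1 / 8
  consensus_gain : C + 2 ≤ B * (1 - ρ) / 2
  tracking_gain : 2 * C * B + 1 ≤ S * (1 - ρ)
  upper_gain : C + 1 ≤ φ * k / 2
  low_gain : A * C * cβ + 5 * C ^ 2 * φ * cβ ^ 2 ≤ φ * cγ / 2

/-- The choice starts with `cβ`, large compared with `C² / μ`, and `φ`, small enough for the last
terms of `lower_gain` and `φ_le`; the remaining weights then solve their conditions in turn. -/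
theorem exists_weights {C ρ μ : ℝ} (hC : 1 ≤ C) (hρ : ρ < 1) (hμ : 0 < μ) :
    ∃ cβ A B S φ k cγ : ℝ, Weights C ρ μ cβ A B S φ k cγ := by
  have hρ' : 0 < 1 - ρ := by linarith
  set cβ := 32 * C * (C + 1) / μ + 1 with hcβ
  have hcβ1 : 1 ≤ cβ := by rw [hcβ]; linarith [show 0 ≤ 32 * C * (C + 1) / μ by positivity]
  set φ := min (1 / 8) (μ / (32 * C)) / (5 * C ^ 2) with hφ
  have hφ0 : 0 < φ := by positivity
  have e1 : 5 * C ^ 2 * φ = min (1 / 8) (μ / (32 * C)) := by rw [hφ]; field_simp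
  have h8 : 5 * C ^ 2 * φ ≤ 1 / 8 := e1.trans_le (min_le_left _ _)
  have hμφ : 5 * C ^ 2 * φ ≤ μ / (32 * C) := e1.trans_le (min_le_right _ _)
  refine ⟨cβ, cβ / (8 * C), 2 * (C + 2) / (1 - ρ), (2 * C * (2 * (C + 2) / (1 - ρ)) + 1) / (1 - ρ),
    φ, 2 * (C + 1) / φ, 2 * (cβ ^ 2 + φ) / φ, ?_⟩
  constructor
  · linarith
  · positivity
  · positivity
  · positivity
  · exact hφ0
  · rw [le_div_iff₀ hφ0]
    have : φ ≤ 1 := by nlinarith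
    nlinarith
  · rw [le_div_iff₀ hφ0]
    nlinarith [sq_nonneg cβ]
  · refine le_of_eq ?_
    field_simp
  · have h1 : 5 * C ^ 2 * φ * cβ ^ 2 ≤ μ / (32 * C) * cβ ^ 2 :=
      mul_le_mul_of_nonneg_right hμφ (sq_nonneg _)
    have h2 : C + 1 ≤ μ / (32 * C) * cβ ^ 2 := by
      have h3 : 32 * C * (C + 1) / μ ≤ cβ ^ 2 := by nlinarith
      have h4 := mul_le_mul_of_nonneg_left h3 (show 0 ≤ μ / (32 * C) by positivity)
      have e : μ / (32 * C) * (32 * C * (C + 1) / μ) = C + 1 := by field_simp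
      linarith
    have e : cβ / (8 * C) * cβ * μ / 2 = 2 * (μ / (32 * C) * cβ ^ 2) := by field_simp; ring
    linarith
  · exact h8
  · refine le_of_eq ?_
    field_simp
  · refine le_of_eq ?_
    field_simp
  · refine le_of_eq ?_
    field_simp
  · have e2 : φ * (2 * (cβ ^ 2 + φ) / φ) / 2 = cβ ^ 2 + φ := by field_simp
    have e3 : cβ / (8 * C) * C * cβ = cβ ^ 2 / 8 := by field_simp
    rw [e2, e3]
    nlinarith [sq_nonneg cβ]

/-- One step of the Lyapunov inequality. The variables are the values at consecutive times of the
objective (`l`), the squared gradient (`G`) and averaged direction (`N`), the lower-level error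
(`r`), the consensus errors of the iterates (`c`) and of the tracked gradients (`s`), the errors of
the two momentum estimators (`e`, `f`), and the squared displacement of the iterates (`D`). -/
theorem lyapunov_step {C ρ μ cβ A B S φ k cγ R α α' bias l l' G N r r' c c' s s' e e' f f' D : ℝ}
    (W : Weights C ρ μ cβ A B S φ k cγ) (hC : 1 ≤ C) (hρ0 : 0 < ρ) (hρ1 : ρ < 1) (hR : 1 ≤ R)
    (hα : 0 < α) (hα1 : α ≤ 1) (hαα : α' ≤ α)
    (hinv : 1 / α' ≤ 1 / α * (1 + α ^ 3)) (hαρ : α ^ 3 ≤ (1 - ρ) / 2)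
    (hαS : S * α ^ 2 * R ≤ φ) (hαk : S * C * k ^ 2 * R ^ 2 * α ^ 4 ≤ 1)
    (hN : 0 ≤ N) (hr : 0 ≤ r) (hc : 0 ≤ c) (hs : 0 ≤ s) (he : 0 ≤ e) (hf : 0 ≤ f) (hD0 : 0 ≤ D)
    (hc0 : 0 ≤ c') (hs0 : 0 ≤ s') (he0 : 0 ≤ e') (hf0 : 0 ≤ f')
    (hl : l' ≤ l - α / 2 * G - α / 4 * N + C * α * (c + r + e + bias))
    (hr' : r' ≤ (1 - cβ * α * μ / 2) * r + C * (cβ * α) * f +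
      C / (cβ * α) * (c + α ^ 2 * (s + N)))
    (hc' : c' ≤ ρ * c + C * α ^ 2 * s)
    (hs' : s' ≤ ρ * s + C * (R * D + (k * R * α ^ 2) ^ 2 * (e + R)))
    (he' : e' ≤ (1 - k * R * α ^ 2) * e + C * ((k * R * α ^ 2) ^ 2 * R + R * D))
    (hf' : f' ≤ (1 - cγ * α ^ 2) * f + C * ((cγ * α ^ 2) ^ 2 + D))
    (hD : D ≤ C * (c + α ^ 2 * (s + N) + (cβ * α) ^ 2 * (f + r))) :
    l' + A * r' + B / α' * c' + S * α' * s' + φ / R * (1 / α') * e' + φ * (1 / α') * f' ≤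
      l + A * r + B / α * c + S * α * s + φ / R * (1 / α) * e + φ * (1 / α) * f -
        α * (G / 2 + r + c) + C * α * bias +
        φ * C * (3 * k ^ 2 + 2 * cγ ^ 2) * R ^ 2 * α ^ 3 := by
  obtain ⟨hcβ, hA, hB, hS, hφ, hk, hcγ, w1, w2, w3, w4, w5, w6, w7⟩ := W
  have hC0 : 0 < C := by linarith
  have hR0 : 0 < R := by linarith
  have hk0 : 0 < k := by linarith
  have hcγ0 : 0 < cγ := by linarith
  have hα3 : 0 < α ^ 3 := by positivity
  have hα31 : α ^ 3 ≤ 1 := pow_le_one₀ hα.le hα1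
  have hα32 : α ^ 3 ≤ α ^ 2 := pow_le_pow_of_le_one hα.le hα1 (by norm_num)
  set X := c / α with hX
  have hX0 : 0 ≤ X := by positivity
  have hXα : α * c ≤ X := by
    rw [hX, le_div_iff₀ hα]
    calc α * c * α = α * α * c := by ring
      _ ≤ 1 * c := mul_le_mul_of_nonneg_right (mul_le_one₀ hα1 hα.le hα1) hc
      _ = c := one_mul c
  set Y := D / α with hY
  have hY0 : 0 ≤ Y := by positivity
  -- lower-level error
  have Tr : A * r' ≤ A * r - A * cβ * μ / 2 * (α * r) + A * C * cβ * (α * f) +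
      1 / 8 * (X + α * s + α * N) := by
    have h1 := mul_le_mul_of_nonneg_left hr' hA.le
    have h2 : A * (C / (cβ * α) * (c + α ^ 2 * (s + N))) ≤ 1 / 8 * (X + α * s + α * N) := by
      have e1 : A * (C / (cβ * α) * (c + α ^ 2 * (s + N))) =
          A * C / cβ * (X + α * s + α * N) := by rw [hX]; field_simp; ring
      rw [e1]
      refine mul_le_mul_of_nonneg_right ?_ (by positivity)
      rw [div_le_iff₀ hcβ]
      linarith
    have e2 : A * ((1 - cβ * α * μ / 2) * r + C * (cβ * α) * f +
        C / (cβ * α) * (c + α ^ 2 * (s + N)))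
        = A * r - A * cβ * μ / 2 * (α * r) + A * C * cβ * (α * f) +
          A * (C / (cβ * α) * (c + α ^ 2 * (s + N))) := by ring
    linarith only [h1, h2, e2]
  -- a factor `1 / α'` costs `1 + α ^ 3` relative to `1 / α`
  have hgrow : ∀ {z : ℝ}, 0 ≤ z → 1 / α' * z ≤ 1 / α * ((1 + α ^ 3) * z) := by
    intro z hz
    calc 1 / α' * z ≤ 1 / α * (1 + α ^ 3) * z := mul_le_mul_of_nonneg_right hinv hz
      _ = _ := by ring
  -- consensus error
  have Tc : B / α' * c' ≤ B / α * c - (C + 2) * X + 2 * C * B * (α * s) := by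
    have h1 := hgrow hc0
    have h2 : (1 + α ^ 3) * c' ≤ (1 + ρ) / 2 * c + 2 * C * α ^ 2 * s := by
      have h3 : (1 + α ^ 3) * c' ≤ (1 + α ^ 3) * (ρ * c + C * α ^ 2 * s) :=
        mul_le_mul_of_nonneg_left hc' (by positivity)
      have h4 : (1 + α ^ 3) * ρ ≤ (1 + ρ) / 2 := by
        have h0 : α ^ 3 * ρ ≤ α ^ 3 := mul_le_of_le_one_right hα3.le hρ1.le
        linarith only [h0, hαρ]
      have h5 : (1 + α ^ 3) * (C * α ^ 2 * s) ≤ 2 * (C * α ^ 2 * s) :=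
        mul_le_mul_of_nonneg_right (by linarith) (by positivity)
      have h6 := mul_le_mul_of_nonneg_right h4 hc
      linarith only [h3, h5, h6]
    have h6 : B / α' * c' ≤ B * (1 / α * ((1 + ρ) / 2 * c + 2 * C * α ^ 2 * s)) := by
      have h7 : 1 / α' * c' ≤ 1 / α * ((1 + ρ) / 2 * c + 2 * C * α ^ 2 * s) :=
        h1.trans (mul_le_mul_of_nonneg_left h2 (by positivity))
      have e1 : B / α' * c' = B * (1 / α' * c') := by ring
      rw [e1]
      exact mul_le_mul_of_nonneg_left h7 hB.le
    have e2 : B * (1 / α * ((1 + ρ) / 2 * c + 2 * C * α ^ 2 * s)) =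
        B / α * c - B * (1 - ρ) / 2 * X + 2 * C * B * (α * s) := by rw [hX]; field_simp; ring
    have h8 := mul_le_mul_of_nonneg_right w4 hX0
    linarith only [h6, e2, h8]
  -- gradient tracking error
  have Ts : S * α' * s' ≤ S * α * s - (2 * C * B + 1) * (α * s) + C * φ * Y + α * e +
      φ * C * k ^ 2 * R ^ 2 * α ^ 3 := by
    have h1 : S * α' * s' ≤ S * α * s' :=
      mul_le_mul_of_nonneg_right (mul_le_mul_of_nonneg_left hαα hS.le) hs0
    have h2 : S * α * s' ≤ S * α * (ρ * s + C * (R * D + (k * R * α ^ 2) ^ 2 * (e + R))) :=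
      mul_le_mul_of_nonneg_left hs' (by positivity)
    have h3 := mul_le_mul_of_nonneg_right w5 (show 0 ≤ α * s by positivity)
    have h4 : S * α * (C * (R * D)) ≤ C * φ * Y := by
      have e1 : S * α * (C * (R * D)) = S * α ^ 2 * R * (C * Y) := by rw [hY]; field_simp
      rw [e1]
      calc S * α ^ 2 * R * (C * Y) ≤ φ * (C * Y) := mul_le_mul_of_nonneg_right hαS (by positivity)
        _ = _ := by ring
    have h5 : S * α * (C * ((k * R * α ^ 2) ^ 2 * e)) ≤ α * e := by
      have e1 : S * α * (C * ((k * R * α ^ 2) ^ 2 * e)) =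
        S * C * k ^ 2 * R ^ 2 * α ^ 4 * (α * e) := by ring
      rw [e1]
      exact mul_le_of_le_one_left (by positivity) hαk
    have h6 : S * α * (C * ((k * R * α ^ 2) ^ 2 * R)) ≤ φ * C * k ^ 2 * R ^ 2 * α ^ 3 := by
      have e1 : S * α * (C * ((k * R * α ^ 2) ^ 2 * R)) =
        S * α ^ 2 * R * (C * k ^ 2 * R ^ 2 * α ^ 3) := by ring
      rw [e1]
      calc _ ≤ φ * (C * k ^ 2 * R ^ 2 * α ^ 3) := mul_le_mul_of_nonneg_right hαS (by positivity)
        _ = _ := by ring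
    have e2 : S * α * (ρ * s + C * (R * D + (k * R * α ^ 2) ^ 2 * (e + R))) =
        S * α * s - S * (1 - ρ) * (α * s) + S * α * (C * (R * D)) +
        S * α * (C * ((k * R * α ^ 2) ^ 2 * e)) + S * α * (C * ((k * R * α ^ 2) ^ 2 * R)) := by
      ring
    linarith only [h1, h2, h3, h4, h5, h6, e2]
  -- momentum estimators: `(1 + α ^ 3) (1 - κ α ^ 2) ≤ 1 - κ α ^ 2 / 2`
  have hmom : ∀ {κ z z' q : ℝ}, 2 ≤ κ → 0 ≤ z → 0 ≤ z' → 0 ≤ q →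
      z' ≤ (1 - κ * α ^ 2) * z + q →
      1 / α' * z' ≤ 1 / α * z - κ / 2 * (α * z) + 2 * (q / α) := by
    intro κ z z' q hκ hz hz' hq h
    have h1 := hgrow hz'
    have h2 : (1 + α ^ 3) * z' ≤ (1 - κ / 2 * α ^ 2) * z + 2 * q := by
      have h3 : (1 + α ^ 3) * z' ≤ (1 + α ^ 3) * ((1 - κ * α ^ 2) * z + q) :=
        mul_le_mul_of_nonneg_left h (by positivity)
      have h4 : (1 + α ^ 3) * (1 - κ * α ^ 2) ≤ 1 - κ / 2 * α ^ 2 := by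
        have h5 : 0 ≤ α ^ 3 * (κ * α ^ 2) := by positivity
        have h6 : 2 * α ^ 2 ≤ κ * α ^ 2 := mul_le_mul_of_nonneg_right hκ (sq_nonneg α)
        linarith only [h5, h6, hα32]
      have h7 : (1 + α ^ 3) * q ≤ 2 * q := mul_le_mul_of_nonneg_right (by linarith) hq
      have h8 := mul_le_mul_of_nonneg_right h4 hz
      linarith only [h3, h7, h8]
    refine h1.trans ((mul_le_mul_of_nonneg_left h2 (by positivity)).trans (le_of_eq ?_))
    field_simp
  have Te : φ / R * (1 / α') * e' ≤ φ / R * (1 / α) * e - (C + 1) * (α * e) +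
      2 * C * φ * k ^ 2 * R ^ 2 * α ^ 3 + 2 * C * φ * Y := by
    have hkR : 2 ≤ k * R := hk.trans (le_mul_of_one_le_right hk0.le hR)
    have h1 := hmom hkR he he0 (show 0 ≤ C * ((k * R * α ^ 2) ^ 2 * R + R * D) by positivity) he'
    have h2 := mul_le_mul_of_nonneg_left h1 (show 0 ≤ φ / R by positivity)
    have h3 := mul_le_mul_of_nonneg_right w6 (show 0 ≤ α * e by positivity)
    have e1 : φ / R * (1 / α * e - k * R / 2 * (α * e) +
        2 * (C * ((k * R * α ^ 2) ^ 2 * R + R * D) / α)) =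
        φ / R * (1 / α) * e - φ * k / 2 * (α * e) + 2 * C * φ * k ^ 2 * R ^ 2 * α ^ 3 +
        2 * C * φ * Y := by rw [hY]; field_simp; ring
    have e2 : φ / R * (1 / α') * e' = φ / R * (1 / α' * e') := by ring
    linarith only [h2, h3, e1, e2]
  have Tf : φ * (1 / α') * f' ≤ φ * (1 / α) * f - φ * cγ / 2 * (α * f) +
      2 * C * φ * cγ ^ 2 * α ^ 3 + 2 * C * φ * Y := by
    have h1 := hmom hcγ hf hf0 (show 0 ≤ C * ((cγ * α ^ 2) ^ 2 + D) by positivity) hf'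
    have h2 := mul_le_mul_of_nonneg_left h1 hφ.le
    have e1 : φ * (1 / α * f - cγ / 2 * (α * f) + 2 * (C * ((cγ * α ^ 2) ^ 2 + D) / α)) =
        φ * (1 / α) * f - φ * cγ / 2 * (α * f) + 2 * C * φ * cγ ^ 2 * α ^ 3 +
        2 * C * φ * Y := by rw [hY]; field_simp; ring
    linarith only [h2, e1]
  have TD : 5 * C * φ * Y ≤
      5 * C ^ 2 * φ * (X + α * s + α * N) + 5 * C ^ 2 * φ * cβ ^ 2 * (α * f + α * r) := by
    have h1 : Y ≤ C * (X + α * (s + N) + cβ ^ 2 * α * (f + r)) := by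
      rw [hY, div_le_iff₀ hα]
      refine hD.trans (le_of_eq ?_)
      rw [hX]; field_simp
    have h2 := mul_le_mul_of_nonneg_left h1 (show 0 ≤ 5 * C * φ by positivity)
    refine h2.trans (le_of_eq ?_)
    ring
  have TD2 : 5 * C ^ 2 * φ * (X + α * s + α * N) ≤ 1 / 8 * (X + α * s + α * N) :=
    mul_le_mul_of_nonneg_right w3 (by positivity)
  have Gr := mul_le_mul_of_nonneg_right w2 (show 0 ≤ α * r by positivity)
  have Gf := mul_le_mul_of_nonneg_right w7 (show 0 ≤ α * f by positivity)
  have GX : C * (α * c) ≤ C * X := mul_le_mul_of_nonneg_left hXα hC0.le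
  have hRq : 2 * C * φ * cγ ^ 2 * α ^ 3 ≤ 2 * C * φ * cγ ^ 2 * R ^ 2 * α ^ 3 := by
    have h1 : (1 : ℝ) ≤ R ^ 2 := one_le_pow₀ hR
    have h2 := le_mul_of_one_le_right (show 0 ≤ 2 * C * φ * cγ ^ 2 * α ^ 3 by positivity) h1
    linarith only [h2]
  have hs2 : 0 ≤ α * s := by positivity
  have hNα : 0 ≤ α * N := by positivity
  linarith only [Tr, Tc, Ts, Te, Tf, TD, TD2, Gr, Gf, GX, hRq, hl, hs2, hNα, hX0, hXα]

/-! ### Step-sizes and summation -/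

section Stepsize

variable {w t : ℝ}

theorem stepsize_pos (h : 0 < w + t) : 0 < stepsize w t := Real.rpow_pos_of_pos h _

theorem stepsize_anti {t' : ℝ} (h : 0 < w + t) (htt : t ≤ t') : stepsize w t' ≤ stepsize w t :=
  Real.rpow_le_rpow_of_nonpos h (by linarith) (by norm_num)

theorem stepsize_pow_three (h : 0 < w + t) : stepsize w t ^ 3 = 1 / (w + t) := by
  rw [stepsize, ← Real.rpow_natCast, ← Real.rpow_mul h.le, one_div]
  norm_num
  rw [Real.rpow_neg_one]

theorem one_div_stepsize (h : 0 < w + t) : 1 / stepsize w t = (w + t) ^ (1 / 3 : ℝ) := by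
  rw [stepsize, Real.rpow_neg h.le, one_div, inv_inv]

/-- The weights `1 / α` grow by a factor `1 + α³`, as `(1 + z)^(1/3) ≤ 1 + z`. -/
theorem one_div_stepsize_succ_le (h : 0 < w + t) :
    1 / stepsize w (t + 1) ≤ 1 / stepsize w t * (1 + stepsize w t ^ 3) := by
  rw [one_div_stepsize (by linarith), one_div_stepsize h, stepsize_pow_three h]
  have e : w + (t + 1) = (w + t) * (1 + 1 / (w + t)) := by field_simp; ring
  rw [e, Real.mul_rpow h.le (by positivity)]
  refine mul_le_mul_of_nonneg_left ?_ (by positivity)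
  have h1 : (1 : ℝ) ≤ 1 + 1 / (w + t) := by
    have : 0 < 1 / (w + t) := by positivity
    linarith
  calc (1 + 1 / (w + t)) ^ (1 / 3 : ℝ) ≤ (1 + 1 / (w + t)) ^ (1 : ℝ) :=
      Real.rpow_le_rpow_of_exponent_le h1 (by norm_num)
    _ = _ := Real.rpow_one _

theorem sum_stepsize_pow_three_le (hw : 1 ≤ w) (T : ℕ) :
    ∑ t ∈ Finset.range T, stepsize w t ^ 3 ≤ 1 + Real.log T := by
  have h := harmonic_le_one_add_log T
  refine le_trans ?_ h
  rw [harmonic]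
  push_cast
  refine Finset.sum_le_sum fun t _ => ?_
  have ht : (0 : ℝ) ≤ t := Nat.cast_nonneg t
  rw [stepsize_pow_three (by linarith), one_div]
  exact inv_anti₀ (by linarith) (by linarith)

/-- The offset `w = 1 + (R / a)³` makes all step-sizes at most `a / R`. -/
theorem stepsize_offset_le {a R : ℝ} (ha : 0 < a) (hR : 0 < R) (ht : -1 ≤ t) :
    stepsize (1 + (R / a) ^ 3) t ≤ a / R := by
  have hq : 0 < R / a := by positivity
  have h3 : 0 < (R / a) ^ 3 := by positivity
  refine (stepsize_anti (t := -1) (by linarith) ht).trans (le_of_eq ?_)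
  rw [stepsize, show 1 + (R / a) ^ 3 + -1 = (R / a) ^ 3 by ring, ← Real.rpow_natCast,
    ← Real.rpow_mul hq.le]
  norm_num
  rw [Real.rpow_neg_one, inv_div]

theorem one_div_stepsize_offset_le {a R : ℝ} (ha : 0 < a) (haR : a ≤ R) {T : ℕ} (hT : 0 < T) :
    1 / stepsize (1 + (R / a) ^ 3) T ≤ 3 * (R / a) * (T : ℝ) ^ (1 / 3 : ℝ) := by
  have hR : 0 < R := ha.trans_le haR
  have hq : 1 ≤ R / a := by rwa [one_le_div ha]
  have hT1 : (1 : ℝ) ≤ T := by exact_mod_cast hT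
  have h3 : 1 ≤ (R / a) ^ 3 := one_le_pow₀ hq
  rw [one_div_stepsize (by linarith)]
  have h1 : 1 + (R / a) ^ 3 + T ≤ (3 * (R / a)) ^ 3 * T := by nlinarith
  calc (1 + (R / a) ^ 3 + T) ^ (1 / 3 : ℝ) ≤ ((3 * (R / a)) ^ 3 * T) ^ (1 / 3 : ℝ) :=
      Real.rpow_le_rpow (by linarith) h1 (by norm_num)
    _ = _ := by
      rw [Real.mul_rpow (by positivity) (by positivity), ← Real.rpow_natCast,
        ← Real.rpow_mul (by positivity)]
      norm_num

theorem one_div_stepsize_offset_zero_le {a R : ℝ} (ha : 0 < a) (haR : a ≤ R) :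
    1 / stepsize (1 + (R / a) ^ 3) 0 ≤ 2 * (R / a) := by
  have hR : 0 < R := ha.trans_le haR
  have hq : 1 ≤ R / a := by rwa [one_le_div ha]
  have h3 : 1 ≤ (R / a) ^ 3 := one_le_pow₀ hq
  rw [one_div_stepsize (by linarith)]
  have h1 : 1 + (R / a) ^ 3 + 0 ≤ (2 * (R / a)) ^ 3 := by nlinarith
  calc (1 + (R / a) ^ 3 + 0) ^ (1 / 3 : ℝ) ≤ ((2 * (R / a)) ^ 3) ^ (1 / 3 : ℝ) :=
      Real.rpow_le_rpow (by linarith) h1 (by norm_num)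
    _ = _ := by
      rw [← Real.rpow_natCast, ← Real.rpow_mul (by positivity)]
      norm_num

end Stepsize

/-- The coupled recursions satisfied by the expected errors, with the notation of
`lyapunov_step`. -/
structure ErrorRecursions (C ρ μ cβ k cγ R bias : ℝ) (α l G N r c s e f D : ℕ → ℝ) : Prop where
  G_nonneg : ∀ t, 0 ≤ G t
  N_nonneg : ∀ t, 0 ≤ N t
  r_nonneg : ∀ t, 0 ≤ r t
  c_nonneg : ∀ t, 0 ≤ c t
  s_nonneg : ∀ t, 0 ≤ s t
  e_nonneg : ∀ t, 0 ≤ e t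
  f_nonneg : ∀ t, 0 ≤ f t
  D_nonneg : ∀ t, 0 ≤ D t
  descent : ∀ t, l (t + 1) ≤ l t - α t / 2 * G t - α t / 4 * N t +
    C * α t * (c t + r t + e t + bias)
  lower : ∀ t, r (t + 1) ≤ (1 - cβ * α t * μ / 2) * r t + C * (cβ * α t) * f t +
    C / (cβ * α t) * (c t + α t ^ 2 * (s t + N t))
  consensus : ∀ t, c (t + 1) ≤ ρ * c t + C * α t ^ 2 * s t
  tracking : ∀ t, s (t + 1) ≤ ρ * s t + C * (R * D t + (k * R * α t ^ 2) ^ 2 * (e t + R))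
  upper_momentum : ∀ t, e (t + 1) ≤ (1 - k * R * α t ^ 2) * e t +
    C * ((k * R * α t ^ 2) ^ 2 * R + R * D t)
  low_momentum : ∀ t, f (t + 1) ≤ (1 - cγ * α t ^ 2) * f t + C * ((cγ * α t ^ 2) ^ 2 + D t)
  displacement : ∀ t, D t ≤ C * (c t + α t ^ 2 * (s t + N t) + (cβ * α t) ^ 2 * (f t + r t))
  r_zero : r 0 ≤ C
  c_zero : c 0 = 0
  s_zero : s 0 ≤ C * R
  e_zero : e 0 ≤ C * R
  f_zero : f 0 ≤ C
  gap : ∀ t, l 0 - l t ≤ C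

set_option maxHeartbeats 1000000 in
/-- The averaged error after `T` steps is of order `R³ (1 + log T) T^{-2/3}`. The noise level `R` may
grow with `T`: it enters the offset of the step-sizes and the coefficient `k R`, but no constant. -/
theorem exists_average_bound {C ρ μ : ℝ} (hC : 1 ≤ C) (hρ0 : 0 < ρ) (hρ1 : ρ < 1) (hμ : 0 < μ) :
    ∃ cβ k cγ a₁ : ℝ, 0 < cβ ∧ 0 < k ∧ 0 < cγ ∧ 0 < a₁ ∧ ∀ a₀ : ℝ, 0 < a₀ → a₀ ≤ a₁ →
      ∃ Q : ℝ, 0 < Q ∧ ∀ (R : ℝ) (T : ℕ) (bias : ℝ) (l G N r c s e f D : ℕ → ℝ),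
        1 ≤ R → 0 < T → bias ≤ C / T →
        ErrorRecursions C ρ μ cβ k cγ R bias (fun t => stepsize (1 + (R / a₀) ^ 3) t)
          l G N r c s e f D →
        1 / (T : ℝ) * ∑ t ∈ Finset.range T, (G t + r t + c t) ≤
          Q * (R ^ 3 * (1 + Real.log T) * (T : ℝ) ^ (-(2 / 3) : ℝ)) := by
  obtain ⟨cβ, A, B, S, φ, k, cγ, W⟩ := exists_weights hC hρ1 hμ
  have hC0 : 0 < C := by linarith
  have hcβ := W.cβ_pos
  have hA := W.A_pos
  have hS := W.S_pos
  have hφ := W.φ_pos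
  have hk : 0 < k := by linarith [W.k_ge]
  have hcγ : 0 < cγ := by linarith [W.cγ_ge]
  refine ⟨cβ, k, cγ, min (min 1 ((1 - ρ) / 2)) (min (φ / S) (1 / (S * C * k ^ 2))), hcβ, hk, hcγ,
    ?_, fun a₀ ha₀ hle => ?_⟩
  · have : 0 < (1 - ρ) / 2 := by linarith
    positivity
  have ha1 : a₀ ≤ 1 := hle.trans ((min_le_left _ _).trans (min_le_left _ _))
  have haρ : a₀ ≤ (1 - ρ) / 2 := hle.trans ((min_le_left _ _).trans (min_le_right _ _))
  have haS : a₀ * S ≤ φ := by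
    rw [← le_div_iff₀ hS]
    exact hle.trans ((min_le_right _ _).trans (min_le_left _ _))
  have hak : a₀ * (S * C * k ^ 2) ≤ 1 := by
    rw [← le_div_iff₀ (by positivity)]
    exact hle.trans ((min_le_right _ _).trans (min_le_right _ _))
  -- `Q₀` weighs the noise in one step, `Q₁` bounds the initial value of the Lyapunov function, the
  -- bias and the noise together
  set Q₀ := φ * C * (3 * k ^ 2 + 2 * cγ ^ 2) with hQ₀
  have hQ₀0 : 0 < Q₀ := by positivity
  set Q₁ := C + A * C + S * C + φ * (2 / a₀) * C * 2 + C * C + Q₀ with hQ₁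
  have hQ₁0 : 0 < Q₁ := by positivity
  refine ⟨2 * (3 / a₀) * Q₁, by positivity, ?_⟩
  intro R T bias l G N r c s e f D hR hT hbias h
  have hR0 : 0 < R := by linarith
  have hT0 : (0 : ℝ) < T := by exact_mod_cast hT
  have hT1 : (1 : ℝ) ≤ T := by exact_mod_cast hT
  set w := 1 + (R / a₀) ^ 3 with hw
  have haR : a₀ ≤ R := ha1.trans hR
  have hw1 : 1 ≤ w := by
    have : 0 < (R / a₀) ^ 3 := by positivity
    linarith
  have hwt : ∀ t : ℕ, 0 < w + t := fun t => by positivity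
  have hα : ∀ t : ℕ, 0 < stepsize w t := fun t => stepsize_pos (hwt t)
  have hαa : ∀ t : ℕ, stepsize w t ≤ a₀ / R := fun t =>
    stepsize_offset_le ha₀ hR0 (by linarith [(Nat.cast_nonneg t : (0 : ℝ) ≤ t)])
  have hαR : ∀ t : ℕ, stepsize w t * R ≤ a₀ := fun t => by
    rw [← le_div_iff₀ hR0]; exact hαa t
  have hα1 : ∀ t : ℕ, stepsize w t ≤ 1 := fun t =>
    (hαa t).trans ((div_le_one hR0).2 haR)
  have hαa' : ∀ t : ℕ, stepsize w t ≤ a₀ := fun t =>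
    (le_mul_of_one_le_right (hα t).le hR).trans (hαR t)
  -- the Lyapunov function
  set Φ : ℕ → ℝ := fun t => l t + A * r t + B / stepsize w t * c t + S * stepsize w t * s t +
    φ / R * (1 / stepsize w t) * e t + φ * (1 / stepsize w t) * f t with hΦ
  have hstep : ∀ t : ℕ, Φ (t + 1) ≤ Φ t - stepsize w t * (G t / 2 + r t + c t) +
      C * stepsize w t * bias + Q₀ * R ^ 2 * stepsize w t ^ 3 := by
    intro t
    have hinv := one_div_stepsize_succ_le (hwt t)
    have hanti := stepsize_anti (hwt t) (by linarith : (t : ℝ) ≤ t + 1)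
    have hp3 : stepsize w t ^ 3 ≤ stepsize w t := pow_le_of_le_one (hα t).le (hα1 t) (by norm_num)
    have hS2 : S * stepsize w t ^ 2 * R ≤ φ := by
      calc S * stepsize w t ^ 2 * R = S * (stepsize w t * (stepsize w t * R)) := by ring
        _ ≤ S * (1 * a₀) := by
          refine mul_le_mul_of_nonneg_left ?_ hS.le
          exact mul_le_mul (hα1 t) (hαR t) (mul_nonneg (hα t).le hR0.le) zero_le_one
        _ ≤ φ := by linarith
    have hk4 : S * C * k ^ 2 * R ^ 2 * stepsize w t ^ 4 ≤ 1 := by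
      calc S * C * k ^ 2 * R ^ 2 * stepsize w t ^ 4 =
          S * C * k ^ 2 * ((stepsize w t * R) ^ 2 * stepsize w t ^ 2) := by ring
        _ ≤ S * C * k ^ 2 * (a₀ ^ 2 * 1) := by
          refine mul_le_mul_of_nonneg_left ?_ (by positivity)
          exact mul_le_mul (pow_le_pow_left₀ (mul_nonneg (hα t).le hR0.le) (hαR t) 2)
            (pow_le_one₀ (hα t).le (hα1 t)) (by positivity) (by positivity)
        _ ≤ S * C * k ^ 2 * a₀ := by
          refine mul_le_mul_of_nonneg_left ?_ (by positivity)
          nlinarith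
        _ ≤ 1 := by linarith
    have key := lyapunov_step (G := G t) (bias := bias) W hC hρ0 hρ1 hR (hα t) (hα1 t) hanti hinv
      (hp3.trans ((hαa' t).trans haρ)) hS2 hk4 (h.N_nonneg t) (h.r_nonneg t) (h.c_nonneg t)
      (h.s_nonneg t) (h.e_nonneg t) (h.f_nonneg t) (h.D_nonneg t) (h.c_nonneg _) (h.s_nonneg _)
      (h.e_nonneg _) (h.f_nonneg _) (h.descent t) (h.lower t) (h.consensus t) (h.tracking t)
      (h.upper_momentum t) (h.low_momentum t) (h.displacement t)
    simp only [hΦ]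
    push_cast
    exact key
  have hsum : ∀ n : ℕ, ∑ t ∈ Finset.range n, stepsize w t * (G t / 2 + r t + c t) ≤
      Φ 0 - Φ n + C * bias * ∑ t ∈ Finset.range n, stepsize w t +
        Q₀ * R ^ 2 * ∑ t ∈ Finset.range n, stepsize w t ^ 3 := by
    intro n
    induction n with
    | zero => simp
    | succ n ih =>
      rw [Finset.sum_range_succ, Finset.sum_range_succ, Finset.sum_range_succ]
      have := hstep n
      linarith
  have hΦT : l T ≤ Φ T := by
    simp only [hΦ]
    have h1 : 0 ≤ A * r T := mul_nonneg hA.le (h.r_nonneg T)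
    have h2 : 0 ≤ B / stepsize w T * c T :=
      mul_nonneg (div_nonneg W.B_pos.le (hα T).le) (h.c_nonneg T)
    have h3 : 0 ≤ S * stepsize w T * s T := mul_nonneg (mul_nonneg hS.le (hα T).le) (h.s_nonneg T)
    have h4 : 0 ≤ φ / R * (1 / stepsize w T) * e T :=
      mul_nonneg (mul_nonneg (by positivity) (one_div_nonneg.2 (hα T).le)) (h.e_nonneg T)
    have h5 : 0 ≤ φ * (1 / stepsize w T) * f T :=
      mul_nonneg (mul_nonneg hφ.le (one_div_nonneg.2 (hα T).le)) (h.f_nonneg T)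
    linarith
  have hlog : 0 ≤ Real.log T := Real.log_nonneg hT1
  have hR2 : R ≤ R ^ 2 := le_self_pow₀ hR (by norm_num)
  have hR21 : 1 ≤ R ^ 2 := one_le_pow₀ hR
  have hΦ0 : Φ 0 ≤ l 0 + (A * C + S * C + φ * (2 / a₀) * C * 2) * R ^ 2 := by
    simp only [hΦ, h.c_zero]
    have hinv0 := one_div_stepsize_offset_zero_le ha₀ haR
    rw [← hw] at hinv0
    have h0 : 0 ≤ 1 / stepsize w 0 := by
      have := hα 0
      simp only [Nat.cast_zero] at this
      positivity
    have hα0 := hα1 0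
    have hα00 := hα 0
    simp only [Nat.cast_zero] at *
    have h1 : A * r 0 ≤ A * C * R ^ 2 := by
      calc A * r 0 ≤ A * C := mul_le_mul_of_nonneg_left h.r_zero hA.le
        _ ≤ A * C * R ^ 2 := le_mul_of_one_le_right (by positivity) hR21
    have h2 : S * stepsize w 0 * s 0 ≤ S * C * R ^ 2 := by
      calc S * stepsize w 0 * s 0 ≤ S * 1 * (C * R) :=
            mul_le_mul (mul_le_mul_of_nonneg_left hα0 hS.le) h.s_zero (h.s_nonneg 0) (by positivity)
        _ = S * C * R := by ring
        _ ≤ S * C * R ^ 2 := mul_le_mul_of_nonneg_left hR2 (by positivity)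
    have h3 : φ / R * (1 / stepsize w 0) * e 0 ≤ φ * (2 / a₀) * C * R ^ 2 := by
      calc φ / R * (1 / stepsize w 0) * e 0 ≤ φ / R * (2 * (R / a₀)) * (C * R) :=
            mul_le_mul (mul_le_mul_of_nonneg_left hinv0 (by positivity)) h.e_zero (h.e_nonneg 0)
              (by positivity)
        _ = φ * (2 / a₀) * C * R := by field_simp
        _ ≤ φ * (2 / a₀) * C * R ^ 2 := mul_le_mul_of_nonneg_left hR2 (by positivity)
    have h4 : φ * (1 / stepsize w 0) * f 0 ≤ φ * (2 / a₀) * C * R ^ 2 := by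
      calc φ * (1 / stepsize w 0) * f 0 ≤ φ * (2 * (R / a₀)) * C :=
            mul_le_mul (mul_le_mul_of_nonneg_left hinv0 hφ.le) h.f_zero (h.f_nonneg 0)
              (by positivity)
        _ = φ * (2 / a₀) * C * R := by field_simp
        _ ≤ φ * (2 / a₀) * C * R ^ 2 := mul_le_mul_of_nonneg_left hR2 (by positivity)
    linarith
  have hsα : ∑ t ∈ Finset.range T, stepsize w t ≤ T := by
    calc _ ≤ ∑ t ∈ Finset.range T, (1 : ℝ) := Finset.sum_le_sum fun t _ => hα1 t
      _ = T := by simp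
  have hsα0 : 0 ≤ ∑ t ∈ Finset.range T, stepsize w t := Finset.sum_nonneg fun t _ => (hα t).le
  have hbiasT : C * bias * ∑ t ∈ Finset.range T, stepsize w t ≤ C * C := by
    calc C * bias * ∑ t ∈ Finset.range T, stepsize w t
        ≤ C * (C / T) * ∑ t ∈ Finset.range T, stepsize w t :=
          mul_le_mul_of_nonneg_right (mul_le_mul_of_nonneg_left hbias hC0.le) hsα0
      _ ≤ C * (C / T) * T := mul_le_mul_of_nonneg_left hsα (by positivity)
      _ = C * C := by field_simp
  have htotal : ∑ t ∈ Finset.range T, stepsize w t * (G t / 2 + r t + c t) ≤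
      Q₁ * (R ^ 2 * (1 + Real.log T)) := by
    have h1 := hsum T
    have h2 := sum_stepsize_pow_three_le hw1 T
    have h3 := h.gap T
    have h4 : Q₀ * R ^ 2 * ∑ t ∈ Finset.range T, stepsize w t ^ 3 ≤
      Q₀ * R ^ 2 * (1 + Real.log T) := mul_le_mul_of_nonneg_left h2 (by positivity)
    have h5 : R ^ 2 ≤ R ^ 2 * (1 + Real.log T) :=
      le_mul_of_one_le_right (by positivity) (by linarith)
    have h6 : (A * C + S * C + φ * (2 / a₀) * C * 2) * R ^ 2 ≤
      (A * C + S * C + φ * (2 / a₀) * C * 2) * (R ^ 2 * (1 + Real.log T)) :=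
      mul_le_mul_of_nonneg_left h5 (by positivity)
    have h7 : C ≤ C * (R ^ 2 * (1 + Real.log T)) :=
      le_mul_of_one_le_right hC0.le (hR21.trans h5)
    have h8 : C * C ≤ C * C * (R ^ 2 * (1 + Real.log T)) :=
      le_mul_of_one_le_right (by positivity) (hR21.trans h5)
    have e : Q₁ * (R ^ 2 * (1 + Real.log T)) = C * (R ^ 2 * (1 + Real.log T)) +
        (A * C + S * C + φ * (2 / a₀) * C * 2) * (R ^ 2 * (1 + Real.log T)) +
        C * C * (R ^ 2 * (1 + Real.log T)) + Q₀ * R ^ 2 * (1 + Real.log T) := by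
      rw [hQ₁]; ring
    rw [e]
    have h9 : Φ 0 - Φ T ≤ C + (A * C + S * C + φ * (2 / a₀) * C * 2) * R ^ 2 :=
      (sub_le_sub hΦ0 hΦT).trans (by rw [add_sub_right_comm]; exact add_le_add_left h3 _)
    exact h1.trans (add_le_add (add_le_add (h9.trans (add_le_add h7 h6)) (hbiasT.trans h8)) h4)
  -- the step-sizes are at least `stepsize w T`
  have hlower : stepsize w T * ∑ t ∈ Finset.range T, (G t + r t + c t) ≤
      2 * ∑ t ∈ Finset.range T, stepsize w t * (G t / 2 + r t + c t) := by
    rw [Finset.mul_sum, Finset.mul_sum]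
    refine Finset.sum_le_sum fun t ht => ?_
    have h1 : stepsize w T ≤ stepsize w t :=
      stepsize_anti (hwt t) (by exact_mod_cast (Finset.mem_range.1 ht).le)
    have h2 := h.G_nonneg t
    have h3 := h.r_nonneg t
    have h4 := h.c_nonneg t
    have h5 := mul_le_mul_of_nonneg_right h1 (show 0 ≤ G t + r t + c t by positivity)
    have h6 := (hα t).le
    nlinarith [mul_nonneg h6 h3, mul_nonneg h6 h4]
  have hinvT := one_div_stepsize_offset_le ha₀ haR hT
  rw [← hw] at hinvT
  have hfin : ∑ t ∈ Finset.range T, (G t + r t + c t) ≤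
      3 * (R / a₀) * (T : ℝ) ^ (1 / 3 : ℝ) * (2 * (Q₁ * (R ^ 2 * (1 + Real.log T)))) := by
    have h1 : ∑ t ∈ Finset.range T, (G t + r t + c t) ≤
        1 / stepsize w T * (2 * (Q₁ * (R ^ 2 * (1 + Real.log T)))) := by
      rw [div_mul_eq_mul_div, one_mul, le_div_iff₀ (hα T), mul_comm]
      linarith
    exact h1.trans (mul_le_mul_of_nonneg_right hinvT (by positivity))
  have hTpow : 1 / (T : ℝ) * (T : ℝ) ^ (1 / 3 : ℝ) = (T : ℝ) ^ (-(2 / 3) : ℝ) := by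
    rw [one_div, ← Real.rpow_neg_one, ← Real.rpow_add hT0]
    norm_num
  calc 1 / (T : ℝ) * ∑ t ∈ Finset.range T, (G t + r t + c t)
      ≤ 1 / (T : ℝ) * (3 * (R / a₀) * (T : ℝ) ^ (1 / 3 : ℝ) *
        (2 * (Q₁ * (R ^ 2 * (1 + Real.log T))))) := mul_le_mul_of_nonneg_left hfin (by positivity)
    _ = 2 * (3 / a₀) * Q₁ * (R ^ 3 * (1 + Real.log T) * (1 / (T : ℝ) * (T : ℝ) ^ (1 / 3 : ℝ))) := by
      ring
    _ = _ := by rw [hTpow]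

/-- The horizon: `T` of order `ε^{-3/2}`, up to logarithms, makes `Q (1 + log T)^p T^{-2/3} ≤ ε`. -/
theorem exists_horizon (Q : ℝ) (p : ℕ) : ∃ H : ℝ, 0 < H ∧ ∀ ε : ℝ, 0 < ε → ε ≤ 1 →
    ∃ T : ℕ, 0 < T ∧ Q * ((1 + Real.log T) ^ p * (T : ℝ) ^ (-(2 / 3) : ℝ)) ≤ ε ∧
      (T : ℝ) ≤ H * (ε ^ (-(3 / 2) : ℝ) * (1 + Real.log (1 / ε)) ^ (2 * p)) ∧
      1 + Real.log T ≤ H * (1 + Real.log (1 / ε)) := by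
  set b : ℝ := 2 + 2 * p + Real.log 2 with hb
  have hb0 : 0 < b := by
    have := Real.log_pos (by norm_num : (1 : ℝ) < 2)
    positivity
  -- `x` with `Q (b + 2 log x)^p ≤ x`, found in the form `x = exp(-b/2) y`
  obtain ⟨x, hx1, hx⟩ : ∃ x : ℝ, 1 ≤ x ∧ |Q| * (b + 2 * Real.log x) ^ p ≤ x := by
    have h1 := (Real.isLittleO_pow_log_id_atTop (n := p)).bound
      (show 0 < Real.exp (-(b / 2)) / ((|Q| + 1) * 2 ^ p) by positivity)
    obtain ⟨y, hy, hyb⟩ := (h1.and (eventually_ge_atTop (Real.exp (b / 2)))).exists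
    have hy0 : 0 < y := (Real.exp_pos _).trans_le hyb
    have hlogy : b / 2 ≤ Real.log y := by rwa [Real.le_log_iff_exp_le hy0]
    refine ⟨Real.exp (-(b / 2)) * y, ?_, ?_⟩
    · calc (1 : ℝ) = Real.exp (-(b / 2)) * Real.exp (b / 2) := by rw [← Real.exp_add]; simp
        _ ≤ _ := mul_le_mul_of_nonneg_left hyb (Real.exp_pos _).le
    · rw [Real.log_mul (Real.exp_pos _).ne' hy0.ne', Real.log_exp]
      have e1 : b + 2 * (-(b / 2) + Real.log y) = 2 * Real.log y := by ring
      rw [e1, mul_pow]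
      rw [Real.norm_eq_abs, Real.norm_eq_abs, id, abs_of_pos hy0,
        abs_of_nonneg (pow_nonneg (by linarith) p)] at hy
      have h2 := mul_le_mul_of_nonneg_left hy (show 0 ≤ (|Q| + 1) * 2 ^ p by positivity)
      have e2 : (|Q| + 1) * 2 ^ p * (Real.exp (-(b / 2)) / ((|Q| + 1) * 2 ^ p) * y) =
        Real.exp (-(b / 2)) * y := by field_simp
      have h3 : 0 ≤ 2 ^ p * Real.log y ^ p := mul_nonneg (by positivity)
        (pow_nonneg (by linarith) p)
      nlinarith
  have hx0 : 0 < x := by linarith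
  have hlogx : 0 ≤ Real.log x := Real.log_nonneg hx1
  refine ⟨max (2 * x ^ 2) (b + 2 * Real.log x), lt_max_of_lt_left (by positivity), ?_⟩
  intro ε hε hε1
  set L := 1 + Real.log (1 / ε) with hL
  have hL1 : 1 ≤ L := by
    have : 0 ≤ Real.log (1 / ε) := Real.log_nonneg (by rwa [one_le_div hε])
    linarith
  have hL0 : 0 < L := by linarith
  set Y := x ^ 2 * (ε ^ (-(3 / 2) : ℝ) * L ^ (2 * p)) with hY
  have hε32 : 1 ≤ ε ^ (-(3 / 2) : ℝ) := Real.one_le_rpow_of_pos_of_le_one_of_nonpos hε hε1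
    (by norm_num)
  have hY1 : 1 ≤ Y := by
    have h1 : 1 ≤ x ^ 2 := one_le_pow₀ hx1
    have h2 : 1 ≤ L ^ (2 * p) := one_le_pow₀ hL1
    have h3 := one_le_mul_of_one_le_of_one_le hε32 h2
    exact one_le_mul_of_one_le_of_one_le h1 h3
  have hTY : Y ≤ (⌈Y⌉₊ : ℝ) := Nat.le_ceil Y
  have hT2 : (⌈Y⌉₊ : ℝ) ≤ 2 * Y := by
    have := (Nat.ceil_lt_add_one (by linarith : 0 ≤ Y)).le
    linarith
  have hT0 : 0 < ⌈Y⌉₊ := Nat.ceil_pos.2 (by linarith)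
  have hT0' : (0 : ℝ) < ⌈Y⌉₊ := by exact_mod_cast hT0
  have hlog : 1 + Real.log ⌈Y⌉₊ ≤ (b + 2 * Real.log x) * L := by
    have h1 : Real.log ⌈Y⌉₊ ≤ Real.log (2 * Y) := Real.log_le_log hT0' hT2
    have h2 : Real.log (2 * Y) = Real.log 2 + (2 * Real.log x + (-(3 / 2) * Real.log ε +
        2 * p * Real.log L)) := by
      rw [hY, Real.log_mul (by norm_num) (by positivity), Real.log_mul (by positivity)
        (by positivity), Real.log_mul (by positivity) (by positivity), Real.log_pow,
        Real.log_rpow hε, Real.log_pow]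
      push_cast
      ring
    have h3 : -Real.log ε = L - 1 := by rw [hL, one_div, Real.log_inv]; ring
    have h4 : Real.log L ≤ L - 1 := Real.log_le_sub_one_of_pos hL0
    have h5 : 2 * (p : ℝ) * Real.log L ≤ 2 * p * L :=
      mul_le_mul_of_nonneg_left (by linarith) (by positivity)
    have h6 : Real.log 2 ≤ Real.log 2 * L :=
      le_mul_of_one_le_right (Real.log_nonneg (by norm_num)) hL1
    have h7 : 2 * Real.log x ≤ 2 * Real.log x * L := le_mul_of_one_le_right (by positivity) hL1
    rw [hb]
    linarith
  refine ⟨⌈Y⌉₊, hT0, ?_, ?_, ?_⟩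
  · have hTp : (⌈Y⌉₊ : ℝ) ^ (-(2 / 3) : ℝ) ≤ ε / (x * L ^ p) := by
      calc (⌈Y⌉₊ : ℝ) ^ (-(2 / 3) : ℝ) ≤ Y ^ (-(2 / 3) : ℝ) :=
            Real.rpow_le_rpow_of_nonpos (by linarith) hTY (by norm_num)
        _ ≤ (x ^ (3 / 2 : ℝ) * (ε ^ (-(3 / 2) : ℝ) * (L ^ p) ^ (3 / 2 : ℝ))) ^ (-(2 / 3) : ℝ) := by
          refine Real.rpow_le_rpow_of_nonpos (by positivity) ?_ (by norm_num)
          rw [hY, mul_comm 2 p, pow_mul, ← Real.rpow_natCast x 2, ← Real.rpow_natCast (L ^ p) 2]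
          have h1 : x ^ (3 / 2 : ℝ) ≤ x ^ ((2 : ℕ) : ℝ) :=
            Real.rpow_le_rpow_of_exponent_le hx1 (by norm_num)
          have h2 : (L ^ p) ^ (3 / 2 : ℝ) ≤ (L ^ p) ^ ((2 : ℕ) : ℝ) :=
            Real.rpow_le_rpow_of_exponent_le (one_le_pow₀ hL1) (by norm_num)
          gcongr
        _ = ε / (x * L ^ p) := by
          rw [Real.mul_rpow (by positivity) (by positivity), Real.mul_rpow (by positivity)
            (by positivity), ← Real.rpow_mul hx0.le, ← Real.rpow_mul hε.le,
            ← Real.rpow_mul (by positivity)]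
          norm_num
          rw [Real.rpow_neg_one, Real.rpow_neg_one]
          field_simp
    have hlog0 : 0 ≤ 1 + Real.log ⌈Y⌉₊ := by
      have : 0 ≤ Real.log ⌈Y⌉₊ := Real.log_nonneg (by exact_mod_cast hT0)
      linarith
    calc Q * ((1 + Real.log ⌈Y⌉₊) ^ p * (⌈Y⌉₊ : ℝ) ^ (-(2 / 3) : ℝ))
        ≤ |Q| * ((1 + Real.log ⌈Y⌉₊) ^ p * (⌈Y⌉₊ : ℝ) ^ (-(2 / 3) : ℝ)) :=
          mul_le_mul_of_nonneg_right (le_abs_self Q) (by positivity)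
      _ ≤ |Q| * (((b + 2 * Real.log x) * L) ^ p * (ε / (x * L ^ p))) := by
          gcongr
      _ = |Q| * (b + 2 * Real.log x) ^ p * (ε / x) := by
          rw [mul_pow]; field_simp
      _ ≤ x * (ε / x) := mul_le_mul_of_nonneg_right hx (by positivity)
      _ = ε := by field_simp
  · calc (⌈Y⌉₊ : ℝ) ≤ 2 * Y := hT2
      _ = 2 * x ^ 2 * (ε ^ (-(3 / 2) : ℝ) * L ^ (2 * p)) := by rw [hY]; ring
      _ ≤ _ := mul_le_mul_of_nonneg_right (le_max_left _ _) (by positivity)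
  · exact hlog.trans (mul_le_mul_of_nonneg_right (le_max_right _ _) hL0.le)

/-! ### The recursive momentum estimator -/

section Independence

variable {Ω 𝒰 𝒮 : Type*} [MeasurableSpace Ω] [MeasurableSpace 𝒰] [MeasurableSpace 𝒮]
  {ν : Measure Ω} [IsProbabilityMeasure ν] {μ : Measure 𝒮} [IsProbabilityMeasure μ] {d : ℕ}
  {U : Ω → 𝒰} {V : Ω → 𝒮} {φ : 𝒰 → 𝒮 → E d}

theorem integrable_inner_of_memLp {Ω : Type*} [MeasurableSpace Ω] {ν : Measure Ω} {d : ℕ}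
    {f g : Ω → E d} (hf : MemLp f 2 ν) (hg : MemLp g 2 ν) :
    Integrable (fun ω => ⟪f ω, g ω⟫) ν := by
  have hf2 := hf.integrable_norm_pow (by norm_num : (2 : ℕ) ≠ 0)
  have hg2 := hg.integrable_norm_pow (by norm_num : (2 : ℕ) ≠ 0)
  refine (hf2.add hg2).mono' (hf.1.inner hg.1) (ae_of_all _ fun ω => ?_)
  have h1 := norm_inner_le_norm (𝕜 := ℝ) (f ω) (g ω)
  simp only [Pi.add_apply]
  nlinarith [sq_nonneg (‖f ω‖ - ‖g ω‖), sq_nonneg (‖f ω‖), sq_nonneg (‖g ω‖)]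

theorem integrable_norm_sub_sq {Ω : Type*} [MeasurableSpace Ω] {ν : Measure Ω} {d : ℕ}
    {x x' : Ω → E d} (hx : MemLp x 2 ν) (hx' : MemLp x' 2 ν) :
    Integrable (fun ω => ‖x' ω - x ω‖ ^ 2) ν :=
  (hx'.sub hx).integrable_norm_pow (by norm_num : (2 : ℕ) ≠ 0)

/-- Freezing: a conditional second moment bound, given the value of `U`, integrates up when `V` is
independent of `U`. -/
theorem memLp_of_indep (hU : Measurable U) (hV : Measurable V) (hμ : ν.map V = μ)
    (hUV : IndepFun U V ν) (hφ : Measurable fun q : 𝒰 × 𝒮 => φ q.1 q.2) {B : 𝒰 → ℝ}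
    (hB : Integrable (fun ω => B (U ω)) ν) (hBm : Measurable B)
    (hφ2 : ∀ u, MemLp (φ u) 2 μ) (hle : ∀ u, ∫ s, ‖φ u s‖ ^ 2 ∂μ ≤ B u) :
    MemLp (fun ω => φ (U ω) (V ω)) 2 ν ∧ ∫ ω, ‖φ (U ω) (V ω)‖ ^ 2 ∂ν ≤ ∫ ω, B (U ω) ∂ν := by
  have hB0 : ∀ u, 0 ≤ B u := fun u => le_trans (integral_nonneg fun s => sq_nonneg _) (hle u)
  have hmap := hUV.map_prod_eq_prod_map_map hU.aemeasurable hV.aemeasurable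
  rw [hμ] at hmap
  have hsq : Measurable fun q : 𝒰 × 𝒮 => ‖φ q.1 q.2‖ₑ ^ 2 := hφ.enorm.pow_const 2
  have : IsProbabilityMeasure (ν.map U) := Measure.isProbabilityMeasure_map hU.aemeasurable
  refine memLp_two_of_lintegral_le (hφ.comp (hU.prodMk hV)).aestronglyMeasurable
    (integral_nonneg fun ω => hB0 _) ?_
  calc ∫⁻ ω, ‖φ (U ω) (V ω)‖ₑ ^ 2 ∂ν
      = ∫⁻ q, ‖φ q.1 q.2‖ₑ ^ 2 ∂(ν.map fun ω => (U ω, V ω)) :=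
        (lintegral_map hsq (hU.prodMk hV)).symm
    _ = ∫⁻ u, ∫⁻ s, ‖φ u s‖ₑ ^ 2 ∂μ ∂(ν.map U) := by
        rw [hmap, lintegral_prod _ hsq.aemeasurable]
    _ ≤ ∫⁻ u, ENNReal.ofReal (B u) ∂(ν.map U) := by
        refine lintegral_mono fun u => ?_
        refine le_trans (le_of_eq ?_) (ENNReal.ofReal_le_ofReal (hle u))
        rw [ofReal_integral_eq_lintegral_ofReal
          ((hφ2 u).integrable_norm_pow (by norm_num : (2 : ℕ) ≠ 0))
          (ae_of_all _ fun s => sq_nonneg _)]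
        refine lintegral_congr fun s => ?_
        rw [← ofReal_norm, ENNReal.ofReal_pow (norm_nonneg _)]
    _ = ∫⁻ ω, ENNReal.ofReal (B (U ω)) ∂ν := lintegral_map hBm.ennreal_ofReal hU
    _ = ENNReal.ofReal (∫ ω, B (U ω) ∂ν) :=
        (ofReal_integral_eq_lintegral_ofReal hB (ae_of_all _ fun ω => hB0 _)).symm

/-- Noise that is centred given `U` is orthogonal in `L²` to functions of `U`. -/
theorem integral_norm_add_sq_of_indep (hU : Measurable U) (hV : Measurable V) (hμ : ν.map V = μ)
    (hUV : IndepFun U V ν) (hφ : Measurable fun q : 𝒰 × 𝒮 => φ q.1 q.2)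
    (hφL : MemLp (fun ω => φ (U ω) (V ω)) 2 ν) (hφ1 : ∀ u, Integrable (φ u) μ)
    (hφ0 : ∀ u, ∫ s, φ u s ∂μ = 0) {A : 𝒰 → E d} (hA : Measurable A)
    (hAL : MemLp (fun ω => A (U ω)) 2 ν) :
    ∫ ω, ‖A (U ω) + φ (U ω) (V ω)‖ ^ 2 ∂ν =
      ∫ ω, ‖A (U ω)‖ ^ 2 ∂ν + ∫ ω, ‖φ (U ω) (V ω)‖ ^ 2 ∂ν := by
  have hmap := hUV.map_prod_eq_prod_map_map hU.aemeasurable hV.aemeasurable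
  rw [hμ] at hmap
  have : IsProbabilityMeasure (ν.map U) := Measure.isProbabilityMeasure_map hU.aemeasurable
  have hi := integrable_inner_of_memLp hAL hφL
  have hmeas : Measurable fun q : 𝒰 × 𝒮 => ⟪A q.1, φ q.1 q.2⟫ :=
    (hA.comp measurable_fst).inner hφ
  have hcross : ∫ ω, ⟪A (U ω), φ (U ω) (V ω)⟫ ∂ν = 0 := by
    have h1 : ∫ ω, ⟪A (U ω), φ (U ω) (V ω)⟫ ∂ν =
        ∫ q, ⟪A q.1, φ q.1 q.2⟫ ∂(ν.map fun ω => (U ω, V ω)) :=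
      (integral_map (hU.prodMk hV).aemeasurable hmeas.aestronglyMeasurable).symm
    have hi' : Integrable (fun q : 𝒰 × 𝒮 => ⟪A q.1, φ q.1 q.2⟫) ((ν.map U).prod μ) := by
      rw [← hmap, integrable_map_measure hmeas.aestronglyMeasurable (hU.prodMk hV).aemeasurable]
      exact hi
    rw [h1, hmap, integral_prod _ hi']
    refine integral_eq_zero_of_ae (ae_of_all _ fun u => ?_)
    simp only [Pi.zero_apply]
    rw [integral_inner (hφ1 u), hφ0 u, inner_zero_right]
  have hA2 := hAL.integrable_norm_pow (by norm_num : (2 : ℕ) ≠ 0)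
  have hφ2 := hφL.integrable_norm_pow (by norm_num : (2 : ℕ) ≠ 0)
  have e : ∀ ω, ‖A (U ω) + φ (U ω) (V ω)‖ ^ 2 =
      (‖A (U ω)‖ ^ 2 + ‖φ (U ω) (V ω)‖ ^ 2) + 2 * ⟪A (U ω), φ (U ω) (V ω)⟫ := fun ω => by
    rw [norm_add_sq_real]; ring
  simp_rw [e]
  have hs : Integrable (fun ω => ‖A (U ω)‖ ^ 2 + ‖φ (U ω) (V ω)‖ ^ 2) ν := hA2.add hφ2
  rw [integral_add hs (hi.const_mul 2), integral_const_mul, hcross, integral_add hA2 hφ2]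
  ring

end Independence

section Oracle

variable {a b d : ℕ} {𝒮 Ω : Type*} [MeasurableSpace 𝒮] [MeasurableSpace Ω] {ν : Measure Ω}
  [IsProbabilityMeasure ν] {μ : Measure 𝒮} [IsProbabilityMeasure μ] {H : E a → E b → 𝒮 → E d}
  {h : E a → E b → E d} {L σ : ℝ}

theorem Oracle.lipschitz_mean (o : Oracle μ H h L σ) (x : E a) (y : E b) (x' : E a) (y' : E b) :
    ‖h x y - h x' y'‖ ^ 2 ≤ L * (‖x - x'‖ ^ 2 + ‖y - y'‖ ^ 2) := by
  obtain ⟨s₀⟩ : Nonempty 𝒮 := nonempty_of_isProbabilityMeasure μ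
  have h0 := le_trans (sq_nonneg _) (o.lipschitz s₀ x y x' y')
  have h1 := norm_integral_le_of_norm_le_const (μ := μ) (f := fun s => H x y s - H x' y' s)
    (ae_of_all _ fun s => Real.le_sqrt_of_sq_le (o.lipschitz s x y x' y'))
  rw [probReal_univ, mul_one, integral_sub (o.integrable x y) (o.integrable x' y'), o.mean,
    o.mean] at h1
  calc _ ≤ _ := pow_le_pow_left₀ (norm_nonneg _) h1 2
    _ = _ := Real.sq_sqrt h0

theorem Oracle.measurable_mean (o : Oracle μ H h L σ) :
    Measurable fun z : E a × E b => h z.1 z.2 := by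
  have h1 : StronglyMeasurable fun z : E a × E b => ∫ s, H z.1 z.2 s ∂μ :=
    o.measurable.stronglyMeasurable.integral_prod_right
  simpa only [o.mean] using h1.measurable

theorem Oracle.memLp_mean_comp (o : Oracle μ H h L σ) {x : Ω → E a} {y : Ω → E b}
    (hx : MemLp x 2 ν) (hy : MemLp y 2 ν) (hxm : Measurable x) (hym : Measurable y) :
    MemLp (fun ω => h (x ω) (y ω)) 2 ν := by
  have hb : MemLp (fun ω => ‖h 0 0‖ + Real.sqrt |L| * (‖x ω‖ + ‖y ω‖)) 2 ν :=
    have h1 : MemLp (fun _ : Ω => ‖h 0 0‖) 2 ν := memLp_const _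
    have h2 : MemLp (fun ω => ‖x ω‖ + ‖y ω‖) 2 ν := hx.norm.add hy.norm
    h1.add (h2.const_mul _)
  refine hb.of_le (o.measurable_mean.comp (hxm.prodMk hym)).aestronglyMeasurable
    (ae_of_all _ fun ω => ?_)
  have h1 : ‖h (x ω) (y ω) - h 0 0‖ ≤ Real.sqrt |L| * (‖x ω‖ + ‖y ω‖) := by
    refine (pow_le_pow_iff_left₀ (norm_nonneg _) (by positivity) two_ne_zero).1 ?_
    refine (o.lipschitz_mean _ _ _ _).trans ?_
    rw [mul_pow, Real.sq_sqrt (abs_nonneg L), sub_zero, sub_zero]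
    refine mul_le_mul (le_abs_self L) ?_ (by positivity) (abs_nonneg L)
    nlinarith [mul_nonneg (norm_nonneg (x ω)) (norm_nonneg (y ω))]
  rw [Real.norm_of_nonneg (by positivity)]
  have := norm_le_norm_add_norm_sub' (h (x ω) (y ω)) (h 0 0)
  linarith

/-- The increment of the oracle between two points, centred and damped as in the momentum
estimator. -/
theorem Oracle.momentum_noise (o : Oracle μ H h L σ) {η : ℝ} (hη : η ∈ Set.Icc (0 : ℝ) 1)
    (x : E a) (y : E b) (x' : E a) (y' : E b) :
    MemLp (fun s => (H x' y' s - h x' y') - (1 - η) • (H x y s - h x y)) 2 μ ∧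
    ∫ s, ((H x' y' s - h x' y') - (1 - η) • (H x y s - h x y)) ∂μ = 0 ∧
    ∫ s, ‖(H x' y' s - h x' y') - (1 - η) • (H x y s - h x y)‖ ^ 2 ∂μ ≤
      2 * η ^ 2 * σ + 8 * L * (‖x' - x‖ ^ 2 + ‖y' - y‖ ^ 2) := by
  have hη1 : 0 ≤ 1 - η := by linarith [hη.2]
  have hL : MemLp (fun s => (H x' y' s - h x' y') - (1 - η) • (H x y s - h x y)) 2 μ :=
    (o.memLp _ _).sub ((o.memLp _ _).const_smul (1 - η))
  refine ⟨hL, ?_, ?_⟩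
  · have hi : ∀ x y, Integrable (fun s => H x y s - h x y) μ := fun x y =>
      (o.memLp x y).integrable (by norm_num)
    have h0 : ∀ x y, ∫ s, (H x y s - h x y) ∂μ = 0 := fun x y => by
      rw [integral_sub (o.integrable x y) (integrable_const _), o.mean, integral_const,
        probReal_univ, one_smul, sub_self]
    have hi2 : Integrable (fun s => (1 - η) • (H x y s - h x y)) μ := (hi _ _).smul (1 - η)
    rw [integral_sub (hi _ _) hi2, integral_smul, h0, h0, smul_zero, sub_self]
  · set D := ‖x' - x‖ ^ 2 + ‖y' - y‖ ^ 2 with hD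
    have hb : ∀ s, ‖(H x' y' s - h x' y') - (1 - η) • (H x y s - h x y)‖ ^ 2 ≤
        2 * η ^ 2 * ‖H x' y' s - h x' y'‖ ^ 2 + 8 * L * D := by
      intro s
      have e : (H x' y' s - h x' y') - (1 - η) • (H x y s - h x y) =
          η • (H x' y' s - h x' y') +
          (1 - η) • ((H x' y' s - H x y s) - (h x' y' - h x y)) := by module
      have h1 := o.lipschitz s x' y' x y
      have h2 := o.lipschitz_mean x' y' x y
      rw [← hD] at h1 h2
      rw [e]
      generalize H x' y' s - h x' y' = A
      generalize H x' y' s - H x y s = B₁ at h1 ⊢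
      generalize h x' y' - h x y = B₂ at h2 ⊢
      have h3 : ‖B₁ - B₂‖ ^ 2 ≤ 4 * (L * D) := by
        have := norm_sub_le B₁ B₂
        have h5 := pow_le_pow_left₀ (norm_nonneg _) this 2
        nlinarith [sq_nonneg (‖B₁‖ - ‖B₂‖)]
      have h4 : ‖η • A + (1 - η) • (B₁ - B₂)‖ ≤ η * ‖A‖ + 1 * ‖B₁ - B₂‖ := by
        refine (norm_add_le _ _).trans (add_le_add ?_ ?_)
        · rw [norm_smul, Real.norm_of_nonneg hη.1]
        · rw [norm_smul, Real.norm_of_nonneg hη1]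
          exact mul_le_mul_of_nonneg_right (by linarith [hη.1]) (norm_nonneg _)
      have h5 := pow_le_pow_left₀ (norm_nonneg _) h4 2
      nlinarith [sq_nonneg (η * ‖A‖ - ‖B₁ - B₂‖)]
    have hi := (o.memLp x' y').integrable_norm_pow (by norm_num : (2 : ℕ) ≠ 0)
    calc _ ≤ ∫ s, (2 * η ^ 2 * ‖H x' y' s - h x' y'‖ ^ 2 + 8 * L * D) ∂μ :=
          integral_mono (hL.integrable_norm_pow (by norm_num : (2 : ℕ) ≠ 0))
            ((hi.const_mul _).add (integrable_const _)) hb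
      _ = 2 * η ^ 2 * (∫ s, ‖H x' y' s - h x' y'‖ ^ 2 ∂μ) + 8 * L * D := by
          rw [integral_add (hi.const_mul _) (integrable_const _), integral_const_mul,
            integral_const, probReal_univ, one_smul]
      _ ≤ _ := by
          have := mul_le_mul_of_nonneg_left (o.variance x' y') (show 0 ≤ 2 * η ^ 2 by positivity)
          linarith

section MomentumStep

variable {η : ℝ} {x x' : Ω → E a} {y y' : Ω → E b} {p : Ω → E d} {V : Ω → 𝒮}

theorem Oracle.memLp_noise (o : Oracle μ H h L σ) (hxm : Measurable x) (hym : Measurable y)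
    (hV : Measurable V) (hμ : ν.map V = μ) (hind : IndepFun (fun ω => (x ω, y ω)) V ν) :
    MemLp (fun ω => H (x ω) (y ω) (V ω) - h (x ω) (y ω)) 2 ν ∧
      ∫ ω, ‖H (x ω) (y ω) (V ω) - h (x ω) (y ω)‖ ^ 2 ∂ν ≤ σ := by
  have h1 := memLp_of_indep (φ := fun (u : E a × E b) s => H u.1 u.2 s - h u.1 u.2)
    (hxm.prodMk hym) hV hμ hind (o.measurable.sub (o.measurable_mean.comp measurable_fst))
    (B := fun _ => σ) (integrable_const _) measurable_const
    (fun u => o.memLp _ _) (fun u => o.variance _ _)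
  rwa [integral_const, probReal_univ, one_smul] at h1

/-- One step of the momentum estimator `p⁺ = H(x', y'; s) + (1 - η) (p - H(x, y; s))` with a fresh
sample `s`: the error contracts, up to the variance of the oracle and the displacement of the
point. -/
theorem Oracle.momentum_step (o : Oracle μ H h L σ) (hη : η ∈ Set.Icc (0 : ℝ) 1)
    (hx : MemLp x 2 ν) (hy : MemLp y 2 ν) (hx' : MemLp x' 2 ν) (hy' : MemLp y' 2 ν)
    (hp : MemLp p 2 ν) (hxm : Measurable x) (hym : Measurable y) (hxm' : Measurable x')
    (hym' : Measurable y') (hpm : Measurable p) (hV : Measurable V) (hμ : ν.map V = μ)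
    (hind : IndepFun (fun ω => ((x ω, y ω), (x' ω, y' ω), p ω)) V ν) :
    MemLp (fun ω => H (x' ω) (y' ω) (V ω) + (1 - η) • (p ω - H (x ω) (y ω) (V ω))) 2 ν ∧
    ∫ ω, ‖H (x' ω) (y' ω) (V ω) + (1 - η) • (p ω - H (x ω) (y ω) (V ω)) -
      h (x' ω) (y' ω)‖ ^ 2 ∂ν ≤ (1 - η) * ∫ ω, ‖p ω - h (x ω) (y ω)‖ ^ 2 ∂ν +
      (2 * η ^ 2 * σ + 8 * L * ∫ ω, (‖x' ω - x ω‖ ^ 2 + ‖y' ω - y ω‖ ^ 2) ∂ν) := by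
  have hη1 : 0 ≤ 1 - η := by linarith [hη.2]
  have hUm : Measurable fun ω => ((x ω, y ω), (x' ω, y' ω), p ω) :=
    (hxm.prodMk hym).prodMk ((hxm'.prodMk hym').prodMk hpm)
  have hhm := o.measurable_mean
  have hDi : Integrable (fun ω => ‖x' ω - x ω‖ ^ 2 + ‖y' ω - y ω‖ ^ 2) ν :=
    (integrable_norm_sub_sq hx hx').add (integrable_norm_sub_sq hy hy')
  have hφm : Measurable fun q : ((E a × E b) × (E a × E b) × E d) × 𝒮 =>
      (H q.1.2.1.1 q.1.2.1.2 q.2 - h q.1.2.1.1 q.1.2.1.2) -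
        (1 - η) • (H q.1.1.1 q.1.1.2 q.2 - h q.1.1.1 q.1.1.2) :=
    ((o.measurable.comp (measurable_fst.snd.fst.prodMk measurable_snd)).sub
      (hhm.comp measurable_fst.snd.fst)).sub
      (((o.measurable.comp (measurable_fst.fst.prodMk measurable_snd)).sub
        (hhm.comp measurable_fst.fst)).const_smul (1 - η))
  have hDm : Measurable fun u : (E a × E b) × (E a × E b) × E d =>
      2 * η ^ 2 * σ + 8 * L * (‖u.2.1.1 - u.1.1‖ ^ 2 + ‖u.2.1.2 - u.1.2‖ ^ 2) := by
    fun_prop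
  have hBi : Integrable (fun ω => 2 * η ^ 2 * σ +
      8 * L * (‖x' ω - x ω‖ ^ 2 + ‖y' ω - y ω‖ ^ 2)) ν :=
    (integrable_const _).add (hDi.const_mul _)
  obtain ⟨hφ, hφle⟩ := memLp_of_indep
    (φ := fun u s => (H u.2.1.1 u.2.1.2 s - h u.2.1.1 u.2.1.2) -
      (1 - η) • (H u.1.1 u.1.2 s - h u.1.1 u.1.2)) hUm hV hμ hind hφm
    (B := fun u => 2 * η ^ 2 * σ + 8 * L * (‖u.2.1.1 - u.1.1‖ ^ 2 + ‖u.2.1.2 - u.1.2‖ ^ 2))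
    hBi hDm (fun u => (o.momentum_noise hη _ _ _ _).1)
    (fun u => (o.momentum_noise hη _ _ _ _).2.2)
  rw [integral_add (integrable_const _) (hDi.const_mul _), integral_const_mul (8 * L),
    integral_const, probReal_univ, one_smul] at hφle
  have hperr : MemLp (fun ω => (1 - η) • (p ω - h (x ω) (y ω))) 2 ν :=
    have h0 : MemLp (fun ω => p ω - h (x ω) (y ω)) 2 ν := hp.sub (o.memLp_mean_comp hx hy hxm hym)
    h0.const_smul (1 - η)
  have hAm : Measurable fun u : (E a × E b) × (E a × E b) × E d =>
      (1 - η) • (u.2.2 - h u.1.1 u.1.2) :=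
    (measurable_snd.snd.sub (hhm.comp measurable_fst)).const_smul (1 - η)
  have hφ1 : ∀ u : (E a × E b) × (E a × E b) × E d,
      Integrable (fun s => (H u.2.1.1 u.2.1.2 s - h u.2.1.1 u.2.1.2) -
        (1 - η) • (H u.1.1 u.1.2 s - h u.1.1 u.1.2)) μ := fun u =>
    ((o.momentum_noise hη u.1.1 u.1.2 u.2.1.1 u.2.1.2).1).integrable (by norm_num)
  have hφ0 : ∀ u : (E a × E b) × (E a × E b) × E d,
      ∫ s, ((H u.2.1.1 u.2.1.2 s - h u.2.1.1 u.2.1.2) -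
        (1 - η) • (H u.1.1 u.1.2 s - h u.1.1 u.1.2)) ∂μ = 0 := fun u =>
    (o.momentum_noise hη u.1.1 u.1.2 u.2.1.1 u.2.1.2).2.1
  have hsum := integral_norm_add_sq_of_indep hUm hV hμ hind hφm hφ hφ1 hφ0 hAm hperr
  -- the damped old error is a function of the past; the rest is noise that is centred given the past
  have hdec : ∀ ω, H (x' ω) (y' ω) (V ω) + (1 - η) • (p ω - H (x ω) (y ω) (V ω)) -
      h (x' ω) (y' ω) = (1 - η) • (p ω - h (x ω) (y ω)) +
        ((H (x' ω) (y' ω) (V ω) - h (x' ω) (y' ω)) -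
          (1 - η) • (H (x ω) (y ω) (V ω) - h (x ω) (y ω))) := fun ω => by module
  refine ⟨?_, ?_⟩
  · have e : (fun ω => H (x' ω) (y' ω) (V ω) + (1 - η) • (p ω - H (x ω) (y ω) (V ω))) =
        fun ω => (1 - η) • (p ω - h (x ω) (y ω)) +
          ((H (x' ω) (y' ω) (V ω) - h (x' ω) (y' ω)) -
          (1 - η) • (H (x ω) (y ω) (V ω) - h (x ω) (y ω))) + h (x' ω) (y' ω) := by
      funext ω
      rw [← hdec ω, sub_add_cancel]
    rw [e]
    exact (hperr.add hφ).add (o.memLp_mean_comp hx' hy' hxm' hym')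
  · simp_rw [hdec]
    rw [hsum]
    refine add_le_add ?_ hφle
    simp only [norm_smul, mul_pow, Real.norm_of_nonneg hη1]
    rw [integral_const_mul]
    refine mul_le_mul_of_nonneg_right ?_ (integral_nonneg fun ω => sq_nonneg _)
    nlinarith [hη.1]

/-- The increment `p⁺ - p` of the momentum estimator is small even though `p` is not: it consists of
the increment of the oracle at one sample and of `η` times the error of `p` and of the oracle. -/
theorem Oracle.momentum_increment_le (o : Oracle μ H h L σ) (hη : η ∈ Set.Icc (0 : ℝ) 1)
    (hx : MemLp x 2 ν) (hy : MemLp y 2 ν) (hx' : MemLp x' 2 ν) (hy' : MemLp y' 2 ν)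
    (hp : MemLp p 2 ν) (hxm : Measurable x) (hym : Measurable y) (hxm' : Measurable x')
    (hym' : Measurable y') (hpm : Measurable p) (hV : Measurable V) (hμ : ν.map V = μ)
    (hind : IndepFun (fun ω => ((x ω, y ω), (x' ω, y' ω), p ω)) V ν) :
    ∫ ω, ‖H (x' ω) (y' ω) (V ω) + (1 - η) • (p ω - H (x ω) (y ω) (V ω)) - p ω‖ ^ 2 ∂ν ≤
      2 * L * ∫ ω, (‖x' ω - x ω‖ ^ 2 + ‖y' ω - y ω‖ ^ 2) ∂ν +
      4 * η ^ 2 * (∫ ω, ‖p ω - h (x ω) (y ω)‖ ^ 2 ∂ν + σ) := by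
  have hpL := (o.momentum_step hη hx hy hx' hy' hp hxm hym hxm' hym' hpm hV hμ hind).1
  have hDi : Integrable (fun ω => ‖x' ω - x ω‖ ^ 2 + ‖y' ω - y ω‖ ^ 2) ν :=
    (integrable_norm_sub_sq hx hx').add (integrable_norm_sub_sq hy hy')
  obtain ⟨hN, hNle⟩ := o.memLp_noise hxm hym hV hμ (hind.comp measurable_fst measurable_id)
  have hNi := hN.integrable_norm_pow (by norm_num : (2 : ℕ) ≠ 0)
  have hpe := (hp.sub (o.memLp_mean_comp hx hy hxm hym)).integrable_norm_pow
    (by norm_num : (2 : ℕ) ≠ 0)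
  simp only [Pi.sub_apply] at hpe
  have hs : Integrable (fun ω => ‖p ω - h (x ω) (y ω)‖ ^ 2 +
      ‖H (x ω) (y ω) (V ω) - h (x ω) (y ω)‖ ^ 2) ν := hpe.add hNi
  have hb : ∀ ω, ‖H (x' ω) (y' ω) (V ω) + (1 - η) • (p ω - H (x ω) (y ω) (V ω)) - p ω‖ ^ 2 ≤
      2 * L * (‖x' ω - x ω‖ ^ 2 + ‖y' ω - y ω‖ ^ 2) + 4 * η ^ 2 * (‖p ω - h (x ω) (y ω)‖ ^ 2 +
        ‖H (x ω) (y ω) (V ω) - h (x ω) (y ω)‖ ^ 2) := by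
    intro ω
    have e : H (x' ω) (y' ω) (V ω) + (1 - η) • (p ω - H (x ω) (y ω) (V ω)) - p ω =
        (H (x' ω) (y' ω) (V ω) - H (x ω) (y ω) (V ω)) +
        η • ((H (x ω) (y ω) (V ω) - h (x ω) (y ω)) - (p ω - h (x ω) (y ω))) := by module
    have h1 := o.lipschitz (V ω) (x' ω) (y' ω) (x ω) (y ω)
    rw [e]
    generalize H (x' ω) (y' ω) (V ω) - H (x ω) (y ω) (V ω) = A at h1 ⊢
    generalize H (x ω) (y ω) (V ω) - h (x ω) (y ω) = B₁
    generalize p ω - h (x ω) (y ω) = B₂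
    have h4 : ‖A + η • (B₁ - B₂)‖ ≤ ‖A‖ + η * (‖B₁‖ + ‖B₂‖) := by
      refine (norm_add_le _ _).trans (add_le_add le_rfl ?_)
      rw [norm_smul, Real.norm_of_nonneg hη.1]
      exact mul_le_mul_of_nonneg_left (norm_sub_le _ _) hη.1
    have h5 := pow_le_pow_left₀ (norm_nonneg _) h4 2
    nlinarith [sq_nonneg (‖A‖ - η * (‖B₁‖ + ‖B₂‖)), mul_nonneg (sq_nonneg η)
      (sq_nonneg (‖B₁‖ - ‖B₂‖))]
  calc _ ≤ ∫ ω, (2 * L * (‖x' ω - x ω‖ ^ 2 + ‖y' ω - y ω‖ ^ 2) +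
        4 * η ^ 2 * (‖p ω - h (x ω) (y ω)‖ ^ 2 +
        ‖H (x ω) (y ω) (V ω) - h (x ω) (y ω)‖ ^ 2)) ∂ν :=
        integral_mono (integrable_norm_sub_sq hp hpL)
          ((hDi.const_mul _).add (hs.const_mul _)) hb
    _ = 2 * L * ∫ ω, (‖x' ω - x ω‖ ^ 2 + ‖y' ω - y ω‖ ^ 2) ∂ν +
        4 * η ^ 2 * (∫ ω, ‖p ω - h (x ω) (y ω)‖ ^ 2 ∂ν +
        ∫ ω, ‖H (x ω) (y ω) (V ω) - h (x ω) (y ω)‖ ^ 2 ∂ν) := by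
        rw [integral_add (hDi.const_mul _) (hs.const_mul _), integral_const_mul,
          integral_const_mul, integral_add hpe hNi]
    _ ≤ _ := by
        have := mul_le_mul_of_nonneg_left hNle (show 0 ≤ 4 * η ^ 2 by positivity)
        linarith

end MomentumStep

end Oracle

/-! ### One-step inequalities -/

theorem norm_add_sq_le_two {d : ℕ} (v w : E d) : ‖v + w‖ ^ 2 ≤ 2 * ‖v‖ ^ 2 + 2 * ‖w‖ ^ 2 := by
  have h := pow_le_pow_left₀ (norm_nonneg _) (norm_add_le v w) 2
  nlinarith [sq_nonneg (‖v‖ - ‖w‖)]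

namespace LowerRegular

variable {a b : ℕ} {c : Constants} {G : E a → E b → ℝ}

theorem norm_gradY_le (hG : LowerRegular c G) (hc : c.Valid) (x : E a) (y : E b) :
    ‖gradY G x y‖ ≤ c.Lg * ‖argmin G x - y‖ := by
  have h := hG.gradY_lipschitz.right x y (argmin G x)
  rwa [hG.gradY_argmin hc, sub_zero, norm_sub_rev y] at h

/-- A gradient step in `y` contracts towards the minimizer. -/
theorem norm_gradient_step_sq_le (hG : LowerRegular c G) (hc : c.Valid) {β : ℝ} (hβ : 0 ≤ β)
    (hβL : β * c.Lg ^ 2 ≤ c.μg) (x : E a) (y : E b) :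
    ‖argmin G x - (y - β • gradY G x y)‖ ^ 2 ≤ (1 - β * c.μg) * ‖argmin G x - y‖ ^ 2 := by
  have h1 := hG.strongly_monotone x y (argmin G x)
  rw [hG.gradY_argmin hc, sub_zero] at h1
  have h2 := pow_le_pow_left₀ (norm_nonneg _) (hG.norm_gradY_le hc x y) 2
  have e : argmin G x - (y - β • gradY G x y) = (argmin G x - y) + β • gradY G x y := by abel
  have e2 : ⟪argmin G x - y, gradY G x y⟫ = -⟪gradY G x y, y - argmin G x⟫ := by
    rw [← neg_sub y, inner_neg_left, real_inner_comm]
  rw [e, norm_add_sq_real, inner_smul_right, norm_smul, Real.norm_of_nonneg hβ, e2]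
  rw [norm_sub_rev y] at h1
  have h3 : β ^ 2 * ‖gradY G x y‖ ^ 2 ≤ β * (β * c.Lg ^ 2) * ‖argmin G x - y‖ ^ 2 := by
    calc β ^ 2 * ‖gradY G x y‖ ^ 2 ≤ β ^ 2 * (c.Lg * ‖argmin G x - y‖) ^ 2 :=
          mul_le_mul_of_nonneg_left h2 (sq_nonneg _)
      _ = _ := by ring
  have h4 : β * (β * c.Lg ^ 2) * ‖argmin G x - y‖ ^ 2 ≤ β * c.μg * ‖argmin G x - y‖ ^ 2 :=
    mul_le_mul_of_nonneg_right (mul_le_mul_of_nonneg_left hβL hβ) (sq_nonneg _)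
  have h5 := mul_le_mul_of_nonneg_left h1 hβ
  nlinarith

/-- The error of one inexact gradient step for the lower-level problem, while `x` moves. -/
theorem lower_step_le (hG : LowerRegular c G) (hc : c.Valid) {β : ℝ} (hβ : 0 < β)
    (hβL : β * c.Lg ^ 2 ≤ c.μg) (hβμ : β * c.μg ≤ 1 / 2) (x x' : E a) (y v : E b) :
    ‖argmin G x' - (y - β • v)‖ ^ 2 ≤ (1 - β * c.μg / 2) * ‖argmin G x - y‖ ^ 2 +
      4 / c.μg * β * ‖v - gradY G x y‖ ^ 2 +
      4 * (c.Lg / c.μg) ^ 2 / c.μg / β * ‖x' - x‖ ^ 2 := by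
  have hμ := hc.μg_pos
  have hδ : 0 < β * c.μg := by positivity
  have hstep := hG.norm_gradient_step_sq_le hc hβ.le hβL x y
  set δ := β * c.μg with hδdef
  have hq : 0 < 1 - δ / 2 := by linarith
  have hq' : 2 - δ ≠ 0 := by linarith
  -- with this weight, dividing the contraction factor `1 - δ` by `r` leaves `1 - δ / 2`
  set r := (1 - δ) / (1 - δ / 2) with hr
  have hr0 : 0 < r := div_pos (by linarith) hq
  have hr1 : r < 1 := by rw [hr, div_lt_one hq]; linarith
  have h1r : 1 - r = (δ / 2) / (1 - δ / 2) := by rw [hr]; field_simp; ring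
  have e : argmin G x' - (y - β • v) = (argmin G x - (y - β • gradY G x y)) +
      (β • (v - gradY G x y) + (argmin G x' - argmin G x)) := by module
  have h1 := norm_add_sq_le_div hr0 hr1 (argmin G x - (y - β • gradY G x y))
    (β • (v - gradY G x y) + (argmin G x' - argmin G x))
  rw [← e] at h1
  have h2 := norm_add_sq_le_two (β • (v - gradY G x y)) (argmin G x' - argmin G x)
  rw [norm_smul, Real.norm_of_nonneg hβ.le] at h2
  have h3 := pow_le_pow_left₀ (norm_nonneg _) (hG.argmin_lipschitz hc x' x) 2
  have h4 : ‖argmin G x - (y - β • gradY G x y)‖ ^ 2 / r ≤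
      (1 - δ / 2) * ‖argmin G x - y‖ ^ 2 := by
    rw [div_le_iff₀ hr0, hr]
    refine hstep.trans (le_of_eq ?_)
    field_simp
  have h5 : ‖β • (v - gradY G x y) + (argmin G x' - argmin G x)‖ ^ 2 / (1 - r) ≤
      (2 * (β * ‖v - gradY G x y‖) ^ 2 + 2 * (c.Lg / c.μg * ‖x' - x‖) ^ 2) * (2 / δ) := by
    rw [h1r, div_div_eq_mul_div, div_eq_mul_inv (_ * _), mul_assoc]
    refine mul_le_mul (h2.trans (by linarith)) ?_ (by positivity) (by positivity)
    rw [inv_div]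
    have : 0 < 2 / δ := by positivity
    nlinarith
  refine h1.trans ((add_le_add h4 h5).trans (le_of_eq ?_))
  rw [hδdef]
  field_simp
  ring

end LowerRegular

namespace Problem

variable {m a b : ℕ} {Ξ Z : Type*} [MeasurableSpace Ξ] [MeasurableSpace Z]
  {P : Problem m a b Ξ Z} {c : Constants} {σf : ℕ → ℝ} {σg : ℝ}

theorem Regular.hasGradientAt_localObj (hR : P.Regular c σf σg) (hc : c.Valid) (i : Fin m)
    (x : E a) : HasGradientAt (P.localObj i) (P.barGrad i x (P.ystar i x)) x :=
  (hR.lower i).hasGradientAt_value hc (hR.upper i) x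

theorem Regular.hasGradientAt_obj (hR : P.Regular c σf σg) (hc : c.Valid) (x : E a) :
    HasGradientAt P.obj (mean fun i => P.barGrad i x (P.ystar i x)) x := by
  have h := HasFDerivAt.const_mul (HasFDerivAt.fun_sum (u := Finset.univ) fun i _ =>
    (hR.hasGradientAt_localObj hc i x).hasFDerivAt) (1 / (m : ℝ))
  rw [hasGradientAt_iff_hasFDerivAt]
  have e : InnerProductSpace.toDual ℝ (E a) (mean fun i => P.barGrad i x (P.ystar i x)) =
      (1 / (m : ℝ)) • ∑ i, InnerProductSpace.toDual ℝ (E a) (P.barGrad i x (P.ystar i x)) := by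
    simp only [mean, map_smul, map_sum]
  rw [e]
  exact h

theorem Regular.gradient_obj (hR : P.Regular c σf σg) (hc : c.Valid) (x : E a) :
    gradient P.obj x = mean fun i => P.barGrad i x (P.ystar i x) :=
  (hR.hasGradientAt_obj hc x).gradient

theorem Regular.differentiable_obj (hR : P.Regular c σf σg) (hc : c.Valid) :
    Differentiable ℝ P.obj := fun x => (hR.hasGradientAt_obj hc x).differentiableAt

theorem norm_mean_le_of_forall (hm : 0 < m) {z : Fin m → E a} {B : ℝ} (h : ∀ i, ‖z i‖ ≤ B) :
    ‖mean z‖ ≤ B := by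
  have hm' : (0 : ℝ) < m := by exact_mod_cast hm
  rw [mean, norm_smul, Real.norm_of_nonneg (by positivity), one_div, inv_mul_le_iff₀ hm']
  refine (norm_sum_le _ _).trans ((Finset.sum_le_sum fun i _ => h i).trans (le_of_eq ?_))
  simp

theorem Regular.gradient_obj_lipschitz (hR : P.Regular c σf σg) (hc : c.Valid) (hm : 0 < m)
    (x x' : E a) : ‖gradient P.obj x - gradient P.obj x'‖ ≤ valueLip c * ‖x - x'‖ := by
  rw [hR.gradient_obj hc, hR.gradient_obj hc, ← mean_sub]
  exact norm_mean_le_of_forall hm fun i =>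
    (hR.lower i).value_gradient_lipschitz hc (hR.upper i) x x'

theorem Regular.obj_quadratic_bound (hR : P.Regular c σf σg) (hc : c.Valid) (hm : 0 < m)
    (x x' : E a) :
    |P.obj x' - P.obj x - ⟪gradient P.obj x, x' - x⟫| ≤ valueLip c * ‖x' - x‖ ^ 2 :=
  le_of_gradient_lipschitz (valueLip_nonneg hc) (fun x => by
    rw [hR.gradient_obj hc]; exact hR.hasGradientAt_obj hc x)
    (hR.gradient_obj_lipschitz hc hm) x x'

/-- The averaged direction `p̄` approximates the gradient of the objective at the averaged
iterate: the error splits into consensus error, lower-level error, bias and momentum error. -/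
theorem Regular.norm_gradient_sub_mean_sq_le (hR : P.Regular c σf σg) (hc : c.Valid) (hm : 0 < m)
    {bias : ℝ} (z p h : Fin m → E a) (y : Fin m → E b)
    (hb : ∀ i, ‖h i - P.barGrad i (z i) (y i)‖ ^ 2 ≤ bias) :
    ‖gradient P.obj (mean z) - mean p‖ ^ 2 ≤ 4 * (valueLip c ^ 2 * dev z +
      hyperLip c ^ 2 * ∑ i, ‖P.ystar i (z i) - y i‖ ^ 2 + m * bias + ∑ i, ‖p i - h i‖ ^ 2) := by
  rw [hR.gradient_obj hc, ← mean_sub]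
  refine (norm_mean_sq_le hm _).trans ?_
  have key : ∀ i, ‖P.barGrad i (mean z) (P.ystar i (mean z)) - p i‖ ^ 2 ≤
      4 * (valueLip c ^ 2 * ‖z i - mean z‖ ^ 2 + hyperLip c ^ 2 * ‖P.ystar i (z i) - y i‖ ^ 2 +
        bias + ‖p i - h i‖ ^ 2) := by
    intro i
    have h1 := pow_le_pow_left₀ (norm_nonneg _)
      ((hR.lower i).value_gradient_lipschitz hc (hR.upper i) (mean z) (z i)) 2
    have h2 := pow_le_pow_left₀ (norm_nonneg _)
      ((hR.lower i).hyperGrad_lipschitz hc (hR.upper i) (z i) (P.ystar i (z i)) (z i) (y i)) 2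
    rw [sub_self, norm_zero, zero_add, mul_pow] at h2
    rw [norm_sub_rev (mean z), mul_pow] at h1
    have e : P.barGrad i (mean z) (P.ystar i (mean z)) - p i =
        ((P.barGrad i (mean z) (P.ystar i (mean z)) - P.barGrad i (z i) (P.ystar i (z i))) +
        (P.barGrad i (z i) (P.ystar i (z i)) - P.barGrad i (z i) (y i))) +
        ((P.barGrad i (z i) (y i) - h i) + (h i - p i)) := by abel
    have h3 := hb i
    have h4 := norm_add_sq_le_two
      (P.barGrad i (mean z) (P.ystar i (mean z)) - P.barGrad i (z i) (P.ystar i (z i)))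
      (P.barGrad i (z i) (P.ystar i (z i)) - P.barGrad i (z i) (y i))
    have h5 := norm_add_sq_le_two (P.barGrad i (z i) (y i) - h i) (h i - p i)
    rw [norm_sub_rev (P.barGrad i (z i) (y i)), norm_sub_rev (h i) (p i)] at h5
    rw [e]
    refine (norm_add_sq_le_two _ _).trans ?_
    have h1' : ‖P.barGrad i (mean z) (P.ystar i (mean z)) - P.barGrad i (z i) (P.ystar i (z i))‖ ^ 2
      ≤ valueLip c ^ 2 * ‖z i - mean z‖ ^ 2 := h1
    have h2' : ‖P.barGrad i (z i) (P.ystar i (z i)) - P.barGrad i (z i) (y i)‖ ^ 2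
      ≤ hyperLip c ^ 2 * ‖P.ystar i (z i) - y i‖ ^ 2 := h2
    linarith
  refine (Finset.sum_le_sum fun i _ => key i).trans (le_of_eq ?_)
  rw [← Finset.mul_sum, Finset.sum_add_distrib, Finset.sum_add_distrib, Finset.sum_add_distrib,
    ← Finset.mul_sum, ← Finset.mul_sum, dev, Finset.sum_const, Finset.card_univ, Fintype.card_fin,
    nsmul_eq_mul]

/-- Descent of the objective along the averaged direction. -/
theorem Regular.descent_step_le (hR : P.Regular c σf σg) (hc : c.Valid) (hm : 0 < m)
    {α : ℝ} (hα : 0 ≤ α) (hαL : valueLip c * α ≤ 1 / 4) (x p : E a) :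
    P.obj (x - α • p) ≤ P.obj x - α / 2 * ‖gradient P.obj x‖ ^ 2 - α / 4 * ‖p‖ ^ 2 +
      α / 2 * ‖gradient P.obj x - p‖ ^ 2 := by
  have h1 := (abs_le.1 (hR.obj_quadratic_bound hc hm x (x - α • p))).2
  rw [sub_sub_cancel_left, inner_neg_right, inner_smul_right, norm_neg, norm_smul,
    Real.norm_of_nonneg hα] at h1
  have h2 := norm_sub_sq_real (gradient P.obj x) p
  have h3 : valueLip c * α * (α * ‖p‖ ^ 2) ≤ 1 / 4 * (α * ‖p‖ ^ 2) :=
    mul_le_mul_of_nonneg_right hαL (by positivity)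
  rw [h2]
  nlinarith

end Problem

/-! ### The iterates as random variables -/

/-- All vector components of a random state are measurable with respect to `ℱ`. -/
structure State.IsMeasurable {m a b : ℕ} {Ω : Type*} (ℱ : MeasurableSpace Ω)
    (X : Ω → State m a b) : Prop where
  x : ∀ i, Measurable fun ω => (X ω).x i
  y : ∀ i, Measurable fun ω => (X ω).y i
  xPrev : ∀ i, Measurable fun ω => (X ω).xPrev i
  yPrev : ∀ i, Measurable fun ω => (X ω).yPrev i
  p : ∀ i, Measurable fun ω => (X ω).p i
  v : ∀ i, Measurable fun ω => (X ω).v i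
  u : ∀ i, Measurable fun ω => (X ω).u i

/-- All vector components of a random state are square-integrable. -/
structure State.IsMemLp {m a b : ℕ} {Ω : Type*} [MeasurableSpace Ω] (X : Ω → State m a b)
    (ν : Measure Ω) : Prop where
  x : ∀ i, MemLp (fun ω => (X ω).x i) 2 ν
  y : ∀ i, MemLp (fun ω => (X ω).y i) 2 ν
  xPrev : ∀ i, MemLp (fun ω => (X ω).xPrev i) 2 ν
  yPrev : ∀ i, MemLp (fun ω => (X ω).yPrev i) 2 ν
  p : ∀ i, MemLp (fun ω => (X ω).p i) 2 ν
  v : ∀ i, MemLp (fun ω => (X ω).v i) 2 ν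
  u : ∀ i, MemLp (fun ω => (X ω).u i) 2 ν

section

variable {m a b : ℕ} {Ξ Z Ω : Type*} [MeasurableSpace Ξ] [MeasurableSpace Z]
  {P : Problem m a b Ξ Z} {c : Constants} {M : Matrix (Fin m) (Fin m) ℝ} {θ : Params}
  {x₀ : E a} {y₀ : E b}

theorem State.IsMeasurable.mono {m₁ m₂ : MeasurableSpace Ω} {X : Ω → State m a b}
    (h : State.IsMeasurable m₁ X) (hle : m₁ ≤ m₂) : State.IsMeasurable m₂ X :=
  ⟨fun i => (h.x i).mono hle le_rfl, fun i => (h.y i).mono hle le_rfl,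
    fun i => (h.xPrev i).mono hle le_rfl, fun i => (h.yPrev i).mono hle le_rfl,
    fun i => (h.p i).mono hle le_rfl, fun i => (h.v i).mono hle le_rfl,
    fun i => (h.u i).mono hle le_rfl⟩

theorem State.IsMeasurable.step {ℱ : MeasurableSpace Ω} (hP : P.SampleRegular c) (hθ : θ.Lg = c.Lg)
    (t : ℕ) {s : Fin m → Ω → IterSample Ξ Z θ.K} (hs : ∀ i, Measurable (s i))
    {X : Ω → State m a b} (hX : State.IsMeasurable ℱ X) :
    State.IsMeasurable ℱ fun ω => Diamond.step P M θ t (fun i => s i ω) (X ω) := by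
  have hp : ∀ i, Measurable fun ω =>
      (Diamond.step P M θ t (fun i => s i ω) (X ω)).p i := fun i => by
    simp only [Diamond.step, hθ]
    exact ((hP.measurable_hatGrad i).comp (((hX.x i).prodMk (hX.y i)).prodMk (hs i).fst)).add
      (((hX.p i).sub ((hP.measurable_hatGrad i).comp
        (((hX.xPrev i).prodMk (hX.yPrev i)).prodMk (hs i).fst))).const_smul (1 - θ.η t))
  have hv : ∀ i, Measurable fun ω =>
      (Diamond.step P M θ t (fun i => s i ω) (X ω)).v i := fun i =>
    ((hP.measurable_lowGrad i).comp (((hX.x i).prodMk (hX.y i)).prodMk (hs i).snd)).add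
      (((hX.v i).sub ((hP.measurable_lowGrad i).comp
        (((hX.xPrev i).prodMk (hX.yPrev i)).prodMk (hs i).snd))).const_smul (1 - θ.γ t))
  have hu : ∀ i, Measurable fun ω =>
      (Diamond.step P M θ t (fun i => s i ω) (X ω)).u i := fun i =>
    ((Finset.measurable_fun_sum _ fun j _ => (hX.u j).const_smul (M i j)).add (hp i)).sub (hX.p i)
  exact ⟨fun i => (Finset.measurable_fun_sum _ fun j _ => (hX.x j).const_smul (M i j)).sub
    ((hu i).const_smul (θ.α t)), fun i => (hX.y i).sub ((hv i).const_smul (θ.β t)),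
    hX.x, hX.y, hp, hv, hu⟩

/-- The σ-algebra generated by the samples drawn before iteration `t`. -/
abbrev past {K : ℕ} (S : ℕ → Fin m → Ω → IterSample Ξ Z K) (t : ℕ) : MeasurableSpace Ω :=
  ⨆ n ∈ {n : ℕ × Fin m | n.1 < t}, MeasurableSpace.comap (S n.1 n.2) inferInstance

theorem past_mono {K : ℕ} (S : ℕ → Fin m → Ω → IterSample Ξ Z K) (t : ℕ) :
    past S t ≤ past S (t + 1) :=
  biSup_mono fun n (hn : n.1 < t) => Nat.lt_succ_of_lt hn

theorem measurable_past {K : ℕ} (S : ℕ → Fin m → Ω → IterSample Ξ Z K) (t : ℕ) (i : Fin m) :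
    Measurable[past S (t + 1)] (S t i) := by
  rw [measurable_iff_comap_le]
  exact le_biSup (fun n : ℕ × Fin m => MeasurableSpace.comap (S n.1 n.2) inferInstance)
    (show (t, i) ∈ {n : ℕ × Fin m | n.1 < t + 1} from Nat.lt_succ_self t)

/-- The iterate at time `t` is a function of the samples drawn before iteration `t`. -/
theorem isMeasurable_process_past (hP : P.SampleRegular c) (hθ : θ.Lg = c.Lg)
    (S : ℕ → Fin m → Ω → IterSample Ξ Z θ.K) (t : ℕ) :
    State.IsMeasurable (past S t) (process P M θ x₀ y₀ S t) := by
  induction t with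
  | zero =>
    exact ⟨fun i => measurable_const, fun i => measurable_const, fun i => measurable_const,
      fun i => measurable_const, fun i => measurable_const, fun i => measurable_const,
      fun i => measurable_const⟩
  | succ t ih =>
    exact State.IsMeasurable.step hP hθ t (measurable_past S t) (ih.mono (past_mono S t))

variable [MeasurableSpace Ω] {ν : Measure Ω}

/-- The samples of all agents and iterations are independent, with the laws of the algorithm. -/
structure IsSampleStream (P : Problem m a b Ξ Z) {K : ℕ} (S : ℕ → Fin m → Ω → IterSample Ξ Z K)
    (ν : Measure Ω) : Prop where
  measurable : ∀ t i, Measurable (S t i)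
  law : ∀ t i, ν.map (S t i) = P.iterLaw K i
  indep : iIndepFun (fun n : ℕ × Fin m => S n.1 n.2) ν

theorem IsSampleStream.past_le {K : ℕ} {S : ℕ → Fin m → Ω → IterSample Ξ Z K}
    (hS : IsSampleStream P S ν) (t : ℕ) : past S t ≤ ‹MeasurableSpace Ω› :=
  iSup₂_le fun n _ => (hS.measurable n.1 n.2).comap_le

/-- A function of the past is independent of the samples of the current iteration. -/
theorem IsSampleStream.indepFun {K : ℕ} {S : ℕ → Fin m → Ω → IterSample Ξ Z K}
    (hS : IsSampleStream P S ν) {t : ℕ} (i : Fin m) {𝒰 : Type*} [MeasurableSpace 𝒰] {W : Ω → 𝒰}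
    (hW : Measurable[past S t] W) : IndepFun W (S t i) ν := by
  have h := indep_iSup_of_disjoint (fun n : ℕ × Fin m => (hS.measurable n.1 n.2).comap_le)
    hS.indep.iIndep (S := {n : ℕ × Fin m | n.1 < t}) (T := {(t, i)}) (by
      rw [Set.disjoint_singleton_right]
      exact lt_irrefl t)
  rw [IndepFun_iff_Indep]
  refine indep_of_indep_of_le_left (indep_of_indep_of_le_right h ?_) hW.comap_le
  exact le_biSup (fun n : ℕ × Fin m => MeasurableSpace.comap (S n.1 n.2) inferInstance)
    (Set.mem_singleton (t, i))

theorem IsSampleStream.isMeasurable_process (hP : P.SampleRegular c) (hθ : θ.Lg = c.Lg)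
    {S : ℕ → Fin m → Ω → IterSample Ξ Z θ.K} (hS : IsSampleStream P S ν) (t : ℕ) :
    State.IsMeasurable ‹MeasurableSpace Ω› (process P M θ x₀ y₀ S t) :=
  (isMeasurable_process_past hP hθ S t).mono (hS.past_le t)

theorem MemLp.mix {d : ℕ} {z : Ω → Fin m → E d} (hz : ∀ j, MemLp (fun ω => z ω j) 2 ν)
    (w : Fin m → ℝ) :
    MemLp (fun ω => ∑ j, w j • z ω j) 2 ν :=
  memLp_finsetSum _ fun j _ => (hz j).const_smul (w j)

theorem MemLp.mean {d : ℕ} {z : Ω → Fin m → E d} (hz : ∀ j, MemLp (fun ω => z ω j) 2 ν) :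
    MemLp (fun ω => Diamond.mean (z ω)) 2 ν :=
  (memLp_finsetSum _ fun j _ => hz j).const_smul (1 / (m : ℝ))

theorem MemLp.integrable_sum_sq {d : ℕ} {z : Ω → Fin m → E d}
    (hz : ∀ j, MemLp (fun ω => z ω j) 2 ν) : Integrable (fun ω => ∑ j, ‖z ω j‖ ^ 2) ν :=
  integrable_finsetSum _ fun j _ => (hz j).integrable_norm_pow (by norm_num : (2 : ℕ) ≠ 0)

theorem MemLp.integrable_dev {d : ℕ} {z : Ω → Fin m → E d}
    (hz : ∀ j, MemLp (fun ω => z ω j) 2 ν) : Integrable (fun ω => dev (z ω)) ν :=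
  MemLp.integrable_sum_sq (z := fun ω j => z ω j - Diamond.mean (z ω))
    fun j => (hz j).sub (MemLp.mean hz)

section Moments

variable [IsProbabilityMeasure ν] {σf : ℕ → ℝ} {σg : ℝ} {S : ℕ → Fin m → Ω → IterSample Ξ Z θ.K}

theorem oracle_upper (hR : P.Regular c σf σg) (hP : P.SampleRegular c) (hc : c.Valid) {K : ℕ}
    (hK : 1 ≤ K) (i : Fin m) :
    Oracle (P.iterLaw K i) (fun x y s => P.hatGrad c.Lg i x y s.1) (P.meanGrad c.Lg K i)
      (2 * estLip c ^ 2 * K ^ 4) (estVar c σf * K ^ 4) := by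
  have := hR.prob_g i
  have := Problem.isProbabilityMeasure_estLaw hR hK i
  exact (Problem.oracle_hatGrad hR hP hc hK i).comp measurePreserving_fst

theorem oracle_lower (hR : P.Regular c σf σg) (hP : P.SampleRegular c) (hc : c.Valid) {K : ℕ}
    (hK : 1 ≤ K) (i : Fin m) :
    Oracle (P.iterLaw K i) (fun x y s => P.lowGrad i x y s.2) (gradY (P.gAvg i))
      (c.Lg ^ 2) (σg ^ 2) := by
  have := hR.prob_g i
  have := Problem.isProbabilityMeasure_estLaw hR hK i
  exact (Problem.oracle_lowGrad hR hP hc i).comp measurePreserving_snd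

/-- The iterates are square-integrable, by induction: the stochastic gradients have linear growth in
the iterates and a square-integrable error. -/
theorem IsSampleStream.isMemLp_process (hR : P.Regular c σf σg) (hP : P.SampleRegular c)
    (hc : c.Valid) (hK : 1 ≤ θ.K) (hθ : θ.Lg = c.Lg) (hη : ∀ t, θ.η t ∈ Set.Icc (0 : ℝ) 1)
    (hγ : ∀ t, θ.γ t ∈ Set.Icc (0 : ℝ) 1) (hS : IsSampleStream P S ν) (t : ℕ) :
    State.IsMemLp (process P M θ x₀ y₀ S t) ν := by
  induction t with
  | zero =>
    exact ⟨fun i => memLp_const _, fun i => memLp_const _, fun i => memLp_const _,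
      fun i => memLp_const _, fun i => memLp_const _, fun i => memLp_const _,
      fun i => memLp_const _⟩
  | succ t ih =>
    have hpast := isMeasurable_process_past (M := M) (x₀ := x₀) (y₀ := y₀) hP hθ S t
    have hX := hpast.mono (hS.past_le t)
    have hprob : ∀ i, IsProbabilityMeasure (P.iterLaw θ.K i) := fun i => by
      rw [← hS.law t i]; exact Measure.isProbabilityMeasure_map (hS.measurable t i).aemeasurable
    have hp : ∀ i, MemLp (fun ω => (process P M θ x₀ y₀ S (t + 1) ω).p i) 2 ν := fun i => by
      have h := ((oracle_upper hR hP hc hK i).momentum_step (hη t) (ih.xPrev i) (ih.yPrev i)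
        (ih.x i) (ih.y i) (ih.p i) (hX.xPrev i) (hX.yPrev i) (hX.x i) (hX.y i) (hX.p i)
        (hS.measurable t i) (hS.law t i) (hS.indepFun i
          (((hpast.xPrev i).prodMk (hpast.yPrev i)).prodMk
            (((hpast.x i).prodMk (hpast.y i)).prodMk (hpast.p i))))).1
      rw [← hθ] at h
      exact h
    have hv : ∀ i, MemLp (fun ω => (process P M θ x₀ y₀ S (t + 1) ω).v i) 2 ν := fun i =>
      ((oracle_lower hR hP hc hK i).momentum_step (hγ t) (ih.xPrev i) (ih.yPrev i)
        (ih.x i) (ih.y i) (ih.v i) (hX.xPrev i) (hX.yPrev i) (hX.x i) (hX.y i) (hX.v i)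
        (hS.measurable t i) (hS.law t i) (hS.indepFun i
          (((hpast.xPrev i).prodMk (hpast.yPrev i)).prodMk
            (((hpast.x i).prodMk (hpast.y i)).prodMk (hpast.v i))))).1
    have hu : ∀ i, MemLp (fun ω => (process P M θ x₀ y₀ S (t + 1) ω).u i) 2 ν := fun i =>
      ((MemLp.mix ih.u (M i)).add (hp i)).sub (ih.p i)
    exact ⟨fun i => (MemLp.mix ih.x (M i)).sub ((hu i).const_smul (θ.α t)),
      fun i => (ih.y i).sub ((hv i).const_smul (θ.β t)), ih.x, ih.y, hp, hv, hu⟩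

end Moments

end

/-! ### Recursions for the expected errors -/

section

variable {Ω : Type*} [MeasurableSpace Ω] {ν : Measure Ω} [IsProbabilityMeasure ν]

/-- A pointwise affine bound passes to expectations. Six terms are enough for each of the recursions
below; shorter ones are filled up with zero. -/
theorem integral_le_linear {X A₁ A₂ A₃ A₄ A₅ A₆ : Ω → ℝ} (hX : Integrable X ν)
    (h₁ : Integrable A₁ ν) (h₂ : Integrable A₂ ν) (h₃ : Integrable A₃ ν) (h₄ : Integrable A₄ ν)
    (h₅ : Integrable A₅ ν) (h₆ : Integrable A₆ ν) (k₁ k₂ k₃ k₄ k₅ k₆ k₀ : ℝ)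
    (h : ∀ ω, X ω ≤ k₁ * A₁ ω + k₂ * A₂ ω + k₃ * A₃ ω + k₄ * A₄ ω + k₅ * A₅ ω + k₆ * A₆ ω + k₀) :
    ∫ ω, X ω ∂ν ≤ k₁ * ∫ ω, A₁ ω ∂ν + k₂ * ∫ ω, A₂ ω ∂ν + k₃ * ∫ ω, A₃ ω ∂ν + k₄ * ∫ ω, A₄ ω ∂ν +
      k₅ * ∫ ω, A₅ ω ∂ν + k₆ * ∫ ω, A₆ ω ∂ν + k₀ := by
  have i₁ := h₁.const_mul k₁
  have i₂ : Integrable (fun ω => k₁ * A₁ ω + k₂ * A₂ ω) ν := i₁.add (h₂.const_mul k₂)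
  have i₃ : Integrable (fun ω => k₁ * A₁ ω + k₂ * A₂ ω + k₃ * A₃ ω) ν := i₂.add (h₃.const_mul k₃)
  have i₄ : Integrable (fun ω => k₁ * A₁ ω + k₂ * A₂ ω + k₃ * A₃ ω + k₄ * A₄ ω) ν :=
    i₃.add (h₄.const_mul k₄)
  have i₅ : Integrable (fun ω => k₁ * A₁ ω + k₂ * A₂ ω + k₃ * A₃ ω + k₄ * A₄ ω + k₅ * A₅ ω) ν :=
    i₄.add (h₅.const_mul k₅)
  have i₆ : Integrable (fun ω => k₁ * A₁ ω + k₂ * A₂ ω + k₃ * A₃ ω + k₄ * A₄ ω + k₅ * A₅ ω +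
    k₆ * A₆ ω) ν := i₅.add (h₆.const_mul k₆)
  refine (integral_mono hX (i₆.add (integrable_const k₀)) h).trans (le_of_eq ?_)
  simp only [Pi.add_apply]
  rw [integral_add i₆ (integrable_const _), integral_add i₅ (h₆.const_mul k₆),
    integral_add i₄ (h₅.const_mul k₅), integral_add i₃ (h₄.const_mul k₄),
    integral_add i₂ (h₃.const_mul k₃), integral_add i₁ (h₂.const_mul k₂), integral_const,
    probReal_univ, one_smul]
  simp only [integral_const_mul]

theorem memLp_comp_of_lipschitz {d d' : ℕ} {g : E d → E d'} {L : ℝ}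
    (hg : ∀ x x', ‖g x - g x'‖ ≤ L * ‖x - x'‖) {f : Ω → E d} (hf : MemLp f 2 ν) :
    MemLp (fun ω => g (f ω)) 2 ν := by
  have hL : LipschitzWith (Real.toNNReal L) fun x => g x - g 0 := by
    refine LipschitzWith.of_dist_le_mul fun x x' => ?_
    rw [dist_eq_norm, dist_eq_norm, sub_sub_sub_cancel_right]
    exact (hg x x').trans (mul_le_mul_of_nonneg_right (Real.le_coe_toNNReal L) (norm_nonneg _))
  have h1 := hL.comp_memLp (sub_self _) hf
  have h2 : MemLp (fun _ : Ω => g 0) 2 ν := memLp_const _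
  have h3 := h1.add h2
  have e : ((fun x => g x - g 0) ∘ f + fun _ => g 0) = fun ω => g (f ω) := by
    funext ω; simp
  rwa [e] at h3

end

/-- The squared displacement of all agents in the last iteration. -/
noncomputable def State.disp {m a b : ℕ} (X : State m a b) : ℝ :=
  ∑ i, (‖X.x i - X.xPrev i‖ ^ 2 + ‖X.y i - X.yPrev i‖ ^ 2)

section

variable {m a b : ℕ} {Ξ Z Ω : Type*} [MeasurableSpace Ξ] [MeasurableSpace Z]

/-- The squared error of the momentum estimators `p` of the expected hypergradient estimators. In the
state after an iteration `p` was computed at the previous iterate, hence `xPrev` and `yPrev`. -/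
noncomputable def State.upperError (P : Problem m a b Ξ Z) (Lg : ℝ) (K : ℕ) (X : State m a b) : ℝ :=
  ∑ i, ‖X.p i - P.meanGrad Lg K i (X.xPrev i) (X.yPrev i)‖ ^ 2

/-- The squared error of the momentum estimators `v` of the lower-level gradients. -/
noncomputable def State.velocityError (P : Problem m a b Ξ Z) (X : State m a b) : ℝ :=
  ∑ i, ‖X.v i - gradY (P.gAvg i) (X.xPrev i) (X.yPrev i)‖ ^ 2

/-- The squared distance of the lower-level variables from the lower-level minimizers. -/
noncomputable def State.lowerError (P : Problem m a b Ξ Z) (X : State m a b) : ℝ :=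
  ∑ i, ‖P.ystar i (X.x i) - X.y i‖ ^ 2

variable [MeasurableSpace Ω] {P : Problem m a b Ξ Z} {M : Matrix (Fin m) (Fin m) ℝ} {θ : Params}
  {c : Constants} {σf : ℕ → ℝ} {σg lam : ℝ} {S : ℕ → Fin m → Ω → IterSample Ξ Z θ.K}
  {ν : Measure Ω} {x₀ : E a} {y₀ : E b}

/-- The standing hypotheses on a run of the algorithm. -/
structure IsRun (P : Problem m a b Ξ Z) (M : Matrix (Fin m) (Fin m) ℝ) (θ : Params)
    (c : Constants) (σf : ℕ → ℝ) (σg lam : ℝ) (S : ℕ → Fin m → Ω → IterSample Ξ Z θ.K)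
    (ν : Measure Ω) : Prop where
  prob : IsProbabilityMeasure ν
  pos : 0 < m
  valid : c.Valid
  regular : P.Regular c σf σg
  sampleRegular : P.SampleRegular c
  doublyStochastic : M ∈ doublyStochastic ℝ (Fin m)
  symm : M.IsSymm
  eigenvalue_le : secondEigenvalue M ≤ lam
  stream : IsSampleStream P S ν
  K_pos : 1 ≤ θ.K
  Lg_eq : θ.Lg = c.Lg
  η_mem : ∀ t, θ.η t ∈ Set.Icc (0 : ℝ) 1
  γ_mem : ∀ t, θ.γ t ∈ Set.Icc (0 : ℝ) 1

namespace IsRun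

variable (h : IsRun P M θ c σf σg lam S ν)

include h

theorem isMeasurable (x₀ : E a) (y₀ : E b) (t : ℕ) :
    State.IsMeasurable ‹MeasurableSpace Ω› (process P M θ x₀ y₀ S t) :=
  h.stream.isMeasurable_process h.sampleRegular h.Lg_eq t

theorem isMemLp (x₀ : E a) (y₀ : E b) (t : ℕ) : State.IsMemLp (process P M θ x₀ y₀ S t) ν :=
  have := h.prob
  h.stream.isMemLp_process h.regular h.sampleRegular h.valid h.K_pos h.Lg_eq h.η_mem h.γ_mem t

theorem isProbabilityMeasure_iterLaw (i : Fin m) : IsProbabilityMeasure (P.iterLaw θ.K i) := by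
  have := h.prob
  rw [← h.stream.law 0 i]
  exact Measure.isProbabilityMeasure_map (h.stream.measurable 0 i).aemeasurable

theorem integrable_disp_summand (t : ℕ) (i : Fin m) :
    Integrable (fun ω =>
      ‖(process P M θ x₀ y₀ S t ω).x i - (process P M θ x₀ y₀ S t ω).xPrev i‖ ^ 2 +
      ‖(process P M θ x₀ y₀ S t ω).y i - (process P M θ x₀ y₀ S t ω).yPrev i‖ ^ 2) ν :=
  have hX := h.isMemLp x₀ y₀ t
  (integrable_norm_sub_sq (hX.xPrev i) (hX.x i)).add (integrable_norm_sub_sq (hX.yPrev i) (hX.y i))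

theorem integrable_disp (t : ℕ) : Integrable (fun ω => (process P M θ x₀ y₀ S t ω).disp) ν :=
  integrable_finsetSum _ fun i _ => h.integrable_disp_summand t i

theorem integrable_upperError_summand (t : ℕ) (i : Fin m) :
    Integrable (fun ω => ‖(process P M θ x₀ y₀ S t ω).p i - P.meanGrad c.Lg θ.K i
      ((process P M θ x₀ y₀ S t ω).xPrev i) ((process P M θ x₀ y₀ S t ω).yPrev i)‖ ^ 2) ν :=
  have := h.prob
  have := h.isProbabilityMeasure_iterLaw i
  have hX := h.isMemLp x₀ y₀ t
  have hm := h.isMeasurable x₀ y₀ t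
  integrable_norm_sub_sq ((oracle_upper h.regular h.sampleRegular h.valid h.K_pos i).memLp_mean_comp
    (hX.xPrev i) (hX.yPrev i) (hm.xPrev i) (hm.yPrev i)) (hX.p i)

theorem integrable_upperError (t : ℕ) :
    Integrable (fun ω => (process P M θ x₀ y₀ S t ω).upperError P c.Lg θ.K) ν :=
  integrable_finsetSum _ fun i _ => h.integrable_upperError_summand t i

theorem integrable_velocityError_summand (t : ℕ) (i : Fin m) :
    Integrable (fun ω => ‖(process P M θ x₀ y₀ S t ω).v i - gradY (P.gAvg i)
      ((process P M θ x₀ y₀ S t ω).xPrev i) ((process P M θ x₀ y₀ S t ω).yPrev i)‖ ^ 2) ν :=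
  have := h.prob
  have := h.isProbabilityMeasure_iterLaw i
  have hX := h.isMemLp x₀ y₀ t
  have hm := h.isMeasurable x₀ y₀ t
  integrable_norm_sub_sq ((oracle_lower h.regular h.sampleRegular h.valid h.K_pos i).memLp_mean_comp
    (hX.xPrev i) (hX.yPrev i) (hm.xPrev i) (hm.yPrev i)) (hX.v i)

theorem integrable_velocityError (t : ℕ) :
    Integrable (fun ω => (process P M θ x₀ y₀ S t ω).velocityError P) ν :=
  integrable_finsetSum _ fun i _ => h.integrable_velocityError_summand t i

theorem integrable_lowerError (t : ℕ) :
    Integrable (fun ω => (process P M θ x₀ y₀ S t ω).lowerError P) ν :=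
  have := h.prob
  have hX := h.isMemLp x₀ y₀ t
  integrable_finsetSum _ fun i _ => integrable_norm_sub_sq (hX.y i)
    (memLp_comp_of_lipschitz ((h.regular.lower i).argmin_lipschitz h.valid) (hX.x i))

theorem integrable_gradient (t : ℕ) : Integrable
    (fun ω => ‖gradient P.obj (mean (process P M θ x₀ y₀ S t ω).x)‖ ^ 2) ν :=
  have := h.prob
  (memLp_comp_of_lipschitz (h.regular.gradient_obj_lipschitz h.valid h.pos)
    (MemLp.mean (h.isMemLp x₀ y₀ t).x)).integrable_norm_pow (by norm_num : (2 : ℕ) ≠ 0)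

theorem integrable_obj (t : ℕ) :
    Integrable (fun ω => P.obj (mean (process P M θ x₀ y₀ S t ω).x)) ν := by
  have := h.prob
  have hz : MemLp (fun ω => mean (process P M θ x₀ y₀ S t ω).x) 2 ν :=
    MemLp.mean (h.isMemLp x₀ y₀ t).x
  have hz1 := (hz.integrable (by norm_num)).norm
  have hz2 := hz.integrable_norm_pow (by norm_num : (2 : ℕ) ≠ 0)
  have hb : Integrable (fun ω => |P.obj 0| + (‖gradient P.obj 0‖ *
      ‖mean (process P M θ x₀ y₀ S t ω).x‖ + valueLip c *
      ‖mean (process P M θ x₀ y₀ S t ω).x‖ ^ 2)) ν :=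
    (integrable_const _).add ((hz1.const_mul _).add (hz2.const_mul _))
  refine hb.mono' ((h.regular.differentiable_obj h.valid).continuous.comp_aestronglyMeasurable hz.1)
    (ae_of_all _ fun ω => ?_)
  have h1 := abs_le.1 (h.regular.obj_quadratic_bound h.valid h.pos 0
    (mean (process P M θ x₀ y₀ S t ω).x))
  have h2 := abs_le.1 (abs_real_inner_le_norm (gradient P.obj 0)
    (mean (process P M θ x₀ y₀ S t ω).x))
  rw [sub_zero] at h1
  have h3 := neg_abs_le (P.obj 0)
  have h4 := le_abs_self (P.obj 0)
  rw [Real.norm_eq_abs, abs_le]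
  constructor <;> linarith

theorem integrable_mean_p (t : ℕ) :
    Integrable (fun ω => ‖mean (process P M θ x₀ y₀ S t ω).p‖ ^ 2) ν :=
  (MemLp.mean (h.isMemLp x₀ y₀ t).p).integrable_norm_pow (by norm_num : (2 : ℕ) ≠ 0)

/-- The tracked directions have the same average as the momentum estimators. -/
theorem mean_u_eq (t : ℕ) (ω : Ω) :
    mean (process P M θ x₀ y₀ S t ω).u = mean (process P M θ x₀ y₀ S t ω).p := by
  induction t with
  | zero => rfl
  | succ t ih =>
    have e : (process P M θ x₀ y₀ S (t + 1) ω).u = fun i =>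
        ((∑ j, M i j • (process P M θ x₀ y₀ S t ω).u j) + (process P M θ x₀ y₀ S (t + 1) ω).p i) -
          (process P M θ x₀ y₀ S t ω).p i := rfl
    rw [e, mean_sub, mean_add, mean_mix h.doublyStochastic, ih]
    abel

theorem upperError_step (t : ℕ) :
    ∫ ω, (process P M θ x₀ y₀ S (t + 1) ω).upperError P c.Lg θ.K ∂ν ≤
      (1 - θ.η t) * ∫ ω, (process P M θ x₀ y₀ S t ω).upperError P c.Lg θ.K ∂ν +
      (2 * θ.η t ^ 2 * (estVar c σf * θ.K ^ 4) * m +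
        8 * (2 * estLip c ^ 2 * θ.K ^ 4) * ∫ ω, (process P M θ x₀ y₀ S t ω).disp ∂ν) := by
  have := h.prob
  have hX := h.isMemLp x₀ y₀ t
  have hm := h.isMeasurable x₀ y₀ t
  have hpast := isMeasurable_process_past (M := M) (x₀ := x₀) (y₀ := y₀) h.sampleRegular h.Lg_eq S t
  have key : ∀ i, ∫ ω, ‖(process P M θ x₀ y₀ S (t + 1) ω).p i - P.meanGrad c.Lg θ.K i
      ((process P M θ x₀ y₀ S (t + 1) ω).xPrev i) ((process P M θ x₀ y₀ S (t + 1) ω).yPrev i)‖ ^ 2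
      ∂ν ≤ (1 - θ.η t) * ∫ ω, ‖(process P M θ x₀ y₀ S t ω).p i - P.meanGrad c.Lg θ.K i
      ((process P M θ x₀ y₀ S t ω).xPrev i) ((process P M θ x₀ y₀ S t ω).yPrev i)‖ ^ 2 ∂ν +
      (2 * θ.η t ^ 2 * (estVar c σf * θ.K ^ 4) + 8 * (2 * estLip c ^ 2 * θ.K ^ 4) *
        ∫ ω, (‖(process P M θ x₀ y₀ S t ω).x i - (process P M θ x₀ y₀ S t ω).xPrev i‖ ^ 2 +
          ‖(process P M θ x₀ y₀ S t ω).y i - (process P M θ x₀ y₀ S t ω).yPrev i‖ ^ 2) ∂ν) := by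
    intro i
    have := h.isProbabilityMeasure_iterLaw i
    have h1 := ((oracle_upper h.regular h.sampleRegular h.valid h.K_pos i).momentum_step (h.η_mem t)
      (hX.xPrev i) (hX.yPrev i) (hX.x i) (hX.y i) (hX.p i) (hm.xPrev i) (hm.yPrev i) (hm.x i)
      (hm.y i) (hm.p i) (h.stream.measurable t i) (h.stream.law t i) (h.stream.indepFun i
        (((hpast.xPrev i).prodMk (hpast.yPrev i)).prodMk
          (((hpast.x i).prodMk (hpast.y i)).prodMk (hpast.p i))))).2
    refine le_trans (le_of_eq ?_) h1
    refine integral_congr_ae (ae_of_all _ fun ω => ?_)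
    simp only [← h.Lg_eq]
    rfl
  simp only [State.upperError, State.disp]
  rw [integral_finsetSum _ fun i _ => h.integrable_upperError_summand (t + 1) i,
    integral_finsetSum _ fun i _ => h.integrable_upperError_summand t i,
    integral_finsetSum _ fun i _ => h.integrable_disp_summand t i]
  refine (Finset.sum_le_sum fun i _ => key i).trans (le_of_eq ?_)
  rw [Finset.sum_add_distrib, Finset.sum_add_distrib, Finset.sum_const, Finset.card_univ,
    Fintype.card_fin, nsmul_eq_mul, ← Finset.mul_sum, ← Finset.mul_sum]
  ring

theorem velocityError_step (t : ℕ) :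
    ∫ ω, (process P M θ x₀ y₀ S (t + 1) ω).velocityError P ∂ν ≤
      (1 - θ.γ t) * ∫ ω, (process P M θ x₀ y₀ S t ω).velocityError P ∂ν +
      (2 * θ.γ t ^ 2 * σg ^ 2 * m +
        8 * c.Lg ^ 2 * ∫ ω, (process P M θ x₀ y₀ S t ω).disp ∂ν) := by
  have := h.prob
  have hX := h.isMemLp x₀ y₀ t
  have hm := h.isMeasurable x₀ y₀ t
  have hpast := isMeasurable_process_past (M := M) (x₀ := x₀) (y₀ := y₀) h.sampleRegular h.Lg_eq S t
  have key : ∀ i, ∫ ω, ‖(process P M θ x₀ y₀ S (t + 1) ω).v i - gradY (P.gAvg i)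
      ((process P M θ x₀ y₀ S (t + 1) ω).xPrev i) ((process P M θ x₀ y₀ S (t + 1) ω).yPrev i)‖ ^ 2
      ∂ν ≤ (1 - θ.γ t) * ∫ ω, ‖(process P M θ x₀ y₀ S t ω).v i - gradY (P.gAvg i)
      ((process P M θ x₀ y₀ S t ω).xPrev i) ((process P M θ x₀ y₀ S t ω).yPrev i)‖ ^ 2 ∂ν +
      (2 * θ.γ t ^ 2 * σg ^ 2 + 8 * c.Lg ^ 2 *
        ∫ ω, (‖(process P M θ x₀ y₀ S t ω).x i - (process P M θ x₀ y₀ S t ω).xPrev i‖ ^ 2 +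
          ‖(process P M θ x₀ y₀ S t ω).y i - (process P M θ x₀ y₀ S t ω).yPrev i‖ ^ 2) ∂ν) := by
    intro i
    have := h.isProbabilityMeasure_iterLaw i
    exact ((oracle_lower h.regular h.sampleRegular h.valid h.K_pos i).momentum_step (h.γ_mem t)
      (hX.xPrev i) (hX.yPrev i) (hX.x i) (hX.y i) (hX.v i) (hm.xPrev i) (hm.yPrev i) (hm.x i)
      (hm.y i) (hm.v i) (h.stream.measurable t i) (h.stream.law t i) (h.stream.indepFun i
        (((hpast.xPrev i).prodMk (hpast.yPrev i)).prodMk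
          (((hpast.x i).prodMk (hpast.y i)).prodMk (hpast.v i))))).2
  simp only [State.velocityError, State.disp]
  rw [integral_finsetSum _ fun i _ => h.integrable_velocityError_summand (t + 1) i,
    integral_finsetSum _ fun i _ => h.integrable_velocityError_summand t i,
    integral_finsetSum _ fun i _ => h.integrable_disp_summand t i]
  refine (Finset.sum_le_sum fun i _ => key i).trans (le_of_eq ?_)
  rw [Finset.sum_add_distrib, Finset.sum_add_distrib, Finset.sum_const, Finset.card_univ,
    Fintype.card_fin, nsmul_eq_mul, ← Finset.mul_sum, ← Finset.mul_sum]
  ring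

theorem increment_sum_le (t : ℕ) :
    ∫ ω, ∑ i, ‖(process P M θ x₀ y₀ S (t + 1) ω).p i - (process P M θ x₀ y₀ S t ω).p i‖ ^ 2 ∂ν ≤
      2 * (2 * estLip c ^ 2 * θ.K ^ 4) * ∫ ω, (process P M θ x₀ y₀ S t ω).disp ∂ν +
      4 * θ.η t ^ 2 * (∫ ω, (process P M θ x₀ y₀ S t ω).upperError P c.Lg θ.K ∂ν +
        estVar c σf * θ.K ^ 4 * m) := by
  have := h.prob
  have hX := h.isMemLp x₀ y₀ t
  have hX' := h.isMemLp x₀ y₀ (t + 1)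
  have hm := h.isMeasurable x₀ y₀ t
  have hpast := isMeasurable_process_past (M := M) (x₀ := x₀) (y₀ := y₀) h.sampleRegular h.Lg_eq S t
  have key : ∀ i, ∫ ω, ‖(process P M θ x₀ y₀ S (t + 1) ω).p i -
      (process P M θ x₀ y₀ S t ω).p i‖ ^ 2 ∂ν ≤ 2 * (2 * estLip c ^ 2 * θ.K ^ 4) *
        ∫ ω, (‖(process P M θ x₀ y₀ S t ω).x i - (process P M θ x₀ y₀ S t ω).xPrev i‖ ^ 2 +
          ‖(process P M θ x₀ y₀ S t ω).y i - (process P M θ x₀ y₀ S t ω).yPrev i‖ ^ 2) ∂ν +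
      4 * θ.η t ^ 2 * (∫ ω, ‖(process P M θ x₀ y₀ S t ω).p i - P.meanGrad c.Lg θ.K i
      ((process P M θ x₀ y₀ S t ω).xPrev i) ((process P M θ x₀ y₀ S t ω).yPrev i)‖ ^ 2 ∂ν +
        estVar c σf * θ.K ^ 4) := by
    intro i
    have := h.isProbabilityMeasure_iterLaw i
    have h1 := (oracle_upper h.regular h.sampleRegular h.valid h.K_pos i).momentum_increment_le
      (h.η_mem t)
      (hX.xPrev i) (hX.yPrev i) (hX.x i) (hX.y i) (hX.p i) (hm.xPrev i) (hm.yPrev i) (hm.x i)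
      (hm.y i) (hm.p i) (h.stream.measurable t i) (h.stream.law t i) (h.stream.indepFun i
        (((hpast.xPrev i).prodMk (hpast.yPrev i)).prodMk
          (((hpast.x i).prodMk (hpast.y i)).prodMk (hpast.p i))))
    refine le_trans (le_of_eq ?_) h1
    refine integral_congr_ae (ae_of_all _ fun ω => ?_)
    simp only [← h.Lg_eq]
    rfl
  simp only [State.upperError, State.disp]
  rw [integral_finsetSum _ fun i _ => integrable_norm_sub_sq (hX.p i) (hX'.p i),
    integral_finsetSum _ fun i _ => h.integrable_upperError_summand t i,
    integral_finsetSum _ fun i _ => h.integrable_disp_summand t i]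
  refine (Finset.sum_le_sum fun i _ => key i).trans (le_of_eq ?_)
  rw [Finset.sum_add_distrib, ← Finset.mul_sum, ← Finset.mul_sum, Finset.sum_add_distrib,
    Finset.sum_const, Finset.card_univ, Fintype.card_fin, nsmul_eq_mul]
  ring

/-- Gradient tracking: mixing contracts the deviation of `u`, and the increment of the momentum
estimators perturbs it. -/
theorem tracking_step {ρ : ℝ} (hρ0 : 0 < ρ) (hρ1 : ρ < 1) (hlam : lam ≤ ρ) (t : ℕ) :
    ∫ ω, dev (process P M θ x₀ y₀ S (t + 1) ω).u ∂ν ≤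
      ρ * ∫ ω, dev (process P M θ x₀ y₀ S t ω).u ∂ν + 1 / (1 - ρ) *
      (2 * (2 * estLip c ^ 2 * θ.K ^ 4) * ∫ ω, (process P M θ x₀ y₀ S t ω).disp ∂ν +
      4 * θ.η t ^ 2 * (∫ ω, (process P M θ x₀ y₀ S t ω).upperError P c.Lg θ.K ∂ν +
        estVar c σf * θ.K ^ 4 * m)) := by
  have := h.prob
  have hX := h.isMemLp x₀ y₀ t
  have hX' := h.isMemLp x₀ y₀ (t + 1)
  have hinc := h.increment_sum_le (x₀ := x₀) (y₀ := y₀) t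
  have hi : Integrable (fun ω => ∑ i, ‖(process P M θ x₀ y₀ S (t + 1) ω).p i -
      (process P M θ x₀ y₀ S t ω).p i‖ ^ 2) ν :=
    integrable_finsetSum _ fun i _ => integrable_norm_sub_sq (hX.p i) (hX'.p i)
  have hρ : 0 ≤ 1 / (1 - ρ) := by
    have : 0 < 1 - ρ := by linarith
    positivity
  have key := integral_le_linear (MemLp.integrable_dev hX'.u) (MemLp.integrable_dev hX.u) hi
    (integrable_zero Ω ℝ ν) (integrable_zero Ω ℝ ν) (integrable_zero Ω ℝ ν) (integrable_zero Ω ℝ ν)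
    ρ (1 / (1 - ρ)) 0 0 0 0 0 (fun ω => by
      have e : (process P M θ x₀ y₀ S (t + 1) ω).u = fun i =>
          (∑ j, M i j • (process P M θ x₀ y₀ S t ω).u j) +
          ((process P M θ x₀ y₀ S (t + 1) ω).p i - (process P M θ x₀ y₀ S t ω).p i) := by
        funext i
        exact add_sub_assoc _ _ _
      have h1 := dev_mix_add_le h.doublyStochastic h.symm h.eigenvalue_le h.pos hρ0 hρ1 hlam
        (process P M θ x₀ y₀ S t ω).u (fun i => (process P M θ x₀ y₀ S (t + 1) ω).p i -
          (process P M θ x₀ y₀ S t ω).p i)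
      rw [← e] at h1
      have h2 := mul_le_mul_of_nonneg_left (dev_le_sum_norm_sq h.pos fun i =>
        (process P M θ x₀ y₀ S (t + 1) ω).p i - (process P M θ x₀ y₀ S t ω).p i) hρ
      rw [div_eq_mul_one_div, mul_comm (dev _) (1 / (1 - ρ))] at h1
      linarith)
  have := mul_le_mul_of_nonneg_left hinc hρ
  linarith

theorem consensus_step {ρ : ℝ} (hρ0 : 0 < ρ) (hρ1 : ρ < 1) (hlam : lam ≤ ρ) (t : ℕ) :
    ∫ ω, dev (process P M θ x₀ y₀ S (t + 1) ω).x ∂ν ≤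
      ρ * ∫ ω, dev (process P M θ x₀ y₀ S t ω).x ∂ν +
      θ.α t ^ 2 / (1 - ρ) * ∫ ω, dev (process P M θ x₀ y₀ S (t + 1) ω).u ∂ν := by
  have := h.prob
  have hX := h.isMemLp x₀ y₀ t
  have hX' := h.isMemLp x₀ y₀ (t + 1)
  have key := integral_le_linear (MemLp.integrable_dev hX'.x) (MemLp.integrable_dev hX.x)
    (MemLp.integrable_dev hX'.u)
    (integrable_zero Ω ℝ ν) (integrable_zero Ω ℝ ν) (integrable_zero Ω ℝ ν) (integrable_zero Ω ℝ ν)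
    ρ (θ.α t ^ 2 / (1 - ρ)) 0 0 0 0 0 (fun ω => by
      have e : (process P M θ x₀ y₀ S (t + 1) ω).x = fun i =>
          (∑ j, M i j • (process P M θ x₀ y₀ S t ω).x j) +
          (-θ.α t) • (process P M θ x₀ y₀ S (t + 1) ω).u i := by
        funext i
        rw [neg_smul, ← sub_eq_add_neg]
        rfl
      have h1 := dev_mix_add_le h.doublyStochastic h.symm h.eigenvalue_le h.pos hρ0 hρ1 hlam
        (process P M θ x₀ y₀ S t ω).x
          (fun i => (-θ.α t) • (process P M θ x₀ y₀ S (t + 1) ω).u i)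
      rw [← e, dev_smul, neg_sq, mul_div_right_comm] at h1
      linarith)
  linarith

/-- The squared displacement of the upper-level variables. -/
theorem sum_norm_sq_x_le (hlam1 : lam ≤ 1) (t : ℕ) (ω : Ω) :
    ∑ i, ‖(process P M θ x₀ y₀ S (t + 1) ω).x i - (process P M θ x₀ y₀ S t ω).x i‖ ^ 2 ≤
      6 * dev (process P M θ x₀ y₀ S t ω).x + 3 * θ.α t ^ 2 *
        (dev (process P M θ x₀ y₀ S (t + 1) ω).u +
          m * ‖mean (process P M θ x₀ y₀ S (t + 1) ω).p‖ ^ 2) := by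
  rw [← h.mean_u_eq]
  exact sum_norm_sq_step_le h.doublyStochastic h.symm h.eigenvalue_le hlam1 h.pos _ _ _

theorem disp_le (hlam1 : lam ≤ 1) (t : ℕ) :
    ∫ ω, (process P M θ x₀ y₀ S (t + 1) ω).disp ∂ν ≤
      6 * ∫ ω, dev (process P M θ x₀ y₀ S t ω).x ∂ν +
      3 * θ.α t ^ 2 * (∫ ω, dev (process P M θ x₀ y₀ S (t + 1) ω).u ∂ν +
        m * ∫ ω, ‖mean (process P M θ x₀ y₀ S (t + 1) ω).p‖ ^ 2 ∂ν) +
      θ.β t ^ 2 * (2 * ∫ ω, (process P M θ x₀ y₀ S (t + 1) ω).velocityError P ∂ν +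
        2 * c.Lg ^ 2 * ∫ ω, (process P M θ x₀ y₀ S t ω).lowerError P ∂ν) := by
  have := h.prob
  have hX := h.isMemLp x₀ y₀ t
  have hX' := h.isMemLp x₀ y₀ (t + 1)
  have key := integral_le_linear (h.integrable_disp (x₀ := x₀) (y₀ := y₀) (t + 1))
    (MemLp.integrable_dev hX.x)
    (MemLp.integrable_dev hX'.u) (h.integrable_mean_p (x₀ := x₀) (y₀ := y₀) (t + 1))
    (h.integrable_velocityError (x₀ := x₀) (y₀ := y₀) (t + 1))
    (h.integrable_lowerError (x₀ := x₀) (y₀ := y₀) t)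
    (integrable_zero Ω ℝ ν) 6 (3 * θ.α t ^ 2) (3 * θ.α t ^ 2 * m) (θ.β t ^ 2 * 2)
    (θ.β t ^ 2 * (2 * c.Lg ^ 2)) 0 0 (fun ω => by
      have h1 := h.sum_norm_sq_x_le (x₀ := x₀) (y₀ := y₀) hlam1 t ω
      have h2 : ∑ i, ‖(process P M θ x₀ y₀ S (t + 1) ω).y i -
          (process P M θ x₀ y₀ S t ω).y i‖ ^ 2 ≤
          θ.β t ^ 2 * (2 * (process P M θ x₀ y₀ S (t + 1) ω).velocityError P +
            2 * c.Lg ^ 2 * (process P M θ x₀ y₀ S t ω).lowerError P) := by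
        rw [State.velocityError, State.lowerError, Finset.mul_sum, Finset.mul_sum,
          ← Finset.sum_add_distrib, Finset.mul_sum]
        refine Finset.sum_le_sum fun i _ => ?_
        have e : (process P M θ x₀ y₀ S (t + 1) ω).y i - (process P M θ x₀ y₀ S t ω).y i =
            -(θ.β t • (process P M θ x₀ y₀ S (t + 1) ω).v i) := sub_sub_cancel_left _ _
        rw [e, norm_neg, norm_smul, mul_pow, Real.norm_eq_abs, sq_abs]
        refine mul_le_mul_of_nonneg_left ?_ (sq_nonneg _)
        have h3 := norm_add_sq_le_two ((process P M θ x₀ y₀ S (t + 1) ω).v i -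
          gradY (P.gAvg i) ((process P M θ x₀ y₀ S t ω).x i) ((process P M θ x₀ y₀ S t ω).y i))
          (gradY (P.gAvg i) ((process P M θ x₀ y₀ S t ω).x i) ((process P M θ x₀ y₀ S t ω).y i))
        rw [sub_add_cancel] at h3
        have h4 := pow_le_pow_left₀ (norm_nonneg _) ((h.regular.lower i).norm_gradY_le h.valid
          ((process P M θ x₀ y₀ S t ω).x i) ((process P M θ x₀ y₀ S t ω).y i)) 2
        rw [mul_pow] at h4
        refine h3.trans (add_le_add le_rfl ?_)
        rw [mul_assoc]
        exact mul_le_mul_of_nonneg_left h4 zero_le_two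
      have e : (process P M θ x₀ y₀ S (t + 1) ω).disp =
          ∑ i, ‖(process P M θ x₀ y₀ S (t + 1) ω).x i - (process P M θ x₀ y₀ S t ω).x i‖ ^ 2 +
          ∑ i, ‖(process P M θ x₀ y₀ S (t + 1) ω).y i - (process P M θ x₀ y₀ S t ω).y i‖ ^ 2 :=
        Finset.sum_add_distrib
      rw [e]
      linarith)
  linarith

theorem lowerError_step (hlam1 : lam ≤ 1) {t : ℕ} (hβ : 0 < θ.β t)
    (hβL : θ.β t * c.Lg ^ 2 ≤ c.μg) (hβμ : θ.β t * c.μg ≤ 1 / 2) :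
    ∫ ω, (process P M θ x₀ y₀ S (t + 1) ω).lowerError P ∂ν ≤
      (1 - θ.β t * c.μg / 2) * ∫ ω, (process P M θ x₀ y₀ S t ω).lowerError P ∂ν +
      4 / c.μg * θ.β t * ∫ ω, (process P M θ x₀ y₀ S (t + 1) ω).velocityError P ∂ν +
      4 * (c.Lg / c.μg) ^ 2 / c.μg / θ.β t *
        (6 * ∫ ω, dev (process P M θ x₀ y₀ S t ω).x ∂ν +
        3 * θ.α t ^ 2 * (∫ ω, dev (process P M θ x₀ y₀ S (t + 1) ω).u ∂ν +
        m * ∫ ω, ‖mean (process P M θ x₀ y₀ S (t + 1) ω).p‖ ^ 2 ∂ν)) := by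
  have := h.prob
  have hX := h.isMemLp x₀ y₀ t
  have hX' := h.isMemLp x₀ y₀ (t + 1)
  have hμ := h.valid.μg_pos
  set κ := 4 * (c.Lg / c.μg) ^ 2 / c.μg / θ.β t with hκ
  have hκ0 : 0 ≤ κ := by positivity
  have key := integral_le_linear (h.integrable_lowerError (x₀ := x₀) (y₀ := y₀) (t + 1))
    (h.integrable_lowerError (x₀ := x₀) (y₀ := y₀) t)
    (h.integrable_velocityError (x₀ := x₀) (y₀ := y₀) (t + 1))
    (MemLp.integrable_dev hX.x)
    (MemLp.integrable_dev hX'.u) (h.integrable_mean_p (x₀ := x₀) (y₀ := y₀) (t + 1))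
    (integrable_zero Ω ℝ ν) (1 - θ.β t * c.μg / 2) (4 / c.μg * θ.β t) (κ * 6)
    (κ * (3 * θ.α t ^ 2)) (κ * (3 * θ.α t ^ 2 * m)) 0 0 (fun ω => by
      have h1 := mul_le_mul_of_nonneg_left
        (h.sum_norm_sq_x_le (x₀ := x₀) (y₀ := y₀) hlam1 t ω) hκ0
      have h2 : (process P M θ x₀ y₀ S (t + 1) ω).lowerError P ≤
          (1 - θ.β t * c.μg / 2) * (process P M θ x₀ y₀ S t ω).lowerError P +
          4 / c.μg * θ.β t * (process P M θ x₀ y₀ S (t + 1) ω).velocityError P +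
          κ * ∑ i, ‖(process P M θ x₀ y₀ S (t + 1) ω).x i -
            (process P M θ x₀ y₀ S t ω).x i‖ ^ 2 := by
        rw [State.velocityError, State.lowerError, State.lowerError, Finset.mul_sum, Finset.mul_sum,
          Finset.mul_sum, ← Finset.sum_add_distrib, ← Finset.sum_add_distrib]
        exact Finset.sum_le_sum fun i _ => (h.regular.lower i).lower_step_le h.valid hβ hβL hβμ
          ((process P M θ x₀ y₀ S t ω).x i) ((process P M θ x₀ y₀ S (t + 1) ω).x i)
          ((process P M θ x₀ y₀ S t ω).y i) ((process P M θ x₀ y₀ S (t + 1) ω).v i)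
      linarith)
  linarith

theorem descent_step {bias : ℝ} (hbias : ∀ i x y,
    ‖P.meanGrad c.Lg θ.K i x y - P.barGrad i x y‖ ^ 2 ≤ bias) {t : ℕ} (hα : 0 ≤ θ.α t)
    (hαL : valueLip c * θ.α t ≤ 1 / 4) :
    ∫ ω, P.obj (mean (process P M θ x₀ y₀ S (t + 1) ω).x) ∂ν ≤
      ∫ ω, P.obj (mean (process P M θ x₀ y₀ S t ω).x) ∂ν -
      θ.α t / 2 * ∫ ω, ‖gradient P.obj (mean (process P M θ x₀ y₀ S t ω).x)‖ ^ 2 ∂ν -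
      θ.α t / 4 * ∫ ω, ‖mean (process P M θ x₀ y₀ S (t + 1) ω).p‖ ^ 2 ∂ν +
      2 * θ.α t * (valueLip c ^ 2 * ∫ ω, dev (process P M θ x₀ y₀ S t ω).x ∂ν +
        hyperLip c ^ 2 * ∫ ω, (process P M θ x₀ y₀ S t ω).lowerError P ∂ν + m * bias +
        ∫ ω, (process P M θ x₀ y₀ S (t + 1) ω).upperError P c.Lg θ.K ∂ν) := by
  have := h.prob
  have hX := h.isMemLp x₀ y₀ t
  have key := integral_le_linear (h.integrable_obj (x₀ := x₀) (y₀ := y₀) (t + 1))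
    (h.integrable_obj (x₀ := x₀) (y₀ := y₀) t) (h.integrable_gradient (x₀ := x₀) (y₀ := y₀) t)
    (h.integrable_mean_p (x₀ := x₀) (y₀ := y₀) (t + 1))
    (MemLp.integrable_dev hX.x) (h.integrable_lowerError (x₀ := x₀) (y₀ := y₀) t)
    (h.integrable_upperError (x₀ := x₀) (y₀ := y₀) (t + 1))
    1 (-(θ.α t / 2)) (-(θ.α t / 4)) (2 * θ.α t * valueLip c ^ 2) (2 * θ.α t * hyperLip c ^ 2)
    (2 * θ.α t) (2 * θ.α t * (m * bias)) (fun ω => by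
      have e : mean (process P M θ x₀ y₀ S (t + 1) ω).x = mean (process P M θ x₀ y₀ S t ω).x -
          θ.α t • mean (process P M θ x₀ y₀ S (t + 1) ω).p := by
        have e1 : (process P M θ x₀ y₀ S (t + 1) ω).x = fun i =>
          (∑ j, M i j • (process P M θ x₀ y₀ S t ω).x j) -
          θ.α t • (process P M θ x₀ y₀ S (t + 1) ω).u i := rfl
        rw [e1, mean_sub, mean_mix h.doublyStochastic, mean_smul, h.mean_u_eq]
      have h1 := h.regular.descent_step_le h.valid h.pos hα hαL
        (mean (process P M θ x₀ y₀ S t ω).x) (mean (process P M θ x₀ y₀ S (t + 1) ω).p)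
      have h2 := h.regular.norm_gradient_sub_mean_sq_le h.valid h.pos
        (process P M θ x₀ y₀ S t ω).x (process P M θ x₀ y₀ S (t + 1) ω).p
        (fun i => P.meanGrad c.Lg θ.K i ((process P M θ x₀ y₀ S t ω).x i)
          ((process P M θ x₀ y₀ S t ω).y i)) (process P M θ x₀ y₀ S t ω).y
        (fun i => hbias i _ _)
      have h3 := mul_le_mul_of_nonneg_left h2 (show 0 ≤ θ.α t / 2 by positivity)
      have e2 : (process P M θ x₀ y₀ S (t + 1) ω).upperError P c.Lg θ.K =
        ∑ i, ‖(process P M θ x₀ y₀ S (t + 1) ω).p i - P.meanGrad c.Lg θ.K i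
          ((process P M θ x₀ y₀ S t ω).x i) ((process P M θ x₀ y₀ S t ω).y i)‖ ^ 2 := rfl
      rw [e, e2, State.lowerError]
      linarith)
  linarith

end IsRun

end

/-! ### A common constant for the recursions -/

/-- A bound for the squared expected hypergradient estimators at the starting point. -/
noncomputable def initialGradBound (c : Constants) (Δ : ℝ) : ℝ :=
  4 * (Δ + hyperLip c ^ 2 * Δ + 1 / c.Cgxy)

/-- `C` is large enough to serve in all recursions for the expected errors. -/
structure Dominates (C ρ : ℝ) (c : Constants) (m : ℕ) (σg Δ : ℝ) : Prop where
  two_le : 2 ≤ C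
  consensus_bias : 2 * valueLip c ^ 2 ≤ C
  lower_bias : 2 * hyperLip c ^ 2 ≤ C
  velocity : 4 / c.μg ≤ C
  minimizer_drift : 4 * (c.Lg / c.μg) ^ 2 / c.μg * (6 + 3 * m) ≤ C
  tracking : 4 * m / (1 - ρ) ≤ C
  upper : 16 + 2 * m ≤ C
  low : 2 * m * σg ^ 2 + 8 * c.Lg ^ 2 ≤ C
  disp : 8 + 3 * m + 2 * c.Lg ^ 2 ≤ C
  bias : m / c.Cgxy ≤ C
  initial_upper : 4 * m * (initialGradBound c Δ + 1) ≤ C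
  initial_velocity : m * (c.Lg ^ 2 * Δ) + 2 * m * σg ^ 2 ≤ C
  initial_lower : m * Δ ≤ C
  gap : Δ ≤ C

theorem exists_dominates {c : Constants} (hc : c.Valid) {ρ : ℝ} (hρ : ρ < 1) (m : ℕ) (σg : ℝ)
    {Δ : ℝ} (hΔ : 0 ≤ Δ) : ∃ C, Dominates C ρ c m σg Δ := by
  have hμ := hc.μg_pos
  have hC := hc.Cgxy_pos
  have h1ρ : 0 < 1 - ρ := by linarith
  have i1 : 0 ≤ 2 * valueLip c ^ 2 := by positivity
  have i2 : 0 ≤ 2 * hyperLip c ^ 2 := by positivity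
  have i3 : 0 ≤ 4 / c.μg := by positivity
  have i4 : 0 ≤ 4 * (c.Lg / c.μg) ^ 2 / c.μg * (6 + 3 * m) := by positivity
  have i5 : 0 ≤ 4 * m / (1 - ρ) := by positivity
  have i6 : (0 : ℝ) ≤ 16 + 2 * m := by positivity
  have i7 : 0 ≤ 2 * m * σg ^ 2 + 8 * c.Lg ^ 2 := by positivity
  have i8 : 0 ≤ 8 + 3 * m + 2 * c.Lg ^ 2 := by positivity
  have i9 : 0 ≤ m / c.Cgxy := by positivity
  have i10 : 0 ≤ 4 * m * (initialGradBound c Δ + 1) := by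
    unfold initialGradBound; positivity
  have i11 : 0 ≤ m * (c.Lg ^ 2 * Δ) + 2 * m * σg ^ 2 := by positivity
  have i12 : 0 ≤ m * Δ := by positivity
  refine ⟨2 + 2 * valueLip c ^ 2 + 2 * hyperLip c ^ 2 + 4 / c.μg +
    4 * (c.Lg / c.μg) ^ 2 / c.μg * (6 + 3 * m) + 4 * m / (1 - ρ) + (16 + 2 * m) +
    (2 * m * σg ^ 2 + 8 * c.Lg ^ 2) + (8 + 3 * m + 2 * c.Lg ^ 2) + m / c.Cgxy +
    4 * m * (initialGradBound c Δ + 1) + (m * (c.Lg ^ 2 * Δ) + 2 * m * σg ^ 2) + m * Δ + Δ, ?_⟩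
  constructor <;> linarith

section

variable {m a b : ℕ} {Ξ Z Ω : Type*} [MeasurableSpace Ξ] [MeasurableSpace Z]
  [MeasurableSpace Ω] {P : Problem m a b Ξ Z} {M : Matrix (Fin m) (Fin m) ℝ} {θ : Params}
  {c : Constants} {σf : ℕ → ℝ} {σg lam : ℝ} {S : ℕ → Fin m → Ω → IterSample Ξ Z θ.K}
  {ν : Measure Ω} {x₀ : E a} {y₀ : E b}

theorem Problem.norm_meanGrad_initial_sq_le (hR : P.Regular c σf σg) (hc : c.Valid) {Δ : ℝ}
    (hΔ : P.InitialBound x₀ y₀ Δ) {K : ℕ} {bias : ℝ}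
    (hbias : ∀ i x y, ‖P.meanGrad c.Lg K i x y - P.barGrad i x y‖ ^ 2 ≤ bias)
    (hbias1 : bias ≤ 1 / c.Cgxy) (i : Fin m) :
    ‖P.meanGrad c.Lg K i x₀ y₀‖ ^ 2 ≤ initialGradBound c Δ := by
  have h1 := hΔ.hypergradient i
  rw [(hR.hasGradientAt_localObj hc i x₀).gradient] at h1
  have h2 : ‖P.barGrad i x₀ y₀ - P.barGrad i x₀ (P.ystar i x₀)‖ ^ 2 ≤ hyperLip c ^ 2 * Δ := by
    have h3 := pow_le_pow_left₀ (norm_nonneg _)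
      ((hR.lower i).hyperGrad_lipschitz hc (hR.upper i) x₀ y₀ x₀ (P.ystar i x₀)) 2
    rw [sub_self, norm_zero, zero_add, mul_pow] at h3
    exact h3.trans (mul_le_mul_of_nonneg_left (hΔ.lower_error i) (sq_nonneg _))
  have h4 := hbias i x₀ y₀
  have h5 := norm_add_sq_le_two (P.barGrad i x₀ (P.ystar i x₀))
    (P.barGrad i x₀ y₀ - P.barGrad i x₀ (P.ystar i x₀))
  have h6 := norm_add_sq_le_two (P.barGrad i x₀ y₀)
    (P.meanGrad c.Lg K i x₀ y₀ - P.barGrad i x₀ y₀)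
  rw [add_sub_cancel] at h5 h6
  have h7 : 0 ≤ ‖P.meanGrad c.Lg K i x₀ y₀ - P.barGrad i x₀ y₀‖ ^ 2 := sq_nonneg _
  rw [initialGradBound]
  linarith

theorem integral_disp_zero : ∫ ω, (process P M θ x₀ y₀ S 0 ω).disp ∂ν = 0 := by
  have e : ∀ ω, (process P M θ x₀ y₀ S 0 ω).disp =
      ∑ i : Fin m, (‖x₀ - x₀‖ ^ 2 + ‖y₀ - y₀‖ ^ 2) := fun ω => rfl
  simp [e]

namespace IsRun

variable (h : IsRun P M θ c σf σg lam S ν)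

include h

theorem upperError_zero_le {Δ bias : ℝ} (hΔ : P.InitialBound x₀ y₀ Δ)
    (hbias : ∀ i x y, ‖P.meanGrad c.Lg θ.K i x y - P.barGrad i x y‖ ^ 2 ≤ bias)
    (hbias1 : bias ≤ 1 / c.Cgxy) :
    ∫ ω, (process P M θ x₀ y₀ S 0 ω).upperError P c.Lg θ.K ∂ν ≤ m * initialGradBound c Δ := by
  have := h.prob
  have e : ∀ ω, (process P M θ x₀ y₀ S 0 ω).upperError P c.Lg θ.K =
      ∑ i : Fin m, ‖(0 : E a) - P.meanGrad c.Lg θ.K i x₀ y₀‖ ^ 2 := fun ω => rfl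
  simp_rw [e]
  rw [integral_const, probReal_univ, one_smul]
  refine (Finset.sum_le_sum fun i _ => ?_).trans (le_of_eq ?_) (b := ∑ i : Fin m,
    initialGradBound c Δ)
  · rw [zero_sub, norm_neg]
    exact Problem.norm_meanGrad_initial_sq_le h.regular h.valid hΔ hbias hbias1 i
  · simp

theorem velocityError_zero_le {Δ : ℝ} (hΔ : P.InitialBound x₀ y₀ Δ) :
    ∫ ω, (process P M θ x₀ y₀ S 0 ω).velocityError P ∂ν ≤ m * (c.Lg ^ 2 * Δ) := by
  have := h.prob
  have e : ∀ ω, (process P M θ x₀ y₀ S 0 ω).velocityError P =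
      ∑ i : Fin m, ‖(0 : E b) - gradY (P.gAvg i) x₀ y₀‖ ^ 2 := fun ω => rfl
  simp_rw [e]
  rw [integral_const, probReal_univ, one_smul]
  refine (Finset.sum_le_sum fun i _ => ?_).trans (le_of_eq ?_) (b := ∑ i : Fin m,
    c.Lg ^ 2 * Δ)
  · rw [zero_sub, norm_neg]
    have h1 := pow_le_pow_left₀ (norm_nonneg _) ((h.regular.lower i).norm_gradY_le h.valid x₀ y₀) 2
    rw [mul_pow, norm_sub_rev] at h1
    exact h1.trans (mul_le_mul_of_nonneg_left (hΔ.lower_error i) (sq_nonneg _))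
  · simp

set_option maxHeartbeats 1000000 in
/-- The expected errors of a run satisfy the abstract recursions. The error terms of the momentum
estimators and of the tracked directions at time `t` are read off the state after iteration `t`. -/
theorem errorRecursions {C ρ Δ cβ k cγ R bias : ℝ} (hC : Dominates C ρ c m σg Δ)
    (hρ0 : 0 < ρ) (hρ1 : ρ < 1) (hlam : lam ≤ ρ) (hR1 : 1 ≤ R)
    (hL : 2 * estLip c ^ 2 * θ.K ^ 4 ≤ R) (hσ : estVar c σf * θ.K ^ 4 ≤ R)
    (hΔ : P.InitialBound x₀ y₀ Δ)
    (hbias : ∀ i x y, ‖P.meanGrad c.Lg θ.K i x y - P.barGrad i x y‖ ^ 2 ≤ bias)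
    (hbias1 : bias ≤ 1 / c.Cgxy) (hcβ : 0 < cβ) (hα : ∀ t, 0 < θ.α t)
    (hβ : ∀ t, θ.β t = cβ * θ.α t) (hη : ∀ t, θ.η (t + 1) = k * R * θ.α t ^ 2)
    (hγ : ∀ t, θ.γ (t + 1) = cγ * θ.α t ^ 2) (hαL : ∀ t, valueLip c * θ.α t ≤ 1 / 4)
    (hβL : ∀ t, θ.β t * c.Lg ^ 2 ≤ c.μg) (hβμ : ∀ t, θ.β t * c.μg ≤ 1 / 2) :
    ErrorRecursions C ρ c.μg cβ k cγ R (m * bias) θ.α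
      (fun t => ∫ ω, P.obj (mean (process P M θ x₀ y₀ S t ω).x) ∂ν)
      (fun t => ∫ ω, ‖gradient P.obj (mean (process P M θ x₀ y₀ S t ω).x)‖ ^ 2 ∂ν)
      (fun t => ∫ ω, ‖mean (process P M θ x₀ y₀ S (t + 1) ω).p‖ ^ 2 ∂ν)
      (fun t => ∫ ω, (process P M θ x₀ y₀ S t ω).lowerError P ∂ν)
      (fun t => ∫ ω, dev (process P M θ x₀ y₀ S t ω).x ∂ν)
      (fun t => ∫ ω, dev (process P M θ x₀ y₀ S (t + 1) ω).u ∂ν)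
      (fun t => ∫ ω, (process P M θ x₀ y₀ S (t + 1) ω).upperError P c.Lg θ.K ∂ν)
      (fun t => ∫ ω, (process P M θ x₀ y₀ S (t + 1) ω).velocityError P ∂ν)
      (fun t => ∫ ω, (process P M θ x₀ y₀ S (t + 1) ω).disp ∂ν) := by
  have := h.prob
  have hC0 : 0 ≤ C := by linarith [hC.two_le]
  have hlam1 : lam ≤ 1 := hlam.trans hρ1.le
  have h1ρ : 0 < 1 - ρ := by linarith
  have hm1 : (1 : ℝ) ≤ m := by exact_mod_cast h.pos
  have hm0 : (0 : ℝ) ≤ m := by linarith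
  have hμ := h.valid.μg_pos
  have hG0 : ∀ t, 0 ≤ ∫ ω, ‖gradient P.obj (mean (process P M θ x₀ y₀ S t ω).x)‖ ^ 2 ∂ν :=
    fun t => integral_nonneg fun ω => sq_nonneg _
  have hN0 : ∀ t, 0 ≤ ∫ ω, ‖mean (process P M θ x₀ y₀ S t ω).p‖ ^ 2 ∂ν :=
    fun t => integral_nonneg fun ω => sq_nonneg _
  have hr0 : ∀ t, 0 ≤ ∫ ω, (process P M θ x₀ y₀ S t ω).lowerError P ∂ν :=
    fun t => integral_nonneg fun ω => Finset.sum_nonneg fun i _ => sq_nonneg _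
  have hc0 : ∀ t, 0 ≤ ∫ ω, dev (process P M θ x₀ y₀ S t ω).x ∂ν :=
    fun t => integral_nonneg fun ω => dev_nonneg _
  have hs0 : ∀ t, 0 ≤ ∫ ω, dev (process P M θ x₀ y₀ S t ω).u ∂ν :=
    fun t => integral_nonneg fun ω => dev_nonneg _
  have he0 : ∀ t, 0 ≤ ∫ ω, (process P M θ x₀ y₀ S t ω).upperError P c.Lg θ.K ∂ν :=
    fun t => integral_nonneg fun ω => Finset.sum_nonneg fun i _ => sq_nonneg _
  have hf0 : ∀ t, 0 ≤ ∫ ω, (process P M θ x₀ y₀ S t ω).velocityError P ∂ν :=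
    fun t => integral_nonneg fun ω => Finset.sum_nonneg fun i _ => sq_nonneg _
  have hD0 : ∀ t, 0 ≤ ∫ ω, (process P M θ x₀ y₀ S t ω).disp ∂ν :=
    fun t => integral_nonneg fun ω => Finset.sum_nonneg fun i _ => by positivity
  have hbias0 : 0 ≤ bias := le_trans (sq_nonneg _) (hbias ⟨0, h.pos⟩ x₀ y₀)
  refine ⟨hG0, fun t => hN0 _, hr0, hc0, fun t => hs0 _, fun t => he0 _, fun t => hf0 _,
    fun t => hD0 _, fun t => ?_, fun t => ?_, fun t => ?_, fun t => ?_, fun t => ?_, fun t => ?_,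
    fun t => ?_, ?_, ?_, ?_, ?_, ?_, fun t => ?_⟩
  · -- descent
    have key := h.descent_step (x₀ := x₀) (y₀ := y₀) hbias (hα t).le (hαL t)
    have h1 := mul_le_mul_of_nonneg_right hC.consensus_bias (hc0 t)
    have h2 := mul_le_mul_of_nonneg_right hC.lower_bias (hr0 t)
    have h3 := mul_le_mul_of_nonneg_right hC.two_le (mul_nonneg hm0 hbias0)
    have h4 := mul_le_mul_of_nonneg_right hC.two_le (he0 (t + 1))
    have h5 := mul_le_mul_of_nonneg_left (add_le_add (add_le_add (add_le_add h1 h2) h3) h4)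
      (hα t).le
    linarith
  · -- lower-level error
    have key := h.lowerError_step (x₀ := x₀) (y₀ := y₀) hlam1 (t := t)
      (by rw [hβ]; exact mul_pos hcβ (hα t)) (hβL t) (hβμ t)
    have hβ0 : 0 < cβ * θ.α t := mul_pos hcβ (hα t)
    rw [hβ] at key
    have h1 := mul_le_mul_of_nonneg_right hC.velocity (mul_nonneg hβ0.le (hf0 (t + 1)))
    set κ := 4 * (c.Lg / c.μg) ^ 2 / c.μg with hκ
    have hκ0 : 0 ≤ κ := by positivity
    have hsN := add_nonneg (hs0 (t + 1)) (hN0 (t + 1))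
    have h2 : 6 * ∫ ω, dev (process P M θ x₀ y₀ S t ω).x ∂ν + 3 * θ.α t ^ 2 *
        (∫ ω, dev (process P M θ x₀ y₀ S (t + 1) ω).u ∂ν +
        m * ∫ ω, ‖mean (process P M θ x₀ y₀ S (t + 1) ω).p‖ ^ 2 ∂ν) ≤
        (6 + 3 * m) * (∫ ω, dev (process P M θ x₀ y₀ S t ω).x ∂ν + θ.α t ^ 2 *
        (∫ ω, dev (process P M θ x₀ y₀ S (t + 1) ω).u ∂ν +
        ∫ ω, ‖mean (process P M θ x₀ y₀ S (t + 1) ω).p‖ ^ 2 ∂ν)) := by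
      have g1 := mul_nonneg hm0 (hc0 t)
      have g2 := mul_nonneg (sq_nonneg (θ.α t)) (hs0 (t + 1))
      have g3 := mul_nonneg (sq_nonneg (θ.α t)) (hN0 (t + 1))
      have g4 := mul_nonneg hm0 g2
      have g5 := mul_nonneg hm0 g3
      linarith
    have h3 := mul_le_mul_of_nonneg_left h2 (div_nonneg hκ0 hβ0.le)
    have h4 := mul_le_mul_of_nonneg_right hC.minimizer_drift (div_nonneg (add_nonneg (hc0 t)
      (mul_nonneg (sq_nonneg (θ.α t)) hsN)) hβ0.le)
    have e1 : ∀ W : ℝ, κ / (cβ * θ.α t) * ((6 + 3 * m) * W) =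
        κ * (6 + 3 * m) * (W / (cβ * θ.α t)) := fun W => by ring
    have e2 : ∀ W : ℝ, C / (cβ * θ.α t) * W = C * (W / (cβ * θ.α t)) := fun W => by ring
    rw [e1] at h3
    rw [e2]
    have e3 : ∀ W : ℝ, C * (cβ * θ.α t) * W = C * (cβ * θ.α t * W) := fun W => by ring
    have e4 : ∀ W : ℝ, 4 / c.μg * (cβ * θ.α t) * W = 4 / c.μg * (cβ * θ.α t * W) :=
      fun W => by ring
    rw [e4] at key
    rw [e3]
    linarith
  · -- consensus
    have key := h.consensus_step (x₀ := x₀) (y₀ := y₀) hρ0 hρ1 hlam t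
    have h1 : 1 / (1 - ρ) ≤ C := by
      refine le_trans ?_ hC.tracking
      exact div_le_div_of_nonneg_right (by linarith) h1ρ.le
    have h2 := mul_le_mul_of_nonneg_right h1
      (mul_nonneg (sq_nonneg (θ.α t)) (hs0 (t + 1)))
    have e : θ.α t ^ 2 / (1 - ρ) * ∫ ω, dev (process P M θ x₀ y₀ S (t + 1) ω).u ∂ν =
      1 / (1 - ρ) * (θ.α t ^ 2 * ∫ ω, dev (process P M θ x₀ y₀ S (t + 1) ω).u ∂ν) := by ring
    rw [e] at key
    linarith
  · -- tracking
    have key := h.tracking_step (x₀ := x₀) (y₀ := y₀) hρ0 hρ1 hlam (t + 1)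
    rw [hη] at key
    set η2 := (k * R * θ.α t ^ 2) ^ 2 with hη2
    have hη20 : 0 ≤ η2 := sq_nonneg _
    have hD := hD0 (t + 1)
    have he := he0 (t + 1)
    generalize (∫ ω, (process P M θ x₀ y₀ S (t + 1) ω).disp ∂ν) = D at *
    generalize (∫ ω, (process P M θ x₀ y₀ S (t + 1) ω).upperError P c.Lg θ.K ∂ν) = e at *
    have h1 : 2 * (2 * estLip c ^ 2 * θ.K ^ 4) * D + 4 * η2 * (e + estVar c σf * θ.K ^ 4 * m) ≤
        4 * m * (R * D + η2 * (e + R)) := by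
      have g1 := mul_le_mul_of_nonneg_right hL hD
      have g2 := mul_le_mul_of_nonneg_left (mul_le_mul_of_nonneg_right hσ hm0) hη20
      have g3 := mul_le_mul_of_nonneg_right hm1 (mul_nonneg (zero_le_one.trans hR1) hD)
      have g4 := mul_le_mul_of_nonneg_right hm1 (mul_nonneg hη20 he)
      have g5 := mul_nonneg (zero_le_one.trans hR1) hD
      linarith
    have hW : 0 ≤ R * D + η2 * (e + R) := by positivity
    have h2 := mul_le_mul_of_nonneg_left h1 (show 0 ≤ 1 / (1 - ρ) by positivity)
    have h3 := mul_le_mul_of_nonneg_right hC.tracking hW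
    have e1 : 1 / (1 - ρ) * (4 * m * (R * D + η2 * (e + R))) =
      4 * m / (1 - ρ) * (R * D + η2 * (e + R)) := by ring
    rw [e1] at h2
    linarith
  · -- momentum estimator of the hypergradients
    have key := h.upperError_step (x₀ := x₀) (y₀ := y₀) (t + 1)
    rw [hη] at key
    have hη20 : 0 ≤ (k * R * θ.α t ^ 2) ^ 2 := sq_nonneg _
    have hD := hD0 (t + 1)
    have hR0 := zero_le_one.trans hR1
    have g1 := mul_le_mul_of_nonneg_right hL hD
    have g2 := mul_le_mul_of_nonneg_left (mul_le_mul_of_nonneg_right hσ hm0) hη20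
    have g3 := mul_le_mul_of_nonneg_right hC.upper (add_nonneg (mul_nonneg hη20 hR0)
      (mul_nonneg hR0 hD))
    have g4 := mul_nonneg hη20 hR0
    have g5 := mul_nonneg hR0 hD
    have g6 := mul_nonneg hm0 g5
    linarith
  · -- momentum estimator of the lower-level gradients
    have key := h.velocityError_step (x₀ := x₀) (y₀ := y₀) (t + 1)
    rw [hγ] at key
    have hγ20 : 0 ≤ (cγ * θ.α t ^ 2) ^ 2 := sq_nonneg _
    have hD := hD0 (t + 1)
    have g3 := mul_le_mul_of_nonneg_right hC.low (add_nonneg hγ20 hD)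
    have g4 : 0 ≤ 8 * c.Lg ^ 2 * (cγ * θ.α t ^ 2) ^ 2 := by positivity
    have g5 : 0 ≤ 2 * m * σg ^ 2 * ∫ ω, (process P M θ x₀ y₀ S (t + 1) ω).disp ∂ν := by positivity
    linarith
  · -- displacement
    have key := h.disp_le (x₀ := x₀) (y₀ := y₀) hlam1 t
    rw [hβ] at key
    have g1 := hc0 t
    have g2 := mul_nonneg (sq_nonneg (θ.α t)) (hs0 (t + 1))
    have g3 := mul_nonneg (sq_nonneg (θ.α t)) (hN0 (t + 1))
    have g4 := mul_nonneg (sq_nonneg (cβ * θ.α t)) (hf0 (t + 1))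
    have g5 := mul_nonneg (sq_nonneg (cβ * θ.α t)) (hr0 t)
    have k1 := mul_le_mul_of_nonneg_right hC.disp
      (add_nonneg (add_nonneg g1 (add_nonneg g2 g3)) (add_nonneg g4 g5))
    have hLg := sq_nonneg c.Lg
    have l1 := mul_nonneg hm0 g1
    have l2 := mul_nonneg hm0 g2
    have l3 := mul_nonneg hm0 g3
    have l4 := mul_nonneg hm0 g4
    have l5 := mul_nonneg hm0 g5
    have m1 := mul_nonneg hLg g1
    have m2 := mul_nonneg hLg g2
    have m3 := mul_nonneg hLg g3
    have m4 := mul_nonneg hLg g4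
    linarith
  · -- initial lower-level error
    have e : ∀ ω, (process P M θ x₀ y₀ S 0 ω).lowerError P =
      ∑ i : Fin m, ‖P.ystar i x₀ - y₀‖ ^ 2 := fun ω => rfl
    simp only [e]
    rw [integral_const, probReal_univ, one_smul]
    refine (Finset.sum_le_sum fun i _ => ?_).trans (le_trans (le_of_eq ?_) hC.initial_lower)
      (b := ∑ i : Fin m, Δ)
    · rw [norm_sub_rev]; exact hΔ.lower_error i
    · simp
  · have e : ∀ ω, dev (process P M θ x₀ y₀ S 0 ω).x = 0 := fun ω => dev_const h.pos x₀
    simp only [e, integral_zero]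
  · -- initial tracking error
    have key := h.increment_sum_le (x₀ := x₀) (y₀ := y₀) 0
    rw [integral_disp_zero] at key
    have h0 := h.upperError_zero_le (x₀ := x₀) (y₀ := y₀) hΔ hbias hbias1
    have h1 : ∫ ω, dev (process P M θ x₀ y₀ S (0 + 1) ω).u ∂ν ≤
        ∫ ω, ∑ i, ‖(process P M θ x₀ y₀ S (0 + 1) ω).p i - (process P M θ x₀ y₀ S 0 ω).p i‖ ^ 2
          ∂ν := by
      have hX := h.isMemLp x₀ y₀ 0
      have hX' := h.isMemLp x₀ y₀ (0 + 1)
      refine integral_mono (MemLp.integrable_dev hX'.u) (integrable_finsetSum _ fun i _ =>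
        integrable_norm_sub_sq (hX.p i) (hX'.p i)) fun ω => ?_
      refine (dev_le_sum_norm_sq h.pos _).trans (le_of_eq (Finset.sum_congr rfl fun i _ => ?_))
      have e : (process P M θ x₀ y₀ S (0 + 1) ω).u i = (∑ j, M i j • (0 : E a)) +
        (process P M θ x₀ y₀ S (0 + 1) ω).p i - (process P M θ x₀ y₀ S 0 ω).p i := rfl
      rw [e]
      simp
    have hη1 : θ.η 0 ^ 2 ≤ 1 := pow_le_one₀ (h.η_mem 0).1 (h.η_mem 0).2
    have h2 : ∫ ω, (process P M θ x₀ y₀ S 0 ω).upperError P c.Lg θ.K ∂ν +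
        estVar c σf * θ.K ^ 4 * m ≤ m * (initialGradBound c Δ + R) := by
      have := mul_le_mul_of_nonneg_right hσ hm0
      linarith
    have hB : 0 ≤ m * initialGradBound c Δ := (he0 0).trans h0
    have h3 : 4 * θ.η 0 ^ 2 * (∫ ω, (process P M θ x₀ y₀ S 0 ω).upperError P c.Lg θ.K ∂ν +
        estVar c σf * θ.K ^ 4 * m) ≤ 4 * 1 * (m * (initialGradBound c Δ + R)) := by
      have hb : 0 ≤ m * (initialGradBound c Δ + R) := by
        have := mul_nonneg hm0 (zero_le_one.trans hR1)
        linarith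
      calc _ ≤ 4 * θ.η 0 ^ 2 * (m * (initialGradBound c Δ + R)) :=
            mul_le_mul_of_nonneg_left h2 (by positivity)
        _ ≤ _ := mul_le_mul_of_nonneg_right (by linarith) hb
    have h4 := mul_le_mul_of_nonneg_right hC.initial_upper (zero_le_one.trans hR1)
    have h5 := mul_le_mul_of_nonneg_left hR1 hB
    linarith
  · -- initial error of the upper momentum estimator
    have key := h.upperError_step (x₀ := x₀) (y₀ := y₀) 0
    rw [integral_disp_zero] at key
    have h0 := h.upperError_zero_le (x₀ := x₀) (y₀ := y₀) hΔ hbias hbias1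
    have hη1 : θ.η 0 ^ 2 ≤ 1 := pow_le_one₀ (h.η_mem 0).1 (h.η_mem 0).2
    have h1 := mul_le_mul_of_nonneg_right (show 1 - θ.η 0 ≤ 1 by linarith [(h.η_mem 0).1]) (he0 0)
    have hB : 0 ≤ m * initialGradBound c Δ := (he0 0).trans h0
    have h2 : 2 * θ.η 0 ^ 2 * (estVar c σf * θ.K ^ 4) * m ≤ 2 * 1 * R * m := by
      refine mul_le_mul_of_nonneg_right ?_ hm0
      calc _ ≤ 2 * θ.η 0 ^ 2 * R := mul_le_mul_of_nonneg_left hσ (by positivity)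
        _ ≤ _ := mul_le_mul_of_nonneg_right (by linarith) (zero_le_one.trans hR1)
    have h4 := mul_le_mul_of_nonneg_right hC.initial_upper (zero_le_one.trans hR1)
    have h5 := mul_le_mul_of_nonneg_left hR1 hB
    have h6 := mul_nonneg hm0 (zero_le_one.trans hR1)
    linarith
  · -- initial error of the lower momentum estimator
    have key := h.velocityError_step (x₀ := x₀) (y₀ := y₀) 0
    rw [integral_disp_zero] at key
    have h0 := h.velocityError_zero_le (x₀ := x₀) (y₀ := y₀) hΔ
    have hγ1 : θ.γ 0 ^ 2 ≤ 1 := pow_le_one₀ (h.γ_mem 0).1 (h.γ_mem 0).2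
    have h1 := mul_le_mul_of_nonneg_right (show 1 - θ.γ 0 ≤ 1 by linarith [(h.γ_mem 0).1]) (hf0 0)
    have h2 : 2 * θ.γ 0 ^ 2 * σg ^ 2 * m ≤ 2 * 1 * σg ^ 2 * m :=
      mul_le_mul_of_nonneg_right (mul_le_mul_of_nonneg_right (by linarith) (sq_nonneg _)) hm0
    have h3 := hC.initial_velocity
    linarith
  · -- gap
    have e : ∀ ω, P.obj (mean (process P M θ x₀ y₀ S 0 ω).x) = P.obj x₀ := fun ω => by
      rw [show (process P M θ x₀ y₀ S 0 ω).x = fun _ => x₀ from rfl, mean_const h.pos]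
    simp only [e]
    rw [integral_const, probReal_univ, one_smul]
    have h1 : P.obj x₀ - Δ ≤ ∫ ω, P.obj (mean (process P M θ x₀ y₀ S t ω).x) ∂ν := by
      have h2 := integral_mono (integrable_const (P.obj x₀ - Δ))
        (h.integrable_obj (x₀ := x₀) (y₀ := y₀) t) fun ω => by
          have := hΔ.gap (mean (process P M θ x₀ y₀ S t ω).x)
          simp only
          linarith
      rwa [integral_const, probReal_univ, one_smul] at h2
    linarith [hC.gap]

end IsRun

end

/-! ### Replacing exceptional samples -/

/-- A property that holds almost surely holds everywhere after a measurable modification of the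
sample on a null set. -/
theorem exists_measurable_retract {Ξ : Type*} [MeasurableSpace Ξ] {μ : Measure Ξ}
    [IsProbabilityMeasure μ] {p : Ξ → Prop} (h : ∀ᵐ ξ ∂μ, p ξ) :
    ∃ φ : Ξ → Ξ, Measurable φ ∧ (∀ ξ, p (φ ξ)) ∧ ∀ᵐ ξ ∂μ, φ ξ = ξ := by
  classical
  set N := toMeasurable μ {ξ | ¬ p ξ} with hN
  have hN0 : μ N = 0 := by rw [hN, measure_toMeasurable]; exact h
  have hNm : MeasurableSet N := measurableSet_toMeasurable _ _
  have hp : ∀ ξ, ξ ∉ N → p ξ := fun ξ hξ => by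
    by_contra hc
    exact hξ (subset_toMeasurable _ _ hc)
  have hae : ∀ᵐ ξ ∂μ, ξ ∉ N := measure_eq_zero_iff_ae_notMem.1 hN0
  obtain ⟨ξ₀, hξ₀⟩ := hae.exists
  refine ⟨fun ξ => if ξ ∈ N then ξ₀ else ξ, Measurable.ite hNm measurable_const measurable_id,
    fun ξ => ?_, ?_⟩
  · by_cases hξ : ξ ∈ N
    · simpa [hξ] using hp _ hξ₀
    · simpa [hξ] using hp _ hξ
  · filter_upwards [hae] with ξ hξ
    simp [hξ]

namespace Problem

variable {m a b : ℕ} {Ξ Z : Type*} [MeasurableSpace Ξ] [MeasurableSpace Z]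
  {P : Problem m a b Ξ Z} {c : Constants} {σf : ℕ → ℝ} {σg : ℝ}

/-- The problem with samples transformed by `φ` and `ψ`. -/
def mapSample (P : Problem m a b Ξ Z) (φ : Fin m → Ξ → Ξ) (ψ : Fin m → Z → Z) :
    Problem m a b Ξ Z where
  f i x y ξ := P.f i x y (φ i ξ)
  g i x y ζ := P.g i x y (ψ i ζ)
  πf := P.πf
  πg := P.πg

variable {φ : Fin m → Ξ → Ξ} {ψ : Fin m → Z → Z}

theorem fAvg_mapSample (hφ : ∀ i, ∀ᵐ ξ ∂(P.πf i), φ i ξ = ξ) :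
    (P.mapSample φ ψ).fAvg = P.fAvg := by
  funext i x y
  refine integral_congr_ae ?_
  filter_upwards [hφ i] with ξ hξ
  simp only [mapSample, hξ]

theorem gAvg_mapSample (hψ : ∀ i, ∀ᵐ ζ ∂(P.πg i), ψ i ζ = ζ) :
    (P.mapSample φ ψ).gAvg = P.gAvg := by
  funext i x y
  refine integral_congr_ae ?_
  filter_upwards [hψ i] with ζ hζ
  simp only [mapSample, hζ]

theorem hatGrad_mapSample (Lg : ℝ) {K : ℕ} (i : Fin m) (x : E a) (y : E b)
    (s : EstSample Ξ Z K) : (P.mapSample φ ψ).hatGrad Lg i x y s =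
      P.hatGrad Lg i x y (φ i s.1, fun j => ψ i (s.2.1 j), s.2.2) := rfl

theorem lowGrad_mapSample (i : Fin m) (x : E a) (y : E b) (ζ : Z) :
    (P.mapSample φ ψ).lowGrad i x y ζ = P.lowGrad i x y (ψ i ζ) := rfl

theorem ae_estLaw_sample_eq (hR : P.Regular c σf σg) {K : ℕ} (hK : 1 ≤ K)
    (hφ : ∀ i, ∀ᵐ ξ ∂(P.πf i), φ i ξ = ξ) (hψ : ∀ i, ∀ᵐ ζ ∂(P.πg i), ψ i ζ = ζ) (i : Fin m) :
    ∀ᵐ s ∂(P.estLaw K i), (φ i s.1, (fun j => ψ i (s.2.1 j)), s.2.2) = s := by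
  have := hR.prob_f i
  have := hR.prob_g i
  have : Nonempty (Fin K) := ⟨⟨0, hK⟩⟩
  have hu : IsProbabilityMeasure (uniformOn (Set.univ : Set (Fin K))) :=
    isProbabilityMeasure_uniformOn Set.finite_univ Set.univ_nonempty
  have h1 : ∀ᵐ s ∂(P.estLaw K i), φ i s.1 = s.1 :=
    Measure.quasiMeasurePreserving_fst.ae (hφ i)
  have h2 : ∀ᵐ s ∂(P.estLaw K i), ∀ j, ψ i (s.2.1 j) = s.2.1 j := by
    rw [ae_all_iff]
    intro j
    have h3 : ∀ᵐ q ∂(Measure.pi fun _ : Fin (K + 1) => P.πg i), ψ i (q j) = q j :=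
      (measurePreserving_eval (fun _ : Fin (K + 1) => P.πg i) j).quasiMeasurePreserving.ae (hψ i)
    exact Measure.quasiMeasurePreserving_snd.ae (Measure.quasiMeasurePreserving_fst.ae h3)
  filter_upwards [h1, h2] with s hs1 hs2
  exact Prod.ext hs1 (Prod.ext (funext hs2) rfl)

theorem barGrad_mapSample (hφ : ∀ i, ∀ᵐ ξ ∂(P.πf i), φ i ξ = ξ)
    (hψ : ∀ i, ∀ᵐ ζ ∂(P.πg i), ψ i ζ = ζ) : (P.mapSample φ ψ).barGrad = P.barGrad := by
  funext i x y
  simp only [barGrad, fAvg_mapSample hφ, gAvg_mapSample hψ]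

theorem ystar_mapSample (hψ : ∀ i, ∀ᵐ ζ ∂(P.πg i), ψ i ζ = ζ) :
    (P.mapSample φ ψ).ystar = P.ystar := by
  funext i x
  simp only [ystar, gAvg_mapSample hψ]

theorem obj_mapSample (hφ : ∀ i, ∀ᵐ ξ ∂(P.πf i), φ i ξ = ξ)
    (hψ : ∀ i, ∀ᵐ ζ ∂(P.πg i), ψ i ζ = ζ) : (P.mapSample φ ψ).obj = P.obj := by
  funext x
  simp only [obj, localObj, fAvg_mapSample hφ, ystar_mapSample hψ]

theorem InitialBound.mapSample (hφ : ∀ i, ∀ᵐ ξ ∂(P.πf i), φ i ξ = ξ)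
    (hψ : ∀ i, ∀ᵐ ζ ∂(P.πg i), ψ i ζ = ζ) {x₀ : E a} {y₀ : E b} {Δ : ℝ}
    (h : P.InitialBound x₀ y₀ Δ) : (P.mapSample φ ψ).InitialBound x₀ y₀ Δ where
  gap := by rw [obj_mapSample hφ hψ]; exact h.gap
  lower_error := by rw [ystar_mapSample hψ]; exact h.lower_error
  hypergradient i := by
    have e : (P.mapSample φ ψ).localObj i = P.localObj i := by
      funext x
      simp only [localObj, fAvg_mapSample hφ, ystar_mapSample hψ]
    rw [e]
    exact h.hypergradient i

theorem Regular.mapSample (hR : P.Regular c σf σg) (hφm : ∀ i, Measurable (φ i))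
    (hψm : ∀ i, Measurable (ψ i)) (hφ : ∀ i, ∀ᵐ ξ ∂(P.πf i), φ i ξ = ξ)
    (hψ : ∀ i, ∀ᵐ ζ ∂(P.πg i), ψ i ζ = ζ) : (P.mapSample φ ψ).Regular c σf σg where
  prob_f := hR.prob_f
  prob_g := hR.prob_g
  measurable_f i x y := (hR.measurable_f i x y).comp (hφm i)
  measurable_g i x y := (hR.measurable_g i x y).comp (hψm i)
  integrable_f i x y := by
    refine (hR.integrable_f i x y).congr ?_
    filter_upwards [hφ i] with ξ hξ
    simp only [Problem.mapSample, hξ]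
  integrable_g i x y := by
    refine (hR.integrable_g i x y).congr ?_
    filter_upwards [hψ i] with ζ hζ
    simp only [Problem.mapSample, hζ]
  upper := by rw [fAvg_mapSample hφ]; exact hR.upper
  lower := by rw [gAvg_mapSample hψ]; exact hR.lower
  upper_sample i := by
    filter_upwards [hφ i, hR.upper_sample i] with ξ hξ h
    simpa only [Problem.mapSample, hξ] using h
  lower_sample i := by
    filter_upwards [hψ i, hR.lower_sample i] with ζ hζ h
    simpa only [Problem.mapSample, hζ] using h
  variance_f K hK i x y := by
    have hae := ae_estLaw_sample_eq hR hK hφ hψ i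
    have hb : (P.mapSample φ ψ).bias c.Lg K i x y = P.bias c.Lg K i x y := by
      rw [Problem.bias, Problem.bias, barGrad_mapSample hφ hψ]
      congr 1
      refine integral_congr_ae ?_
      filter_upwards [hae] with s hs
      rw [hatGrad_mapSample, hs]
    rw [hb, barGrad_mapSample hφ hψ]
    refine le_trans (le_of_eq (lintegral_congr_ae ?_)) (hR.variance_f K hK i x y)
    filter_upwards [hae] with s hs
    rw [hatGrad_mapSample, hs]
  variance_g i x y := by
    rw [gAvg_mapSample hψ]
    refine le_trans (le_of_eq (lintegral_congr_ae ?_)) (hR.variance_g i x y)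
    filter_upwards [hψ i] with ζ hζ
    rw [lowGrad_mapSample, hζ]

/-- Every problem can be modified on null sets of samples so that all samples are regular. -/
theorem Regular.exists_sampleRegular (hR : P.Regular c σf σg) :
    ∃ (φ : Fin m → Ξ → Ξ) (ψ : Fin m → Z → Z), (∀ i, Measurable (φ i)) ∧ (∀ i, Measurable (ψ i)) ∧
      (∀ i, ∀ᵐ ξ ∂(P.πf i), φ i ξ = ξ) ∧ (∀ i, ∀ᵐ ζ ∂(P.πg i), ψ i ζ = ζ) ∧
      (P.mapSample φ ψ).SampleRegular c := by
  have := hR.prob_f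
  have := hR.prob_g
  choose φ hφm hφp hφ using fun i => exists_measurable_retract (hR.upper_sample i)
  choose ψ hψm hψp hψ using fun i => exists_measurable_retract (hR.lower_sample i)
  exact ⟨φ, ψ, hφm, hψm, hφ, hψ, hφp, hψp, fun i x y => (hR.measurable_f i x y).comp (hφm i),
    fun i x y => (hR.measurable_g i x y).comp (hψm i)⟩

end Problem

section

variable {m a b : ℕ} {Ξ Z Ω : Type*} [MeasurableSpace Ξ] [MeasurableSpace Z] [MeasurableSpace Ω]
  {P : Problem m a b Ξ Z} {c : Constants} {σf : ℕ → ℝ} {σg : ℝ} {ν : Measure Ω}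
  {φ : Fin m → Ξ → Ξ} {ψ : Fin m → Z → Z} {M : Matrix (Fin m) (Fin m) ℝ} {θ : Params}
  {S : ℕ → Fin m → Ω → IterSample Ξ Z θ.K} {x₀ : E a} {y₀ : E b}

/-- Modifying the problem on null sets of samples changes the iterates on a null set only. -/
theorem process_mapSample (hR : P.Regular c σf σg) (hK : 1 ≤ θ.K)
    (hφ : ∀ i, ∀ᵐ ξ ∂(P.πf i), φ i ξ = ξ) (hψ : ∀ i, ∀ᵐ ζ ∂(P.πg i), ψ i ζ = ζ)
    (hS : IsSampleStream P S ν) :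
    ∀ᵐ ω ∂ν, ∀ t, process (P.mapSample φ ψ) M θ x₀ y₀ S t ω = process P M θ x₀ y₀ S t ω := by
  have hgood : ∀ᵐ ω ∂ν, ∀ t i, (φ i (S t i ω).1.1, (fun j => ψ i ((S t i ω).1.2.1 j)),
      (S t i ω).1.2.2) = (S t i ω).1 ∧ ψ i (S t i ω).2 = (S t i ω).2 := by
    rw [ae_all_iff]
    intro t
    rw [ae_all_iff]
    intro i
    have := hR.prob_g i
    have := Problem.isProbabilityMeasure_estLaw hR hK i
    have h1 : ∀ᵐ s ∂(P.iterLaw θ.K i), (φ i s.1.1, (fun j => ψ i (s.1.2.1 j)), s.1.2.2) = s.1 ∧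
        ψ i s.2 = s.2 :=
      (Measure.quasiMeasurePreserving_fst.ae (Problem.ae_estLaw_sample_eq hR hK hφ hψ i)).and
        (Measure.quasiMeasurePreserving_snd.ae (hψ i))
    rw [← hS.law t i] at h1
    exact ae_of_ae_map (hS.measurable t i).aemeasurable h1
  filter_upwards [hgood] with ω hω t
  induction t with
  | zero => rfl
  | succ t ih =>
    have e1 : process (P.mapSample φ ψ) M θ x₀ y₀ S (t + 1) ω = step (P.mapSample φ ψ) M θ t
      (fun i => S t i ω) (process (P.mapSample φ ψ) M θ x₀ y₀ S t ω) := rfl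
    have e2 : process P M θ x₀ y₀ S (t + 1) ω = step P M θ t
      (fun i => S t i ω) (process P M θ x₀ y₀ S t ω) := rfl
    rw [e1, e2, ih]
    simp only [step, Problem.hatGrad_mapSample, Problem.lowGrad_mapSample, (hω t _).1, (hω t _).2]

end

/-! ### Choice of the parameters -/

/-- The number of terms of the hypergradient estimator is logarithmic in the horizon. -/
theorem exists_numTerms_le (c : Constants) : ∃ B : ℝ, 0 < B ∧ ∀ T : ℕ, 0 < T →
    (numTerms c T : ℝ) ≤ B * (1 + Real.log T) := by
  set A := c.Cgxy * c.Cfy / c.μg with hA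
  set κ := |c.Lg / c.μg| with hκ
  refine ⟨κ * (|Real.log A| + 1) + 2, by positivity, fun T hT => ?_⟩
  have hT1 : (1 : ℝ) ≤ T := by exact_mod_cast hT
  have hlog : 0 ≤ Real.log T := Real.log_nonneg hT1
  have h1 : |Real.log (c.Cgxy * c.Cfy * T / c.μg)| ≤ |Real.log A| + Real.log T := by
    have e : c.Cgxy * c.Cfy * T / c.μg = A * T := by rw [hA]; ring
    rw [e]
    rcases eq_or_ne A 0 with h0 | h0
    · rw [h0, zero_mul, Real.log_zero, abs_zero]
      linarith
    · rw [Real.log_mul h0 (by positivity)]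
      exact (abs_add_le _ _).trans (by rw [abs_of_nonneg hlog])
  set X := (c.Lg / c.μg) * Real.log (c.Cgxy * c.Cfy * T / c.μg) with hX
  have h2 : |X| ≤ κ * (|Real.log A| + Real.log T) := by
    rw [hX, abs_mul]
    exact mul_le_mul_of_nonneg_left h1 (abs_nonneg _)
  have h3 : (⌈X⌉₊ : ℝ) ≤ |X| + 1 := by
    have h4 := (Nat.ceil_lt_add_one (abs_nonneg X)).le
    exact le_trans (by exact_mod_cast Nat.ceil_le_ceil (le_abs_self X)) h4
  have h4 : (numTerms c T : ℝ) ≤ 1 + (|X| + 1) := by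
    rw [numTerms]
    push_cast
    exact max_le (by linarith [abs_nonneg X]) (by linarith)
  have h5 : 0 ≤ κ := abs_nonneg _
  have h6 : 0 ≤ |Real.log A| := abs_nonneg _
  nlinarith [mul_nonneg h5 hlog, mul_nonneg (mul_nonneg h5 h6) hlog, mul_nonneg h5 h6]

theorem one_le_numTerms (c : Constants) (T : ℕ) : 1 ≤ numTerms c T := le_max_left _ _

/-- An upper bound `a` for the step-sizes that meets the admissibility conditions and the conditions
of the descent and lower-level steps. -/
theorem exists_small_stepsize {c : Constants} (hc : c.Valid) {lam : ℝ} (hlam : lam < 1)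
    (cβ k cγ : ℝ) {a₁ : ℝ} (ha₁ : 0 < a₁) :
    ∃ a : ℝ, 0 < a ∧ a ≤ a₁ ∧ a ≤ 1 ∧ a ≤ 1 - lam ∧ cβ * a ≤ 1 / (c.μg + c.Lg) ∧ k * a ≤ 1 ∧
      cγ * a ≤ 1 ∧ valueLip c * a ≤ 1 / 4 ∧ cβ * c.Lg ^ 2 * a ≤ c.μg ∧
      cβ * c.μg * a ≤ 1 / 2 := by
  have ev : ∀ X Y : ℝ, 0 < Y → ∀ᶠ a in 𝓝[>] (0 : ℝ), X * a ≤ Y := fun X Y hY => by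
    have h1 : Tendsto (fun a : ℝ => X * a) (𝓝[>] 0) (𝓝 0) := by
      have h2 : Tendsto (fun a : ℝ => X * a) (𝓝 0) (𝓝 (X * 0)) :=
        (continuous_const.mul continuous_id).tendsto 0
      rw [mul_zero] at h2
      exact h2.mono_left nhdsWithin_le_nhds
    exact (h1.eventually_lt_const hY).mono fun a h => h.le
  have hμ := hc.μg_pos
  have hL := hc.Lg_nonneg
  have h0 : ∀ᶠ a in 𝓝[>] (0 : ℝ), 0 < a := self_mem_nhdsWithin
  obtain ⟨a, g0, g1, g2, g3, g4, g5, g6, g7, g8, g9⟩ := (h0.and ((ev 1 a₁ ha₁).and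
    ((ev 1 1 one_pos).and ((ev 1 (1 - lam) (by linarith)).and
    ((ev cβ (1 / (c.μg + c.Lg)) (by positivity)).and ((ev k 1 one_pos).and
    ((ev cγ 1 one_pos).and ((ev (valueLip c) (1 / 4) (by norm_num)).and
    ((ev (cβ * c.Lg ^ 2) c.μg hμ).and (ev (cβ * c.μg) (1 / 2) (by norm_num))))))))))).exists
  rw [one_mul] at g1 g2 g3
  exact ⟨a, g0, g1, g2, g3, g4, g5, g6, g7, g8, g9⟩

theorem Problem.InitialBound.mono {m a b : ℕ} {Ξ Z : Type*} [MeasurableSpace Ξ] [MeasurableSpace Z]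
    {P : Problem m a b Ξ Z} {x₀ : E a} {y₀ : E b} {Δ Δ' : ℝ} (h : P.InitialBound x₀ y₀ Δ)
    (hle : Δ ≤ Δ') : P.InitialBound x₀ y₀ Δ' :=
  ⟨fun x => (h.gap x).trans hle, fun i => (h.lower_error i).trans hle,
    fun i => (h.hypergradient i).trans hle⟩

/-- The estimator with `K` terms has Lipschitz and variance constants of order `K⁴`. -/
noncomputable def noiseScale (c : Constants) (σf : ℕ → ℝ) (T : ℕ) : ℝ :=
  (1 + 2 * estLip c ^ 2 + estVar c σf) * (numTerms c T : ℝ) ^ 4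

theorem estVar_nonneg (c : Constants) (σf : ℕ → ℝ) : 0 ≤ estVar c σf := by
  unfold estVar; positivity

theorem le_noiseScale (c : Constants) (σf : ℕ → ℝ) (T : ℕ) :
    1 ≤ noiseScale c σf T ∧ 2 * estLip c ^ 2 * (numTerms c T : ℝ) ^ 4 ≤ noiseScale c σf T ∧
      estVar c σf * (numTerms c T : ℝ) ^ 4 ≤ noiseScale c σf T := by
  have h1 : (1 : ℝ) ≤ (numTerms c T : ℝ) ^ 4 :=
    one_le_pow₀ (by exact_mod_cast one_le_numTerms c T)
  have h2 := estVar_nonneg c σf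
  have h3 : 0 ≤ 2 * estLip c ^ 2 := by positivity
  unfold noiseScale
  refine ⟨?_, ?_, ?_⟩ <;> nlinarith

theorem IsRun.integrable_stationarityError {m a b : ℕ} {Ξ Z Ω : Type*} [MeasurableSpace Ξ]
    [MeasurableSpace Z] [MeasurableSpace Ω] {P : Problem m a b Ξ Z}
    {M : Matrix (Fin m) (Fin m) ℝ} {θ : Params} {c : Constants} {σf : ℕ → ℝ} {σg lam : ℝ}
    {S : ℕ → Fin m → Ω → IterSample Ξ Z θ.K} {ν : Measure Ω} {x₀ : E a} {y₀ : E b}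
    (h : IsRun P M θ c σf σg lam S ν) (t : ℕ) :
    Integrable (fun ω => stationarityError P (process P M θ x₀ y₀ S t ω).x
      (process P M θ x₀ y₀ S t ω).y) ν :=
  ((h.integrable_gradient t).add (h.integrable_lowerError t)).add
    ((MemLp.integrable_dev (h.isMemLp x₀ y₀ t).x).const_mul (1 / (m : ℝ)))

/-- The weight `1 / m` of the consensus error is replaced by `1`. -/
theorem IsRun.integral_stationarityError_le {m a b : ℕ} {Ξ Z Ω : Type*} [MeasurableSpace Ξ]
    [MeasurableSpace Z] [MeasurableSpace Ω] {P : Problem m a b Ξ Z}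
    {M : Matrix (Fin m) (Fin m) ℝ} {θ : Params} {c : Constants} {σf : ℕ → ℝ} {σg lam : ℝ}
    {S : ℕ → Fin m → Ω → IterSample Ξ Z θ.K} {ν : Measure Ω} {x₀ : E a} {y₀ : E b}
    (h : IsRun P M θ c σf σg lam S ν) (t : ℕ) :
    ∫ ω, stationarityError P (process P M θ x₀ y₀ S t ω).x (process P M θ x₀ y₀ S t ω).y ∂ν ≤
      ∫ ω, ‖gradient P.obj (mean (process P M θ x₀ y₀ S t ω).x)‖ ^ 2 ∂ν +
      ∫ ω, (process P M θ x₀ y₀ S t ω).lowerError P ∂ν +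
      ∫ ω, dev (process P M θ x₀ y₀ S t ω).x ∂ν := by
  have hm : 1 / (m : ℝ) ≤ 1 := by
    rw [div_le_one (by exact_mod_cast h.pos)]
    exact_mod_cast h.pos
  have hd := MemLp.integrable_dev (h.isMemLp x₀ y₀ t).x
  have hs : Integrable (fun ω => ‖gradient P.obj (mean (process P M θ x₀ y₀ S t ω).x)‖ ^ 2 +
      (process P M θ x₀ y₀ S t ω).lowerError P) ν :=
    (h.integrable_gradient t).add (h.integrable_lowerError t)
  rw [← integral_add (h.integrable_gradient t) (h.integrable_lowerError t), ← integral_add hs hd]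
  refine integral_mono (h.integrable_stationarityError t) (hs.add hd) fun ω => ?_
  have e : stationarityError P (process P M θ x₀ y₀ S t ω).x (process P M θ x₀ y₀ S t ω).y =
    ‖gradient P.obj (mean (process P M θ x₀ y₀ S t ω).x)‖ ^ 2 +
      (process P M θ x₀ y₀ S t ω).lowerError P +
      1 / (m : ℝ) * dev (process P M θ x₀ y₀ S t ω).x := rfl
  rw [e]
  exact add_le_add le_rfl (mul_le_of_le_one_left (dev_nonneg _) hm)

/-- The parameters of the schedule, and the averaged stationarity error when all samples are regular.
The momentum constant of the upper level scales with the noise level of the estimator. -/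
theorem exists_schedule (m : ℕ) {c : Constants} (hc : c.Valid) {lam : ℝ}
    (hlam : lam < 1) (σf : ℕ → ℝ) (σg Δ : ℝ) :
    ∃ cβ k cγ Q : ℝ, 0 < cβ ∧ 0 < k ∧ 0 < cγ ∧ 0 < Q ∧ ∀ T : ℕ, 0 < T →
      ∃ w : ℝ, 2 ≤ w ∧
      (schedule c T w cβ (k * noiseScale c σf T) cγ).Admissible c lam ∧
      ∀ (a b : ℕ) (Ξ Z Ω : Type*) [MeasurableSpace Ξ] [MeasurableSpace Z] [MeasurableSpace Ω]
        (P : Problem m a b Ξ Z) (M : Matrix (Fin m) (Fin m) ℝ) (x₀ : E a) (y₀ : E b)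
        (ν : Measure Ω)
        (S : ℕ → Fin m → Ω →
          IterSample Ξ Z (schedule c T w cβ (k * noiseScale c σf T) cγ).K),
        IsRun P M (schedule c T w cβ (k * noiseScale c σf T) cγ) c σf σg lam S ν →
        P.InitialBound x₀ y₀ Δ →
        1 / (T : ℝ) * ∑ t ∈ Finset.range T, ∫ ω, stationarityError P
          (process P M (schedule c T w cβ (k * noiseScale c σf T) cγ) x₀ y₀ S t ω).x
          (process P M (schedule c T w cβ (k * noiseScale c σf T) cγ) x₀ y₀ S t ω).y ∂ν ≤
          Q * (noiseScale c σf T ^ 3 * (1 + Real.log T) * (T : ℝ) ^ (-(2 / 3) : ℝ)) := by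
  -- a contraction rate strictly between `max lam 0` and `1`
  set ρ := (1 + max lam 0) / 2 with hρ
  have hmax : max lam 0 < 1 := max_lt hlam one_pos
  have hmax0 : 0 ≤ max lam 0 := le_max_right _ _
  have hρ0 : 0 < ρ := by linarith
  have hρ1 : ρ < 1 := by linarith
  have hlamρ : lam ≤ ρ := by linarith [le_max_left lam 0]
  have hμ := hc.μg_pos
  have hCg := hc.Cgxy_pos
  obtain ⟨C, hC⟩ := exists_dominates hc hρ1 m σg (abs_nonneg Δ)
  obtain ⟨cβ, k, cγ, a₁, hcβ, hk, hcγ, ha₁, H⟩ :=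
    exists_average_bound (by linarith [hC.two_le] : 1 ≤ C) hρ0 hρ1 hμ
  obtain ⟨a₀, ha₀, hle, ha1, halam, haβ, hak, haγ, haV, haL, haμ⟩ :=
    exists_small_stepsize hc hlam cβ k cγ ha₁
  obtain ⟨Q, hQ, HQ⟩ := H a₀ ha₀ hle
  refine ⟨cβ, k, cγ, Q, hcβ, hk, hcγ, hQ, fun T hT => ?_⟩
  obtain ⟨hR1, hRL, hRσ⟩ := le_noiseScale c σf T
  set R := noiseScale c σf T with hR
  have hR0 : 0 < R := zero_lt_one.trans_le hR1
  -- `α t ≤ a₀ / R` for all `t ≥ -1`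
  set w := 1 + (R / a₀) ^ 3 with hw
  have hq : 1 ≤ R / a₀ := by rw [one_le_div ha₀]; exact ha1.trans hR1
  have hw2 : 2 ≤ w := by
    have : 1 ≤ (R / a₀) ^ 3 := one_le_pow₀ hq
    linarith
  have hst0 : ∀ t : ℝ, -1 ≤ t → 0 < stepsize w t := fun t ht => stepsize_pos (by linarith)
  have hstR : ∀ t : ℝ, -1 ≤ t → stepsize w t * R ≤ a₀ := fun t ht => by
    rw [← le_div_iff₀ hR0]; exact stepsize_offset_le ha₀ hR0 ht
  have hst : ∀ t : ℝ, -1 ≤ t → stepsize w t ≤ a₀ := fun t ht =>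
    (le_mul_of_one_le_right (hst0 t ht).le hR1).trans (hstR t ht)
  have hnat : ∀ t : ℕ, (-1 : ℝ) ≤ t := fun t => by
    linarith [(Nat.cast_nonneg t : (0 : ℝ) ≤ t)]
  have hnat' : ∀ t : ℕ, (-1 : ℝ) ≤ (t : ℝ) - 1 := fun t => by
    linarith [(Nat.cast_nonneg t : (0 : ℝ) ≤ t)]
  have hscale : ∀ X Y : ℝ, 0 ≤ X → X * a₀ ≤ Y → ∀ t : ℝ, -1 ≤ t → X * stepsize w t ≤ Y :=
    fun X Y hX h t ht => (mul_le_mul_of_nonneg_left (hst t ht) hX).trans h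
  have hadm : (schedule c T w cβ (k * R) cγ).Admissible c lam := by
    refine ⟨fun t => (hst t (hnat t)).trans halam, fun t => hscale _ _ hcβ.le haβ t (hnat t),
      fun t => ⟨?_, ?_⟩, fun t => ⟨?_, ?_⟩⟩
    · exact mul_nonneg (by positivity) (sq_nonneg _)
    · have h1 := hstR _ (hnat' t)
      have h2 := hscale k 1 hk.le hak _ (hnat' t)
      have h3 := (hst0 _ (hnat' t)).le
      calc k * R * stepsize w ((t : ℝ) - 1) ^ 2
          = (k * stepsize w ((t : ℝ) - 1)) * (stepsize w ((t : ℝ) - 1) * R) := by ring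
        _ ≤ 1 * 1 := mul_le_mul h2 (h1.trans ha1) (mul_nonneg h3 hR0.le) zero_le_one
        _ = 1 := one_mul 1
    · exact mul_nonneg hcγ.le (sq_nonneg _)
    · have h2 := hscale cγ 1 hcγ.le haγ _ (hnat' t)
      have h3 := (hst0 _ (hnat' t)).le
      calc cγ * stepsize w ((t : ℝ) - 1) ^ 2
          = (cγ * stepsize w ((t : ℝ) - 1)) * stepsize w ((t : ℝ) - 1) := by ring
        _ ≤ 1 * 1 := mul_le_mul h2 ((hst _ (hnat' t)).trans ha1) h3 zero_le_one
        _ = 1 := one_mul 1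
  refine ⟨w, hw2, hadm, ?_⟩
  intro a b Ξ Z Ω _ _ _ P M x₀ y₀ ν S h hΔ
  have hT1 : (1 : ℝ) ≤ T := by exact_mod_cast hT
  have hT0 : (0 : ℝ) < T := by linarith
  set bias := 1 / (c.Cgxy * (T : ℝ) ^ 2) with hbiasdef
  have hbias : ∀ i x y, ‖P.meanGrad c.Lg (numTerms c T) i x y - P.barGrad i x y‖ ^ 2 ≤ bias := by
    intro i x y
    have h1 := pow_le_pow_left₀ (norm_nonneg _)
      (Problem.norm_bias_numTerms_le h.regular h.sampleRegular hc hT i x y) 2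
    rwa [div_pow, one_pow, mul_pow, Real.sq_sqrt hCg.le] at h1
  have hbias1 : bias ≤ 1 / c.Cgxy := by
    refine one_div_le_one_div_of_le hCg (le_mul_of_one_le_right hCg.le (one_le_pow₀ hT1))
  have hbiasT : m * bias ≤ C / T := by
    have h1 : m * bias ≤ m / c.Cgxy / T := by
      rw [hbiasdef, div_div, mul_one_div]
      refine div_le_div_of_nonneg_left (Nat.cast_nonneg m) (by positivity) ?_
      exact mul_le_mul_of_nonneg_left (le_self_pow₀ hT1 two_ne_zero) hCg.le
    exact h1.trans (div_le_div_of_nonneg_right hC.bias hT0.le)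
  have hrec := h.errorRecursions (k := k) (cγ := cγ) hC hρ0 hρ1 hlamρ hR1 hRL hRσ
    (hΔ.mono (le_abs_self Δ)) hbias hbias1 hcβ (fun t => hst0 t (hnat t)) (fun t => rfl)
    (fun t => by
      simp only [schedule]
      push_cast
      rw [add_sub_cancel_right])
    (fun t => by
      simp only [schedule]
      push_cast
      rw [add_sub_cancel_right])
    (fun t => hscale _ _ (valueLip_nonneg hc) haV t (hnat t))
    (fun t => by
      have h1 := hscale (cβ * c.Lg ^ 2) _ (by positivity) haL t (hnat t)
      simp only [schedule]
      linarith)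
    (fun t => by
      have h1 := hscale (cβ * c.μg) _ (by positivity) haμ t (hnat t)
      simp only [schedule]
      linarith)
  refine le_trans ?_ (HQ R T (m * bias) _ _ _ _ _ _ _ _ _ hR1 hT hbiasT hrec)
  exact mul_le_mul_of_nonneg_left
    (Finset.sum_le_sum fun t _ => h.integral_stationarityError_le t) (by positivity)

/-! ### Complexity -/

section

variable {m a b : ℕ} {Ξ Z Ω : Type*} [MeasurableSpace Ξ] [MeasurableSpace Z]

theorem process_ifoCalls (P : Problem m a b Ξ Z) (M : Matrix (Fin m) (Fin m) ℝ) (θ : Params)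
    (x₀ : E a) (y₀ : E b) (S : ℕ → Fin m → Ω → IterSample Ξ Z θ.K) (t : ℕ) (ω : Ω) :
    (process P M θ x₀ y₀ S t ω).ifoCalls = t * (2 * (θ.K + 3)) := by
  induction t with
  | zero => simp [process, run, State.init]
  | succ t ih =>
    have e : (process P M θ x₀ y₀ S (t + 1) ω).ifoCalls =
      (process P M θ x₀ y₀ S t ω).ifoCalls + 2 * (estimatorCalls θ.K + lowGradCalls) := rfl
    rw [e, ih, estimatorCalls, lowGradCalls]
    ring

theorem process_commRounds (P : Problem m a b Ξ Z) (M : Matrix (Fin m) (Fin m) ℝ) (θ : Params)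
    (x₀ : E a) (y₀ : E b) (S : ℕ → Fin m → Ω → IterSample Ξ Z θ.K) (t : ℕ) (ω : Ω) :
    (process P M θ x₀ y₀ S t ω).commRounds = t := by
  induction t with
  | zero => rfl
  | succ t ih => exact congrArg (· + 1) ih

end

/-- The cubed noise scale is polylogarithmic in the horizon: it is of order `K ^ 12`. -/
theorem exists_noiseScale_le (c : Constants) (σf : ℕ → ℝ) : ∃ A B : ℝ, 0 < A ∧ 0 < B ∧
    ∀ T : ℕ, 0 < T → (numTerms c T : ℝ) ≤ B * (1 + Real.log T) ∧
      noiseScale c σf T ^ 3 * (1 + Real.log T) ≤ A * (1 + Real.log T) ^ 13 := by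
  obtain ⟨B, hB, h⟩ := exists_numTerms_le c
  have hV := estVar_nonneg c σf
  set A := 1 + 2 * estLip c ^ 2 + estVar c σf with hA
  have hA0 : 0 < A := by positivity
  refine ⟨(A * B ^ 4) ^ 3, B, by positivity, hB, fun T hT => ⟨h T hT, ?_⟩⟩
  have hlog : 0 ≤ Real.log T := Real.log_nonneg (by exact_mod_cast hT)
  have h1 : noiseScale c σf T ≤ A * (B * (1 + Real.log T)) ^ 4 :=
    mul_le_mul_of_nonneg_left (pow_le_pow_left₀ (Nat.cast_nonneg _) (h T hT) 4) hA0.le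
  calc noiseScale c σf T ^ 3 * (1 + Real.log T)
      ≤ (A * (B * (1 + Real.log T)) ^ 4) ^ 3 * (1 + Real.log T) :=
        mul_le_mul_of_nonneg_right
          (pow_le_pow_left₀ (zero_le_one.trans (le_noiseScale c σf T).1) h1 3) (by linarith)
    _ = (A * B ^ 4) ^ 3 * (1 + Real.log T) ^ 13 := by ring

/-- The oracle and communication counts of a horizon of order `ε^(-3/2)` up to logarithms. -/
theorem complexity_le {T K ε B H : ℝ} (hK1 : 1 ≤ K) (hε : 0 < ε) (hε1 : ε ≤ 1)
    (hB : 0 < B) (hH : 0 < H)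
    (hTle : T ≤ H * (ε ^ (-(3 / 2) : ℝ) * (1 + Real.log (1 / ε)) ^ 26)) {Λ : ℝ}
    (hK : K ≤ B * Λ) (hΛ : Λ ≤ H * (1 + Real.log (1 / ε))) :
    T * (2 * (K + 3)) ≤
        (8 * B * H ^ 2 + H) * ε ^ (-(3 / 2) : ℝ) * (1 + Real.log (1 / ε)) ^ 27 ∧
      T ≤ (8 * B * H ^ 2 + H) * ε ^ (-(3 / 2) : ℝ) * (1 + Real.log (1 / ε)) ^ 27 := by
  have hlog : 0 ≤ Real.log (1 / ε) := Real.log_nonneg (by rw [le_div_iff₀ hε]; linarith)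
  set L := 1 + Real.log (1 / ε) with hL
  have hL1 : 1 ≤ L := by linarith
  set X := ε ^ (-(3 / 2) : ℝ) with hX
  have hX0 : 0 ≤ X := Real.rpow_nonneg hε.le _
  have hXL : 0 ≤ X * L ^ 27 := by positivity
  have hKL : 2 * (K + 3) ≤ 8 * (B * (H * L)) := by
    have h1 : K ≤ B * (H * L) := hK.trans (mul_le_mul_of_nonneg_left hΛ hB.le)
    linarith
  constructor
  · calc T * (2 * (K + 3)) ≤ (H * (X * L ^ 26)) * (8 * (B * (H * L))) :=
          mul_le_mul hTle hKL (by linarith) (by positivity)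
      _ = 8 * B * H ^ 2 * (X * L ^ 27) := by ring
      _ ≤ (8 * B * H ^ 2 + H) * (X * L ^ 27) :=
          mul_le_mul_of_nonneg_right (by linarith) hXL
      _ = _ := by ring
  · calc T ≤ H * (X * L ^ 26) := hTle
      _ ≤ H * (X * L ^ 27) := by
          refine mul_le_mul_of_nonneg_left (mul_le_mul_of_nonneg_left ?_ hX0) hH.le
          exact pow_le_pow_right₀ hL1 (by norm_num)
      _ ≤ (8 * B * H ^ 2 + H) * (X * L ^ 27) :=
          mul_le_mul_of_nonneg_right (le_add_of_nonneg_left (by positivity)) hXL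
      _ = _ := by ring

theorem exists_lt_le_of_average_le {e : ℕ → ℝ} {T : ℕ} (hT : 0 < T) {ε : ℝ}
    (h : 1 / (T : ℝ) * ∑ t ∈ Finset.range T, e t ≤ ε) : ∃ t, t < T ∧ e t ≤ ε := by
  have hT0 : (0 : ℝ) < T := by exact_mod_cast hT
  obtain ⟨t, ht, hle⟩ := Finset.exists_le_of_sum_le (s := Finset.range T) (f := e)
    (g := fun _ => ε) (Finset.nonempty_range_iff.2 hT.ne') (by
      rw [Finset.sum_const, Finset.card_range, nsmul_eq_mul]
      rwa [one_div, inv_mul_le_iff₀ hT0] at h)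
  exact ⟨t, Finset.mem_range.1 ht, hle⟩

section

variable {m a b : ℕ} {Ξ Z Ω : Type*} [MeasurableSpace Ξ] [MeasurableSpace Z] [MeasurableSpace Ω]

/-- The stationarity errors of a run whose samples are regular only almost surely agree almost
surely with those of a run that satisfies the regularity conditions at every sample. -/
theorem exists_isRun {P : Problem m a b Ξ Z} {M : Matrix (Fin m) (Fin m) ℝ} {θ : Params}
    {c : Constants} {σf : ℕ → ℝ} {σg lam Δ : ℝ} {S : ℕ → Fin m → Ω → IterSample Ξ Z θ.K}
    {ν : Measure Ω} {x₀ : E a} {y₀ : E b} (hν : IsProbabilityMeasure ν) (hm : 0 < m)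
    (hc : c.Valid) (hR : P.Regular c σf σg) (hΔ : P.InitialBound x₀ y₀ Δ)
    (hM : M ∈ doublyStochastic ℝ (Fin m)) (hsymm : M.IsSymm) (hlam : secondEigenvalue M ≤ lam)
    (hS : IsSampleStream P S ν) (hK : 1 ≤ θ.K) (hLg : θ.Lg = c.Lg)
    (hη : ∀ t, θ.η t ∈ Set.Icc (0 : ℝ) 1) (hγ : ∀ t, θ.γ t ∈ Set.Icc (0 : ℝ) 1) :
    ∃ P' : Problem m a b Ξ Z, IsRun P' M θ c σf σg lam S ν ∧ P'.InitialBound x₀ y₀ Δ ∧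
      ∀ᵐ ω ∂ν, ∀ t,
        stationarityError P' (process P' M θ x₀ y₀ S t ω).x (process P' M θ x₀ y₀ S t ω).y =
          stationarityError P (process P M θ x₀ y₀ S t ω).x (process P M θ x₀ y₀ S t ω).y := by
  obtain ⟨φ, ψ, hφm, hψm, hφ, hψ, hs⟩ := hR.exists_sampleRegular
  refine ⟨P.mapSample φ ψ, ⟨hν, hm, hc, hR.mapSample hφm hψm hφ hψ, hs, hM, hsymm, hlam,
    ⟨hS.measurable, hS.law, hS.indep⟩, hK, hLg, hη, hγ⟩, hΔ.mapSample hφ hψ, ?_⟩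
  filter_upwards [process_mapSample (M := M) (x₀ := x₀) (y₀ := y₀) hR hK hφ hψ hS] with ω hω t
  simp only [hω, stationarityError, Problem.obj_mapSample hφ hψ, Problem.ystar_mapSample hψ]

end

end Diamond

open Diamond
theorem mainTheorem2 :
    ∃ q : ℕ, ∀ (m : ℕ) (c : Constants) (lam : ℝ) (σf : ℕ → ℝ) (σg Δ : ℝ),
      0 < m → c.Valid → lam < 1 →
      ∃ C : ℝ, 0 < C ∧ ∀ ε : ℝ, 0 < ε → ε ≤ 1 →
        ∃ (T : ℕ) (w cβ cη cγ : ℝ),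
          0 < T ∧ 2 ≤ w ∧ 0 < cβ ∧ 0 < cη ∧ 0 < cγ ∧
          (schedule c T w cβ cη cγ).Admissible c lam ∧
          ∀ (a b : ℕ) (Ξ Z Ω : Type*) [MeasurableSpace Ξ] [MeasurableSpace Z] [MeasurableSpace Ω]
            (P : Problem m a b Ξ Z) (G : SimpleGraph (Fin m)) (M : Matrix (Fin m) (Fin m) ℝ)
            (x₀ : E a) (y₀ : E b) (ν : MeasureTheory.Measure Ω)
            (S : ℕ → Fin m → Ω → IterSample Ξ Z (schedule c T w cβ cη cγ).K),
            P.Regular c σf σg → P.InitialBound x₀ y₀ Δ →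
            IsConsensusMatrix G M → secondEigenvalue M ≤ lam →
            MeasureTheory.IsProbabilityMeasure ν →
            (∀ t i, Measurable (S t i)) →
            (∀ t i, ν.map (S t i) = P.iterLaw (schedule c T w cβ cη cγ).K i) →
            ProbabilityTheory.iIndepFun (fun n : ℕ × Fin m => S n.1 n.2) ν →
            ∀ X : ℕ → Ω → State m a b, X = process P M (schedule c T w cβ cη cγ) x₀ y₀ S →
            -- the lower-level minimizers exist and the upper-level objective is differentiable
            (∀ i x y, P.gAvg i x (P.ystar i x) ≤ P.gAvg i x y) ∧ Differentiable ℝ P.obj ∧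
            -- the error is at most `ε` on average over the first `T` iterates
            (∀ t, t < T → MeasureTheory.Integrable
              (fun ω => stationarityError P (X t ω).x (X t ω).y) ν) ∧
            (1 / (T : ℝ)) * ∑ t ∈ Finset.range T,
              ∫ ω, stationarityError P (X t ω).x (X t ω).y ∂ν ≤ ε ∧
            -- so DIAMOND reaches an `ε`-stationary point within `T` iterations
            (∃ t, t < T ∧
              IsEpsStationary P ν (fun ω => (X t ω).x) (fun ω => (X t ω).y) ε) ∧
            -- sample complexity per agent and communication complexity
            (∀ ω, ((X T ω).ifoCalls : ℝ) ≤
              C * ε ^ (-(3 / 2) : ℝ) * (1 + Real.log (1 / ε)) ^ q) ∧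
            (∀ ω, ((X T ω).commRounds : ℝ) ≤
              C * ε ^ (-(3 / 2) : ℝ) * (1 + Real.log (1 / ε)) ^ q) := by
  -- `13` logarithms in the error bound give `2 * 13` in the horizon, and `K` contributes one more
  refine ⟨27, fun m c lam σf σg Δ hm hc hlam => ?_⟩
  obtain ⟨cβ, k, cγ, Q, hcβ, hk, hcγ, hQ, hsched⟩ := exists_schedule m hc hlam σf σg Δ
  obtain ⟨A, B, hA, hB, hnoise⟩ := exists_noiseScale_le c σf
  obtain ⟨H, hH, hhor⟩ := exists_horizon (Q * A) 13
  refine ⟨8 * B * H ^ 2 + H, by positivity, fun ε hε hε1 => ?_⟩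
  obtain ⟨T, hT, hTε, hTH, hlogH⟩ := hhor ε hε hε1
  obtain ⟨w, hw, hadm, hrun⟩ := hsched T hT
  have hR0 : 0 < noiseScale c σf T := zero_lt_one.trans_le (le_noiseScale c σf T).1
  refine ⟨T, w, cβ, k * noiseScale c σf T, cγ, hT, hw, hcβ, mul_pos hk hR0, hcγ, hadm, ?_⟩
  rintro a b Ξ Z Ω _ _ _ P G M x₀ y₀ ν S hR hΔ hM hlamM hν hSm hSl hSi X rfl
  -- the regularity conditions hold at almost every sample only, so the bound is applied to a
  -- modification `P'` of the problem with almost surely the same iterates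
  obtain ⟨P', hP', hΔ', hae⟩ := exists_isRun hν hm hc hR hΔ hM.doublyStochastic hM.symm hlamM
    ⟨hSm, hSl, hSi⟩ (one_le_numTerms c T) rfl hadm.η_mem hadm.γ_mem
  have hint : ∀ t, MeasureTheory.Integrable (fun ω => stationarityError P
      (process P M (schedule c T w cβ (k * noiseScale c σf T) cγ) x₀ y₀ S t ω).x
      (process P M (schedule c T w cβ (k * noiseScale c σf T) cγ) x₀ y₀ S t ω).y) ν := fun t =>
    (hP'.integrable_stationarityError t).congr (hae.mono fun ω h => h t)
  have havg : 1 / (T : ℝ) * ∑ t ∈ Finset.range T, ∫ ω, stationarityError P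
      (process P M (schedule c T w cβ (k * noiseScale c σf T) cγ) x₀ y₀ S t ω).x
      (process P M (schedule c T w cβ (k * noiseScale c σf T) cγ) x₀ y₀ S t ω).y ∂ν ≤ ε := by
    have h1 := hrun a b Ξ Z Ω P' M x₀ y₀ ν S hP' hΔ'
    have h2 : ∀ t, ∫ ω, stationarityError P'
        (process P' M (schedule c T w cβ (k * noiseScale c σf T) cγ) x₀ y₀ S t ω).x
        (process P' M (schedule c T w cβ (k * noiseScale c σf T) cγ) x₀ y₀ S t ω).y ∂ν =
      ∫ ω, stationarityError P
        (process P M (schedule c T w cβ (k * noiseScale c σf T) cγ) x₀ y₀ S t ω).x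
        (process P M (schedule c T w cβ (k * noiseScale c σf T) cγ) x₀ y₀ S t ω).y ∂ν := fun t =>
      MeasureTheory.integral_congr_ae (hae.mono fun ω h => h t)
    rw [Finset.sum_congr rfl fun t _ => h2 t] at h1
    refine h1.trans (le_trans ?_ hTε)
    rw [mul_assoc Q A]
    refine mul_le_mul_of_nonneg_left ?_ hQ.le
    rw [← mul_assoc A]
    exact mul_le_mul_of_nonneg_right (hnoise T hT).2 (Real.rpow_nonneg (Nat.cast_nonneg T) _)
  have hcount := complexity_le (T := T)
    (by exact_mod_cast one_le_numTerms c T : (1 : ℝ) ≤ numTerms c T) hε hε1 hB hH hTH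
    (hnoise T hT).1 hlogH
  obtain ⟨t, ht, hle⟩ := exists_lt_le_of_average_le hT havg
  refine ⟨fun i x y => (hR.lower i).argmin_le hc x y, hR.differentiable_obj hc, fun t _ => hint t,
    havg, ⟨t, ht, hint t, hle⟩, fun ω => ?_, fun ω => ?_⟩
  · rw [process_ifoCalls]
    push_cast
    exact hcount.1
  · rw [process_commRounds]
    exact hcount.2
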